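/- **Setting.** Let $\Psi=\sum_{i\in\mathbb Z}\delta_{P_i}$ be a simple, locally finite, stationary point process on $\mathbb R$ with intensity $\lambda=\mathbf E\Psi([0,1])\in(0,\infty)$. Let $(\Phi_i,R_i)_{i\in\mathbb Z}$ be i.i.d. random vectors with values in $[0,\pi]\times[0,\infty)$, independent of the sequence $(P_i)_{i\in\mathbb Z}$, such that $\Phi_0$ and $R_0$ are independent; let $G$ be the distribution function of $\Phi_0$ and put $\Xi_0=[-R_0,R_0]$. Let $|\cdot|_k$ denote $k$-dimensional Lebesgue measure (for subsets of a line in the plane, $|\cdot|_1$ is one-dimensional Hausdorff measure), $v(\varphi)=(\cos\varphi,\sin\varphi)$, $g(p,\varphi)=\{(x,y)\in\mathbb R^2: x\cos\varphi+y\sin\varphi=p\}$, $b(\mathbf o,r)$ the closed disc of radius $r$ about the origin $\mathbf o$, and let $$\Xi=\bigcup_{i\in\mathbb Z}\big(g(P_i,\Phi_i)\oplus b(\mathbf o,R_i)\big)$$ be the planar cylinder process. Let $K\subset\mathbb R^2$ be compact and star-shaped with respect to $\mathbf o$, with $\mathbf o$ an interior point of $K$. **Cumulant measures.** Let $\alpha^{(k)}$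 be the $k$-th factorial moment measure of $\Psi$. For bounded Borel sets $B_1,\dots,B_k\subset\mathbb R$ put $$\gamma^{(k)}(B_1\times\cdots\times B_k)=\sum_{\ell=1}^k(-1)^{\ell-1}(\ell-1)!\sum_{K_1\cup\cdots\cup K_\ell=\{1,\dots,k\}}\ \prod_{j=1}^\ell\alpha^{(\#K_j)}\big(\times_{i\in K_j}B_i\big),$$ the inner sum running over the partitions of $\{1,\dots,k\}$ into $\ell$ non-empty blocks. For $k\ge2$ the reduced cumulant measure $\gamma^{(k)}_{red}$ is the signed measure on $\mathbb R^{k-1}$ with $\gamma^{(k)}(\times_{i=1}^kB_i)=\lambda\int_{B_1}\gamma^{(k)}_{red}\big(\times_{i=2}^k(B_i-p)\big)\,\mathrm dp$ for all bounded Borel sets $B_i$; $\|\gamma^{(k)}_{red}\|_{TV}$ is its total variation and $c^{(k)}_{red}$ its Lebesgue density, if it has one. Put $\|c\|_q=\big(\int_{\mathbb R^{k-1}}|c|^q\big)^{1/q}$ and, for $k\ge3$, $\|c\|_q^*=\int_{\mathbb R}\big(\int_{\mathbb R^{k-2}}|c(x,p)|^q\,\mathrm dx\big)^{1/q}\mathrm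 dp$. **Mixing conditions.** In each of them all moments $\mathbf E\Psi^k([0,1])$, $k\ge2$, are assumed finite. $\Psi$ is *strongly Brillinger-mixing* with constant $b>0$ if for some $a\ge b^{-1}$ one has $\|\gamma^{(k)}_{red}\|_{TV}\le a\,b^k\,k!$ for all $k\ge2$. It is *strongly $L_q$-Brillinger-mixing* with constant $b_q>0$ if $c^{(k)}_{red}$ exists for all $k\ge2$, $\|c^{(2)}_{red}\|_1<\infty$ and, for some $a_q>0$, $\|c^{(k)}_{red}\|_q\le a_q\,b_q^k\,k!$ for all $k\ge2$. It is *strongly $L_q^*$-Brillinger-mixing* with constant $b_q^*>0$ if $c^{(k)}_{red}$ exists for all $k\ge2$, $\|c^{(2)}_{red}\|_1<\infty$ and, for some $a_q^*>0$, $\|c^{(k)}_{red}\|_q^*\le a_q^*\,(b_q^*)^k\,k!$ for all $k\ge3$. **Theorem 2.** Assume that $\Psi$ is either strongly Brillinger-mixing with $b<1/2$, or, for some $q>1$, both strongly $L_q$-Brillinger-mixing with $(\mathbf E|\Xi_0|_1)^{1-1/q}\,b_q<1/2$ and strongly $L_q^*$-Brillinger-mixing with $(\mathbf E|\Xi_0|_1)^{1-1/q}\,b_q^*<1/2$.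 Assume further that $\mathbf E R_0^2<\infty$ and that $G$ is continuous. Then $$\lim_{\varrho\to\infty}\frac{\mathbf{Var}(|\Xi\cap\varrho K|_2)}{\varrho^3}=\lambda\,e^{-2\lambda\mathbf E|\Xi_0|_1}\Big((\mathbf E|\Xi_0|_1)^2\,\gamma^{(2)}_{red}(\mathbb R)\,C_1^{G,K}+2\,\mathbf E\big(|\Xi_0|_1^2\big)\,C_2^{G,K}\Big),$$ where $$C_1^{G,K}=\int_{\mathbb R}\big(\mathbf E|g(p,\Phi_0)\cap K|_1\big)^2\,\mathrm dp,\qquad C_2^{G,K}=\int_0^\pi\int_0^{r_K(\varphi\pm\pi/2)}\big|K\cap\big(K+s\,v(\varphi\pm\tfrac\pi2)\big)\big|_2\,\mathrm ds\,\mathrm dG(\varphi),$$ with $r_K(\psi)=\max\{r\ge0: r\,v(\psi)\in K\oplus(-K)\}$; the formula for $C_2^{G,K}$ holds with either choice of the sign $\pm$. -/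

import Mathlib

open MeasureTheory ProbabilityTheory Filter Topology Set
open scoped Pointwise ENNReal

noncomputable section

namespace PlanarCylinder

/-- The Euclidean plane. -/
abbrev Plane : Type := EuclideanSpace ℝ (Fin 2)

/-! ### Lines, cylinders and the cylinder process -/

/-- The unit vector `v(φ) = (cos φ, sin φ)`. -/
def dir (φ : ℝ) : Plane := !₂[Real.cos φ, Real.sin φ]

/-- The line `g(p, φ) = {(x, y) : x cos φ + y sin φ = p}`. -/
def line (p φ : ℝ) : Set Plane := {x | x 0 * Real.cos φ + x 1 * Real.sin φ = p}

variable {Ω : Type*} [MeasurableSpace Ω]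

/-- The cylinder process: the union of the cylinders `g(P i, Φ i) ⊕ b(o, R i)`, `i ∈ ℤ`
(Minkowski sums of lines with closed discs). -/
def cylinderProcess (P Φ R : ℤ → Ω → ℝ) (ω : Ω) : Set Plane :=
  ⋃ i : ℤ, (line (P i ω) (Φ i ω) + Metric.closedBall (0 : Plane) (R i ω))

/-! ### Stationary point processes on the real line and independent marking -/

/-- The counting measure `Ψ = ∑ i, δ_{P i}` on the line. -/
def countingMeasure (P : ℤ → Ω → ℝ) (ω : Ω) : Measure ℝ :=
  Measure.sum fun i => Measure.dirac (P i ω)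

/-- `E Ψ([0,1])` as an extended number. -/
def eintensity (P : ℤ → Ω → ℝ) (μ : Measure Ω) : ℝ≥0∞ :=
  ∫⁻ ω, countingMeasure P ω (Icc 0 1) ∂μ

/-- The intensity `E Ψ([0,1])`. -/
def intensity (P : ℤ → Ω → ℝ) (μ : Measure Ω) : ℝ := (eintensity P μ).toReal

/-- `Ψ = ∑ i, δ_{P i}` is a simple, locally finite, stationary point process on the line with
positive and finite intensity. Stationarity: the law of the random measure `Ψ` (on the σ-algebra
generated by the maps `ψ ↦ ψ B`, `B` Borel) is invariant under all translations. -/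
structure IsStationaryPointProcess (P : ℤ → Ω → ℝ) (μ : Measure Ω) : Prop where
  measurable : ∀ i, Measurable (P i)
  locallyFinite : ∀ᵐ ω ∂μ, ∀ r : ℝ, {i : ℤ | |P i ω| ≤ r}.Finite
  simple : ∀ᵐ ω ∂μ, Function.Injective fun i => P i ω
  stationary : ∀ t : ℝ,
    μ.map (fun ω => (countingMeasure P ω).map (fun x => x + t)) = μ.map (countingMeasure P)
  intensity_pos : 0 < eintensity P μ
  intensity_lt_top : eintensity P μ < ∞

/-- The marks `(Φ i, R i)` with values in `[0,π] × [0,∞)` are i.i.d., each with independent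
components, and the whole sequence of marks is independent of the sequence of points. -/
structure IsIndependentMarking (P Φ R : ℤ → Ω → ℝ) (μ : Measure Ω) : Prop where
  measurable_angle : ∀ i, Measurable (Φ i)
  measurable_radius : ∀ i, Measurable (R i)
  angle_mem : ∀ i ω, Φ i ω ∈ Icc 0 Real.pi
  radius_nonneg : ∀ i ω, 0 ≤ R i ω
  indep_marks : iIndepFun (fun (i : ℤ) (ω : Ω) => (Φ i ω, R i ω)) μ
  identDistrib : ∀ i : ℤ,
    IdentDistrib (fun ω => (Φ i ω, R i ω)) (fun ω => (Φ 0 ω, R 0 ω)) μ μ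
  indep_angle_radius : IndepFun (Φ 0) (R 0) μ
  indep_points_marks :
    IndepFun (fun (ω : Ω) (i : ℤ) => P i ω) (fun (ω : Ω) (i : ℤ) => (Φ i ω, R i ω)) μ

/-! ### Factorial moment and cumulant measures -/

/-- The factorial moment measure with a finite index set `ι` (`α^{(k)}` for `#ι = k`):
`A ↦ E ∑ 1_A (P (s j) : j ∈ ι)`, the sum over all families `s` of pairwise distinct indices. -/
def factorialMoment (P : ℤ → Ω → ℝ) (μ : Measure Ω) (ι : Type) : Measure (ι → ℝ) :=
  Measure.sum fun s : ι ↪ ℤ => μ.map (fun ω j => P (s j) ω)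

/-- The factorial cumulant measure `γ^{(k)}` on the box `B 0 × ⋯ × B (k-1)`:
the sum over all partitions of the index set into `ℓ` blocks of
`(-1)^{ℓ-1} (ℓ-1)!` times the product of the factorial moment measures of the block boxes. -/
def factorialCumulant (P : ℤ → Ω → ℝ) (μ : Measure Ω) (k : ℕ) (B : Fin k → Set ℝ) : ℝ :=
  ∑ π : Finpartition (Finset.univ : Finset (Fin k)),
    (-1 : ℝ) ^ (π.parts.card - 1) * ((π.parts.card - 1).factorial : ℝ) *
      ∏ J ∈ π.parts, (factorialMoment P μ J (Set.univ.pi fun i : J => B i)).toReal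

/-- The box `(B 1 - p) × ⋯ × (B m - p)`. -/
def shiftedBox {m : ℕ} (B : Fin (m + 1) → Set ℝ) (p : ℝ) : Set (Fin m → ℝ) :=
  Set.univ.pi fun j => (fun x => x + p) ⁻¹' B j.succ

/-- The finite signed measure `γ` on `ℝ^m` is the reduced cumulant measure of order `m + 1`. -/
def IsReducedCumulantMeasure (P : ℤ → Ω → ℝ) (μ : Measure Ω) (m : ℕ)
    (γ : SignedMeasure (Fin m → ℝ)) : Prop :=
  ∀ B : Fin (m + 1) → Set ℝ, (∀ i, MeasurableSet (B i)) → (∀ i, Bornology.IsBounded (B i)) →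
    factorialCumulant P μ (m + 1) B = intensity P μ * ∫ p in B 0, γ (shiftedBox B p)

/-- The function `c` on `ℝ^m` is the reduced cumulant density of order `m + 1`, that is, the
Lebesgue density of the (locally finite, signed) reduced cumulant measure. -/
structure IsReducedCumulantDensity (P : ℤ → Ω → ℝ) (μ : Measure Ω) (m : ℕ)
    (c : (Fin m → ℝ) → ℝ) : Prop where
  measurable : Measurable c
  locallyIntegrable : LocallyIntegrable c
  cumulant_eq : ∀ B : Fin (m + 1) → Set ℝ, (∀ i, MeasurableSet (B i)) →
    (∀ i, Bornology.IsBounded (B i)) →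
    factorialCumulant P μ (m + 1) B =
      intensity P μ * ∫ p in B 0, ∫ x in shiftedBox B p, c x

open Classical in
/-- The reduced cumulant measure of order `m + 1`, if it is a finite signed measure (it is then
unique), and `0` otherwise. -/
def reducedCumulantMeasure (P : ℤ → Ω → ℝ) (μ : Measure Ω) (m : ℕ) :
    SignedMeasure (Fin m → ℝ) :=
  if h : ∃ γ, IsReducedCumulantMeasure P μ m γ then h.choose else 0

/-- The modified norm `‖c‖_q^* = ∫ (∫ |c(x, p)|^q dx)^{1/q} dp`, with `x` in `ℝ^n`, `p` in `ℝ`. -/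
def starNorm (q : ℝ) {n : ℕ} (c : (Fin (n + 1) → ℝ) → ℝ) : ℝ≥0∞ :=
  ∫⁻ p : ℝ, (∫⁻ x : Fin n → ℝ, ‖c (Fin.snoc x p)‖ₑ ^ q) ^ (1 / q)

/-! ### Mixing conditions -/

/-- All moments of `Ψ([0,1])` are finite. -/
def HasAllMoments (P : ℤ → Ω → ℝ) (μ : Measure Ω) : Prop :=
  ∀ k : ℕ, 2 ≤ k → ∫⁻ ω, countingMeasure P ω (Icc 0 1) ^ k ∂μ < ∞

/-- Strong Brillinger-mixing with constant `b`: for some `a ≥ 1/b`, the reduced cumulant measure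
of every order `k ≥ 2` has total variation at most `a b^k k!`. -/
def StronglyBrillingerMixing (P : ℤ → Ω → ℝ) (μ : Measure Ω) (b : ℝ) : Prop :=
  HasAllMoments P μ ∧ 0 < b ∧ ∃ a : ℝ, b⁻¹ ≤ a ∧ ∀ m : ℕ, 1 ≤ m →
    ∃ γ : SignedMeasure (Fin m → ℝ), IsReducedCumulantMeasure P μ m γ ∧
      γ.totalVariation univ ≤ ENNReal.ofReal (a * b ^ (m + 1) * ((m + 1).factorial : ℝ))

/-- Strong `L_q`-Brillinger-mixing with constant `b`: the reduced cumulant densities of all orders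
`k ≥ 2` exist, the one of order `2` is integrable, and for some `a > 0` the `L_q`-norm of the one
of order `k` is at most `a b^k k!` for all `k ≥ 2`. -/
def StronglyLqBrillingerMixing (P : ℤ → Ω → ℝ) (μ : Measure Ω) (q b : ℝ) : Prop :=
  HasAllMoments P μ ∧ 0 < b ∧ ∃ a : ℝ, 0 < a ∧ ∃ c : (m : ℕ) → (Fin m → ℝ) → ℝ,
    (∀ m : ℕ, 1 ≤ m → IsReducedCumulantDensity P μ m (c m)) ∧
    eLpNorm (c 1) 1 volume < ∞ ∧
    ∀ m : ℕ, 1 ≤ m → eLpNorm (c m) (ENNReal.ofReal q) volume ≤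
      ENNReal.ofReal (a * b ^ (m + 1) * ((m + 1).factorial : ℝ))

/-- Strong `L_q^*`-Brillinger-mixing with constant `b`: the reduced cumulant densities of all
orders `k ≥ 2` exist, the one of order `2` is integrable, and for some `a > 0` the modified norm
`‖·‖_q^*` of the one of order `k` is at most `a b^k k!` for all `k ≥ 3`. -/
def StronglyLqStarBrillingerMixing (P : ℤ → Ω → ℝ) (μ : Measure Ω) (q b : ℝ) : Prop :=
  HasAllMoments P μ ∧ 0 < b ∧ ∃ a : ℝ, 0 < a ∧ ∃ c : (m : ℕ) → (Fin m → ℝ) → ℝ,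
    (∀ m : ℕ, 1 ≤ m → IsReducedCumulantDensity P μ m (c m)) ∧
    eLpNorm (c 1) 1 volume < ∞ ∧
    ∀ n : ℕ, 1 ≤ n → starNorm q (c (n + 1)) ≤
      ENNReal.ofReal (a * b ^ (n + 2) * ((n + 2).factorial : ℝ))

/-! ### The quantities in the limit -/

/-- The length `|Ξ_0|_1` of the base `Ξ_0 = [-R 0, R 0]` of the typical cylinder. -/
def baseLength (R : ℤ → Ω → ℝ) (ω : Ω) : ℝ := (volume (Icc (-(R 0 ω)) (R 0 ω))).toReal

/-- The chord length `|g(p, φ) ∩ K|_1` (one-dimensional Hausdorff measure). -/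
def chordLength (K : Set Plane) (p φ : ℝ) : ℝ := (Measure.hausdorffMeasure 1 (line p φ ∩ K)).toReal

/-- `r_K(ψ) = max {r ≥ 0 : r v(ψ) ∈ K ⊕ (-K)}`. -/
def radialExtent (K : Set Plane) (ψ : ℝ) : ℝ := sSup {r : ℝ | 0 ≤ r ∧ r • dir ψ ∈ K + (-K)}

/-- `C_1 = ∫ (E |g(p, Φ 0) ∩ K|_1)^2 dp`. -/
def constOne (K : Set Plane) (Φ : ℤ → Ω → ℝ) (μ : Measure Ω) : ℝ :=
  ∫ p : ℝ, (∫ ω, chordLength K p (Φ 0 ω) ∂μ) ^ 2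

/-- `C_2 = ∫_0^π ∫_0^{r_K(φ ± π/2)} |K ∩ (K + s v(φ ± π/2))|_2 ds dG(φ)`, where `G` is the law of
`Φ 0` and `ε = 1` or `ε = -1` is the choice of the sign `±`. -/
def constTwo (K : Set Plane) (Φ : ℤ → Ω → ℝ) (μ : Measure Ω) (ε : ℝ) : ℝ :=
  ∫ φ in Icc 0 Real.pi,
    (∫ s in (0 : ℝ)..radialExtent K (φ + ε * (Real.pi / 2)),
      (volume (K ∩ (K + {s • dir (φ + ε * (Real.pi / 2))}))).toReal) ∂(μ.map (Φ 0))

end PlanarCylinder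

end

open PlanarCylinder

noncomputable section

namespace PlanarCylinder

/-! ### Set partitions and exponential generating functions -/

section Combinatorics

open Finset

/-! A point x of the plane is uncovered exactly when no marked point (P_i, Φ_i, R_i) lies in `strip
x`. Covered and vacant area of ϱK have the same variance, so the variance is the double integral
over ϱK × ϱK of the covariance `voidProb (strip x ∪ strip y) - voidProb (strip x) * voidProb (strip
y)` (`variance_volume_eq`). Averaging over the independent marks turns a void probability into a
generating functional E ∏ (1 - w(P_i)) with w = `hitProb` (`measure_forall_notMem`), and
inclusion-exclusion reads w_{A∪B} = w_A + w_B - w_{A∩B}.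

The generating functional is the exponential of the series ∑ (-1)^k γ^(k)(w,…,w)/k!
(`moment_succ_eq`, `tsum_moments_eq_exp`, `integral_finprod_one_sub`). Hence voidProb(A∪B) =
voidProb(A) voidProb(B) exp D, where D is λ ∫ w_{A∩B} from order one, plus γ^(2)(w_A, w_B) from
order two, plus a remainder. By multilinearity every remainder term contains either w_{A∩B} in some
argument, or both w_A and w_B in two different arguments. The mixing conditions bound such terms by
b^k k! times a power of N = δ^θ S^(1-θ), where δ bounds the hit probabilities and S their integrals.
A small δ makes N small and absorbs the geometric growth, so the remainder is at most η ∫ w_{A∩B}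
plus an energy of w_A and w_B with respect to a measure of mass η (`cumulantsSmall_of_reps`,
`SmallBounds.genFun_ratio`, `CumulantsSmall.abs_voidProb_le`).

Continuity of G supplies the small δ. The angle law has no atoms, so for large ‖x‖ the projection of
x onto the random normal direction is spread out, and the hit probabilities of `strip x` are
uniformly small; likewise ∫ w_{A∩B} is small when x and y are far apart (`exists_hitProb_strip_le`,
`exists_lintegral_hitProb_inter_le`). The pairs that are not far apart or not far from the origin
have measure O(ϱ²) and do not matter at the scale ϱ³ (`measure_near_diagonal_le`).

What remains is the double integral of e^{-2λE|Ξ₀|} λ (∫ w_{A∩B} + ∬ w_A(p) w_B(p+t) γ_red(dt) dp).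
Tonelli's theorem and the substitution p = ϱq compute it as ϱ³ times integrals of products of strip
areas (`lintegral_cross_strip`, `lintegral_hitProb_inter_strip`). Seen at scale ϱ, a strip of
half-width R shrinks to a line, and its area becomes 2R times a chord length, by L¹-continuity of
translations (`tendsto_lintegral_cross`, `tendsto_lintegral_lintegral_stripArea_sq`). Independence
of angle and radius separates the moments of |Ξ₀| from the geometric constants. The integral of
squared chord lengths is the integrated covariogram, which is twice the inner integral of C₂
(`lintegral_chord_sq`, `intervalIntegral_shiftInter`). -/

lemma sum_finpartition_insert {ι : Type*} [DecidableEq ι] {a : ι} {s : Finset ι} (ha : a ∉ s)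
    (F : Finset (Finset ι) → ℝ) :
    ∑ π : Finpartition (insert a s), F π.parts =
      ∑ t ∈ s.powerset, ∑ σ : Finpartition (s \ t), F (insert (insert a t) σ.parts) := by
  classical
  rw [Finset.sum_sigma']
  symm
  have hne : ∀ t : Finset ι, insert a t ≠ (⊥ : Finset ι) := fun t => by simp
  have hdis : ∀ t : Finset ι, Disjoint (s \ t) (insert a t) := fun t => by
    rw [Finset.disjoint_left]
    intro x hx
    simp only [Finset.mem_sdiff, Finset.mem_insert, not_or] at hx ⊢
    exact ⟨fun h => ha (h ▸ hx.1), hx.2⟩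
  have hsup : ∀ t ∈ s.powerset, (s \ t) ⊔ insert a t = insert a s := fun t ht => by
    rw [Finset.mem_powerset] at ht
    ext x
    simp only [Finset.sup_eq_union, Finset.mem_union, Finset.mem_sdiff, Finset.mem_insert]
    constructor
    · rintro (h | h | h)
      exacts [Or.inr h.1, Or.inl h, Or.inr (ht h)]
    · rintro (h | h)
      · exact Or.inr (Or.inl h)
      · by_cases hx : x ∈ t
        exacts [Or.inr (Or.inr hx), Or.inl ⟨h, hx⟩]
  -- A partition of `insert a s` is determined by the rest `t` of the block of `a` and the partition
  -- induced on `s \ t`.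
  refine Finset.sum_bij
    (fun p hp => p.2.extend (hne p.1) (hdis p.1) (hsup p.1 (Finset.mem_sigma.1 hp).1))
    (fun _ _ => Finset.mem_univ _) ?_ ?_ (fun _ _ => rfl)
  · rintro ⟨t, σ⟩ ht ⟨t', σ'⟩ ht' h
    have ht := Finset.mem_powerset.1 (Finset.mem_sigma.1 ht).1
    have ht' := Finset.mem_powerset.1 (Finset.mem_sigma.1 ht').1
    have hp : insert (insert a t) σ.parts = insert (insert a t') σ'.parts :=
      congrArg Finpartition.parts h
    have hna : ∀ (t : Finset ι) (σ : Finpartition (s \ t)), ∀ J ∈ σ.parts, a ∉ J :=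
      fun t σ J hJ haJ => ha (Finset.mem_sdiff.1 (σ.le hJ haJ)).1
    have htt : t = t' := by
      have h1 : insert a t ∈ insert (insert a t') σ'.parts := hp ▸ Finset.mem_insert_self _ _
      rcases Finset.mem_insert.1 h1 with h2 | h2
      · have := congrArg (fun u => u.erase a) h2
        simpa [Finset.erase_insert (fun h => ha (ht h)), Finset.erase_insert (fun h => ha (ht' h))]
          using this
      · exact absurd (Finset.mem_insert_self a t) (hna t' σ' _ h2)
    subst htt
    have hs : σ.parts = σ'.parts := by
      have h1 : insert a t ∉ σ.parts := fun h => hna t σ _ h (Finset.mem_insert_self _ _)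
      have h2 : insert a t ∉ σ'.parts := fun h => hna t σ' _ h (Finset.mem_insert_self _ _)
      have := congrArg (fun u => u.erase (insert a t)) hp
      simpa [Finset.erase_insert h1, Finset.erase_insert h2] using this
    have : σ = σ' := Finpartition.ext hs
    rw [this]
  · intro π _
    have haπ : a ∈ insert a s := Finset.mem_insert_self _ _
    have hmem : π.part a ∈ π.parts := π.part_mem.2 haπ
    have hap : a ∈ π.part a := π.mem_part_self.2 haπ
    have hts : (π.part a).erase a ⊆ s := fun x hx => by
      rw [Finset.mem_erase] at hx
      exact (Finset.mem_insert.1 (π.part_subset a hx.2)).resolve_left hx.1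
    have hs : (π.parts.erase (π.part a)).sup id = s \ (π.part a).erase a := by
      ext x
      simp only [Finset.mem_sup, Finset.mem_erase, id, Finset.mem_sdiff, not_and]
      constructor
      · rintro ⟨J, ⟨hJ, hJp⟩, hx⟩
        have hxs := π.le hJp hx
        have hxa : x ∉ π.part a := fun hxa => hJ (π.eq_of_mem_parts hJp hmem hx hxa)
        have hxne : x ≠ a := fun h => hxa (h ▸ hap)
        exact ⟨(Finset.mem_insert.1 hxs).resolve_left hxne, fun _ => hxa⟩
      · rintro ⟨hx, hx2⟩
        have hxne : x ≠ a := fun h => ha (h ▸ hx)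
        obtain ⟨J, hJ, hxJ⟩ := π.exists_mem (Finset.mem_insert_of_mem hx)
        exact ⟨J, ⟨fun h => hx2 hxne (h ▸ hxJ), hJ⟩, hxJ⟩
    refine ⟨⟨(π.part a).erase a, π.ofSubset (Finset.erase_subset _ _) hs⟩, ?_, ?_⟩
    · simp only [Finset.mem_sigma, Finset.mem_powerset, Finset.mem_univ, and_true]
      exact hts
    · apply Finpartition.ext
      simp only [Finpartition.extend_parts, Finpartition.ofSubset_parts]
      rw [Finset.insert_erase hap, Finset.insert_erase hmem]

/-- The partial exponential Bell polynomials, defined by their recursion. -/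
def bellPoly (m : ℕ → ℝ) : ℕ → ℕ → ℝ
  | 0, k => if k = 0 then 1 else 0
  | _ + 1, 0 => 0
  | l + 1, k + 1 => ∑ j ∈ range (k + 1), (k.choose j : ℝ) * (m (j + 1) * bellPoly m l (k - j))

/-- Removing the block of a distinguished element leaves a partition of the complement with one
block fewer. The weights depend on cardinalities only, so the subsets of size j contribute equally,
which produces the binomial coefficient in the recursion of `bellPoly`. -/
lemma sum_finpartition_card_eq (m : ℕ → ℝ) {ι : Type*} [DecidableEq ι] (l : ℕ) (s : Finset ι) :
    ∑ π : Finpartition s, (if π.parts.card = l then ∏ J ∈ π.parts, m J.card else 0) =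
      bellPoly m l s.card := by
  induction l generalizing s with
  | zero =>
    rcases s.eq_empty_or_nonempty with rfl | hs
    · have : Unique (Finpartition (∅ : Finset ι)) :=
        inferInstanceAs (Unique (Finpartition (⊥ : Finset ι)))
      rw [Fintype.sum_unique]
      have h0 : ∀ π : Finpartition (∅ : Finset ι), π.parts = ∅ := fun π =>
        π.parts_eq_empty_iff.2 rfl
      simp [h0, bellPoly]
    · have h0 : ∀ π : Finpartition s, π.parts.card ≠ 0 := fun π h => by
        rw [Finset.card_eq_zero, π.parts_eq_empty_iff] at h
        exact hs.ne_empty h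
      simp [h0, bellPoly, hs.ne_empty]
  | succ l ih =>
    rcases s.eq_empty_or_nonempty with rfl | ⟨a, has⟩
    · have h0 : ∀ π : Finpartition (∅ : Finset ι), π.parts = ∅ := fun π =>
        π.parts_eq_empty_iff.2 rfl
      simp [h0, bellPoly]
    · obtain ⟨s, ha, rfl⟩ : ∃ s', a ∉ s' ∧ insert a s' = s :=
        ⟨s.erase a, Finset.notMem_erase _ _, Finset.insert_erase has⟩
      rw [sum_finpartition_insert ha
        (fun p => if p.card = l + 1 then ∏ J ∈ p, m J.card else 0), Finset.card_insert_of_notMem ha]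
      have key : ∀ t ∈ s.powerset, ∑ σ : Finpartition (s \ t),
          (if (insert (insert a t) σ.parts).card = l + 1 then
            ∏ J ∈ insert (insert a t) σ.parts, m J.card else 0) =
          (fun j => m (j + 1) * bellPoly m l (s.card - j)) t.card := by
        intro t ht
        rw [Finset.mem_powerset] at ht
        have hna : ∀ (σ : Finpartition (s \ t)), insert a t ∉ σ.parts := fun σ hJ =>
          ha (Finset.mem_sdiff.1 (σ.le hJ (Finset.mem_insert_self a t))).1
        simp only
        rw [← Finset.card_sdiff_of_subset ht, ← ih, Finset.mul_sum]
        refine Finset.sum_congr rfl fun σ _ => ?_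
        rw [Finset.card_insert_of_notMem (hna σ), Finset.prod_insert (hna σ),
          Finset.card_insert_of_notMem (fun h => ha (ht h))]
        simp
      rw [Finset.sum_congr rfl key,
        Finset.sum_powerset_apply_card (fun j => m (j + 1) * bellPoly m l (s.card - j))]
      simp [bellPoly]

/-- The cumulants of a moment sequence, as a sum over set partitions. -/
def cumulantOf (m : ℕ → ℝ) (k : ℕ) : ℝ :=
  ∑ π : Finpartition (Finset.univ : Finset (Fin k)),
    (-1 : ℝ) ^ (π.parts.card - 1) * ((π.parts.card - 1).factorial : ℝ) *
      ∏ J ∈ π.parts, m J.card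

/-- No partition of k + 1 elements has more than k + 1 blocks, so the sum over the number of blocks
may be cut at any N > k. A cut-off common to all orders up to k + 1 is what the power series
argument needs. -/
lemma cumulantOf_succ_eq (m : ℕ → ℝ) {k N : ℕ} (hN : k < N) :
    cumulantOf m (k + 1) =
      ∑ l ∈ range N, (-1 : ℝ) ^ l * (l.factorial : ℝ) * bellPoly m (l + 1) (k + 1) := by
  have h : ∀ l, bellPoly m (l + 1) (k + 1) =
      ∑ π : Finpartition (Finset.univ : Finset (Fin (k + 1))),
        (if π.parts.card = l + 1 then ∏ J ∈ π.parts, m J.card else 0) := fun l => by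
    rw [sum_finpartition_card_eq, Finset.card_univ, Fintype.card_fin]
  simp_rw [h, Finset.mul_sum]
  rw [Finset.sum_comm, cumulantOf]
  refine Finset.sum_congr rfl fun π _ => ?_
  have h1 : π.parts.card ≠ 0 := fun h => by
    rw [Finset.card_eq_zero, π.parts_eq_empty_iff] at h
    exact Finset.univ_nonempty.ne_empty h
  have h2 : π.parts.card ≤ k + 1 := by
    simpa using π.card_parts_le_card
  rw [Finset.sum_eq_single (π.parts.card - 1)]
  · rw [if_pos (by omega)]
  · intro l _ hl
    rw [if_neg (by omega), mul_zero]
  · intro h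
    exact absurd (Finset.mem_range.2 (by omega)) h

open PowerSeries in
-- With M the exponential generating function of m, the Bell recursion says B_{l+1}' = M' B_l.
lemma derivative_mk_bellPoly (m : ℕ → ℝ) (l : ℕ) :
    d⁄dX ℝ (PowerSeries.mk fun k => bellPoly m (l + 1) k / k.factorial) =
      (PowerSeries.mk fun k => m (k + 1) / k.factorial) *
        PowerSeries.mk fun k => bellPoly m l k / k.factorial := by
  ext k
  rw [PowerSeries.coeff_derivative, PowerSeries.coeff_mul, PowerSeries.coeff_mk, bellPoly,
    Finset.Nat.sum_antidiagonal_eq_sum_range_succ_mk, Nat.factorial_succ, Finset.sum_div,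
    Finset.sum_mul]
  refine Finset.sum_congr rfl fun j hj => ?_
  have hj : j ≤ k := Nat.lt_succ_iff.1 (Finset.mem_range.1 hj)
  simp only [PowerSeries.coeff_mk]
  have h1 : (k.choose j : ℝ) = k.factorial / (j.factorial * (k - j).factorial) :=
    Nat.cast_choose ℝ hj
  rw [h1]
  have := Nat.factorial_ne_zero k
  have := Nat.factorial_ne_zero j
  have := Nat.factorial_ne_zero (k - j)
  have : (k : ℝ) + 1 ≠ 0 := by positivity
  push_cast
  field_simp

open PowerSeries in
-- This is B_l = (M - 1)^l / l!. In the induction step both sides have the same derivative and,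
-- because m 0 = 1, the same constant coefficient.
lemma mk_bellPoly (m : ℕ → ℝ) (h0 : m 0 = 1) (l : ℕ) :
    (PowerSeries.mk fun k => bellPoly m l k / k.factorial) * C (l.factorial : ℝ) =
      ((PowerSeries.mk fun k => m k / k.factorial) - 1) ^ l := by
  induction l with
  | zero =>
    ext k
    rcases k with _ | k <;> simp [bellPoly, PowerSeries.coeff_one]
  | succ l ih =>
    apply PowerSeries.derivative.ext
    · have hM : d⁄dX ℝ (PowerSeries.mk fun k => m k / k.factorial) =
          PowerSeries.mk fun k => m (k + 1) / k.factorial := by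
        ext k
        rw [PowerSeries.coeff_derivative, PowerSeries.coeff_mk, PowerSeries.coeff_mk,
          Nat.factorial_succ]
        have := Nat.factorial_ne_zero k
        have : (k : ℝ) + 1 ≠ 0 := by positivity
        push_cast
        field_simp
      rw [Derivation.leibniz, Derivation.leibniz_pow, derivative_mk_bellPoly,
        PowerSeries.derivative_C, Nat.add_sub_cancel, map_sub, hM, ← ih]
      simp only [smul_eq_mul, nsmul_eq_mul, mul_zero, zero_add, Derivation.map_one_eq_zero,
        sub_zero, Nat.factorial_succ]
      push_cast
      rw [map_mul, map_add, map_one, map_natCast]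
      ring
    · have hm : PowerSeries.constantCoeff (PowerSeries.mk fun k => m k / k.factorial) = 1 := by
        rw [← PowerSeries.coeff_zero_eq_constantCoeff_apply, PowerSeries.coeff_mk]
        simp [h0]
      have hb : PowerSeries.constantCoeff
          (PowerSeries.mk fun k => bellPoly m (l + 1) k / k.factorial) = 0 := by
        rw [← PowerSeries.coeff_zero_eq_constantCoeff_apply, PowerSeries.coeff_mk]
        simp [bellPoly]
      rw [map_mul, hb, map_pow, map_sub, hm]
      simp

/-- The recursion between moments and cumulants. -/
lemma moment_succ_eq (m : ℕ → ℝ) (h0 : m 0 = 1) (k : ℕ) :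
    m (k + 1) / k.factorial =
      ∑ p ∈ antidiagonal k, cumulantOf m (p.1 + 1) / p.1.factorial * (m p.2 / p.2.factorial) := by
  set M : PowerSeries ℝ := PowerSeries.mk fun k => m k / k.factorial with hM
  set M' : PowerSeries ℝ := PowerSeries.mk fun k => m (k + 1) / k.factorial with hM'
  set N := k + 1 with hN
  -- The product M' ∑_{l<N} (1 - M)^l is a truncation of M'/M = (log M)', whose coefficients are the
  -- cumulants.
  have hcum : ∀ j ≤ k, cumulantOf m (j + 1) / j.factorial =
      PowerSeries.coeff j (M' * ∑ l ∈ range N, (1 - M) ^ l) := by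
    intro j hj
    rw [cumulantOf_succ_eq m (by omega : j < N), Finset.mul_sum, map_sum, Finset.sum_div]
    refine Finset.sum_congr rfl fun l _ => ?_
    have h1 : (1 - M) ^ l = PowerSeries.C ((-1 : ℝ) ^ l * l.factorial) *
        (PowerSeries.mk fun k => bellPoly m l k / k.factorial) := by
      rw [← neg_sub, neg_pow, ← mk_bellPoly m h0, map_mul, map_pow, map_neg, map_one]
      ring
    have h2 : M' * (1 - M) ^ l = PowerSeries.C ((-1 : ℝ) ^ l * l.factorial) *
        PowerSeries.derivative ℝ
          (PowerSeries.mk fun k => bellPoly m (l + 1) k / k.factorial) := by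
      rw [derivative_mk_bellPoly, h1, hM']
      ring
    rw [h2, PowerSeries.coeff_C_mul, PowerSeries.coeff_derivative, PowerSeries.coeff_mk,
      Nat.factorial_succ]
    have := Nat.factorial_ne_zero j
    have : (j : ℝ) + 1 ≠ 0 := by positivity
    push_cast
    field_simp
  have hprod : (M' * ∑ l ∈ range N, (1 - M) ^ l) * M = M' - M' * (1 - M) ^ N := by
    have := mul_neg_geom_sum (1 - M) N
    rw [sub_sub_cancel] at this
    calc _ = M' * (M * ∑ l ∈ range N, (1 - M) ^ l) := by ring
      _ = _ := by rw [this]; ring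
  -- The series 1 - M has no constant term, so the truncation error starts at X^N with N = k + 1 and
  -- is invisible in the coefficient of X^k.
  have hdvd : (PowerSeries.X : PowerSeries ℝ) ^ N ∣ M' * (1 - M) ^ N := by
    refine Dvd.dvd.mul_left (pow_dvd_pow_of_dvd ?_ N) _
    rw [PowerSeries.X_dvd_iff, map_sub, hM, ← PowerSeries.coeff_zero_eq_constantCoeff_apply,
      ← PowerSeries.coeff_zero_eq_constantCoeff_apply, PowerSeries.coeff_mk]
    simp [h0]
  have hz := PowerSeries.X_pow_dvd_iff.1 hdvd k (by omega)
  have := congrArg (PowerSeries.coeff k) hprod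
  rw [map_sub, hz, sub_zero, hM', PowerSeries.coeff_mk, PowerSeries.coeff_mul] at this
  rw [← this]
  refine Finset.sum_congr rfl fun p hp => ?_
  rw [hcum p.1 (by have := HasAntidiagonal.mem_antidiagonal.1 hp; omega), hM, PowerSeries.coeff_mk]

end Combinatorics

/-! ### Exponentials of power series -/

section PowerSeriesExp

open Finset

/-- The factor k + 1 on the left makes a geometric bound of any rate R strictly between r and 1
reproduce itself once k is large; the constant A absorbs the initial terms. -/
lemma exists_geometric_bound_of_recursion {a C : ℕ → ℝ} {B r : ℝ} (hr0 : 0 < r) (hr : r < 1)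
    (hC : ∀ i, |C i| ≤ B * r ^ i)
    (hrec : ∀ k, (k + 1) * a (k + 1) = ∑ p ∈ antidiagonal k, C p.1 * a p.2) :
    ∃ A R : ℝ, r ≤ R ∧ R < 1 ∧ 0 ≤ A ∧ ∀ k, |a k| ≤ A * R ^ k := by
  obtain ⟨R, hrR, hR1⟩ := exists_between hr
  have hR0 : 0 < R := hr0.trans hrR
  have hB : 0 ≤ B := by simpa using (abs_nonneg _).trans (hC 0)
  set q := r / R with hq
  have hq0 : 0 ≤ q := by positivity
  have hq1 : q < 1 := (div_lt_one hR0).2 hrR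
  -- For k + 1 ≥ N this gives B/(1 - q) ≤ (k + 1) R, which closes the induction.
  obtain ⟨N, hN⟩ := exists_nat_ge (B * (1 - q)⁻¹ / R)
  refine ⟨∑ i ∈ range (N + 1), |a i| / R ^ i, R, hrR.le, hR1,
    Finset.sum_nonneg fun i _ => by positivity, ?_⟩
  set A := ∑ i ∈ range (N + 1), |a i| / R ^ i with hA
  have hA0 : 0 ≤ A := Finset.sum_nonneg fun i _ => by positivity
  intro k
  induction k using Nat.strong_induction_on with
  | _ k ih =>
    by_cases hk : k < N + 1
    · have := Finset.single_le_sum (f := fun i => |a i| / R ^ i) (s := range (N + 1))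
        (fun i _ => by positivity) (Finset.mem_range.2 hk)
      rw [← hA] at this
      exact (div_le_iff₀ (by positivity)).1 this
    · obtain ⟨k, rfl⟩ : ∃ j, k = j + 1 := ⟨k - 1, by omega⟩
      have h1 : ((k : ℝ) + 1) * |a (k + 1)| ≤ B * A * R ^ k * (1 - q)⁻¹ := by
        calc ((k : ℝ) + 1) * |a (k + 1)| = |(k + 1) * a (k + 1)| := by
              rw [abs_mul, abs_of_nonneg (by positivity : (0 : ℝ) ≤ k + 1)]
          _ ≤ ∑ p ∈ antidiagonal k, |C p.1 * a p.2| := by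
              rw [hrec]; exact Finset.abs_sum_le_sum_abs _ _
          _ ≤ ∑ p ∈ antidiagonal k, B * A * R ^ k * q ^ p.1 := by
              refine Finset.sum_le_sum fun p hp => ?_
              have hp' := HasAntidiagonal.mem_antidiagonal.1 hp
              rw [abs_mul]
              calc |C p.1| * |a p.2| ≤ (B * r ^ p.1) * (A * R ^ p.2) :=
                    mul_le_mul (hC _) (ih _ (by omega)) (abs_nonneg _) (by positivity)
                _ = B * A * R ^ k * q ^ p.1 := by
                    rw [← hp', hq, div_pow, pow_add]
                    field_simp
          _ = B * A * R ^ k * ∑ i ∈ range (k + 1), q ^ i := by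
              rw [← Finset.mul_sum,
                Finset.Nat.sum_antidiagonal_eq_sum_range_succ_mk (fun p => q ^ p.1)]
          _ ≤ B * A * R ^ k * (1 - q)⁻¹ := by
              refine mul_le_mul_of_nonneg_left ?_ (by positivity)
              rw [← tsum_geometric_of_lt_one hq0 hq1]
              exact (summable_geometric_of_lt_one hq0 hq1).sum_le_tsum _
                (fun i _ => by positivity)
      have h2 : B * (1 - q)⁻¹ ≤ ((k : ℝ) + 1) * R := by
        have : (N : ℝ) ≤ k + 1 := by exact_mod_cast (by omega : N ≤ k + 1)
        rw [div_le_iff₀ hR0] at hN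
        nlinarith
      have h3 : ((k : ℝ) + 1) * |a (k + 1)| ≤ (k + 1) * (A * R ^ (k + 1)) := by
        refine h1.trans ?_
        calc B * A * R ^ k * (1 - q)⁻¹ = (A * R ^ k) * (B * (1 - q)⁻¹) := by ring
          _ ≤ (A * R ^ k) * ((k + 1) * R) := mul_le_mul_of_nonneg_left h2 (by positivity)
          _ = _ := by ring
      exact le_of_mul_le_mul_left h3 (by positivity)

lemma summable_mul_pow_of_geometric {a : ℕ → ℝ} {A R z : ℝ} (hR0 : 0 ≤ R)
    (ha : ∀ k, |a k| ≤ A * R ^ k) (hz : |z| * R < 1) : Summable fun k => |a k * z ^ k| := by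
  have h0 : 0 ≤ |z| * R := by positivity
  refine Summable.of_nonneg_of_le (fun _ => abs_nonneg _) (fun k => ?_)
    ((summable_geometric_of_lt_one h0 hz).mul_left A)
  rw [abs_mul, abs_pow, mul_pow]
  calc |a k| * |z| ^ k ≤ A * R ^ k * |z| ^ k :=
        mul_le_mul_of_nonneg_right (ha k) (by positivity)
    _ = _ := by ring

lemma hasDerivAt_tsum_pow {a : ℕ → ℝ} {A R : ℝ} (hR0 : 0 ≤ R) (ha : ∀ k, |a k| ≤ A * R ^ k)
    {ρ z : ℝ} (hρ0 : 0 < ρ) (hρ : ρ * R < 1) (hz : z ∈ Metric.ball (0 : ℝ) ρ) :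
    HasDerivAt (fun z => ∑' k, a k * z ^ k) (∑' k : ℕ, (k + 1) * a (k + 1) * z ^ k) z := by
  have hA : 0 ≤ A := by simpa using (abs_nonneg _).trans (ha 0)
  have hs : Summable fun n : ℕ => (n : ℝ) * A * R ^ n * ρ ^ (n - 1) := by
    have h1 : ‖ρ * R‖ < 1 := by
      rw [Real.norm_of_nonneg (by positivity)]; exact hρ
    have := (summable_pow_mul_geometric_of_norm_lt_one 1 h1).mul_left (A / ρ)
    refine this.congr fun n => ?_
    rcases n with _ | n
    · simp
    · rw [Nat.add_sub_cancel, mul_pow, pow_succ ρ]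
      field_simp
  have h := hasDerivAt_tsum_of_isPreconnected (g := fun n z => a n * z ^ n)
    (g' := fun n z => a n * (n * z ^ (n - 1))) (y₀ := 0) hs Metric.isOpen_ball
    (convex_ball (0 : ℝ) ρ).isPreconnected
    (fun n y _ => (hasDerivAt_pow n y).const_mul (a n)) (fun n y hy => ?_)
    (Metric.mem_ball_self hρ0) ?_ hz
  · have hsum : Summable fun n : ℕ => a n * (n * z ^ (n - 1)) := by
      refine Summable.of_norm_bounded hs fun n => ?_
      rw [mem_ball_zero_iff, Real.norm_eq_abs] at hz
      rw [Real.norm_eq_abs, abs_mul, abs_mul, abs_pow, Nat.abs_cast]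
      calc |a n| * (n * |z| ^ (n - 1)) ≤ (A * R ^ n) * (n * ρ ^ (n - 1)) := by
            gcongr
            exact ha n
        _ = _ := by ring
    rw [hsum.tsum_eq_zero_add] at h
    simp only [Nat.cast_zero, zero_mul, mul_zero, zero_add, Nat.add_sub_cancel, Nat.cast_add,
      Nat.cast_one] at h
    refine h.congr_deriv (tsum_congr fun k => by ring)
  · rw [mem_ball_zero_iff, Real.norm_eq_abs] at hy
    rw [Real.norm_eq_abs, abs_mul, abs_mul, abs_pow, Nat.abs_cast]
    calc |a n| * (n * |y| ^ (n - 1)) ≤ (A * R ^ n) * (n * ρ ^ (n - 1)) := by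
          gcongr
          exact ha n
      _ = _ := by ring
  · refine summable_of_ne_finset_zero (s := {0}) fun n hn => ?_
    rw [Finset.mem_singleton] at hn
    simp [hn]

/-- A sequence with `(k+1) a_{k+1} = ∑ C_i a_{k-i}` and `a_0 = 1` has generating function
`exp (∑ C_k z^{k+1} / (k+1))`. -/
lemma tsum_eq_exp_of_recursion {a C : ℕ → ℝ} {B r : ℝ} (hr0 : 0 < r) (hr : r < 1)
    (hC : ∀ i, |C i| ≤ B * r ^ i) (h0 : a 0 = 1)
    (hrec : ∀ k, (k + 1) * a (k + 1) = ∑ p ∈ antidiagonal k, C p.1 * a p.2)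
    {z : ℝ} (hz : |z| ≤ 1) :
    (Summable fun k => |a k|) ∧
      ∑' k, a k * z ^ k = Real.exp (∑' k : ℕ, C k / (k + 1) * z ^ (k + 1)) := by
  obtain ⟨A, R, hrR, hR1, hA, ha⟩ := exists_geometric_bound_of_recursion hr0 hr hC hrec
  have hR0 : 0 < R := hr0.trans_le hrR
  have hB : 0 ≤ B := by simpa using (abs_nonneg _).trans (hC 0)
  refine ⟨by simpa using summable_mul_pow_of_geometric (z := 1) hR0.le ha (by simpa using hR1), ?_⟩
  -- A radius larger than 1 within the disc of convergence, so that |z| ≤ 1 is an interior point.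
  obtain ⟨ρ, hρ1, hρ2⟩ := exists_between ((one_lt_inv₀ hR0).2 hR1)
  have hρR : ρ * R < 1 := by
    have := mul_lt_mul_of_pos_right hρ2 hR0
    rwa [inv_mul_cancel₀ hR0.ne'] at this
  have hρ0 : 0 < ρ := one_pos.trans hρ1
  set c : ℕ → ℝ := fun k => if k = 0 then 0 else C (k - 1) / k with hc
  have hCR : ∀ i, |C i| ≤ B * R ^ i := fun i =>
    (hC i).trans (mul_le_mul_of_nonneg_left (pow_le_pow_left₀ hr0.le hrR i) hB)
  have hcR : ∀ k, |c k| ≤ (B / R) * R ^ k := by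
    intro k
    rcases k with _ | k
    · simp only [hc, if_pos, abs_zero]; positivity
    · simp only [hc, Nat.succ_ne_zero, if_false, Nat.add_sub_cancel]
      rw [abs_div, Nat.abs_cast, pow_succ]
      calc |C k| / ((k + 1 : ℕ) : ℝ) ≤ |C k| / 1 := by
            gcongr
            push_cast
            linarith [Nat.cast_nonneg (α := ℝ) k]
        _ ≤ B * R ^ k := by rw [div_one]; exact hCR k
        _ = _ := by field_simp
  have hsum : ∀ y ∈ Metric.ball (0 : ℝ) ρ, |y| * R < 1 := by
    intro y hy
    rw [mem_ball_zero_iff, Real.norm_eq_abs] at hy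
    nlinarith
  have hderivC : ∀ y, ∑' k : ℕ, ((k : ℝ) + 1) * c (k + 1) * y ^ k = ∑' k, C k * y ^ k := by
    intro y
    refine tsum_congr fun k => ?_
    simp only [hc, Nat.succ_ne_zero, if_false, Nat.add_sub_cancel]
    have : (k : ℝ) + 1 ≠ 0 := by positivity
    push_cast
    field_simp
  have hderivA : ∀ y ∈ Metric.ball (0 : ℝ) ρ, ∑' k : ℕ, ((k : ℝ) + 1) * a (k + 1) * y ^ k =
      (∑' k, C k * y ^ k) * ∑' k, a k * y ^ k := by
    intro y hy
    rw [tsum_mul_tsum_eq_tsum_sum_antidiagonal_of_summable_norm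
      (f := fun k => C k * y ^ k) (g := fun k => a k * y ^ k)
      (by simpa using summable_mul_pow_of_geometric hR0.le hCR (hsum y hy))
      (by simpa using summable_mul_pow_of_geometric hR0.le ha (hsum y hy))]
    refine tsum_congr fun k => ?_
    rw [hrec, Finset.sum_mul]
    refine Finset.sum_congr rfl fun p hp => ?_
    rw [← HasAntidiagonal.mem_antidiagonal.1 hp, pow_add]
    ring
  set s : ℝ → ℝ := fun y => ∑' k, a k * y ^ k with hs
  set f : ℝ → ℝ := fun y => ∑' k, c k * y ^ k with hf
  -- The recursion is a Cauchy product and says s' = f' s, so s exp(-f) is constant on the ball.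
  have hd : ∀ y ∈ Metric.ball (0 : ℝ) ρ, HasDerivAt (fun y => s y * Real.exp (-f y)) 0 y := by
    intro y hy
    have h1 := hasDerivAt_tsum_pow hR0.le ha hρ0 hρR hy
    have h2 := hasDerivAt_tsum_pow hR0.le hcR hρ0 hρR hy
    rw [hderivA y hy] at h1
    rw [hderivC y] at h2
    refine (h1.mul (h2.neg.exp)).congr_deriv ?_
    simp only [Pi.neg_apply]
    ring
  have hconst := (convex_ball (0 : ℝ) ρ).is_const_of_fderivWithin_eq_zero
    (𝕜 := ℝ) (f := fun y => s y * Real.exp (-f y))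
    (fun y hy => (hd y hy).differentiableAt.differentiableWithinAt)
    (fun y hy => by
      rw [fderivWithin_of_isOpen Metric.isOpen_ball hy]
      ext
      simp [(hd y hy).deriv])
    (x := z) (y := 0)
    (by rw [mem_ball_zero_iff, Real.norm_eq_abs]; linarith) (Metric.mem_ball_self hρ0)
  have hs0 : s 0 = 1 := by
    simp only [hs]
    rw [tsum_eq_single 0 (fun k hk => by simp [hk])]
    simp [h0]
  have hf0 : f 0 = 0 := by
    simp only [hf]
    rw [tsum_eq_single 0 (fun k hk => by simp [hk])]
    simp [hc]
  have hfz : f z = ∑' k : ℕ, C k / (k + 1) * z ^ (k + 1) := by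
    have hS : Summable fun k => c k * z ^ k :=
      (summable_mul_pow_of_geometric hR0.le hcR (hsum z
        (by rw [mem_ball_zero_iff, Real.norm_eq_abs]; linarith))).of_abs
    simp only [hf]
    rw [hS.tsum_eq_zero_add]
    simp [hc]
  simp only [hs0, hf0, neg_zero, Real.exp_zero, mul_one] at hconst
  rw [← hfz]
  have : s z = 1 * Real.exp (f z) := by
    rw [← hconst, mul_assoc, ← Real.exp_add, neg_add_cancel, Real.exp_zero, mul_one]
  simpa [hs] using this

/-- The exponential formula at z = -1. When m consists of the factorial moments of w, the left side
is the expansion of E ∏ (1 - w(P_i)). -/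
lemma tsum_moments_eq_exp {m : ℕ → ℝ} (h0 : m 0 = 1) {B r : ℝ} (hr0 : 0 < r) (hr : r < 1)
    (hm : ∀ k : ℕ, |cumulantOf m (k + 1)| ≤ B * r ^ k * k.factorial) :
    (Summable fun k : ℕ => |m k / k.factorial|) ∧
      ∑' k : ℕ, m k / k.factorial * (-1) ^ k =
        Real.exp (∑' k : ℕ, (-1) ^ (k + 1) * cumulantOf m (k + 1) / (k + 1).factorial) := by
  have h := tsum_eq_exp_of_recursion (a := fun k => m k / k.factorial)
    (C := fun k => cumulantOf m (k + 1) / k.factorial) (B := B) hr0 hr (z := -1)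
    (fun i => ?_) (by simp [h0]) (fun k => ?_) (by simp)
  · refine ⟨h.1, h.2.trans ?_⟩
    congr 1
    refine tsum_congr fun k => ?_
    rw [Nat.factorial_succ]
    push_cast
    field_simp
  · rw [abs_div, Nat.abs_cast, div_le_iff₀ (by positivity)]
    exact hm i
  · rw [← moment_succ_eq m h0 k, Nat.factorial_succ]
    push_cast
    have : (k : ℝ) + 1 ≠ 0 := by positivity
    have := Nat.factorial_ne_zero k
    field_simp

end PowerSeriesExp

end PlanarCylinder

end

noncomputable section

namespace PlanarCylinder

variable {Ω : Type*} [MeasurableSpace Ω]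

/-! ### Test functions and functionals that are integrals in each variable -/

lemma notMem_Icc_of_lt_abs {N x : ℝ} (hx : N < |x|) : x ∉ Icc (-N) N :=
  fun h => absurd (abs_le.2 ⟨h.1, h.2⟩) (not_le.2 hx)

/-- Bounded measurable functions with bounded support. -/
structure IsTest (f : ℝ → ℝ) : Prop where
  measurable : Measurable f
  bounded : ∃ C : ℝ, ∀ x, |f x| ≤ C
  bounded_support : ∃ N : ℝ, ∀ x, N < |x| → f x = 0

namespace IsTest

lemma add {f g : ℝ → ℝ} (hf : IsTest f) (hg : IsTest g) : IsTest (f + g) := by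
  obtain ⟨C, hC⟩ := hf.bounded
  obtain ⟨D, hD⟩ := hg.bounded
  obtain ⟨N, hN⟩ := hf.bounded_support
  obtain ⟨M, hM⟩ := hg.bounded_support
  refine ⟨hf.measurable.add hg.measurable,
    ⟨C + D, fun x => (abs_add_le _ _).trans (add_le_add (hC x) (hD x))⟩, ⟨max N M, fun x hx => ?_⟩⟩
  rw [max_lt_iff] at hx
  simp [hN x hx.1, hM x hx.2]

lemma smul {f : ℝ → ℝ} (hf : IsTest f) (c : ℝ) : IsTest (c • f) := by
  obtain ⟨C, hC⟩ := hf.bounded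
  obtain ⟨N, hN⟩ := hf.bounded_support
  refine ⟨hf.measurable.const_smul c, ⟨|c| * C, fun x => ?_⟩, ⟨N, fun x hx => ?_⟩⟩
  · simp only [Pi.smul_apply, smul_eq_mul, abs_mul]
    exact mul_le_mul_of_nonneg_left (hC x) (abs_nonneg _)
  · simp [hN x hx]

lemma sub {f g : ℝ → ℝ} (hf : IsTest f) (hg : IsTest g) : IsTest (f - g) := by
  have := hf.add (hg.smul (-1))
  rwa [neg_one_smul, ← sub_eq_add_neg] at this

lemma abs {f : ℝ → ℝ} (hf : IsTest f) : IsTest (fun x => |f x|) := by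
  obtain ⟨C, hC⟩ := hf.bounded
  obtain ⟨N, hN⟩ := hf.bounded_support
  exact ⟨hf.measurable.abs, ⟨C, fun x => by rw [abs_abs]; exact hC x⟩,
    ⟨N, fun x hx => by simp [hN x hx]⟩⟩

lemma indicator_one {B : Set ℝ} (hB : MeasurableSet B) (hb : Bornology.IsBounded B) :
    IsTest (B.indicator fun _ => (1 : ℝ)) := by
  obtain ⟨N, hN⟩ := hb.exists_norm_le
  refine ⟨measurable_const.indicator hB, ⟨1, fun x => ?_⟩, ⟨N, fun x hx => ?_⟩⟩
  · by_cases h : x ∈ B <;> simp [h]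
  · exact Set.indicator_of_notMem (fun h => absurd (hN x h) (not_le.2 hx)) _

lemma integrable {f : ℝ → ℝ} (hf : IsTest f) : Integrable f := by
  obtain ⟨C, hC⟩ := hf.bounded
  obtain ⟨N, hN⟩ := hf.bounded_support
  have h1 : IntegrableOn f (Icc (-N) N) :=
    Measure.integrableOn_of_bounded (M := C) measure_Icc_lt_top.ne
      hf.measurable.aestronglyMeasurable (ae_of_all _ hC)
  refine (integrableOn_iff_integrable_of_support_subset fun x hx => ?_).1 h1
  exact abs_le.1 (not_lt.1 fun h => hx (hN x h))

end IsTest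

/-- A functional that behaves like integration against a locally finite signed measure. -/
structure IntLike (L : (ℝ → ℝ) → ℝ) : Prop where
  add : ∀ f g, IsTest f → IsTest g → L (f + g) = L f + L g
  smul : ∀ (c : ℝ) (f), IsTest f → L (c • f) = c * L f
  tendsto : ∀ (g : ℕ → ℝ → ℝ) (h : ℝ → ℝ) (C N : ℝ), (∀ n, Measurable (g n)) →
    (∀ n x, |g n x| ≤ C) → (∀ n x, N < |x| → g n x = 0) →
    (∀ x, Tendsto (fun n => g n x) atTop (𝓝 (h x))) → Tendsto (fun n => L (g n)) atTop (𝓝 (L h))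

lemma IntLike.const_mul {L : (ℝ → ℝ) → ℝ} (hL : IntLike L) (c : ℝ) :
    IntLike fun g => c * L g where
  add f g hf hg := by rw [hL.add f g hf hg, mul_add]
  smul a f hf := by rw [hL.smul a f hf, mul_left_comm]
  tendsto g h C N h1 h2 h3 h4 := (hL.tendsto g h C N h1 h2 h3 h4).const_mul c

lemma IntLike.sum {κ : Type*} (s : Finset κ) {L : κ → (ℝ → ℝ) → ℝ}
    (hL : ∀ a ∈ s, IntLike (L a)) : IntLike fun g => ∑ a ∈ s, L a g where
  add f g hf hg := by
    rw [← Finset.sum_add_distrib]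
    exact Finset.sum_congr rfl fun a ha => (hL a ha).add f g hf hg
  smul c f hf := by
    rw [Finset.mul_sum]
    exact Finset.sum_congr rfl fun a ha => (hL a ha).smul c f hf
  tendsto g h C N h1 h2 h3 h4 :=
    tendsto_finsetSum s fun a ha => (hL a ha).tendsto g h C N h1 h2 h3 h4

lemma IntLike.sub {L L' : (ℝ → ℝ) → ℝ} (hL : IntLike L) (hL' : IntLike L') :
    IntLike fun g => L g - L' g where
  add f g hf hg := by rw [hL.add f g hf hg, hL'.add f g hf hg]; ring
  smul a f hf := by rw [hL.smul a f hf, hL'.smul a f hf]; ring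
  tendsto g h C N h1 h2 h3 h4 :=
    (hL.tendsto g h C N h1 h2 h3 h4).sub (hL'.tendsto g h C N h1 h2 h3 h4)

/-- Linearity gives equality on simple functions cut off to the support of f, and bounded
convergence carries it to f. This stands in for uniqueness of measures when the functionals are sums
of products of moments. -/
lemma IntLike.congr_of_indicator {L L' : (ℝ → ℝ) → ℝ} (hL : IntLike L) (hL' : IntLike L')
    (h : ∀ B : Set ℝ, MeasurableSet B → Bornology.IsBounded B →
      L (B.indicator fun _ => 1) = L' (B.indicator fun _ => 1)) {f : ℝ → ℝ} (hf : IsTest f) :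
    L f = L' f := by
  obtain ⟨C, hC⟩ := hf.bounded
  obtain ⟨N, hN⟩ := hf.bounded_support
  have hb : Bornology.IsBounded (Icc (-N) N) := Metric.isBounded_Icc _ _
  have htest : ∀ φ : SimpleFunc ℝ ℝ, IsTest ((Icc (-N) N).indicator φ) := fun φ => by
    obtain ⟨D, hD⟩ := φ.exists_forall_norm_le
    refine ⟨φ.measurable.indicator measurableSet_Icc, ⟨D, fun x => ?_⟩, ⟨N, fun x hx => ?_⟩⟩
    · exact (norm_indicator_le_norm_self φ x).trans (hD x)
    · exact Set.indicator_of_notMem (notMem_Icc_of_lt_abs hx) _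
  have hsimple : ∀ φ : SimpleFunc ℝ ℝ,
      L ((Icc (-N) N).indicator φ) = L' ((Icc (-N) N).indicator φ) := fun φ => by
    induction φ using SimpleFunc.induction with
    | const c hs =>
      rename_i s
      have he : (Icc (-N) N).indicator
          (SimpleFunc.piecewise s hs (SimpleFunc.const ℝ c) (SimpleFunc.const ℝ 0)) =
          c • (Icc (-N) N ∩ s).indicator fun _ => (1 : ℝ) := by
        ext x
        by_cases h1 : x ∈ Icc (-N) N <;> by_cases h2 : x ∈ s <;>
          simp [Set.indicator, h1, h2]
      have hm : MeasurableSet (Icc (-N) N ∩ s) := measurableSet_Icc.inter hs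
      have hbb := hb.subset (Set.inter_subset_left (t := s))
      rw [he, hL.smul _ _ (IsTest.indicator_one hm hbb), hL'.smul _ _ (IsTest.indicator_one hm hbb),
        h _ hm hbb]
    | add _ ih1 ih2 =>
      rename_i f g _
      rw [SimpleFunc.coe_add, Set.indicator_add', hL.add _ _ (htest f) (htest g),
        hL'.add _ _ (htest f) (htest g), ih1, ih2]
  have hsm : StronglyMeasurable f := hf.measurable.stronglyMeasurable
  have hC0 : 0 ≤ C := (abs_nonneg _).trans (hC 0)
  set g : ℕ → ℝ → ℝ := fun n => (Icc (-N) N).indicator (hsm.approxBounded C n) with hg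
  have h1 : ∀ n, Measurable (g n) := fun n => (htest _).measurable
  have h2 : ∀ n x, |g n x| ≤ C := fun n x =>
    (norm_indicator_le_norm_self _ x).trans (hsm.norm_approxBounded_le hC0 n x)
  have h3 : ∀ n x, N < |x| → g n x = 0 := fun n x hx =>
    Set.indicator_of_notMem (notMem_Icc_of_lt_abs hx) _
  have h4 : ∀ x, Tendsto (fun n => g n x) atTop (𝓝 (f x)) := fun x => by
    by_cases hx : x ∈ Icc (-N) N
    · simp only [hg, Set.indicator_of_mem hx]
      exact hsm.tendsto_approxBounded_of_norm_le (hC x)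
    · have : f x = 0 := hN x (not_le.1 fun h => hx (abs_le.1 h))
      simp only [hg, Set.indicator_of_notMem hx, this]
      exact tendsto_const_nhds
  refine tendsto_nhds_unique (hL.tendsto g f C N h1 h2 h3 h4) ?_
  simp_rw [hg, hsimple]
  exact hL'.tendsto g f C N h1 h2 h3 h4

/-- A functional of tuples of functions that is `IntLike` in each variable. -/
def MultiIntLike {ι : Type*} [DecidableEq ι] (T : (ι → ℝ → ℝ) → ℝ) : Prop :=
  ∀ f : ι → ℝ → ℝ, (∀ i, IsTest (f i)) → ∀ i, IntLike fun g => T (Function.update f i g)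

lemma isTest_update {ι : Type*} [DecidableEq ι] {f : ι → ℝ → ℝ} (hf : ∀ i, IsTest (f i)) (i : ι)
    {g : ℝ → ℝ} (hg : IsTest g) (j : ι) : IsTest (Function.update f i g j) := by
  by_cases h : j = i
  · subst h; simpa using hg
  · simpa [h] using hf j

/-- The arguments are replaced by indicators one at a time while the others stay frozen. Identities
for cumulants of boxes thereby extend to products of test functions. -/
lemma MultiIntLike.congr_of_indicator {ι : Type*} [DecidableEq ι] [Fintype ι]
    {T T' : (ι → ℝ → ℝ) → ℝ} (hT : MultiIntLike T) (hT' : MultiIntLike T')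
    (h : ∀ B : ι → Set ℝ, (∀ i, MeasurableSet (B i)) → (∀ i, Bornology.IsBounded (B i)) →
      T (fun i => (B i).indicator fun _ => 1) = T' (fun i => (B i).indicator fun _ => 1))
    {f : ι → ℝ → ℝ} (hf : ∀ i, IsTest (f i)) : T f = T' f := by
  have key : ∀ s : Finset ι, ∀ f : ι → ℝ → ℝ, (∀ i, IsTest (f i)) →
      (∀ i, i ∉ s → ∃ B : Set ℝ, MeasurableSet B ∧ Bornology.IsBounded B ∧
        f i = B.indicator fun _ => 1) → T f = T' f := by
    intro s
    induction s using Finset.induction_on with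
    | empty =>
      intro f _ hB
      choose B hB1 hB2 hB3 using fun i => hB i (Finset.notMem_empty i)
      have : f = fun i => (B i).indicator fun _ => 1 := funext hB3
      rw [this]
      exact h B hB1 hB2
    | insert i s hi ih =>
      intro f hf hB
      have := (hT f hf i).congr_of_indicator (hT' f hf i) (fun B hBm hBb => ?_) (hf i)
      · simpa using this
      · refine ih _ (isTest_update hf i (IsTest.indicator_one hBm hBb)) fun j hj => ?_
        by_cases hji : j = i
        · subst hji
          exact ⟨B, hBm, hBb, by simp⟩
        · simpa [hji] using hB j (by simp [hji, hj])
  exact key Finset.univ f hf fun i hi => absurd (Finset.mem_univ i) hi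

/-! ### Integrals of product functions -/

/-- Measures on a finite power of the line that are finite on bounded boxes. -/
def FiniteOnBoxes {ι : Type*} (κ : Measure (ι → ℝ)) : Prop :=
  ∀ N : ℝ, κ (Set.univ.pi fun _ => Icc (-N) N) < ∞

/-- The integral of a product function. -/
def prodIntegral {ι : Type*} [Fintype ι] (κ : Measure (ι → ℝ)) (f : ι → ℝ → ℝ) : ℝ :=
  ∫ x, ∏ i, f i (x i) ∂κ

lemma measurable_prod_apply {ι : Type*} [Fintype ι] {f : ι → ℝ → ℝ} (hf : ∀ i, Measurable (f i)) :
    Measurable fun x : ι → ℝ => ∏ i, f i (x i) :=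
  Finset.measurable_prod _ fun i _ => (hf i).comp (measurable_pi_apply i)

lemma FiniteOnBoxes.integrable {ι : Type*} [Fintype ι] {κ : Measure (ι → ℝ)} (hκ : FiniteOnBoxes κ)
    {f : ι → ℝ → ℝ} (hf : ∀ i, IsTest (f i)) : Integrable (fun x => ∏ i, f i (x i)) κ := by
  choose C hC using fun i => (hf i).bounded
  choose N hN using fun i => (hf i).bounded_support
  set M := ∑ i, |N i| with hM
  have hle : ∀ i, N i ≤ M := fun i => (le_abs_self _).trans
    (Finset.single_le_sum (f := fun i => |N i|) (fun _ _ => abs_nonneg _) (Finset.mem_univ i))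
  have h1 : IntegrableOn (fun x : ι → ℝ => ∏ i, f i (x i)) (Set.univ.pi fun _ => Icc (-M) M) κ := by
    refine Measure.integrableOn_of_bounded (M := ∏ i, C i) (hκ M).ne
      (measurable_prod_apply fun i => (hf i).measurable).aestronglyMeasurable
      (ae_of_all _ fun x => ?_)
    rw [norm_prod]
    exact Finset.prod_le_prod (fun _ _ => norm_nonneg _) fun i _ => hC i _
  refine (integrableOn_iff_integrable_of_support_subset fun x hx => ?_).1 h1
  intro i _
  rw [Function.mem_support, Finset.prod_ne_zero_iff] at hx
  exact abs_le.1 ((not_lt.1 fun h => hx i (Finset.mem_univ i) (hN i _ h)).trans (hle i))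

lemma prod_update_apply {ι : Type*} [Fintype ι] [DecidableEq ι] (f : ι → ℝ → ℝ) (i : ι) (g : ℝ → ℝ)
    (x : ι → ℝ) : ∏ j, Function.update f i g j (x j) =
      g (x i) * ∏ j ∈ Finset.univ.erase i, f j (x j) := by
  rw [← Finset.mul_prod_erase _ _ (Finset.mem_univ i)]
  congr 1
  · simp
  · refine Finset.prod_congr rfl fun j hj => ?_
    rw [Function.update_of_ne (Finset.ne_of_mem_erase hj)]

lemma multiIntLike_prodIntegral {ι : Type*} [Fintype ι] [DecidableEq ι] {κ : Measure (ι → ℝ)}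
    (hκ : FiniteOnBoxes κ) : MultiIntLike (prodIntegral κ) := by
  intro f hf i
  refine ⟨fun g h hg hh => ?_, fun c g hg => ?_, fun g h C N h1 h2 h3 h4 => ?_⟩
  · simp only [prodIntegral]
    rw [← integral_add (hκ.integrable (isTest_update hf i hg))
      (hκ.integrable (isTest_update hf i hh))]
    refine integral_congr_ae (ae_of_all _ fun x => ?_)
    simp only [prod_update_apply, Pi.add_apply]
    ring
  · simp only [prodIntegral]
    rw [← integral_const_mul]
    refine integral_congr_ae (ae_of_all _ fun x => ?_)
    simp only [prod_update_apply, Pi.smul_apply, smul_eq_mul]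
    ring
  · have hC0 : 0 ≤ C := (abs_nonneg _).trans (h2 0 0)
    set b : ℝ → ℝ := C • (Icc (-N) N).indicator fun _ => (1 : ℝ) with hb
    have hbt : IsTest b :=
      (IsTest.indicator_one measurableSet_Icc (Metric.isBounded_Icc _ _)).smul C
    have hgb : ∀ n x, |g n x| ≤ b x := fun n x => by
      by_cases hx : x ∈ Icc (-N) N
      · simpa [hb, hx] using h2 n x
      · have : g n x = 0 := h3 n x (not_le.1 fun h => hx (abs_le.1 h))
        simp [hb, hx, this]
    have hgt : ∀ n, IsTest (g n) := fun n => ⟨h1 n, ⟨C, h2 n⟩, ⟨N, h3 n⟩⟩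
    refine tendsto_integral_of_dominated_convergence
      (fun x => ∏ j, Function.update (fun j y => |f j y|) i b j (x j)) (fun n => ?_)
      (hκ.integrable (isTest_update (fun j => (hf j).abs) i hbt)) (fun n => ae_of_all _ fun x => ?_)
      (ae_of_all _ fun x => ?_)
    · exact (hκ.integrable (isTest_update hf i (hgt n))).aestronglyMeasurable
    · simp only [prod_update_apply, Real.norm_eq_abs, abs_mul, Finset.abs_prod]
      exact mul_le_mul_of_nonneg_right (hgb n _) (Finset.prod_nonneg fun _ _ => abs_nonneg _)
    · simp only [prod_update_apply]
      exact (h4 (x i)).mul_const _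

lemma prodIntegral_indicator {ι : Type*} [Fintype ι] (κ : Measure (ι → ℝ)) {B : ι → Set ℝ}
    (hB : ∀ i, MeasurableSet (B i)) :
    prodIntegral κ (fun i => (B i).indicator fun _ => 1) = (κ (Set.univ.pi B)).toReal := by
  classical
  have h : (fun x : ι → ℝ => ∏ i, (B i).indicator (fun _ => (1 : ℝ)) (x i)) =
      (Set.univ.pi B).indicator fun _ => 1 := by
    ext x
    by_cases hx : x ∈ Set.univ.pi B
    · rw [Set.indicator_of_mem hx]
      exact Finset.prod_eq_one fun i _ => Set.indicator_of_mem (hx i (Set.mem_univ i)) _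
    · rw [Set.indicator_of_notMem hx]
      simp only [Set.mem_pi, Set.mem_univ, forall_const, not_forall] at hx
      obtain ⟨i, hi⟩ := hx
      exact Finset.prod_eq_zero (Finset.mem_univ i) (Set.indicator_of_notMem hi _)
  rw [prodIntegral, h, integral_indicator_const _ (MeasurableSet.univ_pi hB)]
  simp [Measure.real]

/-! ### The cumulant functional -/

/-- The moment functional of a block. -/
def blockMoment (P : ℤ → Ω → ℝ) (μ : Measure Ω) {k : ℕ} (J : Finset (Fin k))
    (f : Fin k → ℝ → ℝ) : ℝ :=
  prodIntegral (factorialMoment P μ J) fun j : J => f j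

/-- The factorial cumulant measure evaluated at a product function. -/
def cumulantFunctional (P : ℤ → Ω → ℝ) (μ : Measure Ω) (k : ℕ) (f : Fin k → ℝ → ℝ) : ℝ :=
  ∑ π : Finpartition (Finset.univ : Finset (Fin k)),
    (-1 : ℝ) ^ (π.parts.card - 1) * ((π.parts.card - 1).factorial : ℝ) *
      ∏ J ∈ π.parts, blockMoment P μ J f

/-- All factorial moment measures are finite on bounded boxes. -/
def MomentsFinite (P : ℤ → Ω → ℝ) (μ : Measure Ω) : Prop :=
  ∀ (ι : Type) [Fintype ι], FiniteOnBoxes (factorialMoment P μ ι)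

/-- The argument i enters each product of block moments through exactly one block, the one
containing i. -/
lemma multiIntLike_cumulantFunctional {P : ℤ → Ω → ℝ} {μ : Measure Ω} (hfin : MomentsFinite P μ)
    (k : ℕ) : MultiIntLike (cumulantFunctional P μ k) := by
  intro f hf i
  refine IntLike.sum _ fun π _ => IntLike.const_mul ?_ _
  have hmem : π.part i ∈ π.parts := π.part_mem.2 (Finset.mem_univ i)
  have hi : i ∈ π.part i := π.mem_part_self.2 (Finset.mem_univ i)
  have h : (fun g => ∏ J ∈ π.parts, blockMoment P μ J (Function.update f i g)) =
      fun g => (∏ J ∈ π.parts.erase (π.part i), blockMoment P μ J f) *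
        prodIntegral (factorialMoment P μ (π.part i))
          (Function.update (fun j : π.part i => f j) (⟨i, hi⟩ : {x // x ∈ π.part i}) g) := by
    funext g
    rw [← Finset.prod_erase_mul _ _ hmem]
    congr 1
    · refine Finset.prod_congr rfl fun J hJ => ?_
      rw [Finset.mem_erase] at hJ
      unfold blockMoment
      congr 1
      funext j
      refine Function.update_of_ne (fun hj => hJ.1 ?_) _ _
      exact π.eq_of_mem_parts hJ.2 hmem (hj ▸ j.2) hi
    · unfold blockMoment
      congr 1
      funext j
      by_cases hj : j = (⟨i, hi⟩ : {x // x ∈ π.part i})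
      · subst hj; simp
      · rw [Function.update_of_ne hj, Function.update_of_ne (fun h => hj (Subtype.ext h))]
  rw [h]
  exact (multiIntLike_prodIntegral (hfin (π.part i)) (fun j : {x // x ∈ π.part i} => f j)
    (fun j => hf j) ⟨i, hi⟩).const_mul _

/-- A pair of positive measures takes the place of a signed one because the cumulant measure on ℝ^k
is only finite on bounded sets: stationarity spreads it over the whole diagonal direction. -/
lemma cumulantFunctional_eq_sub {P : ℤ → Ω → ℝ} {μ : Measure Ω} (hfin : MomentsFinite P μ)
    {k : ℕ} {κ κ' : Measure (Fin k → ℝ)} (hκ : FiniteOnBoxes κ) (hκ' : FiniteOnBoxes κ')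
    (h : ∀ B : Fin k → Set ℝ, (∀ i, MeasurableSet (B i)) → (∀ i, Bornology.IsBounded (B i)) →
      factorialCumulant P μ k B = (κ (Set.univ.pi B)).toReal - (κ' (Set.univ.pi B)).toReal)
    {f : Fin k → ℝ → ℝ} (hf : ∀ i, IsTest (f i)) :
    cumulantFunctional P μ k f = prodIntegral κ f - prodIntegral κ' f := by
  refine (multiIntLike_cumulantFunctional hfin k).congr_of_indicator
    (T' := fun f => prodIntegral κ f - prodIntegral κ' f)
    (fun f hf i => (multiIntLike_prodIntegral hκ f hf i).sub (multiIntLike_prodIntegral hκ' f hf i))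
    (fun B hB hb => ?_) hf
  rw [prodIntegral_indicator κ hB, prodIntegral_indicator κ' hB, ← h B hB hb]
  unfold cumulantFunctional factorialCumulant blockMoment
  refine Finset.sum_congr rfl fun π _ => ?_
  congr 1
  refine Finset.prod_congr rfl fun J _ => ?_
  exact prodIntegral_indicator _ (B := fun j : J => B j) fun j => hB j

/-- Factorial moment measures with equivalent index sets. -/
lemma map_factorialMoment {P : ℤ → Ω → ℝ} {μ : Measure Ω} (hP : ∀ i, Measurable (P i))
    {ι ι' : Type} (e : ι ≃ ι') :
    (factorialMoment P μ ι).map (fun x i' => x (e.symm i')) = factorialMoment P μ ι' := by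
  have hm : Measurable fun (x : ι → ℝ) (i' : ι') => x (e.symm i') :=
    measurable_pi_iff.2 fun i' => measurable_pi_apply _
  ext B hB
  rw [Measure.map_apply hm hB, factorialMoment, factorialMoment, Measure.sum_apply _ (hm hB),
    Measure.sum_apply _ hB, ← (Equiv.embeddingCongr e (Equiv.refl ℤ)).tsum_eq]
  refine tsum_congr fun s => ?_
  have h1 : ∀ {κ : Type} (s : κ ↪ ℤ), Measurable fun ω (j : κ) => P (s j) ω :=
    fun s => measurable_pi_iff.2 fun j => hP _
  rw [Measure.map_apply (h1 _) (hm hB), Measure.map_apply (h1 _) hB]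
  rfl

lemma prodIntegral_factorialMoment_equiv {P : ℤ → Ω → ℝ} {μ : Measure Ω}
    (hP : ∀ i, Measurable (P i)) {ι ι' : Type} [Fintype ι] [Fintype ι'] (e : ι ≃ ι')
    {f : ι' → ℝ → ℝ} (hf : ∀ i, Measurable (f i)) :
    prodIntegral (factorialMoment P μ ι') f =
      prodIntegral (factorialMoment P μ ι) fun i => f (e i) := by
  have hm : Measurable fun (x : ι → ℝ) (i' : ι') => x (e.symm i') :=
    measurable_pi_iff.2 fun i' => measurable_pi_apply _
  rw [prodIntegral, ← map_factorialMoment hP e, integral_map hm.aemeasurable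
    (measurable_prod_apply hf).aestronglyMeasurable, prodIntegral]
  refine integral_congr_ae (ae_of_all _ fun x => ?_)
  simp only
  rw [← e.prod_comp]
  simp

/-- A permutation relabels the blocks of each set partition, and factorial moment measures do not
depend on the labelling of their index set. The symmetry is used to move chosen arguments into the
first or last position. -/
lemma cumulantFunctional_comp_perm {P : ℤ → Ω → ℝ} {μ : Measure Ω} (hP : ∀ i, Measurable (P i))
    {k : ℕ} (σ : Equiv.Perm (Fin k)) {f : Fin k → ℝ → ℝ} (hf : ∀ i, Measurable (f i)) :
    cumulantFunctional P μ k (fun i => f (σ i)) = cumulantFunctional P μ k f := by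
  unfold cumulantFunctional
  have hmap : ∀ (σ : Equiv.Perm (Fin k)),
      (Finset.univ : Finset (Fin k)).map σ.toEmbedding = Finset.univ := fun σ =>
    Finset.map_univ_equiv σ
  let g : Equiv.Perm (Fin k) → Finset (Fin k) ≃o Finset (Fin k) := fun σ =>
    { toEquiv := Equiv.finsetCongr σ
      map_rel_iff' := by intro a b; simp }
  have hg : ∀ σ s, g σ s = s.map σ.toEmbedding := fun _ _ => rfl
  let m : Equiv.Perm (Fin k) → Finpartition (Finset.univ : Finset (Fin k)) →
      Finpartition (Finset.univ : Finset (Fin k)) := fun σ π =>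
    (π.map (g σ)).copy (hmap σ)
  have hparts : ∀ σ π, (m σ π).parts = π.parts.map (g σ).toEquiv.toEmbedding := fun σ π => by
    rfl
  have hinv : ∀ (τ σ : Equiv.Perm (Fin k)), (∀ x, τ (σ x) = x) → ∀ π, m τ (m σ π) = π := by
    intro τ σ hστ π
    apply Finpartition.ext
    rw [hparts, hparts, Finset.map_map]
    have : ((g σ).toEquiv.toEmbedding.trans (g τ).toEquiv.toEmbedding) =
        Function.Embedding.refl _ := by
      ext s x
      change x ∈ g τ (g σ s) ↔ x ∈ s
      simp only [hg, Finset.mem_map, Equiv.coe_toEmbedding, exists_exists_and_eq_and, hστ,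
        exists_eq_right]
    rw [this, Finset.map_refl]
  refine Finset.sum_bij' (fun π _ => m σ π) (fun π _ => m σ.symm π) (fun _ _ => Finset.mem_univ _)
    (fun _ _ => Finset.mem_univ _) (fun π _ => hinv _ _ (by simp) π)
    (fun π _ => hinv _ _ (by simp) π) fun π _ => ?_
  rw [hparts, Finset.card_map, Finset.prod_map]
  congr 1
  refine Finset.prod_congr rfl fun J _ => ?_
  unfold blockMoment
  let e : J ≃ ((g σ).toEquiv.toEmbedding J : Finset (Fin k)) :=
    σ.subtypeEquiv fun a => by
      change a ∈ J ↔ σ a ∈ g σ J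
      rw [hg]
      simp
  rw [prodIntegral_factorialMoment_equiv hP e fun j => hf j]
  rfl

/-- The moments `∫ ∏ w dα^{(k)}`. -/
def moment (P : ℤ → Ω → ℝ) (μ : Measure Ω) (w : ℝ → ℝ) (k : ℕ) : ℝ :=
  prodIntegral (factorialMoment P μ (Fin k)) fun _ => w

/-- For equal arguments the moment of a block depends only on its size. -/
lemma cumulantFunctional_const {P : ℤ → Ω → ℝ} {μ : Measure Ω} (hP : ∀ i, Measurable (P i))
    (k : ℕ) {w : ℝ → ℝ} (hw : Measurable w) :
    cumulantFunctional P μ k (fun _ => w) = cumulantOf (moment P μ w) k := by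
  unfold cumulantFunctional cumulantOf
  refine Finset.sum_congr rfl fun π _ => ?_
  congr 1
  refine Finset.prod_congr rfl fun J _ => ?_
  unfold blockMoment moment
  rw [prodIntegral_factorialMoment_equiv hP J.equivFin.symm fun _ => hw]

/-! ### Telescoping -/

/-- In the i-th hybrid tuple the arguments before i have already been switched to a, those after i
are still b, and multilinearity places the difference in position i. -/
lemma MultiIntLike.map_sub_eq_sum {k : ℕ} {T : (Fin k → ℝ → ℝ) → ℝ} (hT : MultiIntLike T)
    {a b : Fin k → ℝ → ℝ} (ha : ∀ i, IsTest (a i)) (hb : ∀ i, IsTest (b i)) :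
    T b - T a = ∑ i : Fin k,
      T (Function.update (fun j => if j < i then a j else b j) i (b i - a i)) := by
  let h : ℕ → Fin k → ℝ → ℝ := fun n j => if (j : ℕ) < n then a j else b j
  have h0 : h 0 = b := by funext j; simp [h]
  have hk : h k = a := by funext j; simp [h]
  have ht : ∀ n j, IsTest (h n j) := fun n j => by
    by_cases hj : (j : ℕ) < n
    · simpa only [h, hj, if_true] using ha j
    · simpa only [h, hj, if_false] using hb j
  have hstep : ∀ i : Fin k, T (h i) - T (h (i + 1)) =
      T (Function.update (fun j => if j < i then a j else b j) i (b i - a i)) := by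
    intro i
    have e0 : (fun j => if j < i then a j else b j) = h i := rfl
    have e1 : h i = Function.update (h i) i (a i + (b i - a i)) := by
      rw [add_sub_cancel]
      funext j
      by_cases hj : j = i
      · subst hj; simp [h]
      · rw [Function.update_of_ne hj]
    have e2 : h (i + 1) = Function.update (h i) i (a i) := by
      funext j
      by_cases hj : j = i
      · subst hj; simp [h]
      · rw [Function.update_of_ne hj]
        have : (j : ℕ) ≠ i := fun h => hj (Fin.ext h)
        have h3 : (j : ℕ) < i + 1 ↔ (j : ℕ) < i := by omega
        simp only [h, h3]
    rw [e0, e2]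
    have := (hT (h i) (ht i) i).add (a i) (b i - a i) (ha i) ((hb i).sub (ha i))
    rw [← e1] at this
    rw [this]
    ring
  rw [← Finset.sum_congr rfl fun i _ => hstep i,
    Fin.sum_univ_eq_sum_range (fun n => T (h n) - T (h (n + 1))), Finset.sum_range_sub', h0, hk]

end PlanarCylinder

end

noncomputable section

namespace PlanarCylinder

variable {Ω : Type*} [MeasurableSpace Ω]

/-! ### Finiteness of the factorial moment measures -/

lemma countingMeasure_apply {Ω : Type*} (P : ℤ → Ω → ℝ) (ω : Ω) {B : Set ℝ} (hB : MeasurableSet B) :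
    countingMeasure P ω B = ∑' i, B.indicator (fun _ => (1 : ℝ≥0∞)) (P i ω) := by
  rw [countingMeasure, Measure.sum_apply _ hB]
  refine tsum_congr fun i => ?_
  rw [Measure.dirac_apply' _ hB]
  rfl

lemma measurable_countingMeasure {P : ℤ → Ω → ℝ} (hP : ∀ i, Measurable (P i)) :
    Measurable (countingMeasure P) := by
  refine Measure.measurable_of_measurable_coe _ fun B hB => ?_
  simp_rw [countingMeasure_apply P _ hB]
  exact Measurable.tsum fun i => (measurable_const.indicator hB).comp (hP i)

namespace IsStationaryPointProcess

variable {P : ℤ → Ω → ℝ} {μ : Measure Ω}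

lemma lintegral_countingMeasure_shift (hP : IsStationaryPointProcess P μ) (t : ℝ) {B : Set ℝ}
    (hB : MeasurableSet B) (k : ℕ) :
    ∫⁻ ω, countingMeasure P ω ((fun x => x + t) ⁻¹' B) ^ k ∂μ =
      ∫⁻ ω, countingMeasure P ω B ^ k ∂μ := by
  have hF : Measurable fun ψ : Measure ℝ => ψ B ^ k := (Measure.measurable_coe hB).pow_const k
  have hm := measurable_countingMeasure hP.measurable
  have hadd : Measurable fun x : ℝ => x + t := measurable_id.add_const t
  have hm' : Measurable fun ω => (countingMeasure P ω).map fun x => x + t :=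
    (Measure.measurable_map _ hadd).comp hm
  rw [← lintegral_map hF hm, ← hP.stationary t, lintegral_map hF hm']
  refine lintegral_congr fun ω => ?_
  rw [Measure.map_apply hadd hB]

/-- The interval is covered by finitely many translates of [0,1]; the power mean inequality and
stationarity reduce the moment to that of Ψ([0,1]). -/
lemma lintegral_countingMeasure_Icc_pow_lt_top [IsProbabilityMeasure μ]
    (hP : IsStationaryPointProcess P μ) (hmom : HasAllMoments P μ) (N : ℝ) (k : ℕ) :
    ∫⁻ ω, countingMeasure P ω (Icc (-N) N) ^ k ∂μ < ∞ := by
  rcases Nat.eq_zero_or_pos k with rfl | hk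
  · simp
  have h1 : ∫⁻ ω, countingMeasure P ω (Icc 0 1) ^ k ∂μ < ∞ := by
    rcases Nat.lt_or_ge k 2 with h | h
    · obtain rfl : k = 1 := by omega
      simpa [eintensity] using hP.intensity_lt_top
    · exact hmom k h
  obtain ⟨n, hn⟩ := exists_nat_ge (2 * N)
  have hsub : Icc (-N) N ⊆ ⋃ j ∈ Finset.range (n + 1), (fun x => x + (N - j)) ⁻¹' Icc (0 : ℝ) 1 := by
    intro x hx
    have h0 : 0 ≤ x + N := by linarith [hx.1]
    simp only [Set.mem_iUnion, Finset.mem_range, Set.mem_preimage, Set.mem_Icc, exists_prop]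
    refine ⟨⌊x + N⌋₊, ?_, ?_, ?_⟩
    · have : ⌊x + N⌋₊ ≤ n := Nat.floor_le_of_le (by linarith [hx.2])
      omega
    · linarith [Nat.floor_le h0]
    · linarith [Nat.lt_floor_add_one (x + N)]
  have hle : ∀ ω, countingMeasure P ω (Icc (-N) N) ^ k ≤ ((n + 1 : ℕ) : ℝ≥0∞) ^ ((k : ℝ) - 1) *
      ∑ j ∈ Finset.range (n + 1),
        countingMeasure P ω ((fun x => x + (N - j)) ⁻¹' Icc (0 : ℝ) 1) ^ k := by
    intro ω
    have h2 : countingMeasure P ω (Icc (-N) N) ≤ ∑ j ∈ Finset.range (n + 1),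
        countingMeasure P ω ((fun x => x + (N - j)) ⁻¹' Icc (0 : ℝ) 1) :=
      (measure_mono hsub).trans (measure_biUnion_finset_le _ _)
    refine (pow_le_pow_left' h2 k).trans ?_
    have h3 := ENNReal.rpow_sum_le_const_mul_sum_rpow (Finset.range (n + 1))
      (fun j : ℕ => countingMeasure P ω ((fun x => x + (N - j)) ⁻¹' Icc (0 : ℝ) 1))
      (p := (k : ℝ)) (by exact_mod_cast hk)
    simpa only [ENNReal.rpow_natCast, Finset.card_range] using h3
  refine (lintegral_mono hle).trans_lt ?_
  have hmeas : ∀ j : ℕ, Measurable fun ω =>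
      countingMeasure P ω ((fun x => x + (N - j)) ⁻¹' Icc (0 : ℝ) 1) ^ k := fun j =>
    ((Measure.measurable_coe (measurableSet_Icc.preimage (measurable_id.add_const _))).comp
      (measurable_countingMeasure hP.measurable)).pow_const k
  rw [lintegral_const_mul _ (Finset.measurable_sum _ fun j _ => hmeas j),
    lintegral_finsetSum _ fun j _ => hmeas j]
  refine ENNReal.mul_lt_top (ENNReal.rpow_lt_top_of_nonneg ?_ (by simp)) ?_
  · have : (1 : ℝ) ≤ k := by exact_mod_cast hk
    linarith
  · refine ENNReal.sum_lt_top.2 fun j _ => ?_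
    rw [hP.lintegral_countingMeasure_shift _ measurableSet_Icc]
    exact h1

end IsStationaryPointProcess

lemma tsum_prod_fin (g : ℤ → ℝ≥0∞) (n : ℕ) :
    ∑' s : Fin n → ℤ, ∏ j, g (s j) = (∑' i, g i) ^ n := by
  induction n with
  | zero => simp
  | succ n ih =>
    rw [← (Fin.consEquiv fun _ : Fin (n + 1) => ℤ).tsum_eq, ENNReal.tsum_prod', pow_succ', ← ih,
      ← ENNReal.tsum_mul_right]
    refine tsum_congr fun i => ?_
    rw [← ENNReal.tsum_mul_left]
    refine tsum_congr fun s => ?_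
    rw [Fin.prod_univ_succ]
    simp [Fin.consEquiv]

lemma lintegral_factorialMoment {P : ℤ → Ω → ℝ} {μ : Measure Ω} (hP : ∀ i, Measurable (P i))
    {ι : Type} [Fintype ι] {H : (ι → ℝ) → ℝ≥0∞} (hH : Measurable H) :
    ∫⁻ x, H x ∂factorialMoment P μ ι = ∫⁻ ω, ∑' s : ι ↪ ℤ, H (fun j => P (s j) ω) ∂μ := by
  have hm : ∀ s : ι ↪ ℤ, Measurable fun ω j => P (s j) ω := fun s =>
    measurable_pi_iff.2 fun j => hP _
  have : Countable (ι ↪ ℤ) := DFunLike.coe_injective.countable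
  rw [factorialMoment, lintegral_sum_measure, lintegral_tsum
    (f := fun (s : ι ↪ ℤ) ω => H fun j => P (s j) ω) fun s => (hH.comp (hm s)).aemeasurable]
  exact tsum_congr fun s => lintegral_map hH (hm s)

/-- The sum over distinct indices is part of the sum over all k-tuples of indices, which is Ψ(B)^k.
-/
lemma momentsFinite {P : ℤ → Ω → ℝ} {μ : Measure Ω} [IsProbabilityMeasure μ]
    (hP : IsStationaryPointProcess P μ) (hmom : HasAllMoments P μ) : MomentsFinite P μ := by
  have hfin : ∀ n, FiniteOnBoxes (factorialMoment P μ (Fin n)) := by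
    intro n N
    have hB : MeasurableSet (Set.univ.pi fun _ : Fin n => Icc (-N) N) :=
      MeasurableSet.univ_pi fun _ => measurableSet_Icc
    rw [← lintegral_indicator_one hB,
      lintegral_factorialMoment hP.measurable (measurable_one.indicator hB)]
    refine lt_of_le_of_lt (lintegral_mono fun ω => ?_)
      (hP.lintegral_countingMeasure_Icc_pow_lt_top hmom N n)
    rw [countingMeasure_apply P ω measurableSet_Icc, ← tsum_prod_fin]
    refine le_trans (ENNReal.tsum_le_tsum fun s => ?_)
      (ENNReal.tsum_comp_le_tsum_of_injective (f := fun (s : Fin n ↪ ℤ) j => s j)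
        DFunLike.coe_injective
        (fun s : Fin n → ℤ => ∏ j, (Icc (-N) N).indicator (fun _ => (1 : ℝ≥0∞)) (P (s j) ω)))
    by_cases h : (fun j => P (s j) ω) ∈ Set.univ.pi fun _ : Fin n => Icc (-N) N
    · rw [Set.indicator_of_mem h, Finset.prod_eq_one fun j _ =>
        Set.indicator_of_mem (h j (Set.mem_univ j)) _]
      rfl
    · rw [Set.indicator_of_notMem h]
      exact zero_le
  intro ι _ N
  have hm : Measurable fun (x : Fin (Fintype.card ι) → ℝ) (i : ι) =>
      x ((Fintype.equivFin ι).symm.symm i) := measurable_pi_iff.2 fun i => measurable_pi_apply _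
  rw [← map_factorialMoment hP.measurable (Fintype.equivFin ι).symm,
    Measure.map_apply hm (MeasurableSet.univ_pi fun _ => measurableSet_Icc)]
  refine lt_of_le_of_lt (measure_mono fun x hx => ?_) (hfin _ N)
  intro i _
  simpa using hx ((Fintype.equivFin ι).symm i) (Set.mem_univ _)

/-! ### The first moment measure -/

lemma moment_zero (P : ℤ → Ω → ℝ) (μ : Measure Ω) [IsProbabilityMeasure μ]
    (hP : ∀ i, Measurable (P i)) (w : ℝ → ℝ) : moment P μ w 0 = 1 := by
  have h := lintegral_factorialMoment (P := P) (μ := μ) hP (ι := Fin 0)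
    (measurable_const (a := (1 : ℝ≥0∞)))
  have h1 : ∑' _ : Fin 0 ↪ ℤ, (1 : ℝ≥0∞) = 1 := by
    rw [tsum_fintype]
    simp
  rw [h1, lintegral_const, lintegral_const, one_mul, one_mul, measure_univ (μ := μ)] at h
  simp [moment, prodIntegral, Measure.real, h]

/-- By stationarity the intensity measure is translation invariant, hence a multiple of Lebesgue
measure by uniqueness of Haar measure; the unit interval identifies the factor. -/
lemma moment_one {P : ℤ → Ω → ℝ} {μ : Measure Ω}
    (hP : IsStationaryPointProcess P μ) {w : ℝ → ℝ} (hw : Measurable w) :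
    moment P μ w 1 = intensity P μ * ∫ x, w x := by
  have hev : Measurable fun x : Fin 1 → ℝ => x 0 := measurable_pi_apply 0
  set ν := (factorialMoment P μ (Fin 1)).map fun x => x 0 with hν
  have hνB : ∀ B, MeasurableSet B → ν B = ∫⁻ ω, countingMeasure P ω B ∂μ := by
    intro B hB
    rw [hν, Measure.map_apply hev hB, ← lintegral_indicator_one (hev hB),
      lintegral_factorialMoment hP.measurable (measurable_one.indicator (hev hB))]
    refine lintegral_congr fun ω => ?_
    rw [countingMeasure_apply P ω hB]
    let e : (Fin 1 ↪ ℤ) ≃ ℤ :=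
      { toFun := fun s => s 0
        invFun := fun i => ⟨fun _ => i, Function.injective_of_subsingleton _⟩
        left_inv := fun s => by ext j; simp [Subsingleton.elim j 0]
        right_inv := fun i => rfl }
    rw [← e.tsum_eq]
    exact tsum_congr fun s => rfl
  have hinv : ν.IsAddLeftInvariant := by
    refine ⟨fun t => ?_⟩
    ext B hB
    have hadd : Measurable fun x : ℝ => t + x := measurable_id.const_add t
    rw [Measure.map_apply hadd hB, hνB _ (hadd hB), hνB _ hB]
    have := hP.lintegral_countingMeasure_shift t hB 1
    simp only [pow_one] at this
    rw [← this]
    simp_rw [add_comm t]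
  have h01 : ν (Icc 0 1) = eintensity P μ := hνB _ measurableSet_Icc
  have hloc : IsLocallyFiniteMeasure ν := by
    refine ⟨fun x => ⟨(fun y => (1 / 2 - x) + y) ⁻¹' Icc 0 1, ?_, ?_⟩⟩
    · refine (continuous_const.add continuous_id).continuousAt.preimage_mem_nhds ?_
      apply Icc_mem_nhds <;> (simp; try norm_num)
    · have hadd : Measurable fun y : ℝ => (1 / 2 - x) + y := measurable_id.const_add _
      rw [← Measure.map_apply hadd measurableSet_Icc, map_add_left_eq_self, h01]
      exact hP.intensity_lt_top
  have hsm := Measure.isAddLeftInvariant_eq_smul ν (volume : Measure ℝ)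
  set c := Measure.addHaarScalarFactor ν (volume : Measure ℝ) with hc
  have hc2 : eintensity P μ = c := by
    rw [← h01, hsm]
    simp
  have h1 : moment P μ w 1 = ∫ x, w x ∂ν := by
    rw [hν, integral_map hev.aemeasurable hw.aestronglyMeasurable]
    simp [moment, prodIntegral]
  rw [h1, hsm, integral_smul_nnreal_measure, intensity, hc2]
  simp [NNReal.smul_def]

/-! ### The generating functional -/

/-- Injections are grouped by their range: each k-subset is the range of k! of them. -/
lemma tsum_embedding_eq (a : ℤ → ℝ≥0∞) (S : Finset ℤ) (ha : ∀ i, i ∉ S → a i = 0) (k : ℕ) :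
    ∑' s : Fin k ↪ ℤ, ∏ j, a (s j) =
      k.factorial * ∑ t ∈ S.powersetCard k, ∏ i ∈ t, a i := by
  classical
  let r : (Fin k ↪ ℤ) → Finset ℤ := fun s => Finset.univ.map s
  have hr : ∀ s, ∏ j, a (s j) = ∏ i ∈ r s, a i := fun s => (Finset.prod_map _ _ _).symm
  have hcard : ∀ t : Finset ℤ, t.card = k → ENat.card {s // r s = t} = k.factorial := by
    intro t ht
    have e : {s // r s = t} ≃ (Fin k ≃ t) :=
      { toFun := fun s => Equiv.ofBijective
          (fun j => ⟨s.1 j, s.2.subset (Finset.mem_map_of_mem s.1 (Finset.mem_univ j))⟩)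
          ⟨fun j j' h => s.1.injective (congrArg Subtype.val h), fun ⟨i, hi⟩ => by
            have hi' := hi
            rw [← s.2] at hi'
            obtain ⟨j, _, hj⟩ := Finset.mem_map.1 hi'
            exact ⟨j, Subtype.ext hj⟩⟩
        invFun := fun e => ⟨e.toEmbedding.trans (Function.Embedding.subtype _), by
          ext i
          simp only [r, Finset.mem_map, Finset.mem_univ, true_and]
          constructor
          · rintro ⟨j, rfl⟩
            exact (e j).2
          · intro hi
            exact ⟨e.symm ⟨i, hi⟩, by simp⟩⟩
        left_inv := fun s => by ext j; rfl
        right_inv := fun e => by ext j; rfl }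
    rw [ENat.card_congr e, ENat.card_eq_coe_fintype_card]
    congr 1
    rw [Fintype.card_equiv (finCongr (by simp [ht] : k = Fintype.card t) |>.trans
      (Fintype.equivFin t).symm)]
    simp
  rw [← (Equiv.sigmaFiberEquiv r).tsum_eq, ENNReal.tsum_sigma']
  have h1 : ∀ t : Finset ℤ, ∑' s : {s // r s = t}, ∏ j, a ((Equiv.sigmaFiberEquiv r) ⟨t, s⟩ j) =
      if t ∈ S.powersetCard k then k.factorial * ∏ i ∈ t, a i else 0 := by
    intro t
    have h2 : ∀ s : {s // r s = t}, ∏ j, a ((Equiv.sigmaFiberEquiv r) ⟨t, s⟩ j) =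
        ∏ i ∈ t, a i := fun s => by
      have : (Equiv.sigmaFiberEquiv r) ⟨t, s⟩ = s.1 := rfl
      rw [this, hr, s.2]
    simp_rw [h2]
    by_cases ht : t ∈ S.powersetCard k
    · rw [if_pos ht, ENNReal.tsum_const, hcard t (Finset.mem_powersetCard.1 ht).2]
      simp
    · rw [if_neg ht]
      by_cases hk : t.card = k
      · have : ¬ t ⊆ S := fun h => ht (Finset.mem_powersetCard.2 ⟨h, hk⟩)
        obtain ⟨i, hi, hiS⟩ := Finset.not_subset.1 this
        rw [Finset.prod_eq_zero hi (ha i hiS)]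
        simp
      · have : IsEmpty {s // r s = t} := ⟨fun s => hk (by rw [← s.2]; simp [r])⟩
        simp
  simp_rw [h1]
  rw [tsum_eq_sum (s := S.powersetCard k) fun t ht => if_neg ht, Finset.mul_sum]
  exact Finset.sum_congr rfl fun t ht => if_pos ht

/-- This is the expansion of a finite product into elementary symmetric functions; the series ends
at the cardinality of S. -/
lemma finprod_one_sub_eq_tsum {a : ℤ → ℝ} (S : Finset ℤ) (ha : ∀ i, i ∉ S → a i = 0)
    (ha0 : ∀ i, 0 ≤ a i) :
    HasSum (fun k : ℕ => (-1 : ℝ) ^ k *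
      ((∑' s : Fin k ↪ ℤ, ∏ j, ENNReal.ofReal (a (s j))).toReal / k.factorial))
      (∏ᶠ i, (1 - a i)) := by
  have h1 : ∀ k : ℕ, (∑' s : Fin k ↪ ℤ, ∏ j, ENNReal.ofReal (a (s j))).toReal / k.factorial =
      ∑ t ∈ S.powersetCard k, ∏ i ∈ t, a i := by
    intro k
    rw [tsum_embedding_eq (fun i => ENNReal.ofReal (a i)) S (fun i hi => by simp [ha i hi]),
      ENNReal.toReal_mul, ENNReal.toReal_natCast,
      mul_div_cancel_left₀ _ (by exact_mod_cast k.factorial_ne_zero),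
      ENNReal.toReal_sum fun t _ => ENNReal.prod_ne_top fun _ _ => ENNReal.ofReal_ne_top]
    refine Finset.sum_congr rfl fun t _ => ?_
    rw [ENNReal.toReal_prod]
    exact Finset.prod_congr rfl fun i _ => ENNReal.toReal_ofReal (ha0 i)
  simp_rw [h1]
  have h2 : ∏ᶠ i, (1 - a i) = ∏ i ∈ S, (1 - a i) := by
    refine finprod_eq_prod_of_mulSupport_subset _ fun i hi => ?_
    by_contra h
    exact hi (by simp [ha i h])
  have h3 : ∏ i ∈ S, (1 - a i) =
      ∑ k ∈ Finset.range (S.card + 1), (-1 : ℝ) ^ k * ∑ t ∈ S.powersetCard k, ∏ i ∈ t, a i := by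
    simp_rw [sub_eq_add_neg, Finset.prod_one_add]
    rw [Finset.sum_powerset]
    refine Finset.sum_congr rfl fun k _ => ?_
    rw [Finset.mul_sum]
    refine Finset.sum_congr rfl fun t ht => ?_
    rw [Finset.prod_neg, (Finset.mem_powersetCard.1 ht).2]
  rw [h2, h3]
  refine hasSum_sum_of_ne_finset_zero fun k hk => ?_
  rw [Finset.powersetCard_eq_empty.2 (by simpa using hk)]
  simp

lemma measurable_tsum_embedding {P : ℤ → Ω → ℝ} (hP : ∀ i, Measurable (P i)) {w : ℝ → ℝ}
    (hw : Measurable w) (k : ℕ) :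
    Measurable fun ω => ∑' s : Fin k ↪ ℤ, ∏ j, ENNReal.ofReal (w (P (s j) ω)) := by
  have : Countable (Fin k ↪ ℤ) := DFunLike.coe_injective.countable
  exact Measurable.tsum fun _ => Finset.measurable_prod _ fun _ _ =>
    (hw.comp (hP _)).ennreal_ofReal

lemma integral_tsum_embedding {P : ℤ → Ω → ℝ} {μ : Measure Ω}
    (hP : ∀ i, Measurable (P i)) (hfin : MomentsFinite P μ) {w : ℝ → ℝ} (hw : IsTest w)
    (hw0 : ∀ x, 0 ≤ w x) (k : ℕ) :
    ∫⁻ ω, ∑' s : Fin k ↪ ℤ, ∏ j, ENNReal.ofReal (w (P (s j) ω)) ∂μ =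
      ENNReal.ofReal (moment P μ w k) := by
  have hm : Measurable fun x : Fin k → ℝ => ∏ j, ENNReal.ofReal (w (x j)) :=
    Finset.measurable_prod _ fun j _ => (hw.measurable.comp (measurable_pi_apply j)).ennreal_ofReal
  rw [← lintegral_factorialMoment hP hm, moment, prodIntegral,
    ofReal_integral_eq_lintegral_ofReal ((hfin (Fin k)).integrable fun _ => hw)
      (ae_of_all _ fun x => Finset.prod_nonneg fun _ _ => hw0 _)]
  exact lintegral_congr fun x => (ENNReal.ofReal_prod_of_nonneg fun _ _ => hw0 _).symm

/-- Expansion of the generating functional into factorial moments. -/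
lemma integral_finprod_one_sub {P : ℤ → Ω → ℝ} {μ : Measure Ω}
    (hP : IsStationaryPointProcess P μ) (hfin : MomentsFinite P μ) {w : ℝ → ℝ} (hw : IsTest w)
    (hw0 : ∀ x, 0 ≤ w x) (hs : Summable fun k : ℕ => |moment P μ w k / k.factorial|) :
    ∫ ω, ∏ᶠ i, (1 - w (P i ω)) ∂μ = ∑' k : ℕ, moment P μ w k / k.factorial * (-1) ^ k := by
  obtain ⟨N, hN⟩ := hw.bounded_support
  set X : ℕ → Ω → ℝ := fun k ω => (-1 : ℝ) ^ k *
    ((∑' s : Fin k ↪ ℤ, ∏ j, ENNReal.ofReal (w (P (s j) ω))).toReal / k.factorial) with hX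
  have hlt : ∀ k, ∫⁻ ω, ∑' s : Fin k ↪ ℤ, ∏ j, ENNReal.ofReal (w (P (s j) ω)) ∂μ ≠ ∞ := fun k => by
    rw [integral_tsum_embedding hP.measurable hfin hw hw0]
    exact ENNReal.ofReal_ne_top
  have hint : ∀ k, Integrable (fun ω =>
      (∑' s : Fin k ↪ ℤ, ∏ j, ENNReal.ofReal (w (P (s j) ω))).toReal) μ := fun k =>
    integrable_toReal_of_lintegral_ne_top
      (measurable_tsum_embedding hP.measurable hw.measurable k).aemeasurable (hlt k)
  have hm0 : ∀ k, 0 ≤ moment P μ w k := fun k =>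
    integral_nonneg fun x => Finset.prod_nonneg fun _ _ => hw0 _
  have hval : ∀ k, ∫ ω, (∑' s : Fin k ↪ ℤ, ∏ j, ENNReal.ofReal (w (P (s j) ω))).toReal ∂μ =
      moment P μ w k := fun k => by
    rw [integral_toReal (measurable_tsum_embedding hP.measurable hw.measurable k).aemeasurable
      (ae_lt_top (measurable_tsum_embedding hP.measurable hw.measurable k) (hlt k)),
      integral_tsum_embedding hP.measurable hfin hw hw0, ENNReal.toReal_ofReal (hm0 k)]
  have hXint : ∀ k, Integrable (X k) μ := fun k => ((hint k).div_const _).const_mul _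
  have hnorm : ∀ k, ∫ ω, ‖X k ω‖ ∂μ = |moment P μ w k / k.factorial| := fun k => by
    have : ∀ ω, ‖X k ω‖ =
        (∑' s : Fin k ↪ ℤ, ∏ j, ENNReal.ofReal (w (P (s j) ω))).toReal / k.factorial := fun ω => by
      simp only [hX, norm_mul, norm_pow, norm_neg, norm_one, one_pow, one_mul]
      exact Real.norm_of_nonneg (by positivity)
    simp_rw [this]
    rw [integral_div, hval, abs_of_nonneg (div_nonneg (hm0 k) (by positivity))]
  have hXval : ∀ k, ∫ ω, X k ω ∂μ = moment P μ w k / k.factorial * (-1) ^ k := fun k => by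
    simp only [hX]
    rw [integral_const_mul, integral_div, hval, mul_comm]
  -- Since w ≥ 0, the L¹-norm of the k-th term is its moment divided by k!, so the assumed
  -- summability justifies exchanging sum and expectation.
  have hsum := integral_tsum_of_summable_integral_norm hXint (by simpa only [hnorm] using hs)
  simp_rw [hXval] at hsum
  rw [hsum]
  refine integral_congr_ae ?_
  filter_upwards [hP.locallyFinite] with ω hω
  refine (finprod_one_sub_eq_tsum (a := fun i => w (P i ω)) (hω N).toFinset (fun i hi => ?_)
    fun i => hw0 _).tsum_eq.symm
  refine hN _ (not_le.1 fun h => hi ?_)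
  simpa using h

/-! ### Void probabilities of the independently marked process -/

/-- Independence lets the points and the marks live on separate copies of Ω. For fixed points only
finitely many can carry a mark placing them in A, since A is bounded in the first coordinate, and
the i.i.d. marks yield a finite product. -/
lemma IsIndependentMarking.measure_forall_notMem {P Φ R : ℤ → Ω → ℝ} {μ : Measure Ω}
    [IsProbabilityMeasure μ] (hP : IsStationaryPointProcess P μ)
    (hM : IsIndependentMarking P Φ R μ) {A : Set (ℝ × ℝ × ℝ)} (hA : MeasurableSet A) {N : ℝ}
    (hN : ∀ x ∈ A, |x.1| ≤ N) :
    μ.real {ω | ∀ i, (P i ω, Φ i ω, R i ω) ∉ A} =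
      ∫ ω, ∏ᶠ i, (1 - μ.real {ω' | (P i ω, Φ 0 ω', R 0 ω') ∈ A}) ∂μ := by
  set M : ℤ → Ω → ℝ × ℝ := fun i ω => (Φ i ω, R i ω) with hMdef
  have hMm : ∀ i, Measurable (M i) := fun i => (hM.measurable_angle i).prodMk (hM.measurable_radius i)
  set Pm : Ω → ℤ → ℝ := fun ω i => P i ω
  set Mm : Ω → ℤ → ℝ × ℝ := fun ω i => M i ω
  have hPm : Measurable Pm := measurable_pi_iff.2 hP.measurable
  have hMmm : Measurable Mm := measurable_pi_iff.2 hMm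
  set D : Set ((ℤ → ℝ) × (ℤ → ℝ × ℝ)) := ⋂ i, {x | (x.1 i, x.2 i) ∈ Aᶜ} with hD
  have hDm : MeasurableSet D := MeasurableSet.iInter fun i => by
    have : Measurable fun x : (ℤ → ℝ) × (ℤ → ℝ × ℝ) => (x.1 i, x.2 i) := by fun_prop
    exact this hA.compl
  have h1 : μ {ω | ∀ i, (P i ω, Φ i ω, R i ω) ∉ A} =
      ∫⁻ ω, μ {ω' | ∀ i, (P i ω, M i ω') ∉ A} ∂μ := by
    have e1 : {ω | ∀ i, (P i ω, Φ i ω, R i ω) ∉ A} = (fun ω => (Pm ω, Mm ω)) ⁻¹' D := by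
      ext ω; simp [hD, Pm, Mm, hMdef]
    rw [e1, ← Measure.map_apply (hPm.prodMk hMmm) hDm,
      (indepFun_iff_map_prod_eq_prod_map_map hPm.aemeasurable hMmm.aemeasurable).1
        hM.indep_points_marks, Measure.prod_apply hDm,
      lintegral_map (measurable_measure_prodMk_left hDm) hPm]
    refine lintegral_congr fun ω => ?_
    rw [Measure.map_apply hMmm (measurable_prodMk_left hDm)]
    congr 1
    ext ω'; simp [hD, Pm, Mm]
  have hsec : ∀ p, MeasurableSet {m : ℝ × ℝ | (p, m) ∈ A} := fun p => measurable_prodMk_left hA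
  have h2 : ∀ᵐ ω ∂μ, μ {ω' | ∀ i, (P i ω, M i ω') ∉ A} =
      ENNReal.ofReal (∏ᶠ i, (1 - μ.real {ω' | (P i ω, Φ 0 ω', R 0 ω') ∈ A})) := by
    filter_upwards [hP.locallyFinite] with ω hω
    set S := (hω N).toFinset with hS
    have hout : ∀ i, i ∉ S → ∀ m, (P i ω, m) ∉ A := fun i hi m hm => by
      refine hi ?_
      have := hN _ hm
      simpa [hS] using this
    have e1 : {ω' | ∀ i, (P i ω, M i ω') ∉ A} =
        ⋂ i ∈ S, M i ⁻¹' {m | (P i ω, m) ∈ A}ᶜ := by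
      ext ω'
      simp only [Set.mem_ofPred_eq, Set.mem_iInter, Set.mem_preimage, Set.mem_compl_iff]
      exact ⟨fun h i _ => h i, fun h i => by
        by_cases hi : i ∈ S
        exacts [h i hi, hout i hi _]⟩
    have e2 : ∀ i, μ (M i ⁻¹' {m | (P i ω, m) ∈ A}ᶜ) =
        ENNReal.ofReal (1 - μ.real {ω' | (P i ω, Φ 0 ω', R 0 ω') ∈ A}) := fun i => by
      have hid := (hM.identDistrib i).measure_mem_eq (hsec (P i ω)).compl
      change μ (M i ⁻¹' {m | (P i ω, m) ∈ A}ᶜ) = μ (M 0 ⁻¹' {m | (P i ω, m) ∈ A}ᶜ) at hid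
      have hpre : MeasurableSet (M 0 ⁻¹' {m | (P i ω, m) ∈ A}) := hMm 0 (hsec _)
      rw [hid, Set.preimage_compl, ← ofReal_measureReal, probReal_compl_eq_one_sub hpre]
      rfl
    have e3 : ∏ᶠ i, (1 - μ.real {ω' | (P i ω, Φ 0 ω', R 0 ω') ∈ A}) =
        ∏ i ∈ S, (1 - μ.real {ω' | (P i ω, Φ 0 ω', R 0 ω') ∈ A}) := by
      refine finprod_eq_prod_of_mulSupport_subset _ fun i hi => ?_
      by_contra h
      refine hi ?_
      have : {ω' | (P i ω, Φ 0 ω', R 0 ω') ∈ A} = ∅ := by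
        ext ω'; simpa using hout i h _
      simp [this]
    rw [e1, hM.indep_marks.measure_inter_preimage_eq_mul S fun i _ => (hsec (P i ω)).compl, e3,
      ENNReal.ofReal_prod_of_nonneg fun i _ => sub_nonneg.2 measureReal_le_one]
    exact Finset.prod_congr rfl fun i _ => e2 i
  have hnn : ∀ ω, 0 ≤ ∏ᶠ i, (1 - μ.real {ω' | (P i ω, Φ 0 ω', R 0 ω') ∈ A}) := fun ω =>
    finprod_nonneg fun i => sub_nonneg.2 measureReal_le_one
  have hmeas : AEMeasurable (fun ω => μ {ω' | ∀ i, (P i ω, M i ω') ∉ A}) μ := by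
    have e1 : ∀ ω, μ {ω' | ∀ i, (P i ω, M i ω') ∉ A} = μ.map Mm (Prod.mk (Pm ω) ⁻¹' D) := fun ω => by
      rw [Measure.map_apply hMmm (measurable_prodMk_left hDm)]
      congr 1
      ext ω'; simp [hD, Pm, Mm]
    simp_rw [e1]
    exact ((measurable_measure_prodMk_left hDm).comp hPm).aemeasurable
  -- Measurability of the `finprod` in ω is inherited from the conditional void probability, with
  -- which it agrees almost surely.
  have hae : AEStronglyMeasurable
      (fun ω => ∏ᶠ i, (1 - μ.real {ω' | (P i ω, Φ 0 ω', R 0 ω') ∈ A})) μ := by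
    refine (hmeas.ennreal_toReal.congr ?_).aestronglyMeasurable
    filter_upwards [h2] with ω hω
    rw [hω, ENNReal.toReal_ofReal (hnn ω)]
  rw [integral_eq_lintegral_of_nonneg_ae (ae_of_all _ hnn) hae, ← lintegral_congr_ae h2, ← h1]
  rfl

end PlanarCylinder

end

noncomputable section

namespace PlanarCylinder

variable {Ω : Type*} [MeasurableSpace Ω]

/-! ### Measures on powers of the line built from reduced measures -/

lemma lintegral_fin_prod_eq_prod {n : ℕ} {g : Fin n → ℝ → ℝ≥0∞} (hg : ∀ i, Measurable (g i)) :
    ∫⁻ x : Fin n → ℝ, ∏ i, g i (x i) = ∏ i, ∫⁻ t, g i t := by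
  induction n with
  | zero => simp [volume_pi]
  | succ n ih =>
    have hmp := (volume_preserving_piFinSuccAbove (fun _ : Fin (n + 1) => ℝ) 0).symm
    have hm : Measurable fun x : Fin (n + 1) → ℝ => ∏ i, g i (x i) :=
      Finset.measurable_prod _ fun i _ => (hg i).comp (measurable_pi_apply i)
    rw [← hmp.lintegral_comp hm, Measure.volume_eq_prod, Fin.prod_univ_succ,
      ← ih fun i => hg i.succ, ← lintegral_prod_mul (hg 0).aemeasurable
        (Finset.measurable_prod _ fun i _ =>
          (hg i.succ).comp (measurable_pi_apply i)).aemeasurable]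
    refine lintegral_congr fun x => ?_
    rw [Fin.prod_univ_succ]
    rfl

lemma lintegral_snoc {n : ℕ} {F : (Fin (n + 1) → ℝ) → ℝ≥0∞} (hF : Measurable F) :
    ∫⁻ x, F x = ∫⁻ p : ℝ, ∫⁻ y : Fin n → ℝ, F (Fin.snoc y p) := by
  have hmp := (volume_preserving_piFinSuccAbove (fun _ : Fin (n + 1) => ℝ) (Fin.last n)).symm
  have hF' : Measurable fun a =>
      F ((MeasurableEquiv.piFinSuccAbove (fun _ : Fin (n + 1) => ℝ) (Fin.last n)).symm a) :=
    hF.comp (MeasurableEquiv.measurable _)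
  rw [← hmp.lintegral_comp hF, Measure.volume_eq_prod, lintegral_prod _ hF'.aemeasurable]
  refine lintegral_congr fun p => lintegral_congr fun y => ?_
  congr 1
  exact Fin.insertNth_last' p y

/-- The map `(p, x) ↦ (p, x₁ + p, …, x_m + p)`. -/
def shearMap {m : ℕ} (q : ℝ × (Fin m → ℝ)) : Fin (m + 1) → ℝ :=
  Fin.cons q.1 fun j => q.2 j + q.1

lemma measurable_shearMap {m : ℕ} : Measurable (shearMap (m := m)) := by
  refine measurable_pi_iff.2 fun i => ?_
  refine Fin.cases ?_ (fun j => ?_) i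
  · exact measurable_fst
  · exact ((measurable_pi_apply j).comp measurable_snd).add measurable_fst

/-- The stationary measure on `ℝ^{m+1}` with reduced measure `γ`. -/
def shear {m : ℕ} (γ : Measure (Fin m → ℝ)) : Measure (Fin (m + 1) → ℝ) :=
  ((volume : Measure ℝ).prod γ).map shearMap

lemma lintegral_shear_prod {m : ℕ} (γ : Measure (Fin m → ℝ)) [SFinite γ]
    {f : Fin (m + 1) → ℝ → ℝ≥0∞} (hf : ∀ i, Measurable (f i)) :
    ∫⁻ y, ∏ i, f i (y i) ∂shear γ =
      ∫⁻ p, f 0 p * ∫⁻ x, ∏ j : Fin m, f j.succ (x j + p) ∂γ := by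
  have hm : Measurable fun y : Fin (m + 1) → ℝ => ∏ i, f i (y i) :=
    Finset.measurable_prod _ fun i _ => (hf i).comp (measurable_pi_apply i)
  have hm' : Measurable fun q : ℝ × (Fin m → ℝ) => ∏ i, f i (shearMap q i) :=
    hm.comp measurable_shearMap
  rw [shear, lintegral_map hm measurable_shearMap, lintegral_prod _ hm'.aemeasurable]
  refine lintegral_congr fun p => ?_
  have hmp : Measurable fun x : Fin m → ℝ => ∏ j : Fin m, f j.succ (x j + p) :=
    Finset.measurable_prod _ fun j _ => (hf _).comp (by fun_prop)
  rw [← lintegral_const_mul _ hmp]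
  refine lintegral_congr fun x => ?_
  rw [Fin.prod_univ_succ]
  rfl

lemma measurableSet_shearMap_preimage {m : ℕ} {B : Fin (m + 1) → Set ℝ}
    (hB : ∀ i, MeasurableSet (B i)) : MeasurableSet (shearMap ⁻¹' Set.univ.pi B) :=
  measurable_shearMap (MeasurableSet.univ_pi hB)

lemma shearMap_section {m : ℕ} (B : Fin (m + 1) → Set ℝ) (p : ℝ) (hp : p ∈ B 0) :
    Prod.mk p ⁻¹' (shearMap ⁻¹' Set.univ.pi B) = shiftedBox B p := by
  ext x
  simp only [Set.mem_preimage, Set.mem_univ_pi, shiftedBox, shearMap]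
  constructor
  · intro h j
    simpa using h j.succ
  · intro h i
    refine Fin.cases ?_ (fun j => ?_) i
    · simpa using hp
    · simpa using h j

lemma shear_apply_pi {m : ℕ} (γ : Measure (Fin m → ℝ)) [SFinite γ] {B : Fin (m + 1) → Set ℝ}
    (hB : ∀ i, MeasurableSet (B i)) :
    shear γ (Set.univ.pi B) = ∫⁻ p in B 0, γ (shiftedBox B p) := by
  rw [shear, Measure.map_apply measurable_shearMap (MeasurableSet.univ_pi hB),
    Measure.prod_apply (measurableSet_shearMap_preimage hB), ← lintegral_indicator (hB 0)]
  refine lintegral_congr fun p => ?_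
  by_cases hp : p ∈ B 0
  · rw [Set.indicator_of_mem hp, shearMap_section B p hp]
  · rw [Set.indicator_of_notMem hp]
    convert measure_empty (μ := γ)
    ext x
    simp only [Set.mem_preimage, Set.mem_univ_pi, Set.mem_empty_iff_false, iff_false, not_forall]
    exact ⟨0, by simpa [shearMap] using hp⟩

lemma integral_shiftedBox {m : ℕ} (γ : Measure (Fin m → ℝ)) [SFinite γ] {B : Fin (m + 1) → Set ℝ}
    (hB : ∀ i, MeasurableSet (B i)) (hfin : shear γ (Set.univ.pi B) < ∞) :
    IntegrableOn (fun p => (γ (shiftedBox B p)).toReal) (B 0) ∧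
      ∫ p in B 0, (γ (shiftedBox B p)).toReal = (shear γ (Set.univ.pi B)).toReal := by
  rw [shear_apply_pi γ hB] at hfin ⊢
  have hm : AEMeasurable (fun p => γ (shiftedBox B p)) (volume.restrict (B 0)) := by
    refine (measurable_measure_prodMk_left (ν := γ)
      (measurableSet_shearMap_preimage hB)).aemeasurable.congr ?_
    filter_upwards [ae_restrict_mem (hB 0)] with p hp
    rw [shearMap_section B p hp]
  exact ⟨integrable_toReal_of_lintegral_ne_top hm hfin.ne,
    integral_toReal hm (ae_lt_top' hm hfin.ne)⟩

/-! ### Bounds for reduced cumulant measures -/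

/-- The bound `∫ ∏ g_j dγ ≤ C N^m` with `N = δ^θ S^{1-θ}` for functions bounded by `δ` with
integrals at most `S`. -/
def ProductBound {m : ℕ} (γ : Measure (Fin m → ℝ)) (C : ℝ≥0∞) (θ : ℝ) : Prop :=
  ∀ (δ S : ℝ≥0∞) (g : Fin m → ℝ → ℝ≥0∞), (∀ j, Measurable (g j)) → (∀ j x, g j x ≤ δ) →
    (∀ j, ∫⁻ x, g j x ≤ S) → ∫⁻ x, ∏ j, g j (x j) ∂γ ≤ C * (δ ^ θ * S ^ (1 - θ)) ^ m

/-- As `ProductBound`, but with an unrestricted function in the last variable, which is integrated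
with respect to `ν`. -/
def LastBound {n : ℕ} (γ : Measure (Fin (n + 1) → ℝ)) (ν : Measure ℝ) (θ : ℝ) : Prop :=
  ∀ (δ S : ℝ≥0∞) (g : Fin n → ℝ → ℝ≥0∞) (h : ℝ → ℝ≥0∞), (∀ j, Measurable (g j)) →
    Measurable h → (∀ j x, g j x ≤ δ) → (∀ j, ∫⁻ x, g j x ≤ S) →
      ∫⁻ x, (∏ j, g j (x j.castSucc)) * h (x (Fin.last n)) ∂γ ≤
        (∫⁻ t, h t ∂ν) * (δ ^ θ * S ^ (1 - θ)) ^ n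

/-- With θ = 1 the bound does not involve the integrals: N = δ, and the estimate is total mass times
supremum. -/
lemma productBound_of_mass {m : ℕ} (γ : Measure (Fin m → ℝ)) {C : ℝ≥0∞} (hC : γ univ ≤ C) :
    ProductBound γ C 1 := by
  intro δ S g _ hδ _
  calc ∫⁻ x, ∏ j, g j (x j) ∂γ ≤ ∫⁻ _, δ ^ m ∂γ := by
        refine lintegral_mono fun x => ?_
        simpa using Finset.prod_le_prod' (s := Finset.univ) fun j _ => hδ j (x j)
    _ ≤ C * (δ ^ (1 : ℝ) * S ^ (1 - 1 : ℝ)) ^ m := by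
        rw [lintegral_const, mul_comm]
        simp only [ENNReal.rpow_one, sub_self, ENNReal.rpow_zero, mul_one]
        gcongr

lemma lastBound_of_mass {n : ℕ} (γ : Measure (Fin (n + 1) → ℝ)) :
    LastBound γ (γ.map fun x => x (Fin.last n)) 1 := by
  intro δ S g h _ hh hδ _
  have hm : Measurable fun x : Fin (n + 1) → ℝ => x (Fin.last n) := measurable_pi_apply _
  rw [lintegral_map hh hm]
  simp only [ENNReal.rpow_one, sub_self, ENNReal.rpow_zero, mul_one]
  have hh' : Measurable fun x : Fin (n + 1) → ℝ => h (x (Fin.last n)) := hh.comp hm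
  rw [mul_comm, ← lintegral_const_mul _ hh']
  refine lintegral_mono fun x => ?_
  gcongr
  simpa using Finset.prod_le_prod' (s := Finset.univ) fun j _ => hδ j (x j.castSucc)

/-- Hölder's inequality for product functions. -/
lemma lintegral_prod_mul_le {n : ℕ} {q : ℝ} (hq : 1 < q) {c : (Fin n → ℝ) → ℝ≥0∞}
    (hc : Measurable c) {δ S : ℝ≥0∞} {g : Fin n → ℝ → ℝ≥0∞} (hg : ∀ j, Measurable (g j))
    (hδ : ∀ j x, g j x ≤ δ) (hS : ∀ j, ∫⁻ x, g j x ≤ S) :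
    ∫⁻ x, c x * ∏ j, g j (x j) ≤
      (∫⁻ x, c x ^ q) ^ (1 / q) * (δ ^ (1 / q) * S ^ (1 - 1 / q)) ^ n := by
  set q' := q / (q - 1) with hq'
  have hq0 : 0 < q := by linarith
  have hq1 : 0 < q - 1 := by linarith
  have hpq : q.HolderConjugate q' := (Real.holderConjugate_iff_eq_conjExponent hq).2 rfl
  have hq'1 : 1 < q' := hpq.symm.lt
  have hq'0 : 0 < q' := by linarith
  have hm : Measurable fun x : Fin n → ℝ => ∏ j, g j (x j) :=
    Finset.measurable_prod _ fun i _ => (hg i).comp (measurable_pi_apply i)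
  refine (ENNReal.lintegral_mul_le_Lp_mul_Lq volume hpq hc.aemeasurable hm.aemeasurable).trans ?_
  gcongr
  have h1 : ∀ x : Fin n → ℝ, (∏ j, g j (x j)) ^ q' = ∏ j, g j (x j) ^ q' := fun x =>
    (ENNReal.prod_rpow_of_nonneg hq'0.le).symm
  simp_rw [h1]
  rw [lintegral_fin_prod_eq_prod (g := fun j t => g j t ^ q') fun j => (hg j).pow_const q',
    ← ENNReal.prod_rpow_of_nonneg (by positivity)]
  -- Interpolation between the supremum and the integral: g^{q'} ≤ δ^{q'-1} g, and the exponents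
  -- become (q' - 1)/q' = 1/q and 1/q' = 1 - 1/q.
  have h2 : ∀ j, (∫⁻ t, g j t ^ q') ^ (1 / q') ≤ δ ^ (1 / q) * S ^ (1 - 1 / q) := by
    intro j
    have h3 : ∫⁻ t, g j t ^ q' ≤ δ ^ (q' - 1) * S := by
      calc ∫⁻ t, g j t ^ q' ≤ ∫⁻ t, δ ^ (q' - 1) * g j t := by
            refine lintegral_mono fun t => ?_
            have : g j t ^ q' = g j t ^ (q' - 1) * g j t := by
              conv_lhs => rw [show q' = (q' - 1) + 1 by ring]
              rw [ENNReal.rpow_add_of_nonneg _ _ (by linarith) zero_le_one, ENNReal.rpow_one]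
            simp only
            rw [this]
            gcongr
            exact hδ j t
        _ = δ ^ (q' - 1) * ∫⁻ t, g j t := lintegral_const_mul _ (hg j)
        _ ≤ _ := by gcongr; exact hS j
    calc (∫⁻ t, g j t ^ q') ^ (1 / q') ≤ (δ ^ (q' - 1) * S) ^ (1 / q') := by gcongr
      _ = δ ^ (1 / q) * S ^ (1 - 1 / q) := by
          rw [ENNReal.mul_rpow_of_nonneg _ _ (by positivity), ← ENNReal.rpow_mul]
          congr 2
          · rw [hq']; field_simp; ring
          · rw [hq']; field_simp
  simpa using Finset.prod_le_prod' (s := Finset.univ) fun j _ => h2 j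

lemma productBound_of_density {m : ℕ} {q : ℝ} (hq : 1 < q) {c : (Fin m → ℝ) → ℝ≥0∞}
    (hc : Measurable c) {C : ℝ≥0∞} (hC : (∫⁻ x, c x ^ q) ^ (1 / q) ≤ C) :
    ProductBound (volume.withDensity c) C (1 / q) := by
  intro δ S g hg hδ hS
  have hm : Measurable fun x : Fin m → ℝ => ∏ j, g j (x j) :=
    Finset.measurable_prod _ fun i _ => (hg i).comp (measurable_pi_apply i)
  rw [lintegral_withDensity_eq_lintegral_mul _ hc hm]
  exact (lintegral_prod_mul_le hq hc hg hδ hS).trans (by gcongr)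

lemma measurable_snoc {n : ℕ} :
    Measurable fun x : ℝ × (Fin n → ℝ) => (Fin.snoc x.2 x.1 : Fin (n + 1) → ℝ) := by
  refine measurable_pi_iff.2 fun i => ?_
  refine Fin.lastCases ?_ (fun j => ?_) i
  · simpa using measurable_fst
  · simp only [Fin.snoc_castSucc]
    exact (measurable_pi_apply j).comp measurable_snd

/-- Hölder's inequality is applied in the first n variables with the last one fixed. The total mass
of the resulting measure on the line is exactly `starNorm` of the density. -/
lemma lastBound_of_density {n : ℕ} {q : ℝ} (hq : 1 < q) {c : (Fin (n + 1) → ℝ) → ℝ≥0∞}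
    (hc : Measurable c) :
    LastBound (volume.withDensity c)
      (volume.withDensity fun p => (∫⁻ y : Fin n → ℝ, c (Fin.snoc y p) ^ q) ^ (1 / q)) (1 / q) := by
  intro δ S g h hg hh hδ hS
  have hprod : Measurable fun x : Fin (n + 1) → ℝ => ∏ j, g j (x j.castSucc) :=
    Finset.measurable_prod _ fun i _ => (hg i).comp (measurable_pi_apply _)
  have hlast : Measurable fun x : Fin (n + 1) → ℝ => h (x (Fin.last n)) :=
    hh.comp (measurable_pi_apply _)
  have hcs : Measurable fun x : ℝ × (Fin n → ℝ) => c (Fin.snoc x.2 x.1) := hc.comp measurable_snoc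
  have hL : Measurable fun p => (∫⁻ y : Fin n → ℝ, c (Fin.snoc y p) ^ q) ^ (1 / q) :=
    (hcs.pow_const q).lintegral_prod_right'.pow_const _
  have hpl : Measurable fun x : Fin (n + 1) → ℝ =>
      (∏ j, g j (x j.castSucc)) * h (x (Fin.last n)) := hprod.mul hlast
  rw [lintegral_withDensity_eq_lintegral_mul _ hc hpl,
    lintegral_snoc (hc.mul hpl), lintegral_withDensity_eq_lintegral_mul _ hL hh]
  rw [← lintegral_mul_const _ (hL.mul hh)]
  refine lintegral_mono fun p => ?_
  simp only [Pi.mul_apply, Fin.snoc_castSucc, Fin.snoc_last]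
  have hcp : Measurable fun y : Fin n → ℝ => c (Fin.snoc y p) := hcs.comp measurable_prodMk_left
  have := lintegral_prod_mul_le hq hcp hg hδ hS
  calc ∫⁻ y : Fin n → ℝ, c (Fin.snoc y p) * ((∏ j, g j (y j)) * h p)
      = (∫⁻ y : Fin n → ℝ, c (Fin.snoc y p) * ∏ j, g j (y j)) * h p := by
        have hmp : Measurable fun y : Fin n → ℝ => c (Fin.snoc y p) * ∏ j, g j (y j) :=
          hcp.mul (Finset.measurable_prod _ fun i _ => (hg i).comp (measurable_pi_apply i))
        rw [← lintegral_mul_const _ hmp]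
        exact lintegral_congr fun y => by ring
    _ ≤ _ := by
        rw [mul_right_comm]
        gcongr

/-! ### Signed representations of the reduced cumulant measures -/

/-- The reduced cumulant measure of order `m + 1` is the difference `γ₁ - γ₂` of positive
measures. -/
def IsSignedRep (P : ℤ → Ω → ℝ) (μ : Measure Ω) (m : ℕ) (γ₁ γ₂ : Measure (Fin m → ℝ)) : Prop :=
  ∀ B : Fin (m + 1) → Set ℝ, (∀ i, MeasurableSet (B i)) → (∀ i, Bornology.IsBounded (B i)) →
    factorialCumulant P μ (m + 1) B =
      intensity P μ * ∫ p in B 0, ((γ₁ (shiftedBox B p)).toReal - (γ₂ (shiftedBox B p)).toReal)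

lemma IsReducedCumulantMeasure.isSignedRep {P : ℤ → Ω → ℝ} {μ : Measure Ω} {m : ℕ}
    {γ : SignedMeasure (Fin m → ℝ)} (h : IsReducedCumulantMeasure P μ m γ) :
    IsSignedRep P μ m γ.toJordanDecomposition.posPart γ.toJordanDecomposition.negPart := by
  intro B hB hb
  rw [h B hB hb]
  congr 1
  refine integral_congr_ae (ae_of_all _ fun p => ?_)
  have hm : MeasurableSet (shiftedBox B p) :=
    MeasurableSet.univ_pi fun j => (hB _).preimage (measurable_id.add_const p)
  exact γ.apply_eq_posPart_real_sub_negPart_real hm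

lemma isBounded_shiftedBox {m : ℕ} {B : Fin (m + 1) → Set ℝ}
    (hb : ∀ i, Bornology.IsBounded (B i)) (p : ℝ) : Bornology.IsBounded (shiftedBox B p) := by
  refine Bornology.IsBounded.pi fun j => ?_
  have : (fun x => x + p) ⁻¹' B j.succ = (fun x => x - p) '' B j.succ := by
    ext x
    simp only [Set.mem_preimage, Set.mem_image]
    exact ⟨fun h => ⟨x + p, h, by ring⟩, fun ⟨y, hy, hyx⟩ => by rw [← hyx]; simpa using hy⟩
  rw [this]
  exact (LipschitzWith.id.sub (LipschitzWith.const p)).isBounded_image (hb _)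

/-- The density need not be integrable over the whole of ℝ^m, so it may define no finite signed
measure. Its positive and negative parts still define measures finite on bounded boxes, and that is
enough. -/
lemma IsReducedCumulantDensity.isSignedRep {P : ℤ → Ω → ℝ} {μ : Measure Ω} {m : ℕ}
    {c : (Fin m → ℝ) → ℝ} (h : IsReducedCumulantDensity P μ m c) :
    IsSignedRep P μ m (volume.withDensity fun x => ENNReal.ofReal (c x))
      (volume.withDensity fun x => ENNReal.ofReal (-c x)) := by
  intro B hB hb
  rw [h.cumulant_eq B hB hb]
  congr 1
  refine integral_congr_ae (ae_of_all _ fun p => ?_)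
  have hm : MeasurableSet (shiftedBox B p) :=
    MeasurableSet.univ_pi fun j => (hB _).preimage (measurable_id.add_const p)
  have hint : IntegrableOn c (shiftedBox B p) :=
    (h.locallyIntegrable.integrableOn_isCompact
      (isBounded_shiftedBox hb p).isCompact_closure).mono_set subset_closure
  simp only
  rw [integral_eq_lintegral_pos_part_sub_lintegral_neg_part hint, withDensity_apply _ hm,
    withDensity_apply _ hm]

lemma finiteOnBoxes_shear {m : ℕ} {γ : Measure (Fin m → ℝ)} [SFinite γ]
    (h : ∀ N : ℝ, ∃ D : ℝ≥0∞, D ≠ ∞ ∧ ∀ p : ℝ,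
      ∫⁻ x, ∏ j : Fin m, (Icc (-N) N).indicator (1 : ℝ → ℝ≥0∞) (x j + p) ∂γ ≤ D) :
    FiniteOnBoxes (shear γ) := by
  intro N
  have h1 := lintegral_shear_prod γ (f := fun _ => (Icc (-N) N).indicator 1)
    fun _ => measurable_one.indicator measurableSet_Icc
  have h2 : shear γ (Set.univ.pi fun _ => Icc (-N) N) =
      ∫⁻ y, ∏ i, (Icc (-N) N).indicator (1 : ℝ → ℝ≥0∞) (y i) ∂shear γ := by
    rw [← lintegral_indicator_one (MeasurableSet.univ_pi fun _ => measurableSet_Icc)]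
    refine lintegral_congr fun y => ?_
    by_cases hy : y ∈ Set.univ.pi fun _ => Icc (-N) N
    · rw [Set.indicator_of_mem hy]
      exact (Finset.prod_eq_one fun i _ => Set.indicator_of_mem (hy i (Set.mem_univ i)) _).symm
    · rw [Set.indicator_of_notMem hy]
      simp only [Set.mem_pi, Set.mem_univ, forall_const, not_forall] at hy
      obtain ⟨i, hi⟩ := hy
      exact (Finset.prod_eq_zero (Finset.mem_univ i) (Set.indicator_of_notMem hi _)).symm
  rw [h2, h1]
  obtain ⟨D, hD, hb⟩ := h N
  refine lt_of_le_of_lt (lintegral_mono fun p => mul_le_mul_right (hb p) _) ?_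
  rw [lintegral_mul_const _ (measurable_one.indicator measurableSet_Icc),
    lintegral_indicator_one measurableSet_Icc]
  exact ENNReal.mul_lt_top measure_Icc_lt_top hD.lt_top

lemma ProductBound.finiteOnBoxes {m : ℕ} {γ : Measure (Fin m → ℝ)} [SFinite γ] {C : ℝ≥0∞} {θ : ℝ}
    (hθ1 : θ ≤ 1) (hC : C ≠ ∞) (h : ProductBound γ C θ) : FiniteOnBoxes (shear γ) := by
  refine finiteOnBoxes_shear fun N => ⟨C * ((1 : ℝ≥0∞) ^ θ * volume (Icc (-N) N) ^ (1 - θ)) ^ m,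
    ENNReal.mul_ne_top hC (ENNReal.pow_ne_top (ENNReal.mul_ne_top (by simp)
      (ENNReal.rpow_ne_top_of_nonneg (by linarith) measure_Icc_lt_top.ne))), fun p => ?_⟩
  refine h 1 _ (fun _ t => (Icc (-N) N).indicator (1 : ℝ → ℝ≥0∞) (t + p)) (fun _ =>
    (measurable_one.indicator measurableSet_Icc).comp (measurable_id.add_const p)) (fun _ x => ?_)
    fun _ => ?_
  · exact Set.indicator_le_self' (fun _ _ => zero_le) _
  · rw [lintegral_add_right_eq_self (fun t => (Icc (-N) N).indicator (1 : ℝ → ℝ≥0∞) t),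
      lintegral_indicator_one measurableSet_Icc]

lemma LastBound.finiteOnBoxes {n : ℕ} {γ : Measure (Fin (n + 1) → ℝ)} [SFinite γ]
    {ν : Measure ℝ} {θ : ℝ} (hθ1 : θ ≤ 1) (hν : ν univ ≠ ∞) (h : LastBound γ ν θ) :
    FiniteOnBoxes (shear γ) := by
  have hm : ∀ N p : ℝ, Measurable fun t => (Icc (-N) N).indicator (1 : ℝ → ℝ≥0∞) (t + p) :=
    fun N p => (measurable_one.indicator measurableSet_Icc).comp (measurable_id.add_const p)
  refine finiteOnBoxes_shear fun N =>
    ⟨ν univ * ((1 : ℝ≥0∞) ^ θ * volume (Icc (-N) N) ^ (1 - θ)) ^ n,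
    ENNReal.mul_ne_top hν (ENNReal.pow_ne_top (ENNReal.mul_ne_top (by simp)
      (ENNReal.rpow_ne_top_of_nonneg (by linarith) measure_Icc_lt_top.ne))), fun p => ?_⟩
  have h1 := h 1 (volume (Icc (-N) N)) (fun _ t => (Icc (-N) N).indicator (1 : ℝ → ℝ≥0∞) (t + p))
    (fun t => (Icc (-N) N).indicator (1 : ℝ → ℝ≥0∞) (t + p)) (fun _ => hm N p) (hm N p)
    (fun _ x => Set.indicator_le_self' (fun _ _ => zero_le) _) fun _ => by
      rw [lintegral_add_right_eq_self (fun t => (Icc (-N) N).indicator (1 : ℝ → ℝ≥0∞) t),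
        lintegral_indicator_one measurableSet_Icc]
  simp_rw [Fin.prod_univ_castSucc]
  refine h1.trans ?_
  gcongr
  calc ∫⁻ t, (Icc (-N) N).indicator (1 : ℝ → ℝ≥0∞) (t + p) ∂ν ≤ ∫⁻ _, 1 ∂ν :=
        lintegral_mono fun t => Set.indicator_le_self' (fun _ _ => zero_le) _
    _ = ν univ := by simp

lemma ProductBound.mono {m : ℕ} {γ γ' : Measure (Fin m → ℝ)} {C : ℝ≥0∞} {θ : ℝ}
    (h : ProductBound γ C θ) (hle : γ' ≤ γ) : ProductBound γ' C θ :=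
  fun δ S g h1 h2 h3 => (lintegral_mono' hle le_rfl).trans (h δ S g h1 h2 h3)

lemma LastBound.mono {n : ℕ} {γ γ' : Measure (Fin (n + 1) → ℝ)} {ν : Measure ℝ} {θ : ℝ}
    (h : LastBound γ ν θ) (hle : γ' ≤ γ) : LastBound γ' ν θ :=
  fun δ S g k h1 h2 h3 h4 => (lintegral_mono' hle le_rfl).trans (h δ S g k h1 h2 h3 h4)

lemma IsSignedRep.cumulantFunctional_eq {P : ℤ → Ω → ℝ} {μ : Measure Ω} (hfin : MomentsFinite P μ)
    {m : ℕ} {γ₁ γ₂ : Measure (Fin m → ℝ)} [SFinite γ₁] [SFinite γ₂] (h : IsSignedRep P μ m γ₁ γ₂)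
    (h₁ : FiniteOnBoxes (shear γ₁)) (h₂ : FiniteOnBoxes (shear γ₂))
    {f : Fin (m + 1) → ℝ → ℝ} (hf : ∀ i, IsTest (f i)) :
    cumulantFunctional P μ (m + 1) f =
      intensity P μ * (prodIntegral (shear γ₁) f - prodIntegral (shear γ₂) f) := by
  have hl : 0 ≤ intensity P μ := ENNReal.toReal_nonneg
  set c := ENNReal.ofReal (intensity P μ) with hc
  have hκ : ∀ {κ : Measure (Fin (m + 1) → ℝ)}, FiniteOnBoxes κ → FiniteOnBoxes (c • κ) :=
    fun {κ} hκ N => by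
      rw [Measure.smul_apply, smul_eq_mul]
      exact ENNReal.mul_lt_top ENNReal.ofReal_lt_top (hκ N)
  have hbox : ∀ {κ : Measure (Fin (m + 1) → ℝ)}, FiniteOnBoxes κ → ∀ B : Fin (m + 1) → Set ℝ,
      (∀ i, Bornology.IsBounded (B i)) → κ (Set.univ.pi B) < ∞ := by
    intro κ hκ B hb
    choose N hN using fun i => (hb i).exists_norm_le
    refine (measure_mono (fun x hx i _ => ?_)).trans_lt (hκ (∑ i, |N i|))
    refine abs_le.1 ((hN i _ (hx i (Set.mem_univ i))).trans ((le_abs_self _).trans ?_))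
    exact Finset.single_le_sum (f := fun i => |N i|) (fun _ _ => abs_nonneg _) (Finset.mem_univ i)
  rw [cumulantFunctional_eq_sub hfin (hκ h₁) (hκ h₂) (fun B hB hb => ?_) hf]
  · simp only [prodIntegral, integral_smul_measure, hc, ENNReal.toReal_ofReal hl, smul_eq_mul]
    ring
  · rw [h B hB hb]
    obtain ⟨i1, e1⟩ := integral_shiftedBox γ₁ hB (hbox h₁ B hb)
    obtain ⟨i2, e2⟩ := integral_shiftedBox γ₂ hB (hbox h₂ B hb)
    rw [integral_sub i1 i2, e1, e2]
    simp only [Measure.smul_apply, smul_eq_mul, ENNReal.toReal_mul, hc, ENNReal.toReal_ofReal hl]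
    ring

/-- On nonnegative functions the difference of two integrals is at most their sum, so γ₁ + γ₂ plays
the role of the total variation. The first argument stays free as the outer integrand. -/
lemma IsSignedRep.abs_cumulantFunctional_le {P : ℤ → Ω → ℝ} {μ : Measure Ω}
    (hfin : MomentsFinite P μ)
    {m : ℕ} {γ₁ γ₂ : Measure (Fin m → ℝ)} [SFinite γ₁] [SFinite γ₂] (h : IsSignedRep P μ m γ₁ γ₂)
    (h₁ : FiniteOnBoxes (shear γ₁)) (h₂ : FiniteOnBoxes (shear γ₂))
    {f : Fin (m + 1) → ℝ → ℝ} (hf : ∀ i, IsTest (f i)) (hf0 : ∀ i x, 0 ≤ f i x) :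
    ENNReal.ofReal |cumulantFunctional P μ (m + 1) f| ≤ ENNReal.ofReal (intensity P μ) *
      ∫⁻ p, ENNReal.ofReal (f 0 p) *
        ∫⁻ x, ∏ j : Fin m, ENNReal.ofReal (f j.succ (x j + p)) ∂(γ₁ + γ₂) := by
  have hl : 0 ≤ intensity P μ := ENNReal.toReal_nonneg
  have hI0 : ∀ κ : Measure (Fin (m + 1) → ℝ), 0 ≤ prodIntegral κ f := fun κ =>
    integral_nonneg fun x => Finset.prod_nonneg fun i _ => hf0 i _
  have hI : ∀ {γ : Measure (Fin m → ℝ)} [SFinite γ], FiniteOnBoxes (shear γ) →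
      ENNReal.ofReal (prodIntegral (shear γ) f) = ∫⁻ p, ENNReal.ofReal (f 0 p) *
        ∫⁻ x, ∏ j : Fin m, ENNReal.ofReal (f j.succ (x j + p)) ∂γ := by
    intro γ _ hγ
    rw [← lintegral_shear_prod γ (f := fun i x => ENNReal.ofReal (f i x))
      fun i => (hf i).measurable.ennreal_ofReal, prodIntegral,
      ofReal_integral_eq_lintegral_ofReal (hγ.integrable hf)
        (ae_of_all _ fun x => Finset.prod_nonneg fun i _ => hf0 i _)]
    exact lintegral_congr fun x => ENNReal.ofReal_prod_of_nonneg fun i _ => hf0 i _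
  have hm : ∀ (γ : Measure (Fin m → ℝ)) [SFinite γ], Measurable fun p => ENNReal.ofReal (f 0 p) *
        ∫⁻ x, ∏ j : Fin m, ENNReal.ofReal (f j.succ (x j + p)) ∂γ := fun γ _ => by
    refine (hf 0).measurable.ennreal_ofReal.mul (Measurable.lintegral_prod_right' (ν := γ)
      (f := fun q : ℝ × (Fin m → ℝ) => ∏ j : Fin m, ENNReal.ofReal (f j.succ (q.2 j + q.1))) ?_)
    refine Finset.measurable_prod _ fun j _ => ((hf j.succ).measurable.comp ?_).ennreal_ofReal
    exact ((measurable_pi_apply j).comp measurable_snd).add measurable_fst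
  rw [h.cumulantFunctional_eq hfin h₁ h₂ hf, abs_mul, abs_of_nonneg hl, ENNReal.ofReal_mul hl]
  gcongr
  simp_rw [lintegral_add_measure, mul_add]
  rw [lintegral_add_left (hm γ₁), ← hI h₁, ← hI h₂, ← ENNReal.ofReal_add (hI0 _) (hI0 _)]
  refine ENNReal.ofReal_le_ofReal (abs_le.2 ⟨?_, ?_⟩) <;> linarith [hI0 (shear γ₁), hI0 (shear γ₂)]

end PlanarCylinder

end

noncomputable section

namespace PlanarCylinder

variable {Ω : Type*} [MeasurableSpace Ω]

/-! ### Smallness of the higher cumulants on small functions -/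

/-- For k ≥ 2 and k ≥ 3 respectively, N^(k-1) and N^(k-2) contain at least one factor N, so a small
N beats the growth of b^k and leaves η/2^k. This is how small test functions absorb the constants of
the mixing conditions. -/
lemma exists_small_radius {l a b η : ℝ} (hl : 0 ≤ l) (ha : 0 ≤ a) (hb : 0 ≤ b) (hη : 0 < η) :
    ∃ N : ℝ, 0 < N ∧ (∀ k : ℕ, 2 ≤ k → k * (l * (a * b ^ k) * N ^ (k - 1)) ≤ η * (1 / 2) ^ k) ∧
      ∀ k : ℕ, 3 ≤ k → 2 * k * (l * (a * b ^ k) * N ^ (k - 2)) ≤ η * (1 / 2) ^ k := by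
  -- From k ≤ 2^k one gets k b^k 2^k ≤ β^k. The constant D below collects every requirement on N, so
  -- that N D ≤ min 1 η suffices.
  set β := 4 * b with hβ
  have hβ0 : 0 ≤ β := by positivity
  set D := 2 * l * a * (β ^ 2 + β ^ 3) + β + η with hD
  have hD0 : 0 < D := by positivity
  refine ⟨min 1 η / (D + 1), by positivity, ?_, ?_⟩
  all_goals
    set N := min 1 η / (D + 1) with hN
    have hN0 : 0 ≤ N := by positivity
    have hND : N * D ≤ min 1 η := by
      rw [hN, div_mul_eq_mul_div, div_le_iff₀ (by positivity)]
      have : 0 ≤ min 1 η := by positivity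
      nlinarith
    have hβN : β * N ≤ 1 := by
      have h1 : β ≤ D := by
        have : 0 ≤ 2 * l * a * (β ^ 2 + β ^ 3) := by positivity
        linarith
      nlinarith [min_le_left 1 η]
    have hβN0 : 0 ≤ β * N := by positivity
    have hk2 : ∀ k : ℕ, (k : ℝ) * b ^ k * 2 ^ k ≤ β ^ k := fun k => by
      have : (k : ℝ) ≤ 2 ^ k := by exact_mod_cast Nat.lt_two_pow_self.le
      calc (k : ℝ) * b ^ k * 2 ^ k ≤ 2 ^ k * b ^ k * 2 ^ k := by gcongr
        _ = β ^ k := by rw [hβ, ← mul_pow, ← mul_pow]; congr 1; ring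
    have hmain : N * (2 * l * a * (β ^ 2 + β ^ 3)) ≤ η := by
      have : N * (2 * l * a * (β ^ 2 + β ^ 3)) ≤ N * D := by
        apply mul_le_mul_of_nonneg_left _ hN0
        rw [hD]; linarith
      exact this.trans (hND.trans (min_le_right _ _))
    intro k hk
  · obtain ⟨j, rfl⟩ : ∃ j, k = j + 2 := ⟨k - 2, by omega⟩
    rw [one_div, inv_pow, ← div_eq_mul_inv, le_div_iff₀ (by positivity)]
    have h1 : (β * N) ^ (j + 1) ≤ β * N := by
      rw [pow_succ]
      exact mul_le_of_le_one_left hβN0 (pow_le_one₀ hβN0 hβN)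
    calc ((j + 2 : ℕ) : ℝ) * (l * (a * b ^ (j + 2)) * N ^ (j + 2 - 1)) * 2 ^ (j + 2)
        = l * a * N ^ (j + 1) * (((j + 2 : ℕ) : ℝ) * b ^ (j + 2) * 2 ^ (j + 2)) := by
          rw [show j + 2 - 1 = j + 1 by omega]; ring
      _ ≤ l * a * N ^ (j + 1) * β ^ (j + 2) := by
          gcongr
          exact hk2 _
      _ = l * a * β * (β * N) ^ (j + 1) := by ring
      _ ≤ l * a * β * (β * N) := by gcongr
      _ ≤ N * (2 * l * a * (β ^ 2 + β ^ 3)) := by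
          have : 0 ≤ N * (l * a * β ^ 2) := by positivity
          have : 0 ≤ N * (l * a * β ^ 3) := by positivity
          nlinarith
      _ ≤ η := hmain
  · obtain ⟨j, rfl⟩ : ∃ j, k = j + 3 := ⟨k - 3, by omega⟩
    rw [one_div, inv_pow, ← div_eq_mul_inv, le_div_iff₀ (by positivity)]
    have h1 : (β * N) ^ (j + 1) ≤ β * N := by
      rw [pow_succ]
      exact mul_le_of_le_one_left hβN0 (pow_le_one₀ hβN0 hβN)
    calc 2 * ((j + 3 : ℕ) : ℝ) * (l * (a * b ^ (j + 3)) * N ^ (j + 3 - 2)) * 2 ^ (j + 3)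
        = 2 * l * a * N ^ (j + 1) * (((j + 3 : ℕ) : ℝ) * b ^ (j + 3) * 2 ^ (j + 3)) := by
          rw [show j + 3 - 2 = j + 1 by omega]; ring
      _ ≤ 2 * l * a * N ^ (j + 1) * β ^ (j + 3) := by
          gcongr
          exact hk2 _
      _ = 2 * l * a * β ^ 2 * (β * N) ^ (j + 1) := by ring
      _ ≤ 2 * l * a * β ^ 2 * (β * N) := by gcongr
      _ ≤ N * (2 * l * a * (β ^ 2 + β ^ 3)) := by
          have : 0 ≤ N * (l * a * β ^ 2) := by positivity
          nlinarith
      _ ≤ η := hmain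

/-- Small nonnegative test functions. -/
structure IsSmallTuple {k : ℕ} (f : Fin k → ℝ → ℝ) (δ S : ℝ) : Prop where
  isTest : ∀ i, IsTest (f i)
  nonneg : ∀ i x, 0 ≤ f i x
  le : ∀ i x, f i x ≤ δ
  integral_le : ∀ i, ∫ x, f i x ≤ S

lemma IsSmallTuple.comp {k : ℕ} {f : Fin k → ℝ → ℝ} {δ S : ℝ} (h : IsSmallTuple f δ S)
    (σ : Equiv.Perm (Fin k)) : IsSmallTuple (fun i => f (σ i)) δ S :=
  ⟨fun _ => h.isTest _, fun _ => h.nonneg _, fun _ => h.le _, fun _ => h.integral_le _⟩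

lemma IsSmallTuple.lintegral_le {k : ℕ} {f : Fin k → ℝ → ℝ} {δ S : ℝ} (h : IsSmallTuple f δ S)
    (i : Fin k) (p : ℝ) : ∫⁻ x, ENNReal.ofReal (f i (x + p)) ≤ ENNReal.ofReal S := by
  rw [lintegral_add_right_eq_self (fun x => ENNReal.ofReal (f i x)),
    ← ofReal_integral_eq_lintegral_ofReal (h.isTest i).integrable (ae_of_all _ (h.nonneg i))]
  exact ENNReal.ofReal_le_ofReal (h.integral_le i)

/-- The cumulant functionals of order `k ≥ 2` are small, in a summable way, on small functions. -/
def CumulantsSmall (P : ℤ → Ω → ℝ) (μ : Measure Ω) : Prop :=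
  ∀ S : ℝ, 0 < S → ∀ η : ℝ, 0 < η → ∃ δ : ℝ, 0 < δ ∧ ∃ ν : ℕ → Measure ℝ,
    (∀ k, ν k univ ≤ ENNReal.ofReal (η * (1 / 2) ^ k)) ∧
    ∀ (k : ℕ) (f : Fin k → ℝ → ℝ), 2 ≤ k → IsSmallTuple f δ S →
      (∀ i, k * |cumulantFunctional P μ k f| ≤ k.factorial * (η * (1 / 2) ^ k) * ∫ x, f i x) ∧
      (3 ≤ k → ∀ i j, i ≠ j →
        ENNReal.ofReal (2 * k * |cumulantFunctional P μ k f| / k.factorial) ≤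
          ∫⁻ p, ENNReal.ofReal (f i p) * ∫⁻ t, ENNReal.ofReal (f j (t + p)) ∂ν k)

lemma exists_perm_apply_eq {k : ℕ} (i j : Fin (k + 2)) (hij : i ≠ j) :
    ∃ σ : Equiv.Perm (Fin (k + 2)), σ 0 = i ∧ σ (Fin.last (k + 1)) = j := by
  have h0 : (0 : Fin (k + 2)) ≠ Fin.last (k + 1) := by simp [Fin.ext_iff]
  set σ₁ := Equiv.swap 0 i with hσ₁
  have hj : σ₁ j ≠ 0 := by
    intro h
    have h2 := congrArg σ₁ h
    rw [hσ₁, Equiv.swap_apply_left] at h2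
    simp only [Equiv.swap_apply_self] at h2
    exact hij h2.symm
  refine ⟨σ₁ * Equiv.swap (Fin.last (k + 1)) (σ₁ j), ?_, ?_⟩
  · rw [Equiv.Perm.mul_apply, Equiv.swap_apply_of_ne_of_ne h0 hj.symm, hσ₁, Equiv.swap_apply_left]
  · rw [Equiv.Perm.mul_apply, Equiv.swap_apply_left, hσ₁, Equiv.swap_apply_self]

/-- `ProductBound` spends k - 1 small factors and leaves one argument free, which gives the bound by
∫ f i. `LastBound` leaves two arguments free and spends only k - 2 small factors, so it yields a
gain only from order 3 on. The exponent is θ = 1 for bounds in total variation and θ = 1/q for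
bounds in L_q. -/
lemma cumulantsSmall_of_reps {P : ℤ → Ω → ℝ} {μ : Measure Ω} (hP : ∀ i, Measurable (P i))
    (hfin : MomentsFinite P μ) {θ a b : ℝ} (hθ0 : 0 < θ) (hθ1 : θ ≤ 1) (ha : 0 ≤ a) (hb : 0 ≤ b)
    (h1 : ∀ m : ℕ, 1 ≤ m → ∃ γ₁ γ₂ : Measure (Fin m → ℝ), SFinite γ₁ ∧ SFinite γ₂ ∧
      IsSignedRep P μ m γ₁ γ₂ ∧
      ProductBound (γ₁ + γ₂) (ENNReal.ofReal (a * b ^ (m + 1) * (m + 1).factorial)) θ)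
    (h2 : ∀ n : ℕ, 1 ≤ n → ∃ γ₁ γ₂ : Measure (Fin (n + 1) → ℝ), ∃ ν : Measure ℝ,
      SFinite γ₁ ∧ SFinite γ₂ ∧ IsSignedRep P μ (n + 1) γ₁ γ₂ ∧ LastBound (γ₁ + γ₂) ν θ ∧
      ν univ ≤ ENNReal.ofReal (a * b ^ (n + 2) * (n + 2).factorial)) :
    CumulantsSmall P μ := by
  intro S hS η hη
  set l := intensity P μ with hl
  have hl0 : 0 ≤ l := ENNReal.toReal_nonneg
  obtain ⟨N, hN0, hN1, hN2⟩ := exists_small_radius hl0 ha hb hη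
  -- Chosen so that δ^θ S^(1-θ) = N.
  set δ : ℝ := (N / S ^ (1 - θ)) ^ (1 / θ) with hδ
  have hδ0 : 0 < δ := by positivity
  have hδN : ENNReal.ofReal δ ^ θ * ENNReal.ofReal S ^ (1 - θ) = ENNReal.ofReal N := by
    rw [ENNReal.ofReal_rpow_of_pos hδ0, ENNReal.ofReal_rpow_of_pos hS,
      ← ENNReal.ofReal_mul (by positivity), hδ, ← Real.rpow_mul (by positivity),
      one_div_mul_cancel hθ0.ne', Real.rpow_one, div_mul_cancel₀ _ (by positivity)]
  choose! γ₁ γ₂ ν hs₁ hs₂ hrep hlast hmass using h2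
  have hle : ∀ {m : ℕ} (κ κ' : Measure (Fin m → ℝ)), κ ≤ κ + κ' ∧ κ' ≤ κ + κ' := fun κ κ' =>
    ⟨Measure.le_add_right le_rfl, Measure.le_add_left le_rfl⟩
  -- The measure for order k is the one from `LastBound`, rescaled by 2k λ N^(k-2)/k!; orders below
  -- 3 need none.
  refine ⟨δ, hδ0, fun k => if 3 ≤ k then
    ENNReal.ofReal (2 * k * (l * N ^ (k - 2)) / k.factorial) • ν (k - 2) else 0, fun k => ?_,
    fun k f hk hf => ⟨fun i => ?_, fun hk3 i j hij => ?_⟩⟩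
  · beta_reduce
    split_ifs with hk
    · obtain ⟨n, rfl⟩ : ∃ n, k = n + 2 := ⟨k - 2, by omega⟩
      rw [Measure.smul_apply, smul_eq_mul, Nat.add_sub_cancel]
      refine (mul_le_mul_right (hmass n (by omega)) _).trans ?_
      rw [← ENNReal.ofReal_mul (by positivity)]
      refine ENNReal.ofReal_le_ofReal (le_trans (le_of_eq ?_) (hN2 (n + 2) hk))
      have := Nat.factorial_ne_zero (n + 2)
      rw [Nat.add_sub_cancel]
      field_simp
    · simp
  · obtain ⟨m, rfl⟩ : ∃ m, k = m + 1 := ⟨k - 1, by omega⟩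
    obtain ⟨κ₁, κ₂, _, _, hr, hpb⟩ := h1 m (by omega)
    set g : Fin (m + 1) → ℝ → ℝ := fun j => f (Equiv.swap 0 i j) with hg
    have hgs : IsSmallTuple g δ S := hf.comp _
    have hTg : cumulantFunctional P μ (m + 1) g = cumulantFunctional P μ (m + 1) f :=
      cumulantFunctional_comp_perm hP _ fun i => (hf.isTest i).measurable
    have hg0 : g 0 = f i := by simp [hg]
    have hb := hr.abs_cumulantFunctional_le hfin
      ((hpb.mono (hle κ₁ κ₂).1).finiteOnBoxes hθ1 ENNReal.ofReal_ne_top)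
      ((hpb.mono (hle κ₁ κ₂).2).finiteOnBoxes hθ1 ENNReal.ofReal_ne_top) hgs.isTest hgs.nonneg
    have hin : ∀ p : ℝ, ∫⁻ x, ∏ j : Fin m, ENNReal.ofReal (g j.succ (x j + p)) ∂(κ₁ + κ₂) ≤
        ENNReal.ofReal (a * b ^ (m + 1) * (m + 1).factorial * N ^ m) := fun p => by
      refine (hpb (ENNReal.ofReal δ) (ENNReal.ofReal S)
        (fun j x => ENNReal.ofReal (g j.succ (x + p)))
        (fun j => ((hgs.isTest _).measurable.comp (measurable_id.add_const p)).ennreal_ofReal)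
        (fun j x => ENNReal.ofReal_le_ofReal (hgs.le _ _)) (fun j => hgs.lintegral_le _ p)).trans ?_
      rw [hδN, ← ENNReal.ofReal_pow hN0.le, ← ENNReal.ofReal_mul (by positivity)]
    have hI0 : 0 ≤ ∫ x, f i x := integral_nonneg (hf.nonneg i)
    have hle2 : ENNReal.ofReal |cumulantFunctional P μ (m + 1) f| ≤ ENNReal.ofReal
        (l * ((∫ x, f i x) * (a * b ^ (m + 1) * (m + 1).factorial * N ^ m))) := by
      rw [← hTg]
      refine hb.trans ?_
      rw [ENNReal.ofReal_mul hl0, ENNReal.ofReal_mul hI0, ofReal_integral_eq_lintegral_ofReal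
        (hf.isTest i).integrable (ae_of_all _ (hf.nonneg i)),
        ← lintegral_mul_const _ (hf.isTest i).measurable.ennreal_ofReal, hg0]
      gcongr with p
      exact hin p
    have hle3 := (ENNReal.ofReal_le_ofReal_iff (by positivity)).1 hle2
    have hN1' := hN1 (m + 1) hk
    rw [Nat.add_sub_cancel] at hN1'
    calc ((m + 1 : ℕ) : ℝ) * |cumulantFunctional P μ (m + 1) f|
        ≤ ((m + 1 : ℕ) : ℝ) *
          (l * ((∫ x, f i x) * (a * b ^ (m + 1) * (m + 1).factorial * N ^ m))) := by gcongr
      _ = (m + 1).factorial * (((m + 1 : ℕ) : ℝ) * (l * (a * b ^ (m + 1)) * N ^ m)) *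
            ∫ x, f i x := by ring
      _ ≤ _ := by gcongr
  · obtain ⟨n, rfl⟩ : ∃ n, k = n + 2 := ⟨k - 2, by omega⟩
    have hn : 1 ≤ n := by omega
    beta_reduce
    rw [if_pos hk3, Nat.add_sub_cancel]
    -- By symmetry of the cumulant the two free arguments are moved to position 0, which is the base
    -- point of the shear, and to the last position.
    obtain ⟨σ, hσ0, hσl⟩ := exists_perm_apply_eq i j hij
    set g : Fin (n + 1 + 1) → ℝ → ℝ := fun j => f (σ j) with hg
    have hgs : IsSmallTuple g δ S := hf.comp _
    have hTg : cumulantFunctional P μ (n + 2) g = cumulantFunctional P μ (n + 2) f :=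
      cumulantFunctional_comp_perm hP _ fun i => (hf.isTest i).measurable
    have hg0 : g 0 = f i := by simp [hg, hσ0]
    have hgl : g (Fin.last n).succ = f j := by
      rw [Fin.succ_last]
      simp only [hg]
      rw [hσl]
    have := hs₁ n hn
    have := hs₂ n hn
    have hνfin : ν n univ ≠ ∞ := ne_top_of_le_ne_top ENNReal.ofReal_ne_top (hmass n hn)
    have hb := (hrep n hn).abs_cumulantFunctional_le hfin
      (((hlast n hn).mono (hle _ _).1).finiteOnBoxes hθ1 hνfin)
      (((hlast n hn).mono (hle _ _).2).finiteOnBoxes hθ1 hνfin) hgs.isTest hgs.nonneg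
    have hin : ∀ p : ℝ,
        ∫⁻ x, ∏ j : Fin (n + 1), ENNReal.ofReal (g j.succ (x j + p)) ∂(γ₁ n + γ₂ n) ≤
        (∫⁻ t, ENNReal.ofReal (f j (t + p)) ∂ν n) * ENNReal.ofReal (N ^ n) := fun p => by
      simp_rw [Fin.prod_univ_castSucc]
      rw [← hgl]
      refine (hlast n hn (ENNReal.ofReal δ) (ENNReal.ofReal S)
        (fun j x => ENNReal.ofReal (g j.castSucc.succ (x + p)))
        (fun x => ENNReal.ofReal (g (Fin.last n).succ (x + p)))
        (fun j => ((hgs.isTest _).measurable.comp (measurable_id.add_const p)).ennreal_ofReal)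
        (((hgs.isTest _).measurable.comp (measurable_id.add_const p)).ennreal_ofReal)
        (fun j x => ENNReal.ofReal_le_ofReal (hgs.le _ _)) (fun j => hgs.lintegral_le _ p)).trans ?_
      rw [hδN, ← ENNReal.ofReal_pow hN0.le]
    have hle2 : ENNReal.ofReal |cumulantFunctional P μ (n + 2) f| ≤ ENNReal.ofReal l *
        ∫⁻ p, ENNReal.ofReal (f i p) *
          ((∫⁻ t, ENNReal.ofReal (f j (t + p)) ∂ν n) * ENNReal.ofReal (N ^ n)) := by
      rw [← hTg]
      refine hb.trans ?_
      rw [hg0]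
      gcongr with p
      exact hin p
    have hconst : ∀ p, ENNReal.ofReal (f i p) * ∫⁻ t, ENNReal.ofReal (f j (t + p))
          ∂(ENNReal.ofReal (2 * ((n + 2 : ℕ) : ℝ) * (l * N ^ n) / (n + 2).factorial) • ν n) =
        ENNReal.ofReal (2 * ((n + 2 : ℕ) : ℝ) / (n + 2).factorial) * (ENNReal.ofReal l *
        (ENNReal.ofReal (f i p) *
          ((∫⁻ t, ENNReal.ofReal (f j (t + p)) ∂ν n) * ENNReal.ofReal (N ^ n)))) := fun p => by
      rw [lintegral_smul_measure, smul_eq_mul,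
        show 2 * ((n + 2 : ℕ) : ℝ) * (l * N ^ n) / (n + 2).factorial =
          (2 * ((n + 2 : ℕ) : ℝ) / (n + 2).factorial) * (l * N ^ n) by ring,
        ENNReal.ofReal_mul (by positivity), ENNReal.ofReal_mul hl0]
      ring
    simp_rw [hconst]
    rw [lintegral_const_mul' _ _ ENNReal.ofReal_ne_top, lintegral_const_mul' _ _
      ENNReal.ofReal_ne_top, mul_div_right_comm, ENNReal.ofReal_mul (by positivity)]
    gcongr

/-! ### Smallness of the cumulants under the mixing conditions -/

lemma StronglyBrillingerMixing.cumulantsSmall {P : ℤ → Ω → ℝ} {μ : Measure Ω}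
    [IsProbabilityMeasure μ] (hP : IsStationaryPointProcess P μ) {b : ℝ}
    (h : StronglyBrillingerMixing P μ b) : CumulantsSmall P μ := by
  obtain ⟨hmom, hb, a, ha, hγ⟩ := h
  have ha0 : 0 ≤ a := (inv_nonneg.2 hb.le).trans ha
  refine cumulantsSmall_of_reps hP.measurable (momentsFinite hP hmom) one_pos le_rfl ha0 hb.le
    (fun m hm => ?_) fun n hn => ?_
  · obtain ⟨γ, hr, htv⟩ := hγ m hm
    exact ⟨_, _, inferInstance, inferInstance, hr.isSignedRep, productBound_of_mass _ htv⟩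
  · obtain ⟨γ, hr, htv⟩ := hγ (n + 1) (by omega)
    refine ⟨_, _, _, inferInstance, inferInstance, hr.isSignedRep, lastBound_of_mass _, ?_⟩
    rw [Measure.map_apply (measurable_pi_apply _) MeasurableSet.univ, Set.preimage_univ]
    exact htv

lemma ofReal_add_ofReal_neg (x : ℝ) : ENNReal.ofReal x + ENNReal.ofReal (-x) = ‖x‖ₑ := by
  rcases le_total 0 x with h | h
  · rw [ENNReal.ofReal_of_nonpos (neg_nonpos.2 h), add_zero, Real.enorm_eq_ofReal h]
  · rw [ENNReal.ofReal_of_nonpos h, zero_add, ← enorm_neg, Real.enorm_eq_ofReal (by linarith)]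

lemma withDensity_add_withDensity_neg {m : ℕ} {c : (Fin m → ℝ) → ℝ} (hc : Measurable c) :
    (volume.withDensity fun x => ENNReal.ofReal (c x)) +
      (volume.withDensity fun x => ENNReal.ofReal (-c x)) = volume.withDensity fun x => ‖c x‖ₑ := by
  rw [← withDensity_add_left hc.ennreal_ofReal]
  congr 1
  ext x
  exact ofReal_add_ofReal_neg (c x)

/-- Here θ = 1/q: the L_q-norms enter through `ProductBound` and the modified norms through
`LastBound`. The two conditions may come with different versions of the densities, which is harmless
because both represent the same cumulant functional; the constants are merged by taking maxima. -/
lemma cumulantsSmall_of_density {P : ℤ → Ω → ℝ} {μ : Measure Ω}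
    [IsProbabilityMeasure μ] (hP : IsStationaryPointProcess P μ) {q b b' : ℝ} (hq : 1 < q)
    (h : StronglyLqBrillingerMixing P μ q b) (h' : StronglyLqStarBrillingerMixing P μ q b') :
    CumulantsSmall P μ := by
  obtain ⟨hmom, hb, a, ha, c, hc, -, hcb⟩ := h
  obtain ⟨-, hb', a', ha', c', hc', -, hcb'⟩ := h'
  have hq0 : 0 < q := by linarith
  have hmax : ∀ k : ℕ, a * b ^ k ≤ max a a' * max b b' ^ k ∧ a' * b' ^ k ≤ max a a' * max b b' ^ k :=
    fun k => ⟨by gcongr <;> apply le_max_left, by gcongr <;> apply le_max_right⟩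
  refine cumulantsSmall_of_reps hP.measurable (momentsFinite hP hmom) (θ := 1 / q) (a := max a a')
    (b := max b b') (by positivity) ((div_le_one hq0).2 hq.le) (by positivity) (by positivity)
    (fun m hm => ?_) fun n hn => ?_
  · refine ⟨_, _, inferInstance, inferInstance, (hc m hm).isSignedRep, ?_⟩
    rw [withDensity_add_withDensity_neg (hc m hm).measurable]
    refine productBound_of_density hq (hc m hm).measurable.enorm ?_
    have h1 := hcb m hm
    rw [eLpNorm_eq_lintegral_rpow_enorm_toReal (by simpa using hq0) ENNReal.ofReal_ne_top,
      ENNReal.toReal_ofReal hq0.le] at h1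
    refine h1.trans (ENNReal.ofReal_le_ofReal ?_)
    exact mul_le_mul_of_nonneg_right (hmax _).1 (by positivity)
  · have hd := hc' (n + 1) (by omega)
    have hlb := lastBound_of_density hq hd.measurable.enorm
    rw [← withDensity_add_withDensity_neg hd.measurable] at hlb
    refine ⟨_, _, _, inferInstance, inferInstance, hd.isSignedRep, hlb, ?_⟩
    · have h1 := hcb' n hn
      rw [withDensity_apply _ MeasurableSet.univ, Measure.restrict_univ]
      refine h1.trans (ENNReal.ofReal_le_ofReal ?_)
      exact mul_le_mul_of_nonneg_right (hmax _).2 (by positivity)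

/-- The reduced covariance measure as a difference of two finite measures on the line. -/
lemma exists_second_cumulant {P : ℤ → Ω → ℝ} {μ : Measure Ω} (hfin : MomentsFinite P μ)
    (h : ∃ γ, IsReducedCumulantMeasure P μ 1 γ) :
    ∃ γ₁ γ₂ : Measure ℝ, IsFiniteMeasure γ₁ ∧ IsFiniteMeasure γ₂ ∧
      reducedCumulantMeasure P μ 1 univ = γ₁.real univ - γ₂.real univ ∧
      ∀ f : Fin 2 → ℝ → ℝ, (∀ i, IsTest (f i)) → cumulantFunctional P μ 2 f =
        intensity P μ * ((∫ q : ℝ × ℝ, f 0 q.1 * f 1 (q.2 + q.1) ∂((volume : Measure ℝ).prod γ₁)) -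
          ∫ q : ℝ × ℝ, f 0 q.1 * f 1 (q.2 + q.1) ∂((volume : Measure ℝ).prod γ₂)) := by
  have hred : IsReducedCumulantMeasure P μ 1 (reducedCumulantMeasure P μ 1) := by
    rw [reducedCumulantMeasure, dif_pos h]
    exact h.choose_spec
  set γ := reducedCumulantMeasure P μ 1 with hγ
  set J := γ.toJordanDecomposition with hJ
  have hev : Measurable fun x : Fin 1 → ℝ => x 0 := measurable_pi_apply 0
  have hbox : ∀ (κ : Measure (Fin 1 → ℝ)) [IsFiniteMeasure κ], FiniteOnBoxes (shear κ) :=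
    fun κ _ => (productBound_of_mass κ le_rfl).finiteOnBoxes le_rfl (measure_ne_top κ _)
  have hint : ∀ (κ : Measure (Fin 1 → ℝ)) [IsFiniteMeasure κ] (f : Fin 2 → ℝ → ℝ),
      (∀ i, IsTest (f i)) → prodIntegral (shear κ) f =
        ∫ q : ℝ × ℝ, f 0 q.1 * f 1 (q.2 + q.1) ∂((volume : Measure ℝ).prod (κ.map fun x => x 0)) := by
    intro κ _ f hf
    have hmm : ((volume : Measure ℝ).prod κ).map (Prod.map id fun x : Fin 1 → ℝ => x 0) =
        (volume : Measure ℝ).prod (κ.map fun x => x 0) := by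
      rw [← Measure.map_prod_map _ _ measurable_id hev, Measure.map_id]
    have hm2 : Measurable fun q : ℝ × ℝ => f 0 q.1 * f 1 (q.2 + q.1) :=
      ((hf 0).measurable.comp measurable_fst).mul
        ((hf 1).measurable.comp (measurable_snd.add measurable_fst))
    rw [← hmm, integral_map (measurable_id.prodMap hev).aemeasurable hm2.aestronglyMeasurable,
      prodIntegral, shear, integral_map measurable_shearMap.aemeasurable
        (measurable_prod_apply fun i => (hf i).measurable).aestronglyMeasurable]
    refine integral_congr_ae (ae_of_all _ fun q => ?_)
    simp [Fin.prod_univ_two, shearMap]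
  refine ⟨J.posPart.map fun x => x 0, J.negPart.map fun x => x 0, inferInstance, inferInstance,
    ?_, fun f hf => ?_⟩
  · rw [γ.apply_eq_posPart_real_sub_negPart_real MeasurableSet.univ]
    simp [Measure.real, Measure.map_apply hev MeasurableSet.univ, hJ]
  · rw [hred.isSignedRep.cumulantFunctional_eq hfin (hbox _) (hbox _) hf, hint _ f hf, hint _ f hf]

/-- Integrability of the density of order 2 is what gives γ_red^(2)(ℝ) a meaning as the mass of a
finite signed measure. -/
lemma exists_reduced_of_density {P : ℤ → Ω → ℝ} {μ : Measure Ω} {c : (Fin 1 → ℝ) → ℝ}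
    (hc : IsReducedCumulantDensity P μ 1 c) (hint : eLpNorm c 1 volume < ∞) :
    ∃ γ, IsReducedCumulantMeasure P μ 1 γ := by
  have hi : Integrable c := memLp_one_iff_integrable.1 ⟨hc.measurable.aestronglyMeasurable, hint⟩
  refine ⟨volume.withDensityᵥ c, fun B hB hb => ?_⟩
  rw [hc.cumulant_eq B hB hb]
  congr 1
  refine integral_congr_ae (ae_of_all _ fun p => ?_)
  exact (withDensityᵥ_apply hi
    (MeasurableSet.univ_pi fun j => (hB _).preimage (measurable_id.add_const p))).symm

end PlanarCylinder

end

noncomputable section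

namespace PlanarCylinder

variable {Ω : Type*} [MeasurableSpace Ω]

/-! ### The logarithm of the generating functional -/

/-- The generating functional `E ∏ (1 - w (P i))`. -/
def genFun (P : ℤ → Ω → ℝ) (μ : Measure Ω) (w : ℝ → ℝ) : ℝ := ∫ ω, ∏ᶠ i, (1 - w (P i ω)) ∂μ

/-- A nonnegative test function bounded by `δ` with integral at most `S`. -/
structure IsSmall (f : ℝ → ℝ) (δ S : ℝ) : Prop where
  isTest : IsTest f
  nonneg : ∀ x, 0 ≤ f x
  le : ∀ x, f x ≤ δ
  integral_le : ∫ x, f x ≤ S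

lemma IsSmall.mono {f g : ℝ → ℝ} {δ S : ℝ} (hg : IsSmall g δ S) (hf : IsTest f)
    (hf0 : ∀ x, 0 ≤ f x) (hfg : ∀ x, f x ≤ g x) : IsSmall f δ S :=
  ⟨hf, hf0, fun x => (hfg x).trans (hg.le x),
    (integral_mono hf.integrable hg.isTest.integrable hfg).trans hg.integral_le⟩

lemma isSmallTuple_of_forall {k : ℕ} {f : Fin k → ℝ → ℝ} {δ S : ℝ} (h : ∀ i, IsSmall (f i) δ S) :
    IsSmallTuple f δ S :=
  ⟨fun i => (h i).isTest, fun i => (h i).nonneg, fun i => (h i).le, fun i => (h i).integral_le⟩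

/-- The mutual energy `∫ f(p) ∫ g(t + p) κ(dt) dp`. -/
def cross (κ : Measure ℝ) (f g : ℝ → ℝ) : ℝ≥0∞ :=
  ∫⁻ p, ENNReal.ofReal (f p) * ∫⁻ t, ENNReal.ofReal (g (t + p)) ∂κ

lemma cross_mono {κ : Measure ℝ} {f f' g g' : ℝ → ℝ} (hf : ∀ x, f x ≤ f' x)
    (hg : ∀ x, g x ≤ g' x) : cross κ f g ≤ cross κ f' g' := by
  unfold cross
  gcongr with p t
  · exact hf p
  · exact hg _

lemma cross_le {κ : Measure ℝ} {f g : ℝ → ℝ} {δ : ℝ} (hf : Integrable f) (hf0 : ∀ x, 0 ≤ f x)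
    (hg : ∀ x, g x ≤ δ) :
    cross κ f g ≤ ENNReal.ofReal (∫ x, f x) * (ENNReal.ofReal δ * κ univ) := by
  rw [ofReal_integral_eq_lintegral_ofReal hf (ae_of_all _ hf0),
    ← lintegral_mul_const'' _ hf.aestronglyMeasurable.aemeasurable.ennreal_ofReal]
  refine lintegral_mono fun p => mul_le_mul_right ?_ _
  calc ∫⁻ t, ENNReal.ofReal (g (t + p)) ∂κ ≤ ∫⁻ _, ENNReal.ofReal δ ∂κ :=
        lintegral_mono fun t => ENNReal.ofReal_le_ofReal (hg _)
    _ = _ := lintegral_const _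

section

variable {P : ℤ → Ω → ℝ} {μ : Measure Ω} {S η δ : ℝ} {ν : ℕ → Measure ℝ}

/-- The estimates in the definition of `CumulantsSmall`. -/
def SmallBounds (P : ℤ → Ω → ℝ) (μ : Measure Ω) (S η δ : ℝ) (ν : ℕ → Measure ℝ) : Prop :=
  (∀ k, ν k univ ≤ ENNReal.ofReal (η * (1 / 2) ^ k)) ∧
    ∀ (k : ℕ) (f : Fin k → ℝ → ℝ), 2 ≤ k → IsSmallTuple f δ S →
      (∀ i, k * |cumulantFunctional P μ k f| ≤ k.factorial * (η * (1 / 2) ^ k) * ∫ x, f i x) ∧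
      (3 ≤ k → ∀ i j, i ≠ j →
        ENNReal.ofReal (2 * k * |cumulantFunctional P μ k f| / k.factorial) ≤ cross (ν k) (f i) (f j))

lemma cumulantFunctional_one [IsProbabilityMeasure μ] (hP : IsStationaryPointProcess P μ)
    {w : ℝ → ℝ} (hw : Measurable w) :
    cumulantFunctional P μ 1 (fun _ => w) = intensity P μ * ∫ x, w x := by
  have h0 := moment_zero P μ hP.measurable w
  have h := moment_succ_eq (moment P μ w) h0 0
  rw [cumulantFunctional_const hP.measurable 1 hw, ← moment_one hP hw]
  simpa [h0] using h.symm

/-! ### Bounds for cumulant functionals and their increments -/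

lemma SmallBounds.abs_le (h : SmallBounds P μ S η δ ν) {k : ℕ} (hk : 2 ≤ k) {f : Fin k → ℝ → ℝ}
    (hf : ∀ i, IsSmall (f i) δ S) (i : Fin k) :
    |cumulantFunctional P μ k f| / k.factorial ≤ η * (1 / 2) ^ k * (∫ x, f i x) / k := by
  have h1 := (h.2 k f hk (isSmallTuple_of_forall hf)).1 i
  have hk0 : (0 : ℝ) < k := by exact_mod_cast (by omega : 0 < k)
  rw [div_le_div_iff₀ (by positivity) hk0]
  linarith

/-- Order one is controlled by the intensity and the higher orders by the smallness bounds, so the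
cumulants are O(2^{-k} k!) and the exponential formula applies. -/
lemma SmallBounds.genFun_eq [IsProbabilityMeasure μ] (hP : IsStationaryPointProcess P μ)
    (hfin : MomentsFinite P μ) (hS : 0 ≤ S) (hη : 0 ≤ η) (h : SmallBounds P μ S η δ ν) {w : ℝ → ℝ}
    (hw : IsSmall w δ S) :
    (Summable fun k : ℕ => (-1 : ℝ) ^ (k + 1) *
      cumulantFunctional P μ (k + 1) (fun _ => w) / (k + 1).factorial) ∧
    genFun P μ w = Real.exp (∑' k : ℕ, (-1 : ℝ) ^ (k + 1) *
      cumulantFunctional P μ (k + 1) (fun _ => w) / (k + 1).factorial) := by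
  have hl0 : 0 ≤ intensity P μ := ENNReal.toReal_nonneg
  have hI0 : 0 ≤ ∫ x, w x := integral_nonneg hw.nonneg
  have hcum : ∀ k : ℕ, |cumulantOf (moment P μ w) (k + 1)| ≤
      (intensity P μ * S + η * S) * (1 / 2) ^ k * k.factorial := by
    intro k
    rw [← cumulantFunctional_const hP.measurable _ hw.isTest.measurable]
    rcases k with _ | k
    · rw [zero_add, cumulantFunctional_one hP hw.isTest.measurable,
        abs_of_nonneg (mul_nonneg hl0 hI0)]
      have : intensity P μ * ∫ x, w x ≤ intensity P μ * S :=
        mul_le_mul_of_nonneg_left hw.integral_le hl0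
      have : 0 ≤ η * S := by positivity
      simpa using by linarith
    · have h1 := (h.2 (k + 1 + 1) (fun _ => w) (by omega)
        (isSmallTuple_of_forall fun _ => hw)).1 0
      rw [Nat.factorial_succ] at h1
      have hk : (0 : ℝ) < ((k + 1 + 1 : ℕ) : ℝ) := by positivity
      have h2 : |cumulantFunctional P μ (k + 1 + 1) fun _ => w| ≤
          (k + 1).factorial * (η * (1 / 2) ^ (k + 1 + 1)) * ∫ x, w x := by
        refine le_of_mul_le_mul_left (h1.trans (le_of_eq ?_)) hk
        push_cast
        ring
      refine h2.trans ?_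
      calc ((k + 1).factorial : ℝ) * (η * (1 / 2) ^ (k + 1 + 1)) * ∫ x, w x
          ≤ (k + 1).factorial * (η * (1 / 2) ^ (k + 1)) * S := by
            gcongr ?_ * (η * ?_) * ?_
            · exact pow_le_pow_of_le_one (by norm_num) (by norm_num) (by omega)
            · exact hw.integral_le
        _ ≤ _ := by
            have : 0 ≤ (1 / 2 : ℝ) ^ (k + 1) * (k + 1).factorial * (intensity P μ * S) := by
              positivity
            linarith
  have hexp := tsum_moments_eq_exp (moment_zero P μ hP.measurable w) (by norm_num)
    (by norm_num) hcum
  refine ⟨?_, ?_⟩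
  · refine Summable.of_norm_bounded (g := fun k : ℕ => (intensity P μ * S + η * S) * (1 / 2 : ℝ) ^ k)
      ((summable_geometric_of_lt_one (by norm_num) (by norm_num)).mul_left _) fun k => ?_
    rw [norm_div, norm_mul, norm_pow, norm_neg, norm_one, one_pow, one_mul, Real.norm_eq_abs,
      cumulantFunctional_const hP.measurable _ hw.isTest.measurable, Real.norm_natCast,
      div_le_iff₀ (by positivity)]
    refine (hcum k).trans ?_
    gcongr
    omega
  · rw [genFun, integral_finprod_one_sub hP hfin hw.isTest hw.nonneg hexp.1, hexp.2]
    simp_rw [cumulantFunctional_const hP.measurable _ hw.isTest.measurable]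

/-- Telescoping puts w - u into one argument of each of k hybrid terms; the factor k in the first
bound of `SmallBounds` pays for their number. -/
lemma SmallBounds.abs_sub_le_of_le (hfin : MomentsFinite P μ) (h : SmallBounds P μ S η δ ν) {k : ℕ}
    (hk : 2 ≤ k) {u w : ℝ → ℝ} (hu : IsSmall u δ S) (hw : IsSmall w δ S) (huw : ∀ x, u x ≤ w x) :
    |cumulantFunctional P μ k (fun _ => w) - cumulantFunctional P μ k (fun _ => u)| / k.factorial ≤
      η * (1 / 2) ^ k * ∫ x, (w - u) x := by
  have hsub : IsSmall (w - u) δ S := hw.mono (hw.isTest.sub hu.isTest)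
    (fun x => sub_nonneg.2 (huw x)) fun x => by simpa using hu.nonneg x
  have hk0 : (0 : ℝ) < k := by exact_mod_cast (by omega : 0 < k)
  rw [(multiIntLike_cumulantFunctional hfin k).map_sub_eq_sum (fun _ => hu.isTest)
    fun _ => hw.isTest]
  calc _ ≤ (∑ i : Fin k, |cumulantFunctional P μ k (Function.update
          (fun j => if j < i then u else w) i (w - u))|) / k.factorial := by
        gcongr
        exact Finset.abs_sum_le_sum_abs _ _
    _ ≤ ∑ _i : Fin k, η * (1 / 2) ^ k * (∫ x, (w - u) x) / k := by
        rw [Finset.sum_div]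
        refine Finset.sum_le_sum fun i _ => ?_
        refine (h.abs_le hk (fun j => ?_) i).trans_eq (by simp)
        by_cases hj : j = i
        · subst hj; simpa using hsub
        · rw [Function.update_of_ne hj]
          split_ifs
          exacts [hu, hw]
    _ = _ := by
        rw [Finset.sum_const, Finset.card_univ, Fintype.card_fin, nsmul_eq_mul]
        field_simp

/-- After multilinear expansion, every term left over contains both u and v. Telescoping from u + v
to u leaves terms with u in position z and v in position i, except for i = z, where the tuple b =
(v, u + v, …, u + v) appears. Telescoping b to v leaves terms with v in position z and u in position
i. There are 2(k - 1) terms in all, each at most `cross` / (2k), which explains the factor 2k in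
`SmallBounds`. -/
lemma SmallBounds.abs_mixed_le (hfin : MomentsFinite P μ) (h : SmallBounds P μ S η δ ν) {k : ℕ}
    (hk : 3 ≤ k) {u v : ℝ → ℝ} (hu : IsTest u) (hu0 : ∀ x, 0 ≤ u x) (hv : IsTest v)
    (hv0 : ∀ x, 0 ≤ v x) (huv : IsSmall (u + v) δ S) :
    |cumulantFunctional P μ k (fun _ => u + v) - cumulantFunctional P μ k (fun _ => u) -
      cumulantFunctional P μ k (fun _ => v)| / k.factorial ≤ (cross (ν k) u v).toReal := by
  have hT := multiIntLike_cumulantFunctional hfin k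
  have hus : IsSmall u δ S := huv.mono hu hu0 fun x => by simpa using hv0 x
  have hvs : IsSmall v δ S := huv.mono hv hv0 fun x => by simpa using hu0 x
  have hk0 : (0 : ℝ) < k := by exact_mod_cast (by omega : 0 < k)
  set X := (cross (ν k) u v).toReal with hX
  have hXtop : cross (ν k) u v ≠ ∞ := by
    refine ne_top_of_le_ne_top ?_ (cross_le hu.integrable hu0 hvs.le)
    exact ENNReal.mul_ne_top ENNReal.ofReal_ne_top (ENNReal.mul_ne_top ENNReal.ofReal_ne_top
      (ne_top_of_le_ne_top ENNReal.ofReal_ne_top (h.1 k)))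
  let z : Fin k := ⟨0, by omega⟩
  have hz : ∀ i : Fin k, i ≠ z → z < i := fun i hi => by
    rw [Fin.lt_def]
    exact Nat.pos_of_ne_zero fun h0 => hi (Fin.ext h0)
  have hbound : ∀ f : Fin k → ℝ → ℝ, (∀ i, IsSmall (f i) δ S) → ∀ i j, i ≠ j → f i = u → f j = v →
      |cumulantFunctional P μ k f| / k.factorial ≤ X / (2 * k) := by
    intro f hf i j hij hi hj
    have h1 := (h.2 k f (by omega) (isSmallTuple_of_forall hf)).2 hk i j hij
    rw [hi, hj, ENNReal.ofReal_le_iff_le_toReal hXtop] at h1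
    rw [le_div_iff₀ (by positivity)]
    calc _ = 2 * k * |cumulantFunctional P μ k f| / k.factorial := by ring
      _ ≤ X := h1
  set b : Fin k → ℝ → ℝ := Function.update (fun _ => u + v) z v with hb
  have hbt : ∀ i, IsSmall (b i) δ S := fun i => by
    by_cases hi : i = z
    · rw [hb, hi, Function.update_self]; exact hvs
    · rw [hb, Function.update_of_ne hi]; exact huv
  have hmem : ∀ (i : Fin k) (a c : Fin k → ℝ → ℝ) (d : ℝ → ℝ), (∀ j, IsSmall (a j) δ S) →
      (∀ j, IsSmall (c j) δ S) → IsSmall d δ S → ∀ j,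
      IsSmall (Function.update (fun j => if j < i then a j else c j) i d j) δ S := by
    intro i a c d ha hc hd j
    by_cases hj : j = i
    · subst hj; simpa using hd
    · rw [Function.update_of_ne hj]
      split_ifs
      exacts [ha j, hc j]
  have e1 := hT.map_sub_eq_sum (a := fun _ => u) (b := fun _ => u + v) (fun _ => hu)
    fun _ => huv.isTest
  have e2 := hT.map_sub_eq_sum (a := fun _ => v) (b := b) (fun _ => hv) fun i => (hbt i).isTest
  simp only [add_sub_cancel_left] at e1
  rw [← Finset.add_sum_erase _ _ (Finset.mem_univ z)] at e1 e2
  have ez1 : Function.update (fun j => if j < z then u else u + v) z v = b := by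
    funext j
    by_cases hj : j = z
    · subst hj; simp [hb]
    · rw [Function.update_of_ne hj, hb, Function.update_of_ne hj, if_neg (hz j hj).not_gt]
  have ez2 : cumulantFunctional P μ k
      (Function.update (fun j => if j < z then v else b j) z (b z - v)) = 0 := by
    have h0 : b z - v = (0 : ℝ) • (0 : ℝ → ℝ) := by simp [hb]
    have ht0 : IsTest (0 : ℝ → ℝ) := by simpa using hu.smul 0
    rw [h0, (hT (fun j => if j < z then v else b j) (fun j => ?_) z).smul 0 0 ht0, zero_mul]
    split_ifs
    exacts [hv, (hbt j).isTest]
  rw [ez1] at e1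
  rw [ez2, zero_add] at e2
  have hbd1 : ∀ i ∈ Finset.univ.erase z, |cumulantFunctional P μ k
      (Function.update (fun j => if j < i then u else u + v) i v)| / k.factorial ≤
        X / (2 * k) := by
    intro i hi
    have hiz := Finset.ne_of_mem_erase hi
    refine hbound _ (hmem i (fun _ => u) (fun _ => u + v) v (fun _ => hus) (fun _ => huv) hvs)
      z i (Ne.symm hiz) ?_ (by simp)
    rw [Function.update_of_ne (Ne.symm hiz), if_pos (hz i hiz)]
  have hbd2 : ∀ i ∈ Finset.univ.erase z, |cumulantFunctional P μ k
      (Function.update (fun j => if j < i then v else b j) i (b i - v))| / k.factorial ≤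
        X / (2 * k) := by
    intro i hi
    have hiz := Finset.ne_of_mem_erase hi
    have hbi : b i - v = u := by
      rw [hb, Function.update_of_ne hiz]
      simp
    rw [hbi]
    refine hbound _ (hmem i (fun _ => v) b u (fun _ => hvs) hbt hus) i z hiz (by simp) ?_
    rw [Function.update_of_ne (Ne.symm hiz), if_pos (hz i hiz)]
  have hX0 : 0 ≤ X := ENNReal.toReal_nonneg
  have hsum : ∀ F : Fin k → ℝ, (∀ i ∈ Finset.univ.erase z, |F i| / k.factorial ≤ X / (2 * k)) →
      |∑ i ∈ Finset.univ.erase z, F i| / k.factorial ≤ X / 2 := by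
    intro F hF
    calc |∑ i ∈ Finset.univ.erase z, F i| / k.factorial
        ≤ (∑ i ∈ Finset.univ.erase z, |F i|) / k.factorial := by
          gcongr
          exact Finset.abs_sum_le_sum_abs _ _
      _ ≤ ∑ _i ∈ Finset.univ.erase z, X / (2 * k) := by
          rw [Finset.sum_div]
          exact Finset.sum_le_sum hF
      _ ≤ k * (X / (2 * k)) := by
          rw [Finset.sum_const, nsmul_eq_mul]
          gcongr
          simp
      _ = X / 2 := by field_simp
  have hfinal : cumulantFunctional P μ k (fun _ => u + v) - cumulantFunctional P μ k (fun _ => u) -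
      cumulantFunctional P μ k (fun _ => v) =
      (∑ i ∈ Finset.univ.erase z, cumulantFunctional P μ k
        (Function.update (fun j => if j < i then u else u + v) i v)) +
      ∑ i ∈ Finset.univ.erase z, cumulantFunctional P μ k
        (Function.update (fun j => if j < i then v else b j) i (b i - v)) := by
    linarith
  rw [hfinal]
  calc _ ≤ (|∑ i ∈ Finset.univ.erase z, cumulantFunctional P μ k
        (Function.update (fun j => if j < i then u else u + v) i v)| +
      |∑ i ∈ Finset.univ.erase z, cumulantFunctional P μ k
        (Function.update (fun j => if j < i then v else b j) i (b i - v))|) / k.factorial := by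
        gcongr
        exact abs_add_le _ _
    _ ≤ X := by
        rw [add_div]
        linarith [hsum _ hbd1, hsum _ hbd2]

/-- With u = w₁ - wc one has w₁ + w₂ - wc = u + w₂, and bilinearity produces the mixed term 2 T(u,
w₂). Replacing u by w₁, both here and in T(u, u), costs only terms with wc in an argument. -/
lemma SmallBounds.abs_second_le (hP : ∀ i, Measurable (P i)) (hfin : MomentsFinite P μ)
    (h : SmallBounds P μ S η δ ν) {w₁ w₂ wc : ℝ → ℝ} (h₁ : IsTest w₁) (h₂ : IsTest w₂)
    (hc : IsTest wc) (hc0 : ∀ x, 0 ≤ wc x) (hc1 : ∀ x, wc x ≤ w₁ x) (hc2 : ∀ x, wc x ≤ w₂ x)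
    (h12 : IsSmall (w₁ + w₂) δ S) :
    |(cumulantFunctional P μ 2 (fun _ => w₁ + w₂ - wc) - cumulantFunctional P μ 2 (fun _ => w₁) -
      cumulantFunctional P μ 2 (fun _ => w₂)) / 2 - cumulantFunctional P μ 2 ![w₁, w₂]| ≤
      η / 2 * ∫ x, wc x := by
  have hT := multiIntLike_cumulantFunctional hfin 2
  set T := cumulantFunctional P μ 2 with hTd
  have add0 : ∀ f g k : ℝ → ℝ, IsTest f → IsTest g → IsTest k →
      T ![f + g, k] = T ![f, k] + T ![g, k] := fun f g k hf hg hk => by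
    have hup : ∀ f' : ℝ → ℝ, Function.update ![f, k] 0 f' = ![f', k] := fun f' => by
      funext i; fin_cases i <;> rfl
    have := (hT ![f, k] (by intro i; fin_cases i; exacts [hf, hk]) 0).add f g hf hg
    simpa only [hup] using this
  have hsym : ∀ f g : ℝ → ℝ, IsTest f → IsTest g → T ![f, g] = T ![g, f] := fun f g hf hg => by
    have := cumulantFunctional_comp_perm (μ := μ) hP (Equiv.swap (0 : Fin 2) 1) (f := ![g, f])
      (by intro i; fin_cases i; exacts [hg.measurable, hf.measurable])
    rw [hTd, ← this]
    congr 1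
    funext i
    fin_cases i <;> simp
  have hconst : ∀ f : ℝ → ℝ, (fun _ : Fin 2 => f) = ![f, f] := fun f => by
    funext i; fin_cases i <;> rfl
  have h₁0 : ∀ x, 0 ≤ w₁ x := fun x => (hc0 x).trans (hc1 x)
  have h₂0 : ∀ x, 0 ≤ w₂ x := fun x => (hc0 x).trans (hc2 x)
  have hs₁ : IsSmall w₁ δ S := h12.mono h₁ h₁0 fun x => by simpa using h₂0 x
  have hs₂ : IsSmall w₂ δ S := h12.mono h₂ h₂0 fun x => by simpa using h₁0 x
  have hsc : IsSmall wc δ S := hs₁.mono hc hc0 hc1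
  set u := w₁ - wc with hu
  have hut : IsTest u := h₁.sub hc
  have hsu : IsSmall u δ S := hs₁.mono hut (fun x => sub_nonneg.2 (hc1 x)) fun x => by
    simpa [hu] using hc0 x
  have hw12 : w₁ + w₂ - wc = u + w₂ := by rw [hu]; abel
  have hw1 : w₁ = u + wc := by rw [hu]; abel
  have hb1 := h.abs_sub_le_of_le hfin le_rfl hsu hs₁ fun x => by simpa [hu] using hc0 x
  have hb2 := h.abs_le le_rfl (f := ![wc, w₂])
    (by intro i; fin_cases i; exacts [hsc, hs₂]) 0
  have e0 : w₁ - u = wc := by rw [hu]; abel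
  rw [e0] at hb1
  simp only [Nat.factorial_two, Nat.cast_ofNat, Matrix.cons_val_zero] at hb1 hb2
  have hI0 : 0 ≤ ∫ x, wc x := integral_nonneg hc0
  have e1 : T (fun _ => w₁ + w₂ - wc) = T (fun _ => u) + T (fun _ => w₂) + 2 * T ![u, w₂] := by
    rw [hw12, hconst, hconst u, hconst w₂, add0 u w₂ _ hut h₂ (hut.add h₂),
      hsym u _ hut (hut.add h₂), hsym w₂ _ h₂ (hut.add h₂), add0 u w₂ _ hut h₂ hut,
      add0 u w₂ _ hut h₂ h₂, hsym w₂ u h₂ hut]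
    ring
  have e2 : T ![w₁, w₂] = T ![u, w₂] + T ![wc, w₂] := by
    conv_lhs => rw [hw1]
    rw [add0 u wc _ hut hc h₂]
  rw [e1, e2]
  have e3 : (T (fun _ => u) + T (fun _ => w₂) + 2 * T ![u, w₂] - T (fun _ => w₁) -
      T fun _ => w₂) / 2 - (T ![u, w₂] + T ![wc, w₂]) =
      -((T (fun _ => w₁) - T fun _ => u) / 2) - T ![wc, w₂] := by ring
  rw [e3]
  have h3 : |T (fun _ => w₁) - T fun _ => u| / 2 ≤ η * (1 / 2) ^ 2 * ∫ x, wc x := hb1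
  have h4 : |T ![wc, w₂]| / 2 ≤ η * (1 / 2) ^ 2 * (∫ x, wc x) / 2 := hb2
  calc _ ≤ |T (fun _ => w₁) - T fun _ => u| / 2 + |T ![wc, w₂]| := by
        refine (abs_sub _ _).trans_eq ?_
        rw [abs_neg, abs_div, abs_two]
    _ ≤ η / 2 * ∫ x, wc x := by linarith

/-- D is the difference of three logarithmic series. Order one contributes exactly λ ∫ wc, and order
two contributes the cumulant of (w₁, w₂) up to a multiple of η ∫ wc. From order three on, u = w₁ -
wc separates a mixed part in u and w₂, bounded by `cross`, from the change of u to w₁, bounded by ∫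
wc. The number ε collects the orders from two on of w₁ and w₂, so the product of the generating
functionals stays close to its Poisson value. -/
lemma SmallBounds.genFun_ratio [IsProbabilityMeasure μ] (hP : IsStationaryPointProcess P μ)
    (hfin : MomentsFinite P μ) (hS : 0 ≤ S) (hη : 0 ≤ η) (h : SmallBounds P μ S η δ ν)
    {w₁ w₂ wc : ℝ → ℝ} (h₁ : IsTest w₁) (h₂ : IsTest w₂)
    (hc : IsTest wc) (hc0 : ∀ x, 0 ≤ wc x) (hc1 : ∀ x, wc x ≤ w₁ x) (hc2 : ∀ x, wc x ≤ w₂ x)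
    (h12 : IsSmall (w₁ + w₂) δ S) :
    ∃ D ε : ℝ, genFun P μ w₁ * genFun P μ w₂ =
        Real.exp (-(intensity P μ * ((∫ x, w₁ x) + ∫ x, w₂ x)) + ε) ∧ |ε| ≤ η * S ∧
      genFun P μ (w₁ + w₂ - wc) = genFun P μ w₁ * genFun P μ w₂ * Real.exp D ∧
      |D - (intensity P μ * ∫ x, wc x) - cumulantFunctional P μ 2 ![w₁, w₂]| ≤
        η * (∫ x, wc x) + (cross (Measure.sum ν) w₁ w₂).toReal := by
  have h₁0 : ∀ x, 0 ≤ w₁ x := fun x => (hc0 x).trans (hc1 x)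
  have h₂0 : ∀ x, 0 ≤ w₂ x := fun x => (hc0 x).trans (hc2 x)
  have hs₁ : IsSmall w₁ δ S := h12.mono h₁ h₁0 fun x => by simpa using h₂0 x
  have hs₂ : IsSmall w₂ δ S := h12.mono h₂ h₂0 fun x => by simpa using h₁0 x
  have hsw : IsSmall (w₁ + w₂ - wc) δ S := h12.mono ((h₁.add h₂).sub hc)
    (fun x => by simp only [Pi.sub_apply, Pi.add_apply]; linarith [hc1 x, h₂0 x])
    fun x => by simpa using hc0 x
  set l := intensity P μ with hl
  -- Index k of the series belongs to the cumulant of order k + 1.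
  set t : (ℝ → ℝ) → ℕ → ℝ := fun w k => (-1 : ℝ) ^ (k + 1) *
    cumulantFunctional P μ (k + 1) (fun _ => w) / (k + 1).factorial with ht
  obtain ⟨hsum₁, hg₁⟩ := h.genFun_eq hP hfin hS hη hs₁
  obtain ⟨hsum₂, hg₂⟩ := h.genFun_eq hP hfin hS hη hs₂
  obtain ⟨hsumw, hgw⟩ := h.genFun_eq hP hfin hS hη hsw
  have ht0 : ∀ w : ℝ → ℝ, Measurable w → t w 0 = -(l * ∫ x, w x) := fun w hw => by
    simp only [ht, zero_add, pow_one, Nat.factorial_one, Nat.cast_one, div_one]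
    rw [cumulantFunctional_one hP hw]
    ring
  have hgeo : Summable fun k : ℕ => (1 / 2 : ℝ) ^ (k + 2) :=
    (summable_nat_add_iff 2).2 (summable_geometric_of_lt_one (by norm_num) (by norm_num))
  have hgeo2 : ∑' k : ℕ, (1 / 2 : ℝ) ^ (k + 2) = 1 / 2 := by
    simp_rw [pow_add]
    rw [tsum_mul_right, tsum_geometric_two]
    norm_num
  have htail : ∀ w : ℝ → ℝ, IsSmall w δ S → Summable (t w) →
      |∑' k, t w (k + 1)| ≤ η * ∫ x, w x := by
    intro w hw hsw
    have hI0 : 0 ≤ ∫ x, w x := integral_nonneg hw.nonneg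
    have hb : ∀ k, ‖t w (k + 1)‖ ≤ η * (∫ x, w x) * (1 / 2 : ℝ) ^ (k + 2) := fun k => by
      simp only [ht]
      rw [norm_div, norm_mul, norm_pow, norm_neg, norm_one, one_pow, one_mul, Real.norm_eq_abs,
        Real.norm_natCast]
      refine (h.abs_le (by omega) (fun _ => hw) 0).trans ?_
      refine (div_le_self (by positivity) ?_).trans_eq (by ring)
      exact_mod_cast (by omega : 1 ≤ k + 1 + 1)
    refine (tsum_of_norm_bounded (hgeo.mul_left _).hasSum hb).trans ?_
    rw [tsum_mul_left, hgeo2]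
    have : 0 ≤ η * ∫ x, w x := by positivity
    linarith
  have hsplit : ∀ w : ℝ → ℝ, Measurable w → Summable (t w) →
      ∑' k, t w k = -(l * ∫ x, w x) + ∑' k, t w (k + 1) := fun w hw hs => by
    rw [hs.tsum_eq_zero_add, ht0 w hw]
  refine ⟨∑' k, t (w₁ + w₂ - wc) k - ∑' k, t w₁ k - ∑' k, t w₂ k,
    ∑' k, t w₁ (k + 1) + ∑' k, t w₂ (k + 1), ?_, ?_, ?_, ?_⟩
  · rw [hg₁, hg₂, ← Real.exp_add]
    congr 1
    change ∑' k, t w₁ k + ∑' k, t w₂ k = _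
    rw [hsplit w₁ h₁.measurable hsum₁, hsplit w₂ h₂.measurable hsum₂]
    ring
  · refine (abs_add_le _ _).trans ?_
    have e : ∫ x, (w₁ + w₂) x = (∫ x, w₁ x) + ∫ x, w₂ x := by
      simp only [Pi.add_apply]
      exact integral_add h₁.integrable h₂.integrable
    have := h12.integral_le
    rw [e] at this
    have := mul_le_mul_of_nonneg_left this hη
    linarith [htail w₁ hs₁ hsum₁, htail w₂ hs₂ hsum₂]
  · rw [hg₁, hg₂, hgw, ← Real.exp_add, ← Real.exp_add]
    congr 1
    change ∑' k, t (w₁ + w₂ - wc) k = ∑' k, t w₁ k + ∑' k, t w₂ k + _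
    ring
  · set d : ℕ → ℝ := fun k => t (w₁ + w₂ - wc) k - t w₁ k - t w₂ k with hd
    have hds : Summable d := (hsumw.sub hsum₁).sub hsum₂
    have hD : ∑' k, t (w₁ + w₂ - wc) k - ∑' k, t w₁ k - ∑' k, t w₂ k = ∑' k, d k := by
      rw [(hsumw.sub hsum₁).tsum_sub hsum₂, hsumw.tsum_sub hsum₁]
    rw [hD, ← hds.sum_add_tsum_nat_add 2, Finset.sum_range_succ, Finset.sum_range_one]
    have hd0 : d 0 = l * ∫ x, wc x := by
      simp only [hd]
      rw [ht0 _ hsw.isTest.measurable, ht0 _ h₁.measurable, ht0 _ h₂.measurable]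
      have : ∫ x, (w₁ + w₂ - wc) x = (∫ x, w₁ x) + (∫ x, w₂ x) - ∫ x, wc x := by
        have e1 := integral_sub (h₁.add h₂).integrable hc.integrable
        have e2 := integral_add h₁.integrable h₂.integrable
        simp only [Pi.sub_apply, Pi.add_apply] at e1 e2 ⊢
        rw [e1, e2]
      rw [this]
      ring
    have hd1 : |d 1 - cumulantFunctional P μ 2 ![w₁, w₂]| ≤ η / 2 * ∫ x, wc x := by
      have := h.abs_second_le hP.measurable hfin h₁ h₂ hc hc0 hc1 hc2 h12
      refine le_trans (le_of_eq ?_) this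
      congr 2
      simp only [hd, ht, Nat.reduceAdd, Nat.factorial_two, Nat.cast_ofNat]
      ring
    set u := w₁ - wc with hu
    have hut : IsTest u := h₁.sub hc
    have hu0 : ∀ x, 0 ≤ u x := fun x => sub_nonneg.2 (hc1 x)
    have huw : ∀ x, u x ≤ w₁ x := fun x => by simpa [hu] using hc0 x
    have hsu : IsSmall u δ S := hs₁.mono hut hu0 huw
    have hw12 : w₁ + w₂ - wc = u + w₂ := by rw [hu]; abel
    have e0 : w₁ - u = wc := by rw [hu]; abel
    have hI0 : 0 ≤ ∫ x, wc x := integral_nonneg hc0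
    have hνtop : ∀ k, cross (ν k) w₁ w₂ ≠ ∞ := fun k => by
      refine ne_top_of_le_ne_top ?_ (cross_le h₁.integrable h₁0 hs₂.le)
      exact ENNReal.mul_ne_top ENNReal.ofReal_ne_top (ENNReal.mul_ne_top ENNReal.ofReal_ne_top
        (ne_top_of_le_ne_top ENNReal.ofReal_ne_top (h.1 k)))
    have hdk : ∀ k, ‖d (k + 2)‖ ≤ η * (∫ x, wc x) * (1 / 2) * (1 / 2) ^ (k + 2) +
        (cross (ν (k + 3)) w₁ w₂).toReal := by
      intro k
      have hb1 := h.abs_sub_le_of_le hfin (k := k + 3) (by omega) hsu hs₁ huw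
      rw [e0] at hb1
      have hb2 := h.abs_mixed_le hfin (k := k + 3) (by omega) hut hu0 h₂ h₂0 (hw12 ▸ hsw)
      have hb3 : (cross (ν (k + 3)) u w₂).toReal ≤ (cross (ν (k + 3)) w₁ w₂).toReal :=
        ENNReal.toReal_mono (hνtop _) (cross_mono huw fun _ => le_rfl)
      set T := cumulantFunctional P μ (k + 3) with hT
      have e1 : d (k + 2) = (-1 : ℝ) ^ (k + 3) *
          (((T fun _ => u + w₂) - (T fun _ => u) - (T fun _ => w₂)) / (k + 3).factorial -
            ((T fun _ => w₁) - (T fun _ => u)) / (k + 3).factorial) := by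
        simp only [hd, ht, hw12]
        ring
      rw [e1, norm_mul, norm_pow, norm_neg, norm_one, one_pow, one_mul]
      refine (norm_sub_le _ _).trans ?_
      rw [Real.norm_eq_abs, Real.norm_eq_abs, abs_div, abs_div, Nat.abs_cast]
      have : (1 / 2 : ℝ) ^ (k + 3) = 1 / 2 * (1 / 2) ^ (k + 2) := by rw [pow_succ]; ring
      rw [this] at hb1
      linarith
    have hmeas : ∀ k, Measurable fun p => ∫⁻ t, ENNReal.ofReal (w₂ (t + p)) ∂ν k := fun k => by
      have : IsFiniteMeasure (ν k) := ⟨(h.1 k).trans_lt ENNReal.ofReal_lt_top⟩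
      exact ((h₂.measurable.comp (measurable_snd.add measurable_fst)).ennreal_ofReal).lintegral_prod_right'
    have hsumcross : cross (Measure.sum ν) w₁ w₂ = ∑' k, cross (ν k) w₁ w₂ := by
      unfold cross
      have hm : ∀ k, AEMeasurable (fun p => ENNReal.ofReal (w₁ p) *
          ∫⁻ t, ENNReal.ofReal (w₂ (t + p)) ∂ν k) volume :=
        fun k => (h₁.measurable.ennreal_ofReal.mul (hmeas k)).aemeasurable
      rw [← lintegral_tsum hm]
      refine lintegral_congr fun p => ?_
      rw [lintegral_sum_measure, ENNReal.tsum_mul_left]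
    have hcrosstop : cross (Measure.sum ν) w₁ w₂ ≠ ∞ := by
      refine ne_top_of_le_ne_top ?_ (cross_le h₁.integrable h₁0 hs₂.le)
      refine ENNReal.mul_ne_top ENNReal.ofReal_ne_top (ENNReal.mul_ne_top ENNReal.ofReal_ne_top ?_)
      rw [Measure.sum_apply _ MeasurableSet.univ]
      refine ne_top_of_le_ne_top ?_ (ENNReal.tsum_le_tsum h.1)
      rw [← ENNReal.ofReal_tsum_of_nonneg (fun k => by positivity)
        ((summable_geometric_of_lt_one (by norm_num) (by norm_num)).mul_left _)]
      exact ENNReal.ofReal_ne_top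
    have hcs0 : Summable fun k => (cross (ν k) w₁ w₂).toReal :=
      ENNReal.summable_toReal (by rw [← hsumcross]; exact hcrosstop)
    have hcs : Summable fun k => (cross (ν (k + 3)) w₁ w₂).toReal :=
      (summable_nat_add_iff 3 (f := fun k => (cross (ν k) w₁ w₂).toReal)).2 hcs0
    have hcle : ∑' k, (cross (ν (k + 3)) w₁ w₂).toReal ≤ (cross (Measure.sum ν) w₁ w₂).toReal := by
      rw [hsumcross, ENNReal.tsum_toReal_eq hνtop, ← hcs0.sum_add_tsum_nat_add 3]
      have : 0 ≤ ∑ i ∈ Finset.range 3, (cross (ν i) w₁ w₂).toReal :=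
        Finset.sum_nonneg fun _ _ => ENNReal.toReal_nonneg
      linarith
    have htl : |∑' k, d (k + 2)| ≤ η * (∫ x, wc x) * (1 / 2) * (1 / 2) +
        (cross (Measure.sum ν) w₁ w₂).toReal := by
      refine (tsum_of_norm_bounded ((hgeo.mul_left _).add hcs).hasSum hdk).trans ?_
      rw [(hgeo.mul_left _).tsum_add hcs, tsum_mul_left, hgeo2]
      linarith
    rw [hd0]
    calc |l * (∫ x, wc x) + d 1 + ∑' k, d (k + 2) - l * (∫ x, wc x) -
          cumulantFunctional P μ 2 ![w₁, w₂]|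
        = |(d 1 - cumulantFunctional P μ 2 ![w₁, w₂]) + ∑' k, d (k + 2)| := by congr 1; ring
      _ ≤ _ := by
        refine (abs_add_le _ _).trans ?_
        have : 0 ≤ η * ∫ x, wc x := by positivity
        linarith

end

end PlanarCylinder

end

noncomputable section

namespace PlanarCylinder

variable {Ω : Type*} [MeasurableSpace Ω]

/-! ### The covariance of two void events -/

lemma measurable_cross_integrand {f g : ℝ → ℝ} (hf : Measurable f) (hg : Measurable g) :
    Measurable fun q : ℝ × ℝ => ENNReal.ofReal (f q.1) * ENNReal.ofReal (g (q.2 + q.1)) :=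
  (hf.comp measurable_fst).ennreal_ofReal.mul
    (hg.comp (measurable_snd.add measurable_fst)).ennreal_ofReal

lemma cross_eq_lintegral_prod (κ : Measure ℝ) [SFinite κ] {f g : ℝ → ℝ} (hf : Measurable f)
    (hg : Measurable g) : cross κ f g = ∫⁻ q : ℝ × ℝ,
      ENNReal.ofReal (f q.1) * ENNReal.ofReal (g (q.2 + q.1)) ∂((volume : Measure ℝ).prod κ) := by
  rw [lintegral_prod _ (measurable_cross_integrand hf hg).aemeasurable]
  refine lintegral_congr fun p => ?_
  exact (lintegral_const_mul _ (hg.comp (measurable_id.add_const p)).ennreal_ofReal).symm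

lemma cross_toReal (κ : Measure ℝ) [SFinite κ] {f g : ℝ → ℝ} (hf : Measurable f)
    (hg : Measurable g) (hf0 : ∀ x, 0 ≤ f x) (hg0 : ∀ x, 0 ≤ g x) : (cross κ f g).toReal =
      ∫ q : ℝ × ℝ, f q.1 * g (q.2 + q.1) ∂((volume : Measure ℝ).prod κ) := by
  have hm : Measurable fun q : ℝ × ℝ => f q.1 * g (q.2 + q.1) :=
    (hf.comp measurable_fst).mul (hg.comp (measurable_snd.add measurable_fst))
  rw [cross_eq_lintegral_prod κ hf hg, integral_eq_lintegral_of_nonneg_ae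
    (ae_of_all _ fun q => mul_nonneg (hf0 _) (hg0 _)) hm.aestronglyMeasurable]
  simp_rw [ENNReal.ofReal_mul (hf0 _)]

lemma cross_add_measure (κ κ' : Measure ℝ) [SFinite κ] [SFinite κ'] {f g : ℝ → ℝ}
    (hf : Measurable f) (hg : Measurable g) : cross (κ + κ') f g = cross κ f g + cross κ' f g := by
  rw [cross_eq_lintegral_prod _ hf hg, Measure.prod_add, lintegral_add_measure,
    ← cross_eq_lintegral_prod _ hf hg, ← cross_eq_lintegral_prod _ hf hg]

lemma cross_smul_measure (κ : Measure ℝ) (c : ℝ≥0∞) {f g : ℝ → ℝ}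
    (hf : Measurable f) (hg : Measurable g) [SFinite κ] : cross (c • κ) f g = c * cross κ f g := by
  have hm : Measurable fun p => ENNReal.ofReal (f p) * ∫⁻ t, ENNReal.ofReal (g (t + p)) ∂κ :=
    hf.ennreal_ofReal.mul
      ((hg.comp (measurable_snd.add measurable_fst)).ennreal_ofReal.lintegral_prod_right')
  unfold cross
  rw [← lintegral_const_mul _ hm]
  refine lintegral_congr fun p => ?_
  rw [lintegral_smul_measure, smul_eq_mul, mul_left_comm]

lemma cross_toReal_le {κ : Measure ℝ} [IsFiniteMeasure κ] {f g : ℝ → ℝ} {δ S : ℝ} (hf : Integrable f)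
    (hf0 : ∀ x, 0 ≤ f x) (hg : ∀ x, g x ≤ δ) (hδ : 0 ≤ δ) (hS : ∫ x, f x ≤ S) :
    (cross κ f g).toReal ≤ S * (δ * κ.real univ) := by
  have hI : 0 ≤ ∫ x, f x := integral_nonneg hf0
  refine (ENNReal.toReal_mono ?_ (cross_le hf hf0 hg)).trans ?_
  · exact ENNReal.mul_ne_top ENNReal.ofReal_ne_top
      (ENNReal.mul_ne_top ENNReal.ofReal_ne_top (measure_ne_top _ _))
  · rw [ENNReal.toReal_mul, ENNReal.toReal_mul, ENNReal.toReal_ofReal hI, ENNReal.toReal_ofReal hδ]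
    exact mul_le_mul_of_nonneg_right hS (mul_nonneg hδ ENNReal.toReal_nonneg)

lemma cross_ne_top {κ : Measure ℝ} [IsFiniteMeasure κ] {f g : ℝ → ℝ} {δ : ℝ} (hf : Integrable f)
    (hf0 : ∀ x, 0 ≤ f x) (hg : ∀ x, g x ≤ δ) : cross κ f g ≠ ∞ :=
  ne_top_of_le_ne_top (ENNReal.mul_ne_top ENNReal.ofReal_ne_top
    (ENNReal.mul_ne_top ENNReal.ofReal_ne_top (measure_ne_top _ _))) (cross_le hf hf0 hg)

/-- Pure real estimate behind the covariance expansion. -/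
lemma abs_exp_expansion_le {p m ε D M r κ : ℝ} (hm : 0 ≤ m) (hp : p = Real.exp (-m + ε)) (hp1 : p ≤ 1)
    (hε : |ε| ≤ κ) (hκ : κ ≤ 1) (hDM : |D - M| ≤ r) {a : ℝ} (hMa : |M| ≤ a) (har : a + r ≤ κ) :
    |p * Real.exp D - p - Real.exp (-m) * M| ≤ 3 * κ * a + (1 + κ) * r := by
  have hp0 : 0 < p := hp ▸ Real.exp_pos _
  have hr0 : 0 ≤ r := (abs_nonneg _).trans hDM
  have ha0 : 0 ≤ a := (abs_nonneg _).trans hMa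
  have hκ0 : 0 ≤ κ := (abs_nonneg _).trans hε
  have hD : |D| ≤ a + r := by
    have := abs_add_le M (D - M)
    rw [add_sub_cancel] at this
    linarith
  have h1 : |Real.exp D - 1 - D| ≤ κ * (a + r) := by
    refine (Real.abs_exp_sub_one_sub_id_le (by linarith)).trans ?_
    rw [← sq_abs, sq]
    exact mul_le_mul (hD.trans har) hD (abs_nonneg _) hκ0
  have h2 : |Real.exp ε - 1| ≤ 2 * κ := (Real.abs_exp_sub_one_le (hε.trans hκ)).trans (by linarith)
  have h3 : Real.exp (-m) ≤ 1 := Real.exp_le_one_iff.2 (by linarith)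
  -- Three errors: the second-order remainder of the exponential, the distance of D from M, and the
  -- replacement of p by exp(-m).
  have e : p * Real.exp D - p - Real.exp (-m) * M =
      p * (Real.exp D - 1 - D) + p * (D - M) + Real.exp (-m) * (Real.exp ε - 1) * M := by
    rw [hp, Real.exp_add]; ring
  rw [e]
  calc _ ≤ |p * (Real.exp D - 1 - D)| + |p * (D - M)| + |Real.exp (-m) * (Real.exp ε - 1) * M| :=
        abs_add_three _ _ _
    _ ≤ 1 * (κ * (a + r)) + 1 * r + 1 * (2 * κ) * a := by
        rw [abs_mul, abs_mul, abs_mul, abs_mul, abs_of_pos hp0, abs_of_pos (Real.exp_pos _)]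
        gcongr
    _ = _ := by ring

/-- Exponentiating the ratio estimate produces κ times the energy with respect to γ₁ + γ₂, besides
the energy of the orders from three on. Both are put into one measure ν of mass at most η, so that
the error has the same form as the leading term and remains a small fraction of ϱ³ after integration
over pairs of points. -/
lemma CumulantsSmall.abs_genFun_le {P : ℤ → Ω → ℝ} {μ : Measure Ω} [IsProbabilityMeasure μ]
    (hP : IsStationaryPointProcess P μ) (hfin : MomentsFinite P μ) (h : CumulantsSmall P μ)
    {γ₁ γ₂ : Measure ℝ} [IsFiniteMeasure γ₁] [IsFiniteMeasure γ₂]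
    (hγ : ∀ f : Fin 2 → ℝ → ℝ, (∀ i, IsTest (f i)) → cumulantFunctional P μ 2 f =
        intensity P μ * ((∫ q : ℝ × ℝ, f 0 q.1 * f 1 (q.2 + q.1) ∂((volume : Measure ℝ).prod γ₁)) -
          ∫ q : ℝ × ℝ, f 0 q.1 * f 1 (q.2 + q.1) ∂((volume : Measure ℝ).prod γ₂)))
    {S η : ℝ} (hS : 0 < S) (hη : 0 < η) :
    ∃ δ : ℝ, 0 < δ ∧ ∃ ν : Measure ℝ, ν univ ≤ ENNReal.ofReal η ∧
      ∀ w₁ w₂ wc : ℝ → ℝ, IsTest w₁ → IsTest w₂ → IsTest wc → (∀ x, 0 ≤ wc x) →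
      (∀ x, wc x ≤ w₁ x) → (∀ x, wc x ≤ w₂ x) → IsSmall (w₁ + w₂) δ S → ∫ x, wc x ≤ δ →
      genFun P μ w₁ * genFun P μ w₂ ≤ 1 →
      |genFun P μ (w₁ + w₂ - wc) - genFun P μ w₁ * genFun P μ w₂ -
        Real.exp (-(intensity P μ * ((∫ x, w₁ x) + ∫ x, w₂ x))) *
          (intensity P μ * ((∫ x, wc x) + (cross γ₁ w₁ w₂).toReal - (cross γ₂ w₁ w₂).toReal))| ≤
        η * (∫ x, wc x) + (cross ν w₁ w₂).toReal := by
  set l := intensity P μ with hl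
  have hl0 : 0 ≤ l := ENNReal.toReal_nonneg
  set γ := γ₁ + γ₂ with hγd
  set g := γ.real univ with hg
  have hg0 : 0 ≤ g := measureReal_nonneg
  -- κC bounds both the mass of ν, at most κ(3λg + 4), and the coefficient of ∫ wc, at most κ(3λ +
  -- 2).
  set C := 3 * l * (1 + g) + 4 with hC
  have hC0 : 0 < C := by positivity
  set κ := min (η / C) 1 with hκ
  have hκ0 : 0 < κ := by positivity
  have hκ1 : κ ≤ 1 := min_le_right _ _
  have hκη : κ * C ≤ η := (le_div_iff₀ hC0).1 (min_le_left _ _)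
  set η' := min κ (κ / S) with hη'
  have hη'0 : 0 < η' := by positivity
  have hη'κ : η' ≤ κ := min_le_left _ _
  have hη'S : η' * S ≤ κ := (le_div_iff₀ hS).1 (min_le_right _ _)
  obtain ⟨δ₀, hδ₀, ν₀, hb⟩ := h S hS η' hη'0
  have hb' : SmallBounds P μ S η' δ₀ ν₀ := hb
  set σ := Measure.sum ν₀ with hσ
  have hσu : σ univ ≤ ENNReal.ofReal (2 * η') := by
    rw [hσ, Measure.sum_apply _ MeasurableSet.univ]
    refine (ENNReal.tsum_le_tsum hb'.1).trans ?_
    rw [← ENNReal.ofReal_tsum_of_nonneg (fun k => by positivity)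
      ((summable_geometric_of_lt_one (by norm_num) (by norm_num)).mul_left _), tsum_mul_left,
      tsum_geometric_two, mul_comm]
  have : IsFiniteMeasure σ := ⟨hσu.trans_lt ENNReal.ofReal_lt_top⟩
  have hσr : σ.real univ ≤ 2 := by
    refine (ENNReal.toReal_mono ENNReal.ofReal_ne_top hσu).trans ?_
    rw [ENNReal.toReal_ofReal (by positivity)]
    linarith
  -- Each of ∫ wc and the energies carries a factor δ, so δc ≤ κ makes the exponent small enough for
  -- the expansion of the exponential.
  set c := l * (1 + S * g) + 1 + 2 * S with hc
  have hc0 : 0 < c := by positivity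
  refine ⟨min δ₀ (κ / c), by positivity, ENNReal.ofReal (3 * κ * l) • γ + ENNReal.ofReal (1 + κ) • σ,
    ?_, ?_⟩
  · rw [Measure.add_apply, Measure.smul_apply, Measure.smul_apply, smul_eq_mul, smul_eq_mul,
      ← ofReal_measureReal (μ := γ), ← ENNReal.ofReal_mul (by positivity)]
    calc _ ≤ ENNReal.ofReal (3 * κ * l * g) + ENNReal.ofReal (1 + κ) * ENNReal.ofReal (2 * η') := by
          gcongr
      _ = ENNReal.ofReal (3 * κ * l * g + (1 + κ) * (2 * η')) := by
          rw [← ENNReal.ofReal_mul (by positivity), ← ENNReal.ofReal_add (by positivity) (by positivity)]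
      _ ≤ _ := by
          refine ENNReal.ofReal_le_ofReal (le_trans ?_ hκη)
          have : (1 + κ) * (2 * η') ≤ 2 * (2 * κ) := by gcongr; linarith
          have : 0 ≤ 3 * κ * l := by positivity
          rw [hC]
          linarith
  intro w₁ w₂ wc h₁ h₂ hct hwc0 hc1 hc2 h12 hIc hp1
  have h₁0 : ∀ x, 0 ≤ w₁ x := fun x => (hwc0 x).trans (hc1 x)
  have h₂0 : ∀ x, 0 ≤ w₂ x := fun x => (hwc0 x).trans (hc2 x)
  set δ := min δ₀ (κ / c) with hδ
  have hδ0 : 0 < δ := by positivity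
  have hδc : δ * c ≤ κ := (le_div_iff₀ hc0).1 (min_le_right _ _)
  have hs₁ : IsSmall w₁ δ S := h12.mono h₁ h₁0 fun x => by simpa using h₂0 x
  have hs₂ : IsSmall w₂ δ S := h12.mono h₂ h₂0 fun x => by simpa using h₁0 x
  have h12' : IsSmall (w₁ + w₂) δ₀ S :=
    ⟨h12.isTest, h12.nonneg, fun x => (h12.le x).trans (min_le_left _ _), h12.integral_le⟩
  obtain ⟨D, ε, hprod, hε, hratio, hD⟩ :=
    hb'.genFun_ratio hP hfin hS.le hη'0.le h₁ h₂ hct hwc0 hc1 hc2 h12'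
  have hI0 : 0 ≤ ∫ x, wc x := integral_nonneg hwc0
  have hI1 : 0 ≤ ∫ x, w₁ x := integral_nonneg h₁0
  have hI2 : 0 ≤ ∫ x, w₂ x := integral_nonneg h₂0
  set X₁ := (cross γ₁ w₁ w₂).toReal with hX₁
  set X₂ := (cross γ₂ w₁ w₂).toReal with hX₂
  have hX₁0 : 0 ≤ X₁ := ENNReal.toReal_nonneg
  have hX₂0 : 0 ≤ X₂ := ENNReal.toReal_nonneg
  have hT : cumulantFunctional P μ 2 ![w₁, w₂] = l * (X₁ - X₂) := by
    rw [hγ _ (by intro i; fin_cases i; exacts [h₁, h₂]), hX₁, hX₂,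
      cross_toReal _ h₁.measurable h₂.measurable h₁0 h₂0,
      cross_toReal _ h₁.measurable h₂.measurable h₁0 h₂0]
    rfl
  have hXγ : X₁ + X₂ = (cross γ w₁ w₂).toReal := by
    rw [hγd, cross_add_measure _ _ h₁.measurable h₂.measurable, ENNReal.toReal_add
      (cross_ne_top h₁.integrable h₁0 hs₂.le) (cross_ne_top h₁.integrable h₁0 hs₂.le)]
  have hXle : X₁ + X₂ ≤ S * (δ * g) := by
    rw [hXγ]
    exact cross_toReal_le h₁.integrable h₁0 hs₂.le hδ0.le hs₁.integral_le
  have hσle : (cross σ w₁ w₂).toReal ≤ S * (δ * 2) := by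
    refine (cross_toReal_le h₁.integrable h₁0 hs₂.le hδ0.le hs₁.integral_le).trans ?_
    gcongr
  rw [hT] at hD
  set r := η' * (∫ x, wc x) + (cross σ w₁ w₂).toReal with hr
  set a := l * ((∫ x, wc x) + (X₁ + X₂)) with ha
  have hmain := abs_exp_expansion_le (p := genFun P μ w₁ * genFun P μ w₂)
    (m := l * ((∫ x, w₁ x) + ∫ x, w₂ x)) (ε := ε) (D := D)
    (M := l * ((∫ x, wc x) + X₁ - X₂)) (r := r) (κ := κ) (a := a)
    (by positivity) hprod hp1 (hε.trans hη'S) hκ1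
    (by refine le_trans (le_of_eq ?_) hD; congr 1; ring)
    (by
      rw [abs_mul, abs_of_nonneg hl0, ha]
      gcongr
      rw [abs_le]
      constructor <;> linarith)
    (by
      calc a + r ≤ l * (δ + S * (δ * g)) + (1 * δ + S * (δ * 2)) := by
            rw [ha, hr]
            gcongr
            exact hη'κ.trans hκ1
        _ = δ * c := by rw [hc]; ring
        _ ≤ κ := hδc)
  rw [hratio]
  refine hmain.trans ?_
  rw [cross_add_measure _ _ h₁.measurable h₂.measurable,
    cross_smul_measure _ _ h₁.measurable h₂.measurable,
    cross_smul_measure _ _ h₁.measurable h₂.measurable, ENNReal.toReal_add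
      (ENNReal.mul_ne_top ENNReal.ofReal_ne_top (cross_ne_top h₁.integrable h₁0 hs₂.le))
      (ENNReal.mul_ne_top ENNReal.ofReal_ne_top (cross_ne_top h₁.integrable h₁0 hs₂.le)),
    ENNReal.toReal_mul, ENNReal.toReal_mul, ENNReal.toReal_ofReal (by positivity),
    ENNReal.toReal_ofReal (by positivity), ← hXγ, ha, hr]
  have h5 : (3 * κ * l + (1 + κ) * η') * (∫ x, wc x) ≤ η * ∫ x, wc x := by
    gcongr
    refine le_trans ?_ hκη
    have : (1 + κ) * η' ≤ 2 * κ := by gcongr; linarith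
    have : 0 ≤ 3 * κ * l * g := by positivity
    rw [hC]
    linarith
  linarith

end PlanarCylinder

end

noncomputable section

namespace PlanarCylinder

variable {Ω : Type*} [MeasurableSpace Ω]

/-! ### Void probabilities of general sets of marked points -/

/-- The probability that a point at `p`, with the typical mark attached, lies in `A`. -/
def hitProb (Φ R : ℤ → Ω → ℝ) (μ : Measure Ω) (A : Set (ℝ × ℝ × ℝ)) (p : ℝ) : ℝ :=
  μ.real {ω | (p, Φ 0 ω, R 0 ω) ∈ A}

/-- The probability that no marked point lies in `A`. -/
def voidProb (P Φ R : ℤ → Ω → ℝ) (μ : Measure Ω) (A : Set (ℝ × ℝ × ℝ)) : ℝ :=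
  μ.real {ω | ∀ i, (P i ω, Φ i ω, R i ω) ∉ A}

/-- The marked points at distance at most `n` from the origin. -/
def slab (n : ℕ) : Set (ℝ × ℝ × ℝ) := {x | |x.1| ≤ n}

lemma measurableSet_slab (n : ℕ) : MeasurableSet (slab n) :=
  measurableSet_le (continuous_abs.measurable.comp measurable_fst) measurable_const

section

variable {P Φ R : ℤ → Ω → ℝ} {μ : Measure Ω}

lemma hitProb_nonneg (A : Set (ℝ × ℝ × ℝ)) (p : ℝ) : 0 ≤ hitProb Φ R μ A p := measureReal_nonneg

lemma IsIndependentMarking.measurableSet_hit (hM : IsIndependentMarking P Φ R μ)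
    {A : Set (ℝ × ℝ × ℝ)} (hA : MeasurableSet A) (p : ℝ) :
    MeasurableSet {ω | (p, Φ 0 ω, R 0 ω) ∈ A} :=
  (measurable_const.prodMk ((hM.measurable_angle 0).prodMk (hM.measurable_radius 0))) hA

lemma measurable_hitProb [IsFiniteMeasure μ] (hM : IsIndependentMarking P Φ R μ)
    {A : Set (ℝ × ℝ × ℝ)} (hA : MeasurableSet A) : Measurable (hitProb Φ R μ A) := by
  have hm : Measurable fun x : ℝ × Ω => (x.1, Φ 0 x.2, R 0 x.2) :=
    measurable_fst.prodMk (((hM.measurable_angle 0).comp measurable_snd).prodMk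
      ((hM.measurable_radius 0).comp measurable_snd))
  exact (measurable_measure_prodMk_left (hm hA)).ennreal_toReal

lemma hitProb_le_one [IsProbabilityMeasure μ] (A : Set (ℝ × ℝ × ℝ)) (p : ℝ) :
    hitProb Φ R μ A p ≤ 1 := measureReal_le_one

lemma hitProb_mono [IsFiniteMeasure μ] {A B : Set (ℝ × ℝ × ℝ)} (h : A ⊆ B) (p : ℝ) :
    hitProb Φ R μ A p ≤ hitProb Φ R μ B p := measureReal_mono fun _ hω => h hω

lemma hitProb_union [IsFiniteMeasure μ] (hM : IsIndependentMarking P Φ R μ)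
    (A : Set (ℝ × ℝ × ℝ)) {B : Set (ℝ × ℝ × ℝ)} (hB : MeasurableSet B) :
    hitProb Φ R μ (A ∪ B) = hitProb Φ R μ A + hitProb Φ R μ B - hitProb Φ R μ (A ∩ B) := by
  funext p
  rw [Pi.sub_apply, Pi.add_apply, eq_sub_iff_add_eq]
  exact measureReal_union_add_inter (hM.measurableSet_hit hB p)

lemma hitProb_inter_slab (A : Set (ℝ × ℝ × ℝ)) (n : ℕ) (p : ℝ) :
    hitProb Φ R μ (A ∩ slab n) p = if |p| ≤ n then hitProb Φ R μ A p else 0 := by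
  unfold hitProb slab
  split_ifs with h <;> simp [h]

lemma isTest_hitProb [IsProbabilityMeasure μ] (hM : IsIndependentMarking P Φ R μ)
    {A : Set (ℝ × ℝ × ℝ)} (hA : MeasurableSet A) (n : ℕ) :
    IsTest (hitProb Φ R μ (A ∩ slab n)) :=
  ⟨measurable_hitProb hM (hA.inter (measurableSet_slab n)),
    ⟨1, fun p => by
      rw [abs_of_nonneg (hitProb_nonneg _ _)]
      exact hitProb_le_one _ _⟩,
    ⟨n, fun p hp => by rw [hitProb_inter_slab, if_neg (not_le.2 hp)]⟩⟩

lemma voidProb_le_one [IsProbabilityMeasure μ] (A : Set (ℝ × ℝ × ℝ)) : voidProb P Φ R μ A ≤ 1 :=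
  measureReal_le_one

lemma genFun_hitProb [IsProbabilityMeasure μ] (hP : IsStationaryPointProcess P μ)
    (hM : IsIndependentMarking P Φ R μ) {A : Set (ℝ × ℝ × ℝ)} (hA : MeasurableSet A) (n : ℕ) :
    genFun P μ (hitProb Φ R μ (A ∩ slab n)) = voidProb P Φ R μ (A ∩ slab n) :=
  (hM.measure_forall_notMem hP (hA.inter (measurableSet_slab n)) fun _ hx => hx.2).symm

lemma tendsto_hitProb (A : Set (ℝ × ℝ × ℝ)) (p : ℝ) :
    Tendsto (fun n : ℕ => hitProb Φ R μ (A ∩ slab n) p) atTop (𝓝 (hitProb Φ R μ A p)) := by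
  refine tendsto_const_nhds.congr' ?_
  filter_upwards [eventually_ge_atTop ⌈|p|⌉₊] with n hn
  rw [hitProb_inter_slab, if_pos (Nat.ceil_le.1 hn)]

lemma tendsto_integral_hitProb [IsProbabilityMeasure μ] (hM : IsIndependentMarking P Φ R μ)
    {A : Set (ℝ × ℝ × ℝ)} (hA : MeasurableSet A) (hi : Integrable (hitProb Φ R μ A)) :
    Tendsto (fun n : ℕ => ∫ p, hitProb Φ R μ (A ∩ slab n) p) atTop
      (𝓝 (∫ p, hitProb Φ R μ A p)) := by
  refine tendsto_integral_of_dominated_convergence _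
    (fun n => (isTest_hitProb hM hA n).measurable.aestronglyMeasurable) hi
    (fun n => ae_of_all _ fun p => ?_) (ae_of_all _ fun p => tendsto_hitProb A p)
  rw [Real.norm_of_nonneg (hitProb_nonneg _ _)]
  exact hitProb_mono inter_subset_left p

lemma tendsto_voidProb [IsProbabilityMeasure μ] (hP : IsStationaryPointProcess P μ)
    (hM : IsIndependentMarking P Φ R μ) {A : Set (ℝ × ℝ × ℝ)} (hA : MeasurableSet A) :
    Tendsto (fun n : ℕ => voidProb P Φ R μ (A ∩ slab n)) atTop (𝓝 (voidProb P Φ R μ A)) := by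
  have hset : {ω | ∀ i, (P i ω, Φ i ω, R i ω) ∉ A} =
      ⋂ n : ℕ, {ω | ∀ i, (P i ω, Φ i ω, R i ω) ∉ A ∩ slab n} := by
    ext ω
    simp only [mem_iInter, mem_ofPred_eq]
    exact ⟨fun h n i hi => h i hi.1, fun h i hi =>
      h ⌈|P i ω|⌉₊ i ⟨hi, (Nat.le_ceil _ : |P i ω| ≤ (⌈|P i ω|⌉₊ : ℝ))⟩⟩
  unfold voidProb Measure.real
  rw [hset]
  refine (ENNReal.tendsto_toReal (measure_ne_top _ _)).comp (tendsto_measure_iInter_atTop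
    (fun n => ?_) (fun n m hnm ω h i hi => h i ⟨hi.1, ?_⟩) ⟨0, measure_ne_top _ _⟩)
  · have : {ω | ∀ i, (P i ω, Φ i ω, R i ω) ∉ A ∩ slab n} =
        ⋂ i, (fun ω => (P i ω, Φ i ω, R i ω)) ⁻¹' (A ∩ slab n)ᶜ := by
      ext ω; simp
    rw [this]
    exact (MeasurableSet.iInter fun i => ((hP.measurable i).prodMk ((hM.measurable_angle i).prodMk
      (hM.measurable_radius i))) (hA.inter (measurableSet_slab n)).compl).nullMeasurableSet
  · exact le_trans (mem_ofPred_eq ▸ hi.2) (Nat.cast_le.2 hnm)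

lemma tendsto_cross_hitProb [IsProbabilityMeasure μ] (hM : IsIndependentMarking P Φ R μ)
    (κ : Measure ℝ) [IsFiniteMeasure κ] {A B : Set (ℝ × ℝ × ℝ)} (hA : MeasurableSet A)
    (hB : MeasurableSet B) (hi : Integrable (hitProb Φ R μ A)) :
    Tendsto (fun n : ℕ => (cross κ (hitProb Φ R μ (A ∩ slab n)) (hitProb Φ R μ (B ∩ slab n))).toReal)
      atTop (𝓝 (cross κ (hitProb Φ R μ A) (hitProb Φ R μ B)).toReal) := by
  have htop : cross κ (hitProb Φ R μ A) (hitProb Φ R μ B) ≠ ∞ :=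
    cross_ne_top hi (hitProb_nonneg _) (hitProb_le_one _)
  have hmA := measurable_hitProb (μ := μ) hM hA
  have hmB := measurable_hitProb (μ := μ) hM hB
  have hm := fun n => measurable_cross_integrand (isTest_hitProb (μ := μ) hM hA n).measurable
    (isTest_hitProb (μ := μ) hM hB n).measurable
  refine (ENNReal.tendsto_toReal htop).comp ?_
  rw [cross_eq_lintegral_prod κ hmA hmB]
  simp_rw [fun n => cross_eq_lintegral_prod κ (isTest_hitProb (μ := μ) hM hA n).measurable
    (isTest_hitProb (μ := μ) hM hB n).measurable]
  refine tendsto_lintegral_of_dominated_convergence _ hm (fun n => ae_of_all _ fun q => ?_)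
    (by rwa [← cross_eq_lintegral_prod κ hmA hmB]) (ae_of_all _ fun q => ?_)
  · exact mul_le_mul' (ENNReal.ofReal_le_ofReal (hitProb_mono inter_subset_left _))
      (ENNReal.ofReal_le_ofReal (hitProb_mono inter_subset_left _))
  · exact ENNReal.Tendsto.mul (ENNReal.tendsto_ofReal (tendsto_hitProb A _))
      (Or.inr ENNReal.ofReal_ne_top) (ENNReal.tendsto_ofReal (tendsto_hitProb B _))
      (Or.inr ENNReal.ofReal_ne_top)

/-- Hit probabilities are integrable but need not have bounded support. The estimate for test
functions is applied to A ∩ slab n and B ∩ slab n, and n → ∞ is harmless because δ and ν do not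
depend on n. -/
lemma CumulantsSmall.abs_voidProb_le [IsProbabilityMeasure μ]
    (hP : IsStationaryPointProcess P μ) (hM : IsIndependentMarking P Φ R μ)
    (hfin : MomentsFinite P μ) (h : CumulantsSmall P μ)
    {γ₁ γ₂ : Measure ℝ} [IsFiniteMeasure γ₁] [IsFiniteMeasure γ₂]
    (hγ : ∀ f : Fin 2 → ℝ → ℝ, (∀ i, IsTest (f i)) → cumulantFunctional P μ 2 f =
        intensity P μ * ((∫ q : ℝ × ℝ, f 0 q.1 * f 1 (q.2 + q.1) ∂((volume : Measure ℝ).prod γ₁)) -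
          ∫ q : ℝ × ℝ, f 0 q.1 * f 1 (q.2 + q.1) ∂((volume : Measure ℝ).prod γ₂)))
    {S η : ℝ} (hS : 0 < S) (hη : 0 < η) :
    ∃ δ : ℝ, 0 < δ ∧ ∃ ν : Measure ℝ, ν univ ≤ ENNReal.ofReal η ∧
      ∀ A B : Set (ℝ × ℝ × ℝ), MeasurableSet A → MeasurableSet B →
      Integrable (hitProb Φ R μ A) → Integrable (hitProb Φ R μ B) →
      (∀ p, hitProb Φ R μ A p + hitProb Φ R μ B p ≤ δ) →
      (∫ p, hitProb Φ R μ A p) + ∫ p, hitProb Φ R μ B p ≤ S →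
      ∫ p, hitProb Φ R μ (A ∩ B) p ≤ δ →
      |voidProb P Φ R μ (A ∪ B) - voidProb P Φ R μ A * voidProb P Φ R μ B -
        Real.exp (-(intensity P μ * ((∫ p, hitProb Φ R μ A p) + ∫ p, hitProb Φ R μ B p))) *
          (intensity P μ * ((∫ p, hitProb Φ R μ (A ∩ B) p) +
            (cross γ₁ (hitProb Φ R μ A) (hitProb Φ R μ B)).toReal -
            (cross γ₂ (hitProb Φ R μ A) (hitProb Φ R μ B)).toReal))| ≤
        η * (∫ p, hitProb Φ R μ (A ∩ B) p) +
          (cross ν (hitProb Φ R μ A) (hitProb Φ R μ B)).toReal := by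
  obtain ⟨δ, hδ, ν, hν, hb⟩ := h.abs_genFun_le hP hfin hγ hS hη
  have : IsFiniteMeasure ν := ⟨hν.trans_lt ENNReal.ofReal_lt_top⟩
  refine ⟨δ, hδ, ν, hν, fun A B hA hB hiA hiB hle hint hintc => ?_⟩
  have hiC : Integrable (hitProb Φ R μ (A ∩ B)) :=
    hiA.mono' (measurable_hitProb hM (hA.inter hB)).aestronglyMeasurable (ae_of_all _ fun p => by
      rw [Real.norm_of_nonneg (hitProb_nonneg _ _)]
      exact hitProb_mono inter_subset_left p)
  have hinter : ∀ n : ℕ, (A ∩ B) ∩ slab n = (A ∩ slab n) ∩ (B ∩ slab n) := fun n => by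
    ext x; simp only [mem_inter_iff]; tauto
  have hA' := tendsto_integral_hitProb (μ := μ) hM hA hiA
  have hB' := tendsto_integral_hitProb (μ := μ) hM hB hiB
  have hC' := tendsto_integral_hitProb (μ := μ) hM (hA.inter hB) hiC
  refine le_of_tendsto_of_tendsto'
    (f := fun n : ℕ => |voidProb P Φ R μ ((A ∪ B) ∩ slab n) -
        voidProb P Φ R μ (A ∩ slab n) * voidProb P Φ R μ (B ∩ slab n) -
        Real.exp (-(intensity P μ * ((∫ p, hitProb Φ R μ (A ∩ slab n) p) +
            ∫ p, hitProb Φ R μ (B ∩ slab n) p))) *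
          (intensity P μ * ((∫ p, hitProb Φ R μ ((A ∩ B) ∩ slab n) p) +
            (cross γ₁ (hitProb Φ R μ (A ∩ slab n)) (hitProb Φ R μ (B ∩ slab n))).toReal -
            (cross γ₂ (hitProb Φ R μ (A ∩ slab n)) (hitProb Φ R μ (B ∩ slab n))).toReal))|)
    (g := fun n : ℕ => η * (∫ p, hitProb Φ R μ ((A ∩ B) ∩ slab n) p) +
          (cross ν (hitProb Φ R μ (A ∩ slab n)) (hitProb Φ R μ (B ∩ slab n))).toReal)
    (b := atTop) ?_ ?_ ?_
  · refine Tendsto.abs (((tendsto_voidProb hP hM (hA.union hB)).sub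
      ((tendsto_voidProb hP hM hA).mul (tendsto_voidProb hP hM hB))).sub (Tendsto.mul ?_ ?_))
    · exact (Real.continuous_exp.tendsto _).comp ((hA'.add hB').const_mul _).neg
    · exact ((hC'.add (tendsto_cross_hitProb hM γ₁ hA hB hiA)).sub
        (tendsto_cross_hitProb hM γ₂ hA hB hiA)).const_mul _
  · exact (hC'.const_mul _).add (tendsto_cross_hitProb hM ν hA hB hiA)
  · intro n
    -- Inclusion-exclusion: the combination w₁ + w₂ - wc is the hit probability of the union.
    have hunion : hitProb Φ R μ (A ∩ slab n) + hitProb Φ R μ (B ∩ slab n) -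
        hitProb Φ R μ ((A ∩ B) ∩ slab n) = hitProb Φ R μ ((A ∪ B) ∩ slab n) := by
      rw [hinter, ← hitProb_union hM _ (hB.inter (measurableSet_slab n)), union_inter_distrib_right]
    have hmonA : ∀ p, hitProb Φ R μ (A ∩ slab n) p ≤ hitProb Φ R μ A p :=
      hitProb_mono inter_subset_left
    have hmonB : ∀ p, hitProb Φ R μ (B ∩ slab n) p ≤ hitProb Φ R μ B p :=
      hitProb_mono inter_subset_left
    have hmonC : ∀ p, hitProb Φ R μ ((A ∩ B) ∩ slab n) p ≤ hitProb Φ R μ (A ∩ B) p :=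
      hitProb_mono inter_subset_left
    have htA := isTest_hitProb (μ := μ) hM hA n
    have htB := isTest_hitProb (μ := μ) hM hB n
    have htC := isTest_hitProb (μ := μ) hM (hA.inter hB) n
    have := hb _ _ _ htA htB htC (hitProb_nonneg _)
      (fun p => by rw [hinter]; exact hitProb_mono inter_subset_left p)
      (fun p => by rw [hinter]; exact hitProb_mono inter_subset_right p)
      ⟨htA.add htB, fun p => add_nonneg (hitProb_nonneg _ _) (hitProb_nonneg _ _),
        fun p => (add_le_add (hmonA p) (hmonB p)).trans (hle p), by
          simp only [Pi.add_apply]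
          rw [integral_add htA.integrable htB.integrable]
          exact (add_le_add (integral_mono htA.integrable hiA hmonA)
            (integral_mono htB.integrable hiB hmonB)).trans hint⟩
      ((integral_mono htC.integrable hiC hmonC).trans hintc)
      (by
        rw [genFun_hitProb hP hM hA, genFun_hitProb hP hM hB]
        exact mul_le_one₀ (voidProb_le_one _) measureReal_nonneg (voidProb_le_one _))
    rwa [hunion, genFun_hitProb hP hM hA, genFun_hitProb hP hM hB,
      genFun_hitProb hP hM (hA.union hB)] at this

end

end PlanarCylinder

end

noncomputable section

namespace PlanarCylinder

/-! ### Rotated coordinates in the plane -/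

/-- The coordinate of `x` in the direction `v(φ)`. -/
def proj (x : Plane) (φ : ℝ) : ℝ := x 0 * Real.cos φ + x 1 * Real.sin φ

/-- The point with coordinates `q` in the orthonormal basis `v(φ)`, `v(φ + π/2)`. -/
def rot (φ : ℝ) (q : ℝ × ℝ) : Plane := q.1 • dir φ + q.2 • dir (φ + Real.pi / 2)

lemma rot_apply_zero (φ : ℝ) (q : ℝ × ℝ) : rot φ q 0 = q.1 * Real.cos φ - q.2 * Real.sin φ := by
  simp [rot, dir, Real.cos_add_pi_div_two, sub_eq_add_neg]

lemma rot_apply_one (φ : ℝ) (q : ℝ × ℝ) : rot φ q 1 = q.1 * Real.sin φ + q.2 * Real.cos φ := by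
  simp [rot, dir, Real.sin_add_pi_div_two]

lemma plane_ext {x y : Plane} (h0 : x 0 = y 0) (h1 : x 1 = y 1) : x = y := by
  ext i; fin_cases i; exacts [h0, h1]

lemma proj_rot (φ : ℝ) (q : ℝ × ℝ) : proj (rot φ q) φ = q.1 := by
  rw [proj, rot_apply_zero, rot_apply_one]
  linear_combination q.1 * Real.cos_sq_add_sin_sq φ

lemma rot_proj (φ : ℝ) (x : Plane) : rot φ (proj x φ, proj x (φ + Real.pi / 2)) = x := by
  refine plane_ext ?_ ?_
  · rw [rot_apply_zero, proj, proj, Real.cos_add_pi_div_two, Real.sin_add_pi_div_two]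
    linear_combination x 0 * Real.cos_sq_add_sin_sq φ
  · rw [rot_apply_one, proj, proj, Real.cos_add_pi_div_two, Real.sin_add_pi_div_two]
    linear_combination x 1 * Real.cos_sq_add_sin_sq φ

lemma norm_sq_plane (x : Plane) : ‖x‖ ^ 2 = x 0 ^ 2 + x 1 ^ 2 := by
  rw [EuclideanSpace.norm_sq_eq, Fin.sum_univ_two, Real.norm_eq_abs, Real.norm_eq_abs, sq_abs, sq_abs]

lemma norm_sq_rot (φ : ℝ) (q : ℝ × ℝ) : ‖rot φ q‖ ^ 2 = q.1 ^ 2 + q.2 ^ 2 := by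
  rw [norm_sq_plane, rot_apply_zero, rot_apply_one]
  linear_combination (q.1 ^ 2 + q.2 ^ 2) * Real.cos_sq_add_sin_sq φ

lemma abs_proj_le (x : Plane) (φ : ℝ) : |proj x φ| ≤ ‖x‖ := by
  refine abs_le_of_sq_le_sq ?_ (norm_nonneg _)
  conv_rhs => rw [← rot_proj φ x, norm_sq_rot]
  exact le_add_of_nonneg_right (sq_nonneg _)

lemma proj_add (x y : Plane) (φ : ℝ) : proj (x + y) φ = proj x φ + proj y φ := by
  simp only [proj, PiLp.add_apply]; ring

lemma proj_sub (x y : Plane) (φ : ℝ) : proj (x - y) φ = proj x φ - proj y φ := by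
  simp only [proj, PiLp.sub_apply]; ring

lemma proj_smul (c : ℝ) (x : Plane) (φ : ℝ) : proj (c • x) φ = c * proj x φ := by
  simp only [proj, PiLp.smul_apply, smul_eq_mul]; ring

lemma continuous_proj : Continuous fun q : Plane × ℝ => proj q.1 q.2 := by
  unfold proj; fun_prop

lemma continuous_rot : Continuous fun q : ℝ × ℝ × ℝ => rot q.1 q.2 := by
  have : (fun q : ℝ × ℝ × ℝ => rot q.1 q.2) = fun q => !₂[q.2.1 * Real.cos q.1 - q.2.2 * Real.sin q.1,
      q.2.1 * Real.sin q.1 + q.2.2 * Real.cos q.1] := by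
    funext q
    exact plane_ext (by simp [rot_apply_zero]) (by simp [rot_apply_one])
  rw [this]
  refine (PiLp.continuous_toLp 2 _).comp (continuous_pi fun i => ?_)
  fin_cases i <;> simp <;> fun_prop

lemma measurePreserving_rot (φ : ℝ) : MeasurePreserving (rot φ) := by
  set M : Matrix (Fin 2) (Fin 2) ℝ := !![Real.cos φ, -Real.sin φ; Real.sin φ, Real.cos φ] with hM
  have hdet : M.det = 1 := by
    rw [hM, Matrix.det_fin_two_of]
    linear_combination Real.cos_sq_add_sin_sq φ
  have h1 : MeasurePreserving (Matrix.toLin' M) := by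
    refine ⟨(LinearMap.continuous_of_finiteDimensional _).measurable, ?_⟩
    rw [Real.map_matrix_volume_pi_eq_smul_volume_pi (by rw [hdet]; norm_num), hdet]
    simp
  have h2 := (PiLp.volume_preserving_toLp (Fin 2)).comp
    (h1.comp (volume_preserving_finTwoArrow ℝ).symm)
  have e : rot φ = WithLp.toLp 2 ∘ Matrix.toLin' M ∘ MeasurableEquiv.finTwoArrow.symm := by
    funext q
    refine plane_ext ?_ ?_
    · simp [rot_apply_zero, hM]
      ring
    · simp [rot_apply_one, hM]
  rw [e]
  exact h2

lemma lintegral_plane (φ : ℝ) {f : Plane → ℝ≥0∞} (hf : Measurable f) :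
    ∫⁻ x, f x = ∫⁻ a : ℝ, ∫⁻ b : ℝ, f (rot φ (a, b)) := by
  rw [← (measurePreserving_rot φ).lintegral_comp hf, Measure.volume_eq_prod,
    lintegral_prod (fun q => f (rot φ q)) (hf.comp (measurePreserving_rot φ).measurable).aemeasurable]

/-- |proj x φ - p| is the distance of x from the axis of the cylinder; the orthogonal projection of
x onto the axis is the witness. -/
lemma mem_line_add_closedBall {x : Plane} {p φ r : ℝ} :
    x ∈ line p φ + Metric.closedBall (0 : Plane) r ↔ |proj x φ - p| ≤ r := by
  constructor
  · rintro ⟨y, hy, z, hz, rfl⟩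
    have hy' : proj y φ = p := hy
    rw [proj_add, hy', add_sub_cancel_left]
    exact (abs_proj_le z φ).trans (mem_closedBall_zero_iff.1 hz)
  · intro h
    refine ⟨rot φ (p, proj x (φ + Real.pi / 2)), ?_, (proj x φ - p) • dir φ, ?_, ?_⟩
    · exact proj_rot φ _
    · have e : (proj x φ - p) • dir φ = rot φ (proj x φ - p, 0) := by simp [rot]
      rw [mem_closedBall_zero_iff, e]
      refine le_trans (le_of_eq ?_) h
      have := norm_sq_rot φ (proj x φ - p, 0)
      rw [← abs_of_nonneg (norm_nonneg (rot φ (proj x φ - p, 0))), ← sq_eq_sq_iff_abs_eq_abs, this]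
      simp
    · conv_rhs => rw [← rot_proj φ x]
      simp only [rot]
      module

/-! ### Chords -/

/-- The set of coordinates along the line `g(p, φ)` of the points of `K`. -/
def slice (K : Set Plane) (p φ : ℝ) : Set ℝ := {b | rot φ (p, b) ∈ K}

/-- The length of a chord of `K`. -/
def chord (K : Set Plane) (p φ : ℝ) : ℝ≥0∞ := volume (slice K p φ)

lemma measurableSet_slice {K : Set Plane} (hK : MeasurableSet K) (p φ : ℝ) :
    MeasurableSet (slice K p φ) :=
  ((continuous_rot.comp (by fun_prop : Continuous fun b : ℝ => (φ, p, b))).measurable) hK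

/-- The parametrisation b ↦ rot φ (p, b) of the line is an isometry, and on the real line the
one-dimensional Hausdorff measure is Lebesgue measure. -/
lemma chordLength_eq (K : Set Plane) (p φ : ℝ) : chordLength K p φ = (chord K p φ).toReal := by
  have hiso : Isometry fun b : ℝ => rot φ (p, b) := Isometry.of_dist_eq fun b c => by
    have e : rot φ (p, b) - rot φ (p, c) = rot φ (0, b - c) := by
      simp only [rot]
      module
    rw [dist_eq_norm, e, Real.dist_eq]
    have := norm_sq_rot φ (0, b - c)
    rw [← abs_of_nonneg (norm_nonneg (rot φ (0, b - c))), ← sq_eq_sq_iff_abs_eq_abs, this]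
    simp
  have himg : line p φ ∩ K = (fun b : ℝ => rot φ (p, b)) '' slice K p φ := by
    ext x
    constructor
    · rintro ⟨hx, hxK⟩
      have hx' : proj x φ = p := hx
      have e := rot_proj φ x
      rw [hx'] at e
      exact ⟨proj x (φ + Real.pi / 2), by rw [slice, mem_ofPred_eq, e]; exact hxK, e⟩
    · rintro ⟨b, hb, rfl⟩
      exact ⟨proj_rot φ _, hb⟩
  rw [chordLength, himg, hiso.hausdorffMeasure_image (Or.inl zero_le_one), hausdorffMeasure_real, chord]

lemma measurable_chord {K : Set Plane} (hK : MeasurableSet K) :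
    Measurable fun q : ℝ × ℝ => chord K q.1 q.2 := by
  have hm : Measurable fun q : (ℝ × ℝ) × ℝ => rot q.1.2 (q.1.1, q.2) :=
    (continuous_rot.comp (by fun_prop : Continuous fun q : (ℝ × ℝ) × ℝ => (q.1.2, q.1.1, q.2))).measurable
  exact measurable_measure_prodMk_left (hm hK)

lemma measurable_chord_comp {α : Type*} [MeasurableSpace α] {K : Set Plane} (hK : MeasurableSet K)
    {f g : α → ℝ} (hf : Measurable f) (hg : Measurable g) : Measurable fun a => chord K (f a) (g a) := by
  have h := (measurable_chord hK).comp (hf.prodMk hg)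
  exact h

lemma lintegral_chord {K : Set Plane} (hK : MeasurableSet K) (φ : ℝ) :
    ∫⁻ p, chord K p φ = volume K := by
  rw [← lintegral_indicator_one hK, lintegral_plane φ (measurable_one.indicator hK)]
  refine lintegral_congr fun p => ?_
  rw [chord, ← lintegral_indicator_one (measurableSet_slice hK p φ)]
  rfl

lemma chord_le {K : Set Plane} {D : ℝ} (hD : ∀ x ∈ K, ‖x‖ ≤ D) (p φ : ℝ) :
    chord K p φ ≤ ENNReal.ofReal (2 * D) := by
  have : slice K p φ ⊆ Icc (-D) D := fun b hb => by
    have h0 := hD _ hb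
    have hb0 : |b| ≤ ‖rot φ (p, b)‖ := by
      refine abs_le_of_sq_le_sq ?_ (norm_nonneg _)
      rw [norm_sq_rot]
      exact le_add_of_nonneg_left (sq_nonneg _)
    exact abs_le.1 (hb0.trans h0)
  refine (measure_mono this).trans (le_of_eq ?_)
  rw [Real.volume_Icc]
  congr 1
  ring

/-! ### Symmetric differences of parallel chords and of translates -/

open scoped symmDiff in
/-- The length of the symmetric difference of two parallel chords. -/
def chordDiff (K : Set Plane) (p s φ : ℝ) : ℝ≥0∞ := volume (slice K p φ ∆ slice K (p + s) φ)

open scoped symmDiff in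
/-- The area of the symmetric difference of `K` and a translate of `K`. -/
def shiftDiff (K : Set Plane) (s φ : ℝ) : ℝ≥0∞ := volume (K ∆ ((fun x => x + s • dir φ) ⁻¹' K))

lemma measurable_chordDiff {K : Set Plane} (hK : MeasurableSet K) :
    Measurable fun q : ℝ × ℝ × ℝ => chordDiff K q.1 q.2.1 q.2.2 := by
  have hm : Measurable fun q : (ℝ × ℝ × ℝ) × ℝ => rot q.1.2.2 (q.1.1, q.2) :=
    (continuous_rot.comp (by fun_prop :
      Continuous fun q : (ℝ × ℝ × ℝ) × ℝ => (q.1.2.2, q.1.1, q.2))).measurable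
  have hm' : Measurable fun q : (ℝ × ℝ × ℝ) × ℝ => rot q.1.2.2 (q.1.1 + q.1.2.1, q.2) :=
    (continuous_rot.comp (by fun_prop :
      Continuous fun q : (ℝ × ℝ × ℝ) × ℝ => (q.1.2.2, q.1.1 + q.1.2.1, q.2))).measurable
  exact measurable_measure_prodMk_left ((hm hK).symmDiff (hm' hK))

lemma measurable_chordDiff_comp {α : Type*} [MeasurableSpace α] {K : Set Plane}
    (hK : MeasurableSet K) {f g h : α → ℝ} (hf : Measurable f) (hg : Measurable g)
    (hh : Measurable h) : Measurable fun a => chordDiff K (f a) (g a) (h a) := by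
  have h := (measurable_chordDiff hK).comp (hf.prodMk (hg.prodMk hh))
  exact h

open scoped symmDiff in
lemma lintegral_chordDiff {K : Set Plane} (hK : MeasurableSet K) (s φ : ℝ) :
    ∫⁻ p, chordDiff K p s φ = shiftDiff K s φ := by
  have hK' : MeasurableSet ((fun x => x + s • dir φ) ⁻¹' K) := (measurable_id.add_const _) hK
  rw [shiftDiff, ← lintegral_indicator_one (hK.symmDiff hK'),
    lintegral_plane φ (measurable_one.indicator (hK.symmDiff hK'))]
  refine lintegral_congr fun p => ?_
  rw [chordDiff, ← lintegral_indicator_one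
    ((measurableSet_slice hK p φ).symmDiff (measurableSet_slice hK (p + s) φ))]
  refine lintegral_congr fun b => ?_
  have e : rot φ (p, b) + s • dir φ = rot φ (p + s, b) := by
    simp only [rot]
    module
  have hiff : b ∈ slice K p φ ∆ slice K (p + s) φ ↔
      rot φ (p, b) ∈ K ∆ ((fun x => x + s • dir φ) ⁻¹' K) := by
    simp only [mem_symmDiff, slice, mem_preimage, mem_ofPred_eq, e]
  by_cases hb : b ∈ slice K p φ ∆ slice K (p + s) φ
  · rw [indicator_of_mem hb, indicator_of_mem (hiff.1 hb)]
    rfl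
  · rw [indicator_of_notMem hb, indicator_of_notMem (mt hiff.2 hb)]

lemma chord_add_le {K : Set Plane} (p s φ : ℝ) :
    chord K (p + s) φ ≤ chord K p φ + chordDiff K p s φ := by
  refine (measure_mono ?_).trans (measure_union_le _ _)
  intro b hb
  by_cases h : b ∈ slice K p φ
  · exact Or.inl h
  · exact Or.inr (Or.inr ⟨hb, h⟩)

lemma chord_le_add {K : Set Plane} (p s φ : ℝ) :
    chord K p φ ≤ chord K (p + s) φ + chordDiff K p s φ := by
  refine (measure_mono ?_).trans (measure_union_le _ _)
  intro b hb
  by_cases h : b ∈ slice K (p + s) φ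
  · exact Or.inl h
  · exact Or.inr (Or.inl ⟨hb, h⟩)

lemma shiftDiff_le (K : Set Plane) (s φ : ℝ) : shiftDiff K s φ ≤ 2 * volume K := by
  refine (measure_mono symmDiff_subset_union).trans ((measure_union_le _ _).trans (le_of_eq ?_))
  rw [measure_preimage_add_right, two_mul]

/-- Translations act continuously on sets of finite measure. Integrated over the position of the
line, this controls nearby chords although a single chord length need not depend continuously on p.
-/
lemma tendsto_shiftDiff {K : Set Plane} (hK : IsCompact K) (φ : ℝ) {l : Filter ℝ} {s : ℝ → ℝ}
    (hs : Tendsto s l (𝓝 0)) : Tendsto (fun ρ => shiftDiff K (s ρ) φ) l (𝓝 0) := by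
  have hc : Continuous fun q : ℝ × Plane => q.2 + q.1 • dir φ := by fun_prop
  set f : C(ℝ, C(Plane, Plane)) := ContinuousMap.curry ⟨_, hc⟩ with hf
  have h0 : Tendsto (fun ρ => f (s ρ)) l (𝓝 (f 0)) := (f.continuous.tendsto 0).comp hs
  have hmp : ∀ t, MeasurePreserving (f t) := fun t => measurePreserving_add_right volume (t • dir φ)
  have := tendsto_measure_symmDiff_preimage_nhds_zero h0 (Eventually.of_forall fun ρ => hmp _)
    (hmp 0) hK.measurableSet.nullMeasurableSet hK.measure_lt_top.ne
  refine this.congr fun ρ => ?_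
  have e : f 0 ⁻¹' K = K := by
    ext x; simp [hf]
  rw [e, symmDiff_comm]
  rfl

end PlanarCylinder

end

noncomputable section

namespace PlanarCylinder

/-! ### Convergence of products -/

lemma tendsto_of_le_add {α : Type*} {l : Filter α} {a e : α → ℝ≥0∞} {b : ℝ≥0∞} (hb : b ≠ ∞)
    (he : Tendsto e l (𝓝 0)) (h1 : ∀ x, a x ≤ b + e x) (h2 : ∀ x, b ≤ a x + e x) :
    Tendsto a l (𝓝 b) := by
  refine tendsto_of_tendsto_of_tendsto_of_le_of_le (g := fun x => b - e x) (h := fun x => b + e x)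
    ?_ ?_ (fun x => tsub_le_iff_right.2 (h2 x)) h1
  · simpa using ENNReal.Tendsto.sub tendsto_const_nhds he (Or.inl hb)
  · simpa using tendsto_const_nhds.add he

lemma lintegral_mul_le_add {β : Type*} [MeasurableSpace β] {m : Measure β}
    {f f' g d d' : β → ℝ≥0∞} {C : ℝ≥0∞} (hg : Measurable g) (hd : Measurable d)
    (hd' : Measurable d') (h1 : ∀ x, f x ≤ g x + d x) (h2 : ∀ x, f' x ≤ g x + d' x)
    (hf' : ∀ x, f' x ≤ C) (hgC : ∀ x, g x ≤ C) :
    ∫⁻ x, f x * f' x ∂m ≤ (∫⁻ x, g x * g x ∂m) + C * ((∫⁻ x, d x ∂m) + ∫⁻ x, d' x ∂m) := by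
  have : ∀ x, f x * f' x ≤ g x * g x + C * (d x + d' x) := fun x => by
    calc f x * f' x ≤ (g x + d x) * f' x := mul_le_mul_left (h1 x) _
      _ = g x * f' x + d x * f' x := add_mul _ _ _
      _ ≤ g x * (g x + d' x) + d x * C := by gcongr; exacts [h2 x, hf' x]
      _ = g x * g x + (g x * d' x + d x * C) := by ring
      _ ≤ g x * g x + (C * d' x + d x * C) := by gcongr; exact hgC x
      _ = _ := by ring
  refine (lintegral_mono this).trans (le_of_eq ?_)
  have hgg : Measurable fun x => g x * g x := hg.mul hg
  have hdd : Measurable fun x => d x + d' x := hd.add hd'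
  rw [lintegral_add_left hgg, lintegral_const_mul _ hdd, lintegral_add_left hd]

lemma lintegral_sq_le_add {β : Type*} [MeasurableSpace β] {m : Measure β}
    {f f' g d d' : β → ℝ≥0∞} {C : ℝ≥0∞} (hd : Measurable d) (hd' : Measurable d')
    (h1 : ∀ x, g x ≤ f x + d x) (h2 : ∀ x, g x ≤ f' x + d' x)
    (hf : ∀ x, f x ≤ C) (hgC : ∀ x, g x ≤ C) :
    ∫⁻ x, g x * g x ∂m ≤ (∫⁻ x, f x * f' x ∂m) + C * ((∫⁻ x, d x ∂m) + ∫⁻ x, d' x ∂m) := by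
  have : ∀ x, g x * g x ≤ f x * f' x + C * (d x + d' x) := fun x => by
    calc g x * g x ≤ (f x + d x) * g x := mul_le_mul_left (h1 x) _
      _ = f x * g x + d x * g x := add_mul _ _ _
      _ ≤ f x * (f' x + d' x) + d x * C := by gcongr; exacts [h2 x, hgC x]
      _ = f x * f' x + (f x * d' x + d x * C) := by ring
      _ ≤ f x * f' x + (C * d' x + d x * C) := by gcongr; exact hf x
      _ = _ := by ring
  refine (lintegral_mono this).trans (le_of_eq ?_)
  have hdd : Measurable fun x => d x + d' x := hd.add hd'
  rw [lintegral_add_right _ (hdd.const_mul C), lintegral_const_mul _ hdd, lintegral_add_left hd]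

/-- The uniform bound C turns L¹-closeness of each factor to g into convergence of the integral of
the product. -/
lemma tendsto_lintegral_mul {α β : Type*} [MeasurableSpace β] {m : Measure β} {l : Filter α}
    {f f' d d' : α → β → ℝ≥0∞} {g : β → ℝ≥0∞} {C : ℝ≥0∞} (hC : C ≠ ∞) (hg : Measurable g)
    (hd : ∀ a, Measurable (d a)) (hd' : ∀ a, Measurable (d' a))
    (h1 : ∀ a x, f a x ≤ g x + d a x) (h1' : ∀ a x, g x ≤ f a x + d a x)
    (h2 : ∀ a x, f' a x ≤ g x + d' a x) (h2' : ∀ a x, g x ≤ f' a x + d' a x)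
    (hf : ∀ a x, f a x ≤ C) (hf' : ∀ a x, f' a x ≤ C) (hgC : ∀ x, g x ≤ C)
    (hgi : ∫⁻ x, g x ∂m ≠ ∞) (hdl : Tendsto (fun a => ∫⁻ x, d a x ∂m) l (𝓝 0))
    (hdl' : Tendsto (fun a => ∫⁻ x, d' a x ∂m) l (𝓝 0)) :
    Tendsto (fun a => ∫⁻ x, f a x * f' a x ∂m) l (𝓝 (∫⁻ x, g x * g x ∂m)) := by
  refine tendsto_of_le_add (e := fun a => C * ((∫⁻ x, d a x ∂m) + ∫⁻ x, d' a x ∂m)) ?_ ?_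
    (fun a => lintegral_mul_le_add hg (hd a) (hd' a) (h1 a) (h2 a) (hf' a) hgC)
    (fun a => lintegral_sq_le_add (hd a) (hd' a) (h1' a) (h2' a) (hf a) hgC)
  · refine ne_top_of_le_ne_top (ENNReal.mul_ne_top hC hgi) ?_
    rw [← lintegral_const_mul _ hg]
    exact lintegral_mono fun x => mul_le_mul_left (hgC x) _
  · simpa using ENNReal.Tendsto.const_mul (hdl.add hdl') (Or.inr hC)

/-! ### Areas of strips -/

/-- `ρ⁻¹` times the area of the intersection of `ρ K` with a strip. -/
def stripArea (K : Set Plane) (ρ q φ r : ℝ) : ℝ≥0∞ := ∫⁻ u in Icc (-r) r, chord K (q + u / ρ) φ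

/-- The error in the approximation of `stripArea` by a chord length. -/
def stripDiff (K : Set Plane) (ρ t q φ r : ℝ) : ℝ≥0∞ :=
  ∫⁻ u in Icc (-r) r, chordDiff K q ((t + u) / ρ) φ

lemma setLIntegral_Icc_symm (r : ℝ) (f : ℝ → ℝ≥0∞) :
    ∫⁻ u in Icc (-r) r, f u = ∫⁻ u, if |u| ≤ r then f u else 0 := by
  rw [← lintegral_indicator measurableSet_Icc]
  refine lintegral_congr fun u => ?_
  simp only [indicator, mem_Icc, abs_le]

section

variable {K : Set Plane} {D : ℝ}

lemma measurable_stripArea (hK : MeasurableSet K) (ρ : ℝ) :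
    Measurable fun x : ℝ × ℝ × ℝ => stripArea K ρ x.1 x.2.1 x.2.2 := by
  simp only [stripArea, setLIntegral_Icc_symm]
  have h1 : Measurable fun x : (ℝ × ℝ × ℝ) × ℝ => chord K (x.1.1 + x.2 / ρ) x.1.2.1 :=
    measurable_chord_comp hK (by fun_prop) (by fun_prop)
  have h2 : Measurable fun x : (ℝ × ℝ × ℝ) × ℝ =>
      if |x.2| ≤ x.1.2.2 then chord K (x.1.1 + x.2 / ρ) x.1.2.1 else 0 :=
    h1.ite (measurableSet_le (by fun_prop) (by fun_prop)) measurable_const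
  exact h2.lintegral_prod_right'

lemma measurable_stripDiff (hK : MeasurableSet K) (ρ t : ℝ) :
    Measurable fun x : ℝ × ℝ × ℝ => stripDiff K ρ t x.1 x.2.1 x.2.2 := by
  simp only [stripDiff, setLIntegral_Icc_symm]
  have h1 : Measurable fun x : (ℝ × ℝ × ℝ) × ℝ => chordDiff K x.1.1 ((t + x.2) / ρ) x.1.2.1 :=
    measurable_chordDiff_comp hK (by fun_prop) (by fun_prop) (by fun_prop)
  have h2 : Measurable fun x : (ℝ × ℝ × ℝ) × ℝ =>
      if |x.2| ≤ x.1.2.2 then chordDiff K x.1.1 ((t + x.2) / ρ) x.1.2.1 else 0 :=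
    h1.ite (measurableSet_le (by fun_prop) (by fun_prop)) measurable_const
  exact h2.lintegral_prod_right'

lemma measurable_stripArea_comp {α : Type*} [MeasurableSpace α] (hK : MeasurableSet K) (ρ : ℝ)
    {f g h : α → ℝ} (hf : Measurable f) (hg : Measurable g)
    (hh : Measurable h) : Measurable fun a => stripArea K ρ (f a) (g a) (h a) := by
  have h := (measurable_stripArea hK ρ).comp (hf.prodMk (hg.prodMk hh))
  exact h

lemma measurable_stripDiff_comp {α : Type*} [MeasurableSpace α] (hK : MeasurableSet K) (ρ t : ℝ)
    {f g h : α → ℝ} (hf : Measurable f) (hg : Measurable g)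
    (hh : Measurable h) : Measurable fun a => stripDiff K ρ t (f a) (g a) (h a) := by
  have h := (measurable_stripDiff hK ρ t).comp (hf.prodMk (hg.prodMk hh))
  exact h

lemma setLIntegral_Icc_const (r : ℝ) (c : ℝ≥0∞) :
    ∫⁻ _ in Icc (-r) r, c = ENNReal.ofReal (2 * r) * c := by
  rw [setLIntegral_const, Real.volume_Icc, mul_comm]
  congr 2
  ring

lemma stripArea_le (hD : ∀ x ∈ K, ‖x‖ ≤ D) (ρ q φ r : ℝ) :
    stripArea K ρ q φ r ≤ ENNReal.ofReal (2 * r) * ENNReal.ofReal (2 * D) := by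
  rw [← setLIntegral_Icc_const]
  exact lintegral_mono fun u => chord_le hD _ _

lemma lintegral_stripArea (hK : MeasurableSet K) (ρ t φ r : ℝ) :
    ∫⁻ q, stripArea K ρ (q + t) φ r = ENNReal.ofReal (2 * r) * volume K := by
  unfold stripArea
  have hm : Measurable fun x : ℝ × ℝ => chord K (x.1 + t + x.2 / ρ) φ :=
    measurable_chord_comp hK (by fun_prop) (by fun_prop)
  rw [lintegral_lintegral_swap hm.aemeasurable, ← setLIntegral_Icc_const]
  refine lintegral_congr fun u => ?_
  rw [← lintegral_chord hK φ, ← lintegral_add_right_eq_self (fun p => chord K p φ) (t + u / ρ)]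
  simp only [add_assoc]

/-- The shift t / ρ is what the separation t of the two points in the second cumulant becomes after
rescaling. -/
lemma stripArea_le_add (ρ t q φ r : ℝ) : stripArea K ρ (q + t / ρ) φ r ≤
    ENNReal.ofReal (2 * r) * chord K q φ + stripDiff K ρ t q φ r := by
  rw [← setLIntegral_Icc_const, stripDiff, ← lintegral_add_left measurable_const]
  refine lintegral_mono fun u => ?_
  refine le_trans (le_of_eq ?_) (chord_add_le q ((t + u) / ρ) φ)
  rw [add_div, add_assoc]

lemma le_stripArea_add (hK : MeasurableSet K) (ρ t q φ r : ℝ) :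
    ENNReal.ofReal (2 * r) * chord K q φ ≤
      stripArea K ρ (q + t / ρ) φ r + stripDiff K ρ t q φ r := by
  have hm : Measurable fun u : ℝ => chord K (q + t / ρ + u / ρ) φ :=
    measurable_chord_comp hK (by fun_prop) (by fun_prop)
  rw [← setLIntegral_Icc_const, stripDiff, stripArea, ← lintegral_add_left hm]
  refine lintegral_mono fun u => ?_
  refine (chord_le_add q ((t + u) / ρ) φ).trans (le_of_eq ?_)
  rw [add_div, add_assoc]

lemma lintegral_stripDiff (hK : MeasurableSet K) (ρ t φ r : ℝ) :
    ∫⁻ q, stripDiff K ρ t q φ r = ∫⁻ u in Icc (-r) r, shiftDiff K ((t + u) / ρ) φ := by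
  unfold stripDiff
  have hm : Measurable fun x : ℝ × ℝ => chordDiff K x.1 ((t + x.2) / ρ) φ :=
    measurable_chordDiff_comp hK (by fun_prop) (by fun_prop) (by fun_prop)
  rw [lintegral_lintegral_swap hm.aemeasurable]
  exact lintegral_congr fun u => lintegral_chordDiff hK _ _

lemma lintegral_stripDiff_le (hK : MeasurableSet K) (ρ t φ r : ℝ) :
    ∫⁻ q, stripDiff K ρ t q φ r ≤ ENNReal.ofReal (2 * r) * (2 * volume K) := by
  rw [lintegral_stripDiff hK, ← setLIntegral_Icc_const]
  exact lintegral_mono fun u => shiftDiff_le _ _ _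

lemma measurable_shiftDiff (hK : MeasurableSet K) (φ : ℝ) : Measurable fun s => shiftDiff K s φ := by
  simp_rw [← lintegral_chordDiff hK]
  have : Measurable fun x : ℝ × ℝ => chordDiff K x.2 x.1 φ :=
    measurable_chordDiff_comp hK (by fun_prop) (by fun_prop) (by fun_prop)
  exact this.lintegral_prod_right'

lemma tendsto_lintegral_stripDiff (hK : IsCompact K) (t φ r : ℝ) :
    Tendsto (fun ρ => ∫⁻ q, stripDiff K ρ t q φ r) atTop (𝓝 0) := by
  simp_rw [lintegral_stripDiff hK.measurableSet]
  rw [← lintegral_zero (μ := volume.restrict (Icc (-r) r))]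
  refine tendsto_lintegral_filter_of_dominated_convergence (fun _ => 2 * volume K)
    (Eventually.of_forall fun ρ => ?_) (Eventually.of_forall fun ρ => ae_of_all _ fun u =>
      shiftDiff_le _ _ _) ?_ (ae_of_all _ fun u => ?_)
  · exact (measurable_shiftDiff hK.measurableSet φ).comp (by fun_prop : Measurable fun u => (t + u) / ρ)
  · rw [setLIntegral_Icc_const]
    exact ENNReal.mul_ne_top ENNReal.ofReal_ne_top
      (ENNReal.mul_ne_top (by simp) hK.measure_lt_top.ne)
  · exact tendsto_shiftDiff hK φ (tendsto_const_nhds.div_atTop tendsto_id)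

lemma tendsto_lintegral_stripArea_sq (hK : IsCompact K) (hD : ∀ x ∈ K, ‖x‖ ≤ D) (φ r : ℝ) :
    Tendsto (fun ρ => ∫⁻ q, stripArea K ρ q φ r * stripArea K ρ q φ r) atTop
      (𝓝 (ENNReal.ofReal (2 * r) ^ 2 * ∫⁻ q, chord K q φ * chord K q φ)) := by
  have hKm := hK.measurableSet
  have hc : Measurable fun q => chord K q φ :=
    measurable_chord_comp hKm (by fun_prop) (by fun_prop)
  have hm : Measurable fun q => ENNReal.ofReal (2 * r) * chord K q φ := hc.const_mul _
  have hd : ∀ ρ, Measurable fun q => stripDiff K ρ 0 q φ r := fun ρ =>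
    measurable_stripDiff_comp hKm ρ 0 (by fun_prop) (by fun_prop) (by fun_prop)
  have h1 : ∀ ρ q, stripArea K ρ q φ r ≤
      ENNReal.ofReal (2 * r) * chord K q φ + stripDiff K ρ 0 q φ r := fun ρ q => by
    simpa using stripArea_le_add ρ 0 q φ r
  have h2 : ∀ ρ q, ENNReal.ofReal (2 * r) * chord K q φ ≤
      stripArea K ρ q φ r + stripDiff K ρ 0 q φ r := fun ρ q => by
    simpa using le_stripArea_add hKm ρ 0 q φ r
  have := tendsto_lintegral_mul (m := volume) (l := atTop)
    (C := ENNReal.ofReal (2 * r) * ENNReal.ofReal (2 * D))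
    (ENNReal.mul_ne_top ENNReal.ofReal_ne_top ENNReal.ofReal_ne_top) hm hd hd h1 h2 h1 h2
    (fun ρ q => stripArea_le hD ρ q φ r) (fun ρ q => stripArea_le hD ρ q φ r)
    (fun q => mul_le_mul_right (chord_le hD q φ) _)
    (by
      rw [lintegral_const_mul _ hc, lintegral_chord hKm]
      exact ENNReal.mul_ne_top ENNReal.ofReal_ne_top hK.measure_lt_top.ne)
    (tendsto_lintegral_stripDiff hK 0 φ r) (tendsto_lintegral_stripDiff hK 0 φ r)
  have hcc : Measurable fun q => chord K q φ * chord K q φ := hc.mul hc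
  have e : ENNReal.ofReal (2 * r) ^ 2 * ∫⁻ q, chord K q φ * chord K q φ =
      ∫⁻ q, ENNReal.ofReal (2 * r) * chord K q φ * (ENNReal.ofReal (2 * r) * chord K q φ) := by
    rw [← lintegral_const_mul _ hcc]
    refine lintegral_congr fun q => ?_
    ring
  rw [e]
  exact this

end

end PlanarCylinder

end

noncomputable section

namespace PlanarCylinder

variable {Ω : Type*} [MeasurableSpace Ω]

/-! ### Averages over the marks -/

section

variable {K : Set Plane} {D : ℝ} {μ : Measure Ω} {F R : Ω → ℝ}

/-- The mean of `stripArea` for a random mark. -/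
def meanStrip (K : Set Plane) (μ : Measure Ω) (F R : Ω → ℝ) (ρ p : ℝ) : ℝ≥0∞ :=
  ∫⁻ ω, stripArea K ρ p (F ω) (R ω) ∂μ

/-- The mean of the product of the base length and the chord length for a random mark. -/
def meanChord (K : Set Plane) (μ : Measure Ω) (F R : Ω → ℝ) (p : ℝ) : ℝ≥0∞ :=
  ∫⁻ ω, ENNReal.ofReal (2 * R ω) * chord K p (F ω) ∂μ

lemma measurable_meanStrip [SFinite μ] (hK : MeasurableSet K) (hF : Measurable F) (hR : Measurable R)
    (ρ : ℝ) : Measurable (meanStrip K μ F R ρ) := by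
  have h : Measurable fun x : ℝ × Ω => stripArea K ρ x.1 (F x.2) (R x.2) :=
    measurable_stripArea_comp hK ρ (by fun_prop) (by fun_prop) (by fun_prop)
  exact h.lintegral_prod_right'

lemma measurable_meanChord [SFinite μ] (hK : MeasurableSet K) (hF : Measurable F) (hR : Measurable R) :
    Measurable (meanChord K μ F R) := by
  have h : Measurable fun x : ℝ × Ω => chord K x.1 (F x.2) :=
    measurable_chord_comp hK (by fun_prop) (by fun_prop)
  have h' : Measurable fun x : ℝ × Ω => ENNReal.ofReal (2 * R x.2) * chord K x.1 (F x.2) :=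
    (by fun_prop : Measurable fun x : ℝ × Ω => ENNReal.ofReal (2 * R x.2)).mul h
  exact h'.lintegral_prod_right'

lemma meanStrip_le (hR : Measurable R) (hD : ∀ x ∈ K, ‖x‖ ≤ D) (ρ p : ℝ) :
    meanStrip K μ F R ρ p ≤ (∫⁻ ω, ENNReal.ofReal (2 * R ω) ∂μ) * ENNReal.ofReal (2 * D) := by
  rw [← lintegral_mul_const _ (by fun_prop)]
  exact lintegral_mono fun ω => stripArea_le hD _ _ _ _

lemma meanChord_le (hR : Measurable R) (hD : ∀ x ∈ K, ‖x‖ ≤ D) (p : ℝ) :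
    meanChord K μ F R p ≤ (∫⁻ ω, ENNReal.ofReal (2 * R ω) ∂μ) * ENNReal.ofReal (2 * D) := by
  rw [← lintegral_mul_const _ (by fun_prop)]
  exact lintegral_mono fun ω => mul_le_mul_right (chord_le hD _ _) _

lemma lintegral_meanStrip [SFinite μ] (hK : MeasurableSet K) (hF : Measurable F) (hR : Measurable R)
    (ρ : ℝ) :
    ∫⁻ p, meanStrip K μ F R ρ p = (∫⁻ ω, ENNReal.ofReal (2 * R ω) ∂μ) * volume K := by
  have h : Measurable fun x : ℝ × Ω => stripArea K ρ x.1 (F x.2) (R x.2) :=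
    measurable_stripArea_comp hK ρ (by fun_prop) (by fun_prop) (by fun_prop)
  unfold meanStrip
  rw [lintegral_lintegral_swap h.aemeasurable, ← lintegral_mul_const _ (by fun_prop)]
  refine lintegral_congr fun ω => ?_
  simpa using lintegral_stripArea hK ρ 0 (F ω) (R ω)

lemma lintegral_meanChord [SFinite μ] (hK : MeasurableSet K) (hF : Measurable F) (hR : Measurable R) :
    ∫⁻ p, meanChord K μ F R p = (∫⁻ ω, ENNReal.ofReal (2 * R ω) ∂μ) * volume K := by
  have h : Measurable fun x : ℝ × Ω => chord K x.1 (F x.2) :=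
    measurable_chord_comp hK (by fun_prop) (by fun_prop)
  have h' : Measurable fun x : ℝ × Ω => ENNReal.ofReal (2 * R x.2) * chord K x.1 (F x.2) :=
    (by fun_prop : Measurable fun x : ℝ × Ω => ENNReal.ofReal (2 * R x.2)).mul h
  unfold meanChord
  rw [lintegral_lintegral_swap h'.aemeasurable, ← lintegral_mul_const _ (by fun_prop)]
  refine lintegral_congr fun ω => ?_
  have hc : Measurable fun p => chord K p (F ω) :=
    measurable_chord_comp hK measurable_id measurable_const
  rw [lintegral_const_mul _ hc, lintegral_chord hK]

lemma lintegral_meanStrip_mul_le [SFinite μ] (hK : MeasurableSet K) (hF : Measurable F)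
    (hR : Measurable R) (hD : ∀ x ∈ K, ‖x‖ ≤ D) (ρ t : ℝ) :
    ∫⁻ p, meanStrip K μ F R ρ p * meanStrip K μ F R ρ (p + t) ≤
      (∫⁻ ω, ENNReal.ofReal (2 * R ω) ∂μ) * volume K *
        ((∫⁻ ω, ENNReal.ofReal (2 * R ω) ∂μ) * ENNReal.ofReal (2 * D)) := by
  rw [← lintegral_meanStrip hK hF hR ρ, ← lintegral_mul_const _ (measurable_meanStrip hK hF hR ρ)]
  exact lintegral_mono fun p => mul_le_mul_right (meanStrip_le hR hD _ _) _

/-- After averaging over the marks both factors approach `meanChord` in L¹, the shift t / ρ being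
negligible for fixed t; finiteness of E R dominates the average. -/
lemma tendsto_lintegral_meanStrip_mul [SFinite μ] (hK : IsCompact K) (hF : Measurable F)
    (hR : Measurable R) (hD : ∀ x ∈ K, ‖x‖ ≤ D) (hRi : ∫⁻ ω, ENNReal.ofReal (2 * R ω) ∂μ ≠ ∞) (t : ℝ) :
    Tendsto (fun ρ => ∫⁻ p, meanStrip K μ F R ρ p * meanStrip K μ F R ρ (p + t / ρ)) atTop
      (𝓝 (∫⁻ p, meanChord K μ F R p * meanChord K μ F R p)) := by
  have hKm := hK.measurableSet
  set d : ℝ → ℝ → ℝ → ℝ≥0∞ := fun s ρ p => ∫⁻ ω, stripDiff K ρ s p (F ω) (R ω) ∂μ with hd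
  have hdm' : ∀ s ρ, Measurable fun x : ℝ × Ω => stripDiff K ρ s x.1 (F x.2) (R x.2) := fun s ρ =>
    measurable_stripDiff_comp hKm ρ s (by fun_prop) (by fun_prop) (by fun_prop)
  have hdm : ∀ s ρ, Measurable (d s ρ) := fun s ρ => (hdm' s ρ).lintegral_prod_right'
  have hcm : ∀ p, Measurable fun ω => ENNReal.ofReal (2 * R ω) * chord K p (F ω) := fun p =>
    (by fun_prop : Measurable fun ω => ENNReal.ofReal (2 * R ω)).mul
      (measurable_chord_comp hKm measurable_const hF)
  have hsm : ∀ ρ p, Measurable fun ω => stripArea K ρ p (F ω) (R ω) := fun ρ p =>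
    measurable_stripArea_comp hKm ρ measurable_const hF hR
  have h1 : ∀ s ρ p, meanStrip K μ F R ρ (p + s / ρ) ≤ meanChord K μ F R p + d s ρ p :=
    fun s ρ p => by
      rw [meanChord, hd, ← lintegral_add_left (hcm p)]
      exact lintegral_mono fun ω => stripArea_le_add _ _ _ _ _
  have h2 : ∀ s ρ p, meanChord K μ F R p ≤ meanStrip K μ F R ρ (p + s / ρ) + d s ρ p :=
    fun s ρ p => by
      rw [meanStrip, hd, ← lintegral_add_left (hsm ρ _)]
      exact lintegral_mono fun ω => le_stripArea_add hKm _ _ _ _ _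
  have hlim : ∀ s, Tendsto (fun ρ => ∫⁻ p, d s ρ p) atTop (𝓝 0) := fun s => by
    have e : ∀ ρ, ∫⁻ p, d s ρ p = ∫⁻ ω, ∫⁻ p, stripDiff K ρ s p (F ω) (R ω) ∂volume ∂μ := fun ρ =>
      lintegral_lintegral_swap (hdm' s ρ).aemeasurable
    simp_rw [e]
    rw [← lintegral_zero (μ := μ)]
    refine tendsto_lintegral_filter_of_dominated_convergence
      (fun ω => ENNReal.ofReal (2 * R ω) * (2 * volume K))
      (Eventually.of_forall fun ρ => (hdm' s ρ).lintegral_prod_left')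
      (Eventually.of_forall fun ρ => ae_of_all _ fun ω => lintegral_stripDiff_le hKm _ _ _ _) ?_
      (ae_of_all _ fun ω => tendsto_lintegral_stripDiff hK s _ _)
    rw [lintegral_mul_const _ (by fun_prop)]
    exact ENNReal.mul_ne_top hRi (ENNReal.mul_ne_top (by simp) hK.measure_lt_top.ne)
  refine tendsto_lintegral_mul (d := d 0) (d' := d t)
    (C := (∫⁻ ω, ENNReal.ofReal (2 * R ω) ∂μ) * ENNReal.ofReal (2 * D))
    (ENNReal.mul_ne_top hRi ENNReal.ofReal_ne_top) (measurable_meanChord hKm hF hR) (hdm 0) (hdm t)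
    (fun ρ p => by simpa using h1 0 ρ p) (fun ρ p => by simpa using h2 0 ρ p) (h1 t) (h2 t)
    (fun ρ p => meanStrip_le hR hD ρ p) (fun ρ p => meanStrip_le hR hD ρ _)
    (meanChord_le hR hD) ?_ (hlim 0) (hlim t)
  rw [lintegral_meanChord hKm hF hR]
  exact ENNReal.mul_ne_top hRi hK.measure_lt_top.ne

/-- The bound of `lintegral_meanStrip_mul_le` is uniform in t, so dominated convergence for the
finite measure κ applies. -/
lemma tendsto_lintegral_cross [SFinite μ] (hK : IsCompact K) (hF : Measurable F)
    (hR : Measurable R) (hD : ∀ x ∈ K, ‖x‖ ≤ D) (hRi : ∫⁻ ω, ENNReal.ofReal (2 * R ω) ∂μ ≠ ∞)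
    (κ : Measure ℝ) [IsFiniteMeasure κ] :
    Tendsto (fun ρ => ∫⁻ t, ∫⁻ p, meanStrip K μ F R ρ p * meanStrip K μ F R ρ (p + t / ρ) ∂volume ∂κ)
      atTop (𝓝 (κ univ * ∫⁻ p, meanChord K μ F R p * meanChord K μ F R p)) := by
  have hKm := hK.measurableSet
  rw [mul_comm, ← lintegral_const]
  refine tendsto_lintegral_filter_of_dominated_convergence
      (fun _ => (∫⁻ ω, ENNReal.ofReal (2 * R ω) ∂μ) * volume K *
        ((∫⁻ ω, ENNReal.ofReal (2 * R ω) ∂μ) * ENNReal.ofReal (2 * D)))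
      (Eventually.of_forall fun ρ => ?_)
      (Eventually.of_forall fun ρ => ae_of_all _ fun t => lintegral_meanStrip_mul_le hKm hF hR hD _ _)
      ?_ (ae_of_all _ fun t => tendsto_lintegral_meanStrip_mul hK hF hR hD hRi t)
  · have hm := measurable_meanStrip (μ := μ) hKm hF hR ρ
    have : Measurable fun x : ℝ × ℝ =>
        meanStrip K μ F R ρ x.2 * meanStrip K μ F R ρ (x.2 + x.1 / ρ) :=
      (hm.comp measurable_snd).mul (hm.comp (by fun_prop))
    exact this.lintegral_prod_right'
  · rw [lintegral_const]
    exact ENNReal.mul_ne_top (ENNReal.mul_ne_top (ENNReal.mul_ne_top hRi hK.measure_lt_top.ne)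
      (ENNReal.mul_ne_top hRi ENNReal.ofReal_ne_top)) (measure_ne_top _ _)

/-- Both factors belong to one and the same cylinder, so its radius appears squared and the
domination requires E R² < ∞. -/
lemma tendsto_lintegral_lintegral_stripArea_sq [SFinite μ] (hK : IsCompact K) (hF : Measurable F)
    (hR : Measurable R) (hD : ∀ x ∈ K, ‖x‖ ≤ D)
    (hRi : ∫⁻ ω, ENNReal.ofReal (2 * R ω) ^ 2 ∂μ ≠ ∞) :
    Tendsto (fun ρ => ∫⁻ ω, ∫⁻ q, stripArea K ρ q (F ω) (R ω) * stripArea K ρ q (F ω) (R ω)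
      ∂volume ∂μ) atTop (𝓝 (∫⁻ ω, ENNReal.ofReal (2 * R ω) ^ 2 *
        ∫⁻ q, chord K q (F ω) * chord K q (F ω) ∂volume ∂μ)) := by
  have hKm := hK.measurableSet
  refine tendsto_lintegral_filter_of_dominated_convergence
      (fun ω => ENNReal.ofReal (2 * R ω) ^ 2 * (volume K * ENNReal.ofReal (2 * D)))
      (Eventually.of_forall fun ρ => ?_)
      (Eventually.of_forall fun ρ => ae_of_all _ fun ω => ?_)
      ?_ (ae_of_all _ fun ω => tendsto_lintegral_stripArea_sq hK hD _ _)
  · have h : Measurable fun x : ℝ × Ω => stripArea K ρ x.1 (F x.2) (R x.2) :=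
      measurable_stripArea_comp hKm ρ (by fun_prop) (by fun_prop) (by fun_prop)
    exact (h.mul h).lintegral_prod_left'
  · calc ∫⁻ q, stripArea K ρ q (F ω) (R ω) * stripArea K ρ q (F ω) (R ω)
        ≤ ∫⁻ q, stripArea K ρ q (F ω) (R ω) *
            (ENNReal.ofReal (2 * R ω) * ENNReal.ofReal (2 * D)) :=
          lintegral_mono fun q => mul_le_mul_right (stripArea_le hD _ _ _ _) _
      _ = _ := by
          have hc : Measurable fun q => stripArea K ρ q (F ω) (R ω) :=
            measurable_stripArea_comp hKm ρ measurable_id measurable_const measurable_const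
          have := lintegral_stripArea hKm ρ 0 (F ω) (R ω)
          simp only [add_zero] at this
          rw [lintegral_mul_const _ hc, this]
          ring
  · rw [lintegral_mul_const _ (by fun_prop)]
    exact ENNReal.mul_ne_top hRi (ENNReal.mul_ne_top hK.measure_lt_top.ne ENNReal.ofReal_ne_top)

end

/-! ### Rescaling -/

lemma lintegral_eq_mul_lintegral_comp_mul {ρ : ℝ} (hρ : 0 < ρ) {f : ℝ → ℝ≥0∞} (hf : Measurable f) :
    ∫⁻ p, f p = ENNReal.ofReal ρ * ∫⁻ q, f (ρ * q) := by
  conv_lhs => rw [← Real.smul_map_volume_mul_left hρ.ne']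
  rw [lintegral_smul_measure, lintegral_map hf (measurable_const_mul ρ), abs_of_pos hρ, smul_eq_mul]

/-- Scaling the area contributes ρ², of which one factor is used up by the substitution a = q + u /
ρ across the strip. -/
lemma volume_inter_strip {K : Set Plane} (hK : MeasurableSet K) {ρ : ℝ} (hρ : 0 < ρ) (q φ r : ℝ) :
    volume {x ∈ ρ • K | |proj x φ - ρ * q| ≤ r} = ENNReal.ofReal ρ * stripArea K ρ q φ r := by
  set A : Set Plane := {y ∈ K | |ρ * proj y φ - ρ * q| ≤ r} with hA
  have hpm : Measurable fun y : Plane => proj y φ :=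
    (continuous_proj.comp (by fun_prop : Continuous fun y : Plane => (y, φ))).measurable
  have hpm' : Measurable fun y : Plane => |ρ * proj y φ - ρ * q| := by
    simp only [← Real.norm_eq_abs]
    exact ((hpm.const_mul ρ).sub_const _).norm
  have hAm : MeasurableSet A := hK.inter (measurableSet_le hpm' measurable_const)
  have e1 : {x ∈ ρ • K | |proj x φ - ρ * q| ≤ r} = ρ • A := by
    ext x
    constructor
    · rintro ⟨⟨y, hy, rfl⟩, h⟩
      simp only [proj_smul] at h
      exact ⟨y, ⟨hy, h⟩, rfl⟩
    · rintro ⟨y, ⟨hy, h⟩, rfl⟩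
      exact ⟨⟨y, hy, rfl⟩, by simpa only [proj_smul] using h⟩
  have hg : Measurable fun a => if |ρ * a - ρ * q| ≤ r then chord K a φ else 0 :=
    (measurable_chord_comp hK measurable_id measurable_const).ite
      (measurableSet_le (by fun_prop) measurable_const) measurable_const
  have e2 : volume A = ∫⁻ a, if |ρ * a - ρ * q| ≤ r then chord K a φ else 0 := by
    rw [← lintegral_indicator_one hAm, lintegral_plane φ (measurable_one.indicator hAm)]
    refine lintegral_congr fun a => ?_
    split_ifs with h
    · rw [chord, ← lintegral_indicator_one (measurableSet_slice hK a φ)]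
      refine lintegral_congr fun b => ?_
      have hiff : rot φ (a, b) ∈ A ↔ b ∈ slice K a φ := by
        simp [hA, slice, proj_rot, h]
      by_cases hb : b ∈ slice K a φ
      · rw [indicator_of_mem hb, indicator_of_mem (hiff.2 hb)]
        rfl
      · rw [indicator_of_notMem hb, indicator_of_notMem (mt hiff.1 hb)]
    · refine (lintegral_congr fun b => ?_).trans lintegral_zero
      refine indicator_of_notMem (fun hb => h ?_) _
      simpa [hA, proj_rot] using hb.2
  have hg' : Measurable fun a => if |ρ * (a + q) - ρ * q| ≤ r then chord K (a + q) φ else 0 :=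
    hg.comp (measurable_add_const q)
  have e3 : volume A = ENNReal.ofReal ρ⁻¹ * stripArea K ρ q φ r := by
    rw [e2, ← lintegral_add_right_eq_self (fun a => if |ρ * a - ρ * q| ≤ r then chord K a φ else 0) q,
      lintegral_eq_mul_lintegral_comp_mul (inv_pos.2 hρ) hg', stripArea, setLIntegral_Icc_symm]
    congr 1
    refine lintegral_congr fun u => ?_
    have h1 : ρ * (ρ⁻¹ * u + q) - ρ * q = u := by field_simp; ring
    have h2 : ρ⁻¹ * u + q = q + u / ρ := by field_simp; ring
    rw [h1, h2]
  rw [e1, Measure.addHaar_smul, e3, ← mul_assoc, ← ENNReal.ofReal_mul (abs_nonneg _)]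
  congr 2
  rw [finrank_euclideanSpace_fin, abs_of_pos (by positivity)]
  field_simp

/-- Tonelli's theorem for a product of two functions with a common variable. -/
lemma lintegral_lintegral_lintegral_mul {X Y Z : Type*} [MeasurableSpace X] [MeasurableSpace Y]
    [MeasurableSpace Z] {α : Measure X} {β : Measure Y} {ζ : Measure Z} [SFinite α] [SFinite β]
    [SFinite ζ] {f : X → Z → ℝ≥0∞} {g : Y → Z → ℝ≥0∞} (hf : Measurable fun q : X × Z => f q.1 q.2)
    (hg : Measurable fun q : Y × Z => g q.1 q.2) :
    ∫⁻ x, ∫⁻ y, ∫⁻ z, f x z * g y z ∂ζ ∂β ∂α = ∫⁻ z, (∫⁻ x, f x z ∂α) * ∫⁻ y, g y z ∂β ∂ζ := by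
  have hfx : ∀ x, Measurable (f x) := fun x => hf.comp measurable_prodMk_left
  have hfz : ∀ z, Measurable fun x => f x z := fun z => hf.comp measurable_prodMk_right
  have hgz : ∀ z, Measurable fun y => g y z := fun z => hg.comp measurable_prodMk_right
  have hG : Measurable fun z => ∫⁻ y, g y z ∂β := hg.lintegral_prod_left'
  have h1 : ∀ x, ∫⁻ y, ∫⁻ z, f x z * g y z ∂ζ ∂β = ∫⁻ z, f x z * ∫⁻ y, g y z ∂β ∂ζ := fun x => by
    have hm : Measurable fun q : Y × Z => f x q.2 * g q.1 q.2 :=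
      ((hfx x).comp measurable_snd).mul hg
    rw [lintegral_lintegral_swap hm.aemeasurable]
    exact lintegral_congr fun z => lintegral_const_mul _ (hgz z)
  have hm : Measurable fun q : X × Z => f q.1 q.2 * ∫⁻ y, g y q.2 ∂β :=
    hf.mul (hG.comp measurable_snd)
  simp_rw [h1]
  rw [lintegral_lintegral_swap hm.aemeasurable]
  exact lintegral_congr fun z => lintegral_mul_const _ (hfz z)

end PlanarCylinder

end

noncomputable section

namespace PlanarCylinder

/-! ### Hitting a point of the plane -/

/-- The marked points whose cylinder contains `x`. -/
def strip (x : Plane) : Set (ℝ × ℝ × ℝ) := {a | |proj x a.2.1 - a.1| ≤ a.2.2}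

lemma measurableSet_strip_pair : MeasurableSet {q : Plane × ℝ × ℝ × ℝ | q.2 ∈ strip q.1} := by
  have h1 : Continuous fun q : Plane × ℝ × ℝ × ℝ => |proj q.1 q.2.2.1 - q.2.1| :=
    ((continuous_proj.comp (by fun_prop : Continuous fun q : Plane × ℝ × ℝ × ℝ =>
      (q.1, q.2.2.1))).sub (by fun_prop)).abs
  exact measurableSet_le h1.measurable (by fun_prop)

lemma measurableSet_strip (x : Plane) : MeasurableSet (strip x) :=
  measurable_prodMk_left (x := x) measurableSet_strip_pair

lemma mem_cylinderProcess {Ω : Type*} {P Φ R : ℤ → Ω → ℝ} {ω : Ω} {x : Plane} :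
    x ∈ cylinderProcess P Φ R ω ↔ ∃ i, (P i ω, Φ i ω, R i ω) ∈ strip x := by
  simp only [cylinderProcess, mem_iUnion, mem_line_add_closedBall]
  rfl

variable {Ω : Type*} [MeasurableSpace Ω]

section

variable {K : Set Plane} {μ : Measure Ω} {P Φ R : ℤ → Ω → ℝ}

lemma measurableSet_strip_mark (hM : IsIndependentMarking P Φ R μ) :
    MeasurableSet {q : Plane × ℝ × Ω | (q.2.1, Φ 0 q.2.2, R 0 q.2.2) ∈ strip q.1} := by
  have h1 := hM.measurable_angle 0
  have h2 := hM.measurable_radius 0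
  have : Measurable fun q : Plane × ℝ × Ω => (q.1, q.2.1, Φ 0 q.2.2, R 0 q.2.2) := by fun_prop
  exact this measurableSet_strip_pair

lemma ofReal_hitProb [IsFiniteMeasure μ] (A : Set (ℝ × ℝ × ℝ)) (p : ℝ) :
    ENNReal.ofReal (hitProb Φ R μ A p) = μ {ω | (p, Φ 0 ω, R 0 ω) ∈ A} := ofReal_measureReal

lemma measurable_hitProb_strip [IsFiniteMeasure μ] (hM : IsIndependentMarking P Φ R μ) :
    Measurable fun q : Plane × ℝ => ENNReal.ofReal (hitProb Φ R μ (strip q.1) q.2) := by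
  simp_rw [ofReal_hitProb]
  have h : Measurable fun q : (Plane × ℝ) × Ω => (q.1.1, q.1.2, q.2) := by fun_prop
  have := measurable_measure_prodMk_left (ν := μ) (h (measurableSet_strip_mark hM))
  exact this

lemma setLIntegral_hitProb_strip [IsFiniteMeasure μ] (hM : IsIndependentMarking P Φ R μ)
    (hK : MeasurableSet K) {ρ : ℝ} (hρ : 0 < ρ) (q : ℝ) :
    ∫⁻ x in ρ • K, ENNReal.ofReal (hitProb Φ R μ (strip x) (ρ * q)) =
      ENNReal.ofReal ρ * meanStrip K μ (Φ 0) (R 0) ρ q := by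
  simp_rw [ofReal_hitProb]
  have hS : MeasurableSet {z : Plane × Ω | (ρ * q, Φ 0 z.2, R 0 z.2) ∈ strip z.1} := by
    have h : Measurable fun z : Plane × Ω => (z.1, ρ * q, z.2) := by fun_prop
    exact h (measurableSet_strip_mark hM)
  have h1 := Measure.prod_apply (μ := volume.restrict (ρ • K)) (ν := μ) hS
  rw [Measure.prod_apply_symm hS] at h1
  refine h1.symm.trans ?_
  have hm : Measurable fun ω => stripArea K ρ q (Φ 0 ω) (R 0 ω) :=
    measurable_stripArea_comp hK ρ measurable_const (hM.measurable_angle 0) (hM.measurable_radius 0)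
  rw [meanStrip, ← lintegral_const_mul _ hm]
  refine lintegral_congr fun ω => ?_
  rw [← volume_inter_strip hK hρ, Measure.restrict_apply (measurable_prodMk_right hS), inter_comm]
  rfl

/-- Tonelli moves the integrations over x and y inside. Each of them contributes one factor ρ, and
the substitution p = ρq contributes the third. -/
lemma lintegral_cross_strip [IsFiniteMeasure μ] (hM : IsIndependentMarking P Φ R μ)
    (hK : MeasurableSet K) (κ : Measure ℝ) [IsFiniteMeasure κ] {ρ : ℝ} (hρ : 0 < ρ) :
    ∫⁻ x in ρ • K, ∫⁻ y in ρ • K, cross κ (hitProb Φ R μ (strip x)) (hitProb Φ R μ (strip y)) =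
      ENNReal.ofReal ρ ^ 3 * ∫⁻ t, ∫⁻ q, meanStrip K μ (Φ 0) (R 0) ρ q *
        meanStrip K μ (Φ 0) (R 0) ρ (q + t / ρ) ∂volume ∂κ := by
  have hh := measurable_hitProb_strip (μ := μ) hM
  have hhx : ∀ x, Measurable (hitProb Φ R μ (strip x)) := fun x =>
    measurable_hitProb hM (measurableSet_strip x)
  simp_rw [fun x y => cross_eq_lintegral_prod κ (hhx x) (hhx y)]
  have hf1 : Measurable fun q : Plane × ℝ × ℝ =>
      ENNReal.ofReal (hitProb Φ R μ (strip q.1) q.2.1) := by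
    have h := hh.comp (by fun_prop : Measurable fun q : Plane × ℝ × ℝ => (q.1, q.2.1))
    exact h
  have hf2 : Measurable fun q : Plane × ℝ × ℝ =>
      ENNReal.ofReal (hitProb Φ R μ (strip q.1) (q.2.2 + q.2.1)) := by
    have h := hh.comp (by fun_prop : Measurable fun q : Plane × ℝ × ℝ => (q.1, q.2.2 + q.2.1))
    exact h
  rw [lintegral_lintegral_lintegral_mul (α := volume.restrict (ρ • K))
    (β := volume.restrict (ρ • K)) hf1 hf2]
  set W : ℝ → ℝ≥0∞ := fun p => ∫⁻ x in ρ • K, ENNReal.ofReal (hitProb Φ R μ (strip x) p) with hW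
  have hWm : Measurable W := hh.lintegral_prod_left'
  have hWm2 : Measurable fun z : ℝ × ℝ => W z.1 * W (z.2 + z.1) :=
    (hWm.comp measurable_fst).mul (hWm.comp (measurable_snd.add measurable_fst))
  have hWe : ∀ q, W (ρ * q) = ENNReal.ofReal ρ * meanStrip K μ (Φ 0) (R 0) ρ q := fun q =>
    setLIntegral_hitProb_strip hM hK hρ q
  change ∫⁻ z : ℝ × ℝ, W z.1 * W (z.2 + z.1) ∂(volume.prod κ) = _
  have hms := measurable_meanStrip (μ := μ) hK (hM.measurable_angle 0) (hM.measurable_radius 0) ρ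
  have hms2 : Measurable fun z : ℝ × ℝ => meanStrip K μ (Φ 0) (R 0) ρ z.2 *
      meanStrip K μ (Φ 0) (R 0) ρ (z.2 + z.1 / ρ) :=
    (hms.comp measurable_snd).mul
      (hms.comp (by fun_prop : Measurable fun z : ℝ × ℝ => z.2 + z.1 / ρ))
  rw [lintegral_prod_symm' _ hWm2, ← lintegral_const_mul _ hms2.lintegral_prod_right']
  refine lintegral_congr fun t => ?_
  have hWt : Measurable fun p => W p * W (t + p) := hWm.mul (hWm.comp (measurable_const_add t))
  have hmt : Measurable fun q => meanStrip K μ (Φ 0) (R 0) ρ q *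
      meanStrip K μ (Φ 0) (R 0) ρ (q + t / ρ) := by
    have h := hms.mul (hms.comp (measurable_add_const (t / ρ)))
    exact h
  change ∫⁻ p, W p * W (t + p) = _
  rw [lintegral_eq_mul_lintegral_comp_mul hρ hWt, pow_succ', mul_assoc, ← lintegral_const_mul _ hmt]
  congr 1
  refine lintegral_congr fun q => ?_
  have e : t + ρ * q = ρ * (q + t / ρ) := by field_simp; ring
  rw [e, hWe, hWe]
  ring

lemma lintegral_hitProb_inter_eq [IsFiniteMeasure μ] (hM : IsIndependentMarking P Φ R μ)
    (x y : Plane) : ∫⁻ p, ENNReal.ofReal (hitProb Φ R μ (strip x ∩ strip y) p) =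
      ∫⁻ z : ℝ × Ω, ({z : ℝ × Ω | (z.1, Φ 0 z.2, R 0 z.2) ∈ strip x}.indicator 1 z : ℝ≥0∞) *
        {z : ℝ × Ω | (z.1, Φ 0 z.2, R 0 z.2) ∈ strip y}.indicator 1 z
          ∂((volume : Measure ℝ).prod μ) := by
  have h : Measurable fun z : ℝ × Ω => (z.1, Φ 0 z.2, R 0 z.2) := by
    have h1 := hM.measurable_angle 0
    have h2 := hM.measurable_radius 0
    fun_prop
  have hxy := h ((measurableSet_strip x).inter (measurableSet_strip y))
  have e : ∀ z : ℝ × Ω, ({z : ℝ × Ω | (z.1, Φ 0 z.2, R 0 z.2) ∈ strip x}.indicator 1 z : ℝ≥0∞) *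
        {z : ℝ × Ω | (z.1, Φ 0 z.2, R 0 z.2) ∈ strip y}.indicator 1 z =
      ((fun z : ℝ × Ω => (z.1, Φ 0 z.2, R 0 z.2)) ⁻¹' (strip x ∩ strip y)).indicator 1 z := fun z => by
    rw [preimage_inter, inter_indicator_one]
    rfl
  simp_rw [e]
  rw [lintegral_indicator_one hxy, Measure.prod_apply hxy]
  refine lintegral_congr fun p => ?_
  rw [ofReal_hitProb]
  rfl

/-- As for `lintegral_cross_strip`, with the pair (p, ω) as common variable: x and y are hit by the
same cylinder, so the mark is shared and the average over it stays outside the product. -/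
lemma lintegral_hitProb_inter_strip [IsFiniteMeasure μ] (hM : IsIndependentMarking P Φ R μ)
    (hK : MeasurableSet K) {ρ : ℝ} (hρ : 0 < ρ) :
    ∫⁻ x in ρ • K, ∫⁻ y in ρ • K, ∫⁻ p, ENNReal.ofReal (hitProb Φ R μ (strip x ∩ strip y) p) =
      ENNReal.ofReal ρ ^ 3 * ∫⁻ ω, ∫⁻ q, stripArea K ρ q (Φ 0 ω) (R 0 ω) *
        stripArea K ρ q (Φ 0 ω) (R 0 ω) ∂volume ∂μ := by
  have hS := measurableSet_strip_mark hM
  simp_rw [lintegral_hitProb_inter_eq hM]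
  have hf : Measurable fun q : Plane × ℝ × Ω =>
      ({z : ℝ × Ω | (z.1, Φ 0 z.2, R 0 z.2) ∈ strip q.1}.indicator 1 q.2 : ℝ≥0∞) := by
    have : (fun q : Plane × ℝ × Ω =>
      ({z : ℝ × Ω | (z.1, Φ 0 z.2, R 0 z.2) ∈ strip q.1}.indicator 1 q.2 : ℝ≥0∞)) =
      {q : Plane × ℝ × Ω | (q.2.1, Φ 0 q.2.2, R 0 q.2.2) ∈ strip q.1}.indicator 1 := by
      funext q
      rfl
    rw [this]
    exact measurable_one.indicator hS
  rw [lintegral_lintegral_lintegral_mul (α := volume.restrict (ρ • K))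
    (β := volume.restrict (ρ • K)) (ζ := (volume : Measure ℝ).prod μ) hf hf]
  set W : ℝ × Ω → ℝ≥0∞ := fun z => ∫⁻ x in ρ • K,
    ({z : ℝ × Ω | (z.1, Φ 0 z.2, R 0 z.2) ∈ strip x}.indicator 1 z : ℝ≥0∞) with hW
  have hWm : Measurable W := hf.lintegral_prod_left'
  have hWe : ∀ q ω, W (ρ * q, ω) = ENNReal.ofReal ρ * stripArea K ρ q (Φ 0 ω) (R 0 ω) :=
    fun q ω => by
      have hs : MeasurableSet {x | (ρ * q, Φ 0 ω, R 0 ω) ∈ strip x} :=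
        measurable_prodMk_right (y := (ρ * q, ω)) hS
      rw [← volume_inter_strip hK hρ]
      have : W (ρ * q, ω) = ∫⁻ x in ρ • K, {x | (ρ * q, Φ 0 ω, R 0 ω) ∈ strip x}.indicator 1 x := rfl
      rw [this, lintegral_indicator_one hs, Measure.restrict_apply hs, inter_comm]
      rfl
  have hsm : Measurable fun z : Ω × ℝ => stripArea K ρ z.2 (Φ 0 z.1) (R 0 z.1) :=
    measurable_stripArea_comp hK ρ measurable_snd ((hM.measurable_angle 0).comp measurable_fst)
      ((hM.measurable_radius 0).comp measurable_fst)
  have hsm2 : Measurable fun z : Ω × ℝ => stripArea K ρ z.2 (Φ 0 z.1) (R 0 z.1) *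
    stripArea K ρ z.2 (Φ 0 z.1) (R 0 z.1) := hsm.mul hsm
  have hWm2 : Measurable fun z => W z * W z := hWm.mul hWm
  rw [lintegral_prod_symm' _ hWm2, ← lintegral_const_mul _ hsm2.lintegral_prod_right']
  refine lintegral_congr fun ω => ?_
  have hWω : Measurable fun p => W (p, ω) * W (p, ω) := hWm2.comp measurable_prodMk_right
  have hsω : Measurable fun q => stripArea K ρ q (Φ 0 ω) (R 0 ω) *
    stripArea K ρ q (Φ 0 ω) (R 0 ω) := hsm2.comp measurable_prodMk_left
  rw [lintegral_eq_mul_lintegral_comp_mul hρ hWω, pow_succ', mul_assoc, ← lintegral_const_mul _ hsω]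
  congr 1
  refine lintegral_congr fun q => ?_
  rw [hWe]
  ring

/-- For a given mark the positions p of the axes whose cylinder contains x form an interval of
length 2R, wherever x lies. -/
lemma lintegral_hitProb_strip [IsFiniteMeasure μ] (hM : IsIndependentMarking P Φ R μ) (x : Plane) :
    ∫⁻ p, ENNReal.ofReal (hitProb Φ R μ (strip x) p) = ∫⁻ ω, ENNReal.ofReal (2 * R 0 ω) ∂μ := by
  simp_rw [ofReal_hitProb]
  have hS : MeasurableSet {z : ℝ × Ω | (z.1, Φ 0 z.2, R 0 z.2) ∈ strip x} :=
    measurable_prodMk_left (x := x) (measurableSet_strip_mark hM)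
  have h1 := Measure.prod_apply (μ := volume) (ν := μ) hS
  rw [Measure.prod_apply_symm hS] at h1
  refine h1.symm.trans (lintegral_congr fun ω => ?_)
  have : (fun p => (p, ω)) ⁻¹' {z : ℝ × Ω | (z.1, Φ 0 z.2, R 0 z.2) ∈ strip x} =
      Icc (proj x (Φ 0 ω) - R 0 ω) (proj x (Φ 0 ω) + R 0 ω) := by
    ext p
    simp only [mem_preimage, mem_ofPred_eq, strip, mem_Icc, abs_le]
    constructor <;> rintro ⟨h1, h2⟩ <;> constructor <;> linarith
  rw [this, Real.volume_Icc]
  congr 1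
  ring

end

end PlanarCylinder

end

noncomputable section

namespace PlanarCylinder

variable {Ω : Type*} [MeasurableSpace Ω]

/-! ### Distant points are rarely hit -/

lemma measure_singleton_eq_zero_of_continuous_cdf {ν : Measure ℝ} [IsProbabilityMeasure ν]
    (h : Continuous (cdf ν)) (a : ℝ) : ν {a} = 0 := by
  rw [← measure_cdf ν, StieltjesFunction.measure_singleton,
    leftLim_eq_of_tendsto (h.continuousAt.tendsto.mono_left inf_le_left),
    sub_self, ENNReal.ofReal_zero]

/-- Used to see that such level sets are null for a law without atoms. -/
lemma countable_cos_sub_eq (ψ q : ℝ) : {φ : ℝ | Real.cos (φ - ψ) = q}.Countable := by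
  by_cases h : ∃ φ₀ : ℝ, Real.cos (φ₀ - ψ) = q
  · obtain ⟨φ₀, h₀⟩ := h
    refine ((countable_range fun k : ℤ => 2 * k * Real.pi + (φ₀ - ψ) + ψ).union
      (countable_range fun k : ℤ => 2 * k * Real.pi - (φ₀ - ψ) + ψ)).mono fun φ hφ => ?_
    obtain ⟨k, hk | hk⟩ := Real.cos_eq_cos_iff.1 (h₀.trans (mem_ofPred_eq ▸ hφ).symm)
    · exact Or.inl ⟨k, by simp only; linarith⟩
    · exact Or.inr ⟨k, by simp only; linarith⟩
  · rw [show {φ : ℝ | Real.cos (φ - ψ) = q} = ∅ from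
      eq_empty_of_forall_notMem fun φ hφ => h ⟨φ, hφ⟩]
    exact countable_empty

lemma dir_apply_zero (ψ : ℝ) : dir ψ 0 = Real.cos ψ := by simp [dir]

lemma dir_apply_one (ψ : ℝ) : dir ψ 1 = Real.sin ψ := by simp [dir]

lemma proj_smul_dir (c ψ φ : ℝ) : proj (c • dir ψ) φ = c * Real.cos (φ - ψ) := by
  rw [proj_smul, Real.cos_sub, proj, dir_apply_zero, dir_apply_one]
  ring

lemma exists_eq_norm_smul_dir (x : Plane) : ∃ ψ ∈ Icc (-Real.pi) Real.pi, x = ‖x‖ • dir ψ := by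
  set z : ℂ := ⟨x 0, x 1⟩ with hz
  have hn : ‖x‖ = ‖z‖ := by
    rw [← sq_eq_sq₀ (norm_nonneg _) (norm_nonneg _), norm_sq_plane, Complex.sq_norm, Complex.normSq_apply]
    ring
  refine ⟨z.arg, ⟨(Complex.neg_pi_lt_arg z).le, Complex.arg_le_pi z⟩, plane_ext ?_ ?_⟩
  · rw [PiLp.smul_apply, smul_eq_mul, dir_apply_zero, hn]
    exact (Complex.norm_mul_cos_arg z).symm
  · rw [PiLp.smul_apply, smul_eq_mul, dir_apply_one, hn]
    exact (Complex.norm_mul_sin_arg z).symm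

section

variable {μ : Measure Ω} [IsProbabilityMeasure μ]

/-- For fixed (ψ, q) the probability tends to zero with ε because the level sets of the cosine are
null. The condition varies in a Lipschitz way with (ψ, q), so compactness makes ε uniform; values of
q outside [-2, 2] are out of reach when ε ≤ 1. -/
lemma exists_measure_cos_le {F : Ω → ℝ} (hF : Measurable F) (hG : Continuous (cdf (μ.map F)))
    {δ : ℝ≥0∞} (hδ : 0 < δ) : ∃ ε : ℝ, 0 < ε ∧ ∀ ψ ∈ Icc (-Real.pi) Real.pi, ∀ q : ℝ,
      μ {ω | |Real.cos (F ω - ψ) - q| ≤ ε} ≤ δ := by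
  have : IsProbabilityMeasure (μ.map F) := Measure.isProbabilityMeasure_map hF.aemeasurable
  have hm : ∀ ψ q ε : ℝ, MeasurableSet {ω | |Real.cos (F ω - ψ) - q| ≤ ε} := fun ψ q ε =>
    measurableSet_le (by fun_prop) measurable_const
  have hnull : ∀ ψ q : ℝ, μ {ω | Real.cos (F ω - ψ) = q} = 0 := fun ψ q => by
    have hc := countable_cos_sub_eq ψ q
    have hz : μ.map F {φ : ℝ | Real.cos (φ - ψ) = q} = 0 := by
      have : NullSingletonClass (μ.map F) := ⟨measure_singleton_eq_zero_of_continuous_cdf hG⟩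
      exact hc.measure_zero _
    rwa [Measure.map_apply hF hc.measurableSet] at hz
  -- The width 3ε leaves room to move ψ and q by ε each.
  have hloc : ∀ ψ q : ℝ, ∃ ε : ℝ, 0 < ε ∧ μ {ω | |Real.cos (F ω - ψ) - q| ≤ 3 * ε} ≤ δ := by
    intro ψ q
    have hset : ⋂ n : ℕ, {ω | |Real.cos (F ω - ψ) - q| ≤ 1 / ((n : ℝ) + 1)} =
        {ω | Real.cos (F ω - ψ) = q} := by
      ext ω
      simp only [mem_iInter, mem_ofPred_eq]
      constructor
      · intro h
        have := ge_of_tendsto' tendsto_one_div_add_atTop_nhds_zero_nat h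
        exact sub_eq_zero.1 (abs_nonpos_iff.1 this)
      · intro h n
        rw [h, sub_self, abs_zero]
        positivity
    have ht := tendsto_measure_iInter_atTop (μ := μ)
      (s := fun n : ℕ => {ω | |Real.cos (F ω - ψ) - q| ≤ 1 / ((n : ℝ) + 1)})
      (fun n => (hm _ _ _).nullMeasurableSet)
      (fun n m hnm ω hω => (mem_ofPred_eq ▸ hω : _ ≤ _).trans (one_div_le_one_div_of_le (by positivity)
        (by exact_mod_cast Nat.succ_le_succ hnm)))
      ⟨0, measure_ne_top _ _⟩
    rw [hset, hnull] at ht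
    obtain ⟨n, hn⟩ := (ht.eventually (gt_mem_nhds hδ)).exists
    refine ⟨1 / ((n : ℝ) + 1) / 3, by positivity, ?_⟩
    rw [mul_div_cancel₀ _ (by norm_num : (3 : ℝ) ≠ 0)]
    exact hn.le
  have hcomp : IsCompact (Icc (-Real.pi) Real.pi ×ˢ Icc (-2 : ℝ) 2) := isCompact_Icc.prod isCompact_Icc
  have hev := hcomp.eventually_forall_of_forall_eventually (x₀ := (0 : ℝ))
    (P := fun ε z => μ {ω | |Real.cos (F ω - z.1) - z.2| ≤ ε} ≤ δ) (by
      rintro ⟨ψ, q⟩ -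
      obtain ⟨ε, hε, h⟩ := hloc ψ q
      rw [nhds_prod_eq, nhds_prod_eq]
      filter_upwards [prod_mem_prod (Iio_mem_nhds hε) (prod_mem_prod (Metric.ball_mem_nhds ψ hε)
        (Metric.ball_mem_nhds q hε))] with z hz
      refine (measure_mono fun ω hω => ?_).trans h
      obtain ⟨h1, h2, h3⟩ := hz
      rw [mem_Iio] at h1
      rw [Metric.mem_ball, Real.dist_eq] at h2 h3
      have h4 := Real.abs_cos_sub_cos_le (F ω - ψ) (F ω - z.2.1)
      have h5 : F ω - ψ - (F ω - z.2.1) = z.2.1 - ψ := by ring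
      rw [h5] at h4
      have hω' : |Real.cos (F ω - z.2.1) - z.2.2| ≤ z.1 := hω
      replace h4 := h4.trans h2.le
      rw [abs_le] at h4 hω'
      rw [abs_lt] at h3
      rw [mem_ofPred_eq, abs_le]
      constructor <;> linarith [h4.1, h4.2, hω'.1, hω'.2, h3.1, h3.2])
  obtain ⟨ε₀, hε₀, hb⟩ := Metric.eventually_nhds_iff.1 hev
  refine ⟨min (ε₀ / 2) 1, by positivity, fun ψ hψ q => ?_⟩
  by_cases hq : q ∈ Icc (-2 : ℝ) 2
  · refine hb ?_ (ψ, q) ⟨hψ, hq⟩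
    rw [dist_zero_right, Real.norm_of_nonneg (by positivity)]
    exact (min_le_left _ _).trans_lt (by linarith)
  · have : {ω | |Real.cos (F ω - ψ) - q| ≤ min (ε₀ / 2) 1} = ∅ := by
      refine eq_empty_of_forall_notMem fun ω hω => hq ?_
      have h1 := abs_le.1 ((mem_ofPred_eq ▸ hω : _ ≤ _).trans (min_le_right (ε₀ / 2) 1))
      have h2 := Real.neg_one_le_cos (F ω - ψ)
      have h3 := Real.cos_le_one (F ω - ψ)
      constructor <;> linarith [h1.1, h1.2]
    rw [this, measure_empty]
    exact zero_le

/-- In polar coordinates the projection is ‖x‖ cos(φ - ψ), so a window of size r for it is a window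
of size r / ‖x‖ for the cosine. -/
lemma exists_measure_proj_le {F : Ω → ℝ} (hF : Measurable F) (hG : Continuous (cdf (μ.map F)))
    (r : ℝ) {δ : ℝ≥0∞} (hδ : 0 < δ) : ∃ M : ℝ, 0 < M ∧ ∀ x : Plane, M ≤ ‖x‖ → ∀ p : ℝ,
      μ {ω | |proj x (F ω) - p| ≤ r} ≤ δ := by
  obtain ⟨ε, hε, h⟩ := exists_measure_cos_le hF hG hδ
  refine ⟨max (r / ε) 1, by positivity, fun x hx p => ?_⟩
  obtain ⟨ψ, hψ, hxψ⟩ := exists_eq_norm_smul_dir x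
  have hx0 : 0 < ‖x‖ := zero_lt_one.trans_le ((le_max_right _ _).trans hx)
  have hxr : r ≤ ‖x‖ * ε := (div_le_iff₀ hε).1 ((le_max_left _ _).trans hx)
  refine (measure_mono fun ω hω => ?_).trans (h ψ hψ (p / ‖x‖))
  have hω' : |proj x (F ω) - p| ≤ r := hω
  rw [hxψ, proj_smul_dir] at hω'
  have e : ‖x‖ * Real.cos (F ω - ψ) - p = ‖x‖ * (Real.cos (F ω - ψ) - p / ‖x‖) := by
    field_simp
  rw [e, abs_mul, abs_of_pos hx0] at hω'
  exact le_of_mul_le_mul_left (hω'.trans hxr) hx0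

lemma tendsto_measure_gt_nat {R : Ω → ℝ} (hR : Measurable R) :
    Tendsto (fun n : ℕ => μ {ω | (n : ℝ) < R ω}) atTop (𝓝 0) := by
  have hset : ⋂ n : ℕ, {ω | (n : ℝ) < R ω} = ∅ := by
    refine eq_empty_of_forall_notMem fun ω hω => ?_
    obtain ⟨n, hn⟩ := exists_nat_gt (R ω)
    exact absurd (mem_iInter.1 hω n) (not_lt.2 hn.le)
  have ht := tendsto_measure_iInter_atTop (μ := μ) (s := fun n : ℕ => {ω | (n : ℝ) < R ω})
    (fun n => (measurableSet_lt measurable_const hR).nullMeasurableSet)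
    (fun n m hnm ω hω => (Nat.cast_le.2 hnm).trans_lt (mem_ofPred_eq ▸ hω : _ < _))
    ⟨0, measure_ne_top _ _⟩
  rwa [hset, measure_empty] at ht

variable {P Φ R : ℤ → Ω → ℝ}

/-- Radii above some n have small probability, and for the others the strip is contained in one of
half-width n. -/
lemma exists_hitProb_strip_le (hM : IsIndependentMarking P Φ R μ)
    (hG : Continuous (cdf (μ.map (Φ 0)))) {δ : ℝ} (hδ : 0 < δ) :
    ∃ M : ℝ, 0 < M ∧ ∀ x : Plane, M ≤ ‖x‖ → ∀ p, hitProb Φ R μ (strip x) p ≤ δ := by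
  have hδ' : (0 : ℝ≥0∞) < ENNReal.ofReal (δ / 2) := ENNReal.ofReal_pos.2 (by positivity)
  obtain ⟨n, hn⟩ := ((tendsto_measure_gt_nat (μ := μ) (hM.measurable_radius 0)).eventually
    (gt_mem_nhds hδ')).exists
  obtain ⟨M, hM0, h⟩ := exists_measure_proj_le (hM.measurable_angle 0) hG n hδ'
  refine ⟨M, hM0, fun x hx p => ?_⟩
  rw [← ENNReal.ofReal_le_ofReal_iff hδ.le, ofReal_hitProb]
  calc μ {ω | (p, Φ 0 ω, R 0 ω) ∈ strip x}
      ≤ μ ({ω | (n : ℝ) < R 0 ω} ∪ {ω | |proj x (Φ 0 ω) - p| ≤ n}) := by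
        refine measure_mono fun ω hω => ?_
        have hω' : |proj x (Φ 0 ω) - p| ≤ R 0 ω := hω
        rcases lt_or_ge (n : ℝ) (R 0 ω) with h1 | h1
        · exact Or.inl h1
        · exact Or.inr (hω'.trans h1)
    _ ≤ ENNReal.ofReal (δ / 2) + ENNReal.ofReal (δ / 2) :=
        (measure_union_le _ _).trans (add_le_add hn.le (h x hx p))
    _ = ENNReal.ofReal δ := by
        rw [← ENNReal.ofReal_add (by positivity) (by positivity), add_halves]

/-- A cylinder of radius at most n contains both x and y only if their projections differ by at most
2n; larger radii contribute the tail of E(2R). -/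
lemma lintegral_hitProb_inter_le (hM : IsIndependentMarking P Φ R μ) (x y : Plane) (n : ℕ) :
    ∫⁻ p, ENNReal.ofReal (hitProb Φ R μ (strip x ∩ strip y) p) ≤
      (∫⁻ ω in {ω | (n : ℝ) < R 0 ω}, ENNReal.ofReal (2 * R 0 ω) ∂μ) +
        ENNReal.ofReal (2 * n) * μ {ω | |proj (x - y) (Φ 0 ω) - 0| ≤ 2 * n} := by
  have hRm := hM.measurable_radius 0
  have hΦm := hM.measurable_angle 0
  have hpm : Measurable fun z : Plane × ℝ => proj z.1 z.2 := continuous_proj.measurable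
  have hB : MeasurableSet {ω | |proj (x - y) (Φ 0 ω) - 0| ≤ 2 * n} := by
    have h := hpm.comp (measurable_const (a := x - y).prodMk hΦm)
    exact measurableSet_le (h.sub_const 0).norm measurable_const
  have hA : MeasurableSet {ω | (n : ℝ) < R 0 ω} := measurableSet_lt measurable_const hRm
  simp_rw [ofReal_hitProb]
  have hS : MeasurableSet {z : ℝ × Ω | (z.1, Φ 0 z.2, R 0 z.2) ∈ strip x ∩ strip y} := by
    have h : Measurable fun z : ℝ × Ω => (z.1, Φ 0 z.2, R 0 z.2) := by fun_prop
    exact h ((measurableSet_strip x).inter (measurableSet_strip y))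
  have h1 := Measure.prod_apply (μ := volume) (ν := μ) hS
  rw [Measure.prod_apply_symm hS] at h1
  refine (h1.symm.le).trans ?_
  rw [← lintegral_indicator hA, ← lintegral_indicator_one hB,
    ← lintegral_const_mul _ (measurable_one.indicator hB),
    ← lintegral_add_right _ ((measurable_one.indicator hB).const_mul _)]
  refine lintegral_mono fun ω => ?_
  have hvol : volume ((fun p => (p, ω)) ⁻¹' {z : ℝ × Ω | (z.1, Φ 0 z.2, R 0 z.2) ∈ strip x ∩ strip y}) ≤
      ENNReal.ofReal (2 * R 0 ω) := by
    refine (measure_mono (t := Icc (proj x (Φ 0 ω) - R 0 ω) (proj x (Φ 0 ω) + R 0 ω))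
      fun p hp => ?_).trans (le_of_eq ?_)
    · have h2 := abs_le.1 (show |proj x (Φ 0 ω) - p| ≤ R 0 ω from hp.1)
      constructor <;> linarith [h2.1, h2.2]
    · rw [Real.volume_Icc]
      congr 1
      ring
  rcases lt_or_ge (n : ℝ) (R 0 ω) with hn | hn
  · rw [indicator_of_mem (show ω ∈ {ω | (n : ℝ) < R 0 ω} from hn)]
    exact le_add_right hvol
  · by_cases hω : ω ∈ {ω | |proj (x - y) (Φ 0 ω) - 0| ≤ 2 * n}
    · rw [indicator_of_mem hω, Pi.one_apply, mul_one]
      refine le_add_left (hvol.trans (ENNReal.ofReal_le_ofReal (by linarith)))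
    · refine le_of_eq_of_le ?_ zero_le
      convert measure_empty (μ := (volume : Measure ℝ))
      refine eq_empty_of_forall_notMem fun p hp => hω ?_
      have h2 := abs_le.1 (show |proj x (Φ 0 ω) - p| ≤ R 0 ω from hp.1)
      have h3 := abs_le.1 (show |proj y (Φ 0 ω) - p| ≤ R 0 ω from hp.2)
      rw [mem_ofPred_eq, proj_sub, sub_zero, abs_le]
      constructor <;> linarith [h2.1, h2.2, h3.1, h3.2]

lemma exists_lintegral_hitProb_inter_le (hM : IsIndependentMarking P Φ R μ)
    (hG : Continuous (cdf (μ.map (Φ 0)))) (hRi : ∫⁻ ω, ENNReal.ofReal (2 * R 0 ω) ∂μ ≠ ∞)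
    {δ : ℝ} (hδ : 0 < δ) :
    ∃ M : ℝ, 0 < M ∧ ∀ x y : Plane, M ≤ ‖x - y‖ →
      ∫⁻ p, ENNReal.ofReal (hitProb Φ R μ (strip x ∩ strip y) p) ≤ ENNReal.ofReal δ := by
  have hδ' : (0 : ℝ≥0∞) < ENNReal.ofReal (δ / 2) := ENNReal.ofReal_pos.2 (by positivity)
  obtain ⟨n, hn⟩ := ((tendsto_setLIntegral_zero hRi (tendsto_measure_gt_nat (μ := μ)
    (hM.measurable_radius 0))).eventually (gt_mem_nhds hδ')).exists
  have hδ2 : (0 : ℝ≥0∞) < ENNReal.ofReal (δ / 2 / (2 * n + 1)) := ENNReal.ofReal_pos.2 (by positivity)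
  obtain ⟨M, hM0, h⟩ := exists_measure_proj_le (hM.measurable_angle 0) hG (2 * n) hδ2
  refine ⟨M, hM0, fun x y hxy => (lintegral_hitProb_inter_le hM x y n).trans ?_⟩
  calc _ ≤ ENNReal.ofReal (δ / 2) + ENNReal.ofReal (2 * n) * ENNReal.ofReal (δ / 2 / (2 * n + 1)) :=
        add_le_add hn.le (mul_le_mul_right (h _ hxy 0) _)
    _ ≤ ENNReal.ofReal (δ / 2) + ENNReal.ofReal (δ / 2) := by
        rw [← ENNReal.ofReal_mul (by positivity)]
        gcongr
        rw [mul_div_assoc', div_le_iff₀ (by positivity)]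
        nlinarith
    _ = ENNReal.ofReal δ := by
        rw [← ENNReal.ofReal_add (by positivity) (by positivity), add_halves]

end

end PlanarCylinder

end

noncomputable section

namespace PlanarCylinder

variable {Ω : Type*} [MeasurableSpace Ω]

/-! ### The constants in the limit -/

/-- The area of the intersection of `K` and its translate by `s v(φ + π/2)`. -/
def shiftInter (K : Set Plane) (φ s : ℝ) : ℝ≥0∞ :=
  volume {x | x ∈ K ∧ x + s • dir (φ + Real.pi / 2) ∈ K}

section

variable {K : Set Plane}

lemma shiftInter_neg (K : Set Plane) (φ s : ℝ) : shiftInter K φ (-s) = shiftInter K φ s := by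
  unfold shiftInter
  rw [← measure_preimage_add_right volume (s • dir (φ + Real.pi / 2))]
  congr 1
  ext x
  simp only [mem_preimage, mem_ofPred_eq, neg_smul, add_neg_cancel_right]
  exact and_comm

lemma measurable_shiftInter (hK : MeasurableSet K) (φ : ℝ) : Measurable (shiftInter K φ) := by
  have h1 : Measurable fun q : ℝ × Plane => q.2 + q.1 • dir (φ + Real.pi / 2) :=
    (by fun_prop : Continuous fun q : ℝ × Plane => q.2 + q.1 • dir (φ + Real.pi / 2)).measurable
  exact measurable_measure_prodMk_left ((measurable_snd hK).inter (h1 hK))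

/-- The square of a chord length measures the pairs (b, b + s) in the slice. Integrating over the
parallel lines gives the covariogram of K in the direction of the lines. -/
lemma lintegral_chord_sq (hK : MeasurableSet K) (φ : ℝ) :
    ∫⁻ q, chord K q φ * chord K q φ = ∫⁻ s, shiftInter K φ s := by
  have hr : Measurable fun z : ℝ × ℝ => rot φ z := (measurePreserving_rot φ).measurable
  have hrb : ∀ (q b s : ℝ), rot φ (q, b) + s • dir (φ + Real.pi / 2) = rot φ (q, b + s) :=
    fun q b s => by simp only [rot]; module
  set I : ℝ → ℝ → ℝ≥0∞ := fun q b => K.indicator 1 (rot φ (q, b)) with hI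
  have hIm : Measurable fun z : ℝ × ℝ => I z.1 z.2 := (measurable_one.indicator hK).comp hr
  have hIq : ∀ q, Measurable (I q) := fun q => hIm.comp measurable_prodMk_left
  have hch : ∀ q, chord K q φ = ∫⁻ b, I q b := fun q => by
    rw [chord, ← lintegral_indicator_one (measurableSet_slice hK q φ)]
    rfl
  have h1 : ∀ q, chord K q φ * chord K q φ = ∫⁻ s, ∫⁻ b, I q b * I q (b + s) := fun q => by
    have hm : Measurable fun z : ℝ × ℝ => I q z.2 * I q (z.2 + z.1) :=
      ((hIq q).comp measurable_snd).mul ((hIq q).comp (measurable_snd.add measurable_fst))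
    rw [lintegral_lintegral_swap hm.aemeasurable, hch, ← lintegral_mul_const _ (hIq q)]
    refine lintegral_congr fun b => ?_
    have hb : Measurable fun s => I q (b + s) := (hIq q).comp (measurable_const_add b)
    rw [lintegral_const_mul _ hb, lintegral_add_left_eq_self]
  have h2 : ∀ s, shiftInter K φ s = ∫⁻ q, ∫⁻ b, I q b * I q (b + s) := fun s => by
    have hs : MeasurableSet {x | x ∈ K ∧ x + s • dir (φ + Real.pi / 2) ∈ K} :=
      hK.inter ((measurable_add_const (s • dir (φ + Real.pi / 2))) hK)
    rw [shiftInter, ← lintegral_indicator_one hs, lintegral_plane φ (measurable_one.indicator hs)]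
    refine lintegral_congr fun q => lintegral_congr fun b => ?_
    simp only [hI, ← hrb]
    by_cases h : rot φ (q, b) ∈ K <;>
      by_cases h' : rot φ (q, b) + s • dir (φ + Real.pi / 2) ∈ K <;> simp [indicator, h, h']
  have hm : Measurable fun z : ℝ × ℝ => ∫⁻ b, I z.1 b * I z.1 (b + z.2) := by
    have h : Measurable fun y : (ℝ × ℝ) × ℝ => I y.1.1 y.2 * I y.1.1 (y.2 + y.1.2) := by
      have ha := hIm.comp (by fun_prop : Measurable fun y : (ℝ × ℝ) × ℝ => (y.1.1, y.2))
      have hb := hIm.comp (by fun_prop : Measurable fun y : (ℝ × ℝ) × ℝ => (y.1.1, y.2 + y.1.2))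
      exact ha.mul hb
    exact h.lintegral_prod_right'
  simp_rw [h1, h2]
  exact lintegral_lintegral_swap hm.aemeasurable

lemma dir_add_sign {ε : ℝ} (hε : ε = 1 ∨ ε = -1) (φ : ℝ) :
    dir (φ + ε * (Real.pi / 2)) = ε • dir (φ + Real.pi / 2) := by
  rcases hε with rfl | rfl
  · simp
  · refine plane_ext ?_ ?_
    · rw [PiLp.smul_apply, dir_apply_zero, dir_apply_zero, neg_one_mul, ← sub_eq_add_neg,
        Real.cos_sub_pi_div_two, Real.cos_add_pi_div_two]
      simp
    · rw [PiLp.smul_apply, dir_apply_one, dir_apply_one, neg_one_mul, ← sub_eq_add_neg,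
        Real.sin_sub_pi_div_two, Real.sin_add_pi_div_two]
      simp

/-- Reversing the direction replaces s by -s, and the covariogram is even. This is why both signs
give the same constant C₂. -/
lemma volume_inter_translate {ε : ℝ} (hε : ε = 1 ∨ ε = -1) (φ s : ℝ) :
    volume (K ∩ (K + {s • dir (φ + ε * (Real.pi / 2))})) = shiftInter K φ s := by
  rw [dir_add_sign hε]
  have : K ∩ (K + {s • ε • dir (φ + Real.pi / 2)}) =
      {x | x ∈ K ∧ x + (-(s * ε)) • dir (φ + Real.pi / 2) ∈ K} := by
    ext x
    simp only [add_singleton, mem_inter_iff, mem_image, mem_ofPred_eq, smul_smul]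
    refine and_congr_right fun _ => ⟨?_, fun h => ⟨_, h, ?_⟩⟩
    · rintro ⟨y, hy, rfl⟩
      simpa using hy
    · simp
  rw [this]
  change shiftInter K φ (-(s * ε)) = _
  rcases hε with rfl | rfl
  · rw [mul_one, shiftInter_neg]
  · simp

lemma norm_smul_dir (c ψ : ℝ) : ‖c • dir ψ‖ = |c| := by
  have h : ‖dir ψ‖ ^ 2 = 1 := by
    rw [norm_sq_plane, dir_apply_zero, dir_apply_one, Real.cos_sq_add_sin_sq]
  have h' : ‖dir ψ‖ = 1 := by
    rw [← sq_eq_sq₀ (norm_nonneg _) zero_le_one, h, one_pow]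
  rw [norm_smul, h', mul_one, Real.norm_eq_abs]

lemma bddAbove_radialExtent {D : ℝ} (hD : ∀ x ∈ K, ‖x‖ ≤ D) (ψ : ℝ) :
    BddAbove {r : ℝ | 0 ≤ r ∧ r • dir ψ ∈ K + (-K)} := by
  refine ⟨2 * D, ?_⟩
  rintro r ⟨hr, x, hx, y, hy, hxy⟩
  have h := norm_add_le x y
  have hxy' : x + y = r • dir ψ := hxy
  rw [hxy', norm_smul_dir, abs_of_nonneg hr] at h
  have h2 := hD _ hy
  rw [norm_neg] at h2
  linarith [hD _ hx]

/-- A common point of K and its translate exhibits the translation vector as a difference of two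
points of K. -/
lemma shiftInter_eq_zero {D : ℝ} (hD : ∀ x ∈ K, ‖x‖ ≤ D) {ε : ℝ} (hε : ε = 1 ∨ ε = -1)
    {φ s : ℝ} (hs0 : 0 ≤ s) (hs : radialExtent K (φ + ε * (Real.pi / 2)) < s) :
    shiftInter K φ s = 0 := by
  rw [← volume_inter_translate hε]
  convert measure_empty (μ := (volume : Measure Plane))
  refine eq_empty_of_forall_notMem fun x hx => not_le.2 hs (le_csSup (bddAbove_radialExtent hD _) ?_)
  obtain ⟨hxK, y, hy, z, hz, hyz⟩ := hx
  rw [mem_singleton_iff] at hz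
  refine ⟨hs0, x, hxK, -y, by simpa using hy, ?_⟩
  simp only at hyz ⊢
  rw [← hyz, hz]
  abel

lemma lintegral_eq_two_mul_of_even {f : ℝ → ℝ≥0∞} (hf : ∀ s, f (-s) = f s) :
    ∫⁻ s, f s = 2 * ∫⁻ s in Ioi 0, f s := by
  rw [← lintegral_add_compl f measurableSet_Ioi (A := Ioi (0 : ℝ)), two_mul, compl_Ioi]
  congr 1
  have h := (Measure.measurePreserving_neg (volume : Measure ℝ)).setLIntegral_comp_preimage_emb
    (MeasurableEquiv.neg ℝ).measurableEmbedding f (Iic 0)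
  rw [← h, neg_preimage, neg_Iic, neg_zero, setLIntegral_congr Ioi_ae_eq_Ici]
  exact lintegral_congr fun s => hf s

/-- Evenness of the covariogram halves the line, and cutting the half-line at the radial extent
removes only zeros. -/
lemma intervalIntegral_shiftInter (hK : IsCompact K) (h0 : (0 : Plane) ∈ K) {ε : ℝ}
    (hε : ε = 1 ∨ ε = -1) (φ : ℝ) :
    2 * ∫ s in (0 : ℝ)..radialExtent K (φ + ε * (Real.pi / 2)),
      (volume (K ∩ (K + {s • dir (φ + ε * (Real.pi / 2))}))).toReal =
    (∫⁻ q, chord K q φ * chord K q φ).toReal := by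
  obtain ⟨D, hD⟩ := hK.isBounded.exists_norm_le
  simp_rw [volume_inter_translate hε]
  set r := radialExtent K (φ + ε * (Real.pi / 2)) with hr
  -- The value 0 competes in the supremum, so the interval integral has its usual orientation.
  have hr0 : 0 ≤ r := le_csSup (bddAbove_radialExtent hD _)
    ⟨le_rfl, 0, h0, 0, by simpa using h0, by simp⟩
  have hm := measurable_shiftInter hK.measurableSet φ
  have hlt : ∀ s, shiftInter K φ s < ∞ := fun s =>
    (measure_mono fun x hx => hx.1).trans_lt hK.measure_lt_top
  rw [intervalIntegral.integral_of_le hr0, integral_toReal hm.aemeasurable (ae_of_all _ hlt),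
    lintegral_chord_sq hK.measurableSet, lintegral_eq_two_mul_of_even (shiftInter_neg K φ),
    ENNReal.toReal_mul, ENNReal.toReal_ofNat]
  congr 2
  rw [← lintegral_indicator measurableSet_Ioc, ← lintegral_indicator measurableSet_Ioi]
  refine lintegral_congr fun s => ?_
  by_cases hs : s ∈ Ioc 0 r
  · rw [indicator_of_mem hs, indicator_of_mem (show s ∈ Ioi 0 from hs.1)]
  · rw [indicator_of_notMem hs]
    by_cases hs0 : s ∈ Ioi 0
    · rw [indicator_of_mem hs0, shiftInter_eq_zero hD hε (le_of_lt hs0)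
        (not_le.1 fun h => hs ⟨hs0, h⟩)]
    · rw [indicator_of_notMem hs0]

variable {μ : Measure Ω} {P Φ R : ℤ → Ω → ℝ}

lemma baseLength_eq (hM : IsIndependentMarking P Φ R μ) (ω : Ω) : baseLength R ω = 2 * R 0 ω := by
  rw [baseLength, Real.volume_Icc, ENNReal.toReal_ofReal]
  · ring
  · linarith [hM.radius_nonneg 0 ω]

lemma lintegral_chord_sq_le {D : ℝ} (hK : MeasurableSet K) (hD : ∀ x ∈ K, ‖x‖ ≤ D) (φ : ℝ) :
    ∫⁻ q, chord K q φ * chord K q φ ≤ volume K * ENNReal.ofReal (2 * D) := by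
  have hc : Measurable fun q => chord K q φ := measurable_chord_comp hK measurable_id measurable_const
  rw [← lintegral_chord hK φ, ← lintegral_mul_const _ hc]
  exact lintegral_mono fun q => mul_le_mul_right (chord_le hD _ _) _

lemma measurable_lintegral_chord_sq (hK : MeasurableSet K) :
    Measurable fun φ => ∫⁻ q, chord K q φ * chord K q φ := by
  have h : Measurable fun z : ℝ × ℝ => chord K z.2 z.1 :=
    measurable_chord_comp hK measurable_snd measurable_fst
  exact (h.mul h).lintegral_prod_right'

lemma two_mul_constTwo (hM : IsIndependentMarking P Φ R μ) (hK : IsCompact K) (h0 : (0 : Plane) ∈ K)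
    {ε : ℝ} (hε : ε = 1 ∨ ε = -1) : 2 * constTwo K Φ μ ε =
      (∫⁻ ω, ∫⁻ q, chord K q (Φ 0 ω) * chord K q (Φ 0 ω) ∂volume ∂μ).toReal := by
  obtain ⟨D, hD⟩ := hK.isBounded.exists_norm_le
  have hm := measurable_lintegral_chord_sq hK.measurableSet
  have hΦ := hM.measurable_angle 0
  have hres : (μ.map (Φ 0)).restrict (Icc 0 Real.pi) = μ.map (Φ 0) :=
    Measure.restrict_eq_self_of_ae_mem
      ((ae_map_iff hΦ.aemeasurable measurableSet_Icc).2 (ae_of_all _ (hM.angle_mem 0)))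
  rw [constTwo, hres, ← integral_const_mul]
  simp_rw [intervalIntegral_shiftInter hK h0 hε]
  have hmΦ : Measurable fun ω => ∫⁻ q, chord K q (Φ 0 ω) * chord K q (Φ 0 ω) := hm.comp hΦ
  rw [integral_map hΦ.aemeasurable hm.ennreal_toReal.aestronglyMeasurable,
    integral_toReal hmΦ.aemeasurable (ae_of_all _ fun ω =>
      (lintegral_chord_sq_le hK.measurableSet hD _).trans_lt
        (ENNReal.mul_lt_top hK.measure_lt_top ENNReal.ofReal_lt_top))]

/-- Independence of angle and radius splits the expectation, leaving the second moment of the base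
length. -/
lemma toReal_lintegral_radius_sq_mul [IsProbabilityMeasure μ] (hM : IsIndependentMarking P Φ R μ) (hK : IsCompact K)
    (h0 : (0 : Plane) ∈ K) {ε : ℝ} (hε : ε = 1 ∨ ε = -1) :
    (∫⁻ ω, ENNReal.ofReal (2 * R 0 ω) ^ 2 *
      ∫⁻ q, chord K q (Φ 0 ω) * chord K q (Φ 0 ω) ∂volume ∂μ).toReal =
      2 * (∫ ω, baseLength R ω ^ 2 ∂μ) * constTwo K Φ μ ε := by
  have hm := measurable_lintegral_chord_sq hK.measurableSet
  have hm2 : Measurable fun r : ℝ => ENNReal.ofReal (2 * r) ^ 2 := by fun_prop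
  have hind := hM.indep_angle_radius.symm.comp hm2 hm
  have hRm := hM.measurable_radius 0
  have := lintegral_mul_eq_lintegral_mul_lintegral_of_indepFun
    (hm2.comp hRm) (hm.comp (hM.measurable_angle 0)) hind
  have e : ∫⁻ ω, ENNReal.ofReal (2 * R 0 ω) ^ 2 *
      ∫⁻ q, chord K q (Φ 0 ω) * chord K q (Φ 0 ω) ∂volume ∂μ =
      (∫⁻ ω, ENNReal.ofReal (2 * R 0 ω) ^ 2 ∂μ) *
        ∫⁻ ω, ∫⁻ q, chord K q (Φ 0 ω) * chord K q (Φ 0 ω) ∂volume ∂μ := this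
  rw [e, ENNReal.toReal_mul, ← two_mul_constTwo hM hK h0 hε]
  have e2 : ∫ ω, baseLength R ω ^ 2 ∂μ = (∫⁻ ω, ENNReal.ofReal (2 * R 0 ω) ^ 2 ∂μ).toReal := by
    have hm3 : Measurable fun ω => ENNReal.ofReal (2 * R 0 ω) ^ 2 := by fun_prop
    rw [← integral_toReal hm3.aemeasurable (ae_of_all _ fun ω =>
      ENNReal.pow_lt_top ENNReal.ofReal_lt_top)]
    refine integral_congr_ae (ae_of_all _ fun ω => ?_)
    simp only
    rw [baseLength_eq hM, ENNReal.toReal_pow, ENNReal.toReal_ofReal]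
    linarith [hM.radius_nonneg 0 ω]
  rw [e2]
  ring

lemma integral_baseLength (hM : IsIndependentMarking P Φ R μ) :
    ∫ ω, baseLength R ω ∂μ = (∫⁻ ω, ENNReal.ofReal (2 * R 0 ω) ∂μ).toReal := by
  have hRm := hM.measurable_radius 0
  rw [← integral_toReal (by fun_prop) (ae_of_all _ fun ω => ENNReal.ofReal_lt_top)]
  refine integral_congr_ae (ae_of_all _ fun ω => ?_)
  simp only
  rw [baseLength_eq hM, ENNReal.toReal_ofReal]
  linarith [hM.radius_nonneg 0 ω]

/-- Independence splits the mean before it is squared, hence the squared first moment of the base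
length here. -/
lemma toReal_lintegral_meanChord_sq [IsProbabilityMeasure μ] (hM : IsIndependentMarking P Φ R μ) (hK : IsCompact K) :
    (∫⁻ p, meanChord K μ (Φ 0) (R 0) p * meanChord K μ (Φ 0) (R 0) p).toReal =
      (∫ ω, baseLength R ω ∂μ) ^ 2 * constOne K Φ μ := by
  obtain ⟨D, hD⟩ := hK.isBounded.exists_norm_le
  have hKm := hK.measurableSet
  have hΦ := hM.measurable_angle 0
  set m := ∫⁻ ω, ENNReal.ofReal (2 * R 0 ω) ∂μ with hmdef
  set a : ℝ → ℝ≥0∞ := fun p => ∫⁻ ω, chord K p (Φ 0 ω) ∂μ with ha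
  have hcp : ∀ p, Measurable fun φ => chord K p φ := fun p =>
    measurable_chord_comp hKm measurable_const measurable_id
  have hmean : ∀ p, meanChord K μ (Φ 0) (R 0) p = m * a p := fun p => by
    have hm2 : Measurable fun r : ℝ => ENNReal.ofReal (2 * r) := by fun_prop
    exact lintegral_mul_eq_lintegral_mul_lintegral_of_indepFun
      (hm2.comp (hM.measurable_radius 0)) ((hcp p).comp hΦ)
      (hM.indep_angle_radius.symm.comp hm2 (hcp p))
  have ham : Measurable a := by
    have h : Measurable fun z : ℝ × Ω => chord K z.1 (Φ 0 z.2) :=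
      measurable_chord_comp hKm measurable_fst (hΦ.comp measurable_snd)
    exact h.lintegral_prod_right'
  have hale : ∀ p, a p ≤ ENNReal.ofReal (2 * D) := fun p => by
    refine (lintegral_mono fun ω => chord_le hD _ _).trans ?_
    simp
  have halt : ∀ p, a p < ∞ := fun p => (hale p).trans_lt ENNReal.ofReal_lt_top
  have hpt : ∀ p, (∫ ω, chordLength K p (Φ 0 ω) ∂μ) ^ 2 = (a p * a p).toReal := fun p => by
    simp_rw [chordLength_eq]
    have hc : Measurable fun ω => chord K p (Φ 0 ω) := (hcp p).comp hΦ
    rw [integral_toReal hc.aemeasurable (ae_of_all _ fun ω =>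
      (chord_le hD _ _).trans_lt ENNReal.ofReal_lt_top), ENNReal.toReal_mul, sq]
  have haa : Measurable fun p => a p * a p := ham.mul ham
  have e : ∀ p, meanChord K μ (Φ 0) (R 0) p * meanChord K μ (Φ 0) (R 0) p = m ^ 2 * (a p * a p) :=
    fun p => by rw [hmean]; ring
  simp_rw [e]
  rw [lintegral_const_mul _ haa, ENNReal.toReal_mul, ENNReal.toReal_pow, integral_baseLength hM,
    constOne]
  simp_rw [hpt]
  rw [integral_toReal haa.aemeasurable (ae_of_all _ fun p => ENNReal.mul_lt_top (halt p) (halt p))]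

end

end PlanarCylinder

end

noncomputable section

namespace PlanarCylinder

variable {Ω : Type*} [MeasurableSpace Ω]

/-! ### The variance as a double integral of covariances -/

section

variable {μ : Measure Ω} {P Φ R : ℤ → Ω → ℝ}

/-- The pairs of a point and an outcome for which the point is not covered. -/
def vacantSet (P Φ R : ℤ → Ω → ℝ) : Set (Plane × Ω) :=
  {z | ∀ i, (P i z.2, Φ i z.2, R i z.2) ∉ strip z.1}

lemma measurableSet_vacantSet (hP : IsStationaryPointProcess P μ)
    (hM : IsIndependentMarking P Φ R μ) : MeasurableSet (vacantSet P Φ R) := by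
  have : vacantSet P Φ R = ⋂ i, {z : Plane × Ω | (P i z.2, Φ i z.2, R i z.2) ∈ strip z.1}ᶜ := by
    ext z
    simp [vacantSet]
  rw [this]
  refine MeasurableSet.iInter fun i => ?_
  have h1 := hP.measurable i
  have h2 := hM.measurable_angle i
  have h3 := hM.measurable_radius i
  have h : Measurable fun z : Plane × Ω => (z.1, P i z.2, Φ i z.2, R i z.2) := by fun_prop
  exact (h measurableSet_strip_pair).compl

lemma voidProb_strip_union (x y : Plane) : voidProb P Φ R μ (strip x ∪ strip y) =
    μ.real {ω | (x, ω) ∈ vacantSet P Φ R ∧ (y, ω) ∈ vacantSet P Φ R} := by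
  unfold voidProb vacantSet
  congr 1
  ext ω
  simp only [mem_union, not_or, mem_ofPred_eq]
  exact forall_and

lemma measurable_voidProb_strip_union [IsFiniteMeasure μ] (hP : IsStationaryPointProcess P μ)
    (hM : IsIndependentMarking P Φ R μ) :
    Measurable fun z : Plane × Plane => voidProb P Φ R μ (strip z.1 ∪ strip z.2) := by
  simp_rw [voidProb_strip_union]
  have hS := measurableSet_vacantSet hP hM
  have h1 : Measurable fun q : (Plane × Plane) × Ω => (q.1.1, q.2) := by fun_prop
  have h2 : Measurable fun q : (Plane × Plane) × Ω => (q.1.2, q.2) := by fun_prop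
  have := measurable_measure_prodMk_left (ν := μ) ((h1 hS).inter (h2 hS))
  exact this.ennreal_toReal

lemma measurable_voidProb_strip [IsFiniteMeasure μ] (hP : IsStationaryPointProcess P μ)
    (hM : IsIndependentMarking P Φ R μ) :
    Measurable fun x : Plane => voidProb P Φ R μ (strip x) := by
  have h := (measurable_voidProb_strip_union hP hM).comp (measurable_id.prodMk measurable_id)
  simpa [Function.comp_def] using h

lemma integrable_of_abs_le {β : Type*} [MeasurableSpace β] (κ : Measure β) [IsFiniteMeasure κ]
    {g : β → ℝ} (C : ℝ) (hg : Measurable g) (h : ∀ b, |g b| ≤ C) : Integrable g κ :=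
  (integrable_const C).mono' hg.aestronglyMeasurable (ae_of_all _ h)

/-- The covered area is the constant |L| minus the vacant area Y, so the two have the same variance.
Fubini's theorem turns E Y² and (E Y)² into integrals over L × L of void probabilities. -/
lemma variance_volume_eq [IsProbabilityMeasure μ] (hP : IsStationaryPointProcess P μ)
    (hM : IsIndependentMarking P Φ R μ) {L : Set Plane}
    (hLt : volume L ≠ ∞) :
    variance (fun ω => (volume (cylinderProcess P Φ R ω ∩ L)).toReal) μ =
      ∫ z : Plane × Plane, (voidProb P Φ R μ (strip z.1 ∪ strip z.2) -
        voidProb P Φ R μ (strip z.1) * voidProb P Φ R μ (strip z.2))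
          ∂((volume.restrict L).prod (volume.restrict L)) := by
  have hS := measurableSet_vacantSet hP hM
  have : IsFiniteMeasure (volume.restrict L) := ⟨by simpa using hLt.lt_top⟩
  set V := vacantSet P Φ R with hV
  set f : Plane → Ω → ℝ := fun x ω => V.indicator 1 (x, ω) with hf
  have hfm : Measurable fun z : Plane × Ω => f z.1 z.2 := measurable_one.indicator hS
  have hf01 : ∀ x ω, |f x ω| ≤ 1 := fun x ω => by
    simp only [hf, indicator]
    split_ifs <;> simp
  have hSω : ∀ ω, MeasurableSet {x | (x, ω) ∈ V} := fun ω => measurable_prodMk_right hS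
  have hSx : ∀ x, MeasurableSet {ω | (x, ω) ∈ V} := fun x => measurable_prodMk_left hS
  set Y : Ω → ℝ := fun ω => ∫ x in L, f x ω with hY
  have hYm : StronglyMeasurable Y := hfm.stronglyMeasurable.integral_prod_left'
  have hYle : ∀ ω, ‖Y ω‖ ≤ volume.real L := fun ω => by
    have := norm_setIntegral_le_of_norm_le_const (μ := volume) (s := L) (f := fun x => f x ω)
      (C := 1) hLt.lt_top fun x _ => hf01 x ω
    simpa using this
  have hXY : (fun ω => (volume (cylinderProcess P Φ R ω ∩ L)).toReal) =
      fun ω => volume.real L - Y ω := by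
    funext ω
    have e1 : Y ω = (volume.restrict L).real {x | (x, ω) ∈ V} := integral_indicator_one (hSω ω)
    have e2 : cylinderProcess P Φ R ω ∩ L = L \ {x | (x, ω) ∈ V} := by
      ext x
      simp only [mem_inter_iff, Set.mem_sdiff, mem_cylinderProcess, hV, vacantSet, mem_ofPred_eq,
        not_forall, not_not]
      exact and_comm
    rw [e1, measureReal_restrict_apply (hSω ω), e2, inter_comm]
    have e3 := measureReal_inter_add_sdiff (μ := volume) (s := L) (hSω ω) hLt
    change volume.real (L \ _) = _
    linarith
  rw [hXY, variance_const_sub hYm.aestronglyMeasurable]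
  have hYL : MemLp Y 2 μ := MemLp.of_bound hYm.aestronglyMeasurable _ (ae_of_all _ hYle)
  rw [variance_eq_sub hYL]
  set m₂ := (volume.restrict L).prod (volume.restrict L) with hm₂
  have hF : Measurable fun q : Ω × (Plane × Plane) => f q.2.1 q.1 * f q.2.2 q.1 := by
    have h1 := hfm.comp (by fun_prop : Measurable fun q : Ω × (Plane × Plane) => (q.2.1, q.1))
    have h2 := hfm.comp (by fun_prop : Measurable fun q : Ω × (Plane × Plane) => (q.2.2, q.1))
    exact h1.mul h2
  have hEY2 : ∫ ω, (Y ^ 2) ω ∂μ = ∫ z, voidProb P Φ R μ (strip z.1 ∪ strip z.2) ∂m₂ := by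
    have e1 : ∀ ω, (Y ^ 2) ω = ∫ z, f z.1 ω * f z.2 ω ∂m₂ := fun ω => by
      rw [hm₂, integral_prod_mul (fun x => f x ω) fun x => f x ω, Pi.pow_apply, sq]
    simp_rw [e1]
    rw [integral_integral_swap (f := fun ω (z : Plane × Plane) => f z.1 ω * f z.2 ω)
      (integrable_of_abs_le (μ.prod m₂) 1 hF fun q => by
        change |f q.2.1 q.1 * f q.2.2 q.1| ≤ 1
        rw [abs_mul]
        exact mul_le_one₀ (hf01 _ _) (abs_nonneg _) (hf01 _ _))]
    refine integral_congr_ae (ae_of_all _ fun z => ?_)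
    simp only
    have e2 : {ω | (z.1, ω) ∈ V ∧ (z.2, ω) ∈ V} = {ω | (z.1, ω) ∈ V} ∩ {ω | (z.2, ω) ∈ V} := rfl
    rw [voidProb_strip_union, e2, ← integral_indicator_one ((hSx z.1).inter (hSx z.2))]
    refine integral_congr_ae (ae_of_all _ fun ω => ?_)
    simp only
    rw [inter_indicator_one]
    rfl
  have hEY : ∫ ω, Y ω ∂μ = ∫ x in L, voidProb P Φ R μ (strip x) := by
    have hfs : Measurable fun q : Ω × Plane => f q.2 q.1 := by
      have h := hfm.comp (measurable_swap (α := Ω) (β := Plane))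
      exact h
    have hi : Integrable (fun q : Ω × Plane => f q.2 q.1) (μ.prod (volume.restrict L)) :=
      integrable_of_abs_le _ 1 hfs fun q => hf01 _ _
    rw [hY, integral_integral_swap (f := fun ω (x : Plane) => f x ω) hi]
    refine integral_congr_ae (ae_of_all _ fun x => ?_)
    exact integral_indicator_one (hSx x)
  have hv1 : ∀ A, |voidProb P Φ R μ A| ≤ 1 := fun A => by
    rw [abs_of_nonneg (show 0 ≤ voidProb P Φ R μ A from measureReal_nonneg)]
    exact voidProb_le_one A
  have hvm := measurable_voidProb_strip hP hM
  rw [hEY2, hEY, sq, ← integral_prod_mul (fun x => voidProb P Φ R μ (strip x)) fun x =>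
    voidProb P Φ R μ (strip x), integral_sub]
  · exact integrable_of_abs_le m₂ 1 (measurable_voidProb_strip_union hP hM) fun z => hv1 _
  · refine integrable_of_abs_le m₂ 1 ((hvm.comp measurable_fst).mul (hvm.comp measurable_snd)) fun z => ?_
    rw [abs_mul]
    exact mul_le_one₀ (hv1 _) (abs_nonneg _) (hv1 _)

/-! ### Double integrals of the terms in the covariance expansion -/

lemma measurable_lintegral_hitProb_inter [IsFiniteMeasure μ] (hM : IsIndependentMarking P Φ R μ) :
    Measurable fun z : Plane × Plane =>
      ∫⁻ p, ENNReal.ofReal (hitProb Φ R μ (strip z.1 ∩ strip z.2) p) := by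
  simp_rw [ofReal_hitProb]
  have hS := measurableSet_strip_mark hM
  have h1 : Measurable fun q : ((Plane × Plane) × ℝ) × Ω => (q.1.1.1, q.1.2, q.2) := by fun_prop
  have h2 : Measurable fun q : ((Plane × Plane) × ℝ) × Ω => (q.1.1.2, q.1.2, q.2) := by fun_prop
  have := measurable_measure_prodMk_left (ν := μ) ((h1 hS).inter (h2 hS))
  exact this.lintegral_prod_right'

lemma measurable_cross_strip [IsFiniteMeasure μ] (hM : IsIndependentMarking P Φ R μ)
    (κ : Measure ℝ) [IsFiniteMeasure κ] : Measurable fun z : Plane × Plane =>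
      cross κ (hitProb Φ R μ (strip z.1)) (hitProb Φ R μ (strip z.2)) := by
  have hh := measurable_hitProb_strip (μ := μ) hM
  have hhx : ∀ x, Measurable (hitProb Φ R μ (strip x)) := fun x =>
    measurable_hitProb hM (measurableSet_strip x)
  simp_rw [fun x y => cross_eq_lintegral_prod κ (hhx x) (hhx y)]
  have h1 := hh.comp (by fun_prop :
    Measurable fun q : (Plane × Plane) × (ℝ × ℝ) => (q.1.1, q.2.1))
  have h2 := hh.comp (by fun_prop :
    Measurable fun q : (Plane × Plane) × (ℝ × ℝ) => (q.1.2, q.2.2 + q.2.1))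
  have h3 := h1.mul h2
  exact h3.lintegral_prod_right'

/-- A pair is bad when x is near the origin, y is near the origin or x is near y. Each event costs
the area of a disc times |L|, which is linear in |L| while the whole product has measure |L|². -/
lemma measure_near_diagonal_le {L : Set Plane} (hLt : volume L ≠ ∞) (M : ℝ) :
    ((volume.restrict L).prod (volume.restrict L))
      {z : Plane × Plane | ¬ (M ≤ ‖z.1‖ ∧ M ≤ ‖z.2‖ ∧ M ≤ ‖z.1 - z.2‖)} ≤
      3 * (volume (Metric.ball (0 : Plane) M) * volume L) := by
  have : IsFiniteMeasure (volume.restrict L) := ⟨by simpa using hLt.lt_top⟩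
  set m := volume.restrict L with hm
  have hmu : m univ = volume L := by rw [hm, Measure.restrict_apply_univ]
  set B := Metric.ball (0 : Plane) M with hB
  have hBm : m B ≤ volume B := Measure.restrict_apply_le _ _
  have hD : MeasurableSet {z : Plane × Plane | z.1 - z.2 ∈ B} :=
    (measurable_fst.sub measurable_snd) Metric.isOpen_ball.measurableSet
  have hsub : {z : Plane × Plane | ¬ (M ≤ ‖z.1‖ ∧ M ≤ ‖z.2‖ ∧ M ≤ ‖z.1 - z.2‖)} ⊆
      (B ×ˢ univ ∪ univ ×ˢ B) ∪ {z | z.1 - z.2 ∈ B} := by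
    intro z hz
    by_contra hcon
    simp only [mem_union, mem_prod, mem_univ, and_true, true_and, not_or, mem_ofPred_eq, hB,
      mem_ball_zero_iff, not_lt] at hcon
    exact hz ⟨hcon.1.1, hcon.1.2, hcon.2⟩
  refine (measure_mono hsub).trans ((measure_union_le _ _).trans ?_)
  have h1 : (m.prod m) (B ×ˢ univ ∪ univ ×ˢ B) ≤ volume B * volume L + volume L * volume B := by
    refine (measure_union_le _ _).trans ?_
    rw [Measure.prod_prod, Measure.prod_prod, hmu]
    gcongr
  have h2 : (m.prod m) {z | z.1 - z.2 ∈ B} ≤ volume L * volume B := by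
    rw [Measure.prod_apply hD, ← hmu, mul_comm, ← lintegral_const]
    refine lintegral_mono fun x => (Measure.restrict_apply_le _ _).trans (le_of_eq ?_)
    have : Prod.mk x ⁻¹' {z : Plane × Plane | z.1 - z.2 ∈ B} = Metric.ball x M := by
      ext y
      simp only [mem_preimage, mem_ofPred_eq, hB, Metric.mem_ball, dist_eq_norm]
      rw [sub_zero, norm_sub_rev]
    rw [this, hB]
    exact Measure.addHaar_ball_center _ _ _
  calc _ ≤ volume B * volume L + volume L * volume B + volume L * volume B := add_le_add h1 h2
    _ = _ := by ring

end

end PlanarCylinder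

end

noncomputable section

namespace PlanarCylinder

variable {Ω : Type*} [MeasurableSpace Ω]

/-! ### The asymptotic variance -/

section

variable {μ : Measure Ω} {P Φ R : ℤ → Ω → ℝ} {K : Set Plane}

lemma lintegral_radius_ne_top [IsProbabilityMeasure μ] {r : Ω → ℝ}
    (hR : Integrable (fun ω => r ω ^ 2) μ) : ∫⁻ ω, ENNReal.ofReal (2 * r ω) ∂μ ≠ ∞ := by
  have hi : Integrable (fun ω => 1 + r ω ^ 2) μ := (integrable_const 1).add hR
  refine ne_top_of_le_ne_top hi.lintegral_lt_top.ne (lintegral_mono fun ω => ?_)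
  exact ENNReal.ofReal_le_ofReal (by nlinarith [sq_nonneg (r ω - 1)])

lemma lintegral_radius_sq_ne_top {r : Ω → ℝ} (h0 : ∀ ω, 0 ≤ r ω)
    (hR : Integrable (fun ω => r ω ^ 2) μ) : ∫⁻ ω, ENNReal.ofReal (2 * r ω) ^ 2 ∂μ ≠ ∞ := by
  have hi : Integrable (fun ω => 4 * r ω ^ 2) μ := hR.const_mul 4
  refine ne_top_of_le_ne_top hi.lintegral_lt_top.ne (lintegral_mono fun ω => ?_)
  rw [← ENNReal.ofReal_pow (by linarith [h0 ω])]
  exact ENNReal.ofReal_le_ofReal (by nlinarith)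

lemma integral_baseLength_nonneg (μ : Measure Ω) (R : ℤ → Ω → ℝ) : 0 ≤ ∫ ω, baseLength R ω ∂μ :=
  integral_nonneg fun _ => ENNReal.toReal_nonneg

variable [IsProbabilityMeasure μ]

lemma integrable_hitProb_strip (hM : IsIndependentMarking P Φ R μ)
    (hRi : ∫⁻ ω, ENNReal.ofReal (2 * R 0 ω) ∂μ ≠ ∞) (x : Plane) :
    Integrable (hitProb Φ R μ (strip x)) := by
  refine ⟨(measurable_hitProb hM (measurableSet_strip x)).aestronglyMeasurable, ?_⟩
  rw [hasFiniteIntegral_iff_ofReal (ae_of_all _ fun p => hitProb_nonneg _ p),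
    lintegral_hitProb_strip hM]
  exact hRi.lt_top

lemma integral_hitProb_eq (hM : IsIndependentMarking P Φ R μ) {A : Set (ℝ × ℝ × ℝ)}
    (hA : MeasurableSet A) : ∫ p, hitProb Φ R μ A p =
      (∫⁻ p, ENNReal.ofReal (hitProb Φ R μ A p)).toReal :=
  integral_eq_lintegral_of_nonneg_ae (ae_of_all _ fun p => hitProb_nonneg _ p)
    (measurable_hitProb hM hA).aestronglyMeasurable

lemma integral_hitProb_strip (hM : IsIndependentMarking P Φ R μ) (x : Plane) :
    ∫ p, hitProb Φ R μ (strip x) p = ∫ ω, baseLength R ω ∂μ := by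
  rw [integral_hitProb_eq hM (measurableSet_strip x), lintegral_hitProb_strip hM,
    integral_baseLength hM]

lemma lintegral_hitProb_inter_le_mean (hM : IsIndependentMarking P Φ R μ) (x y : Plane) :
    ∫⁻ p, ENNReal.ofReal (hitProb Φ R μ (strip x ∩ strip y) p) ≤
      ∫⁻ ω, ENNReal.ofReal (2 * R 0 ω) ∂μ := by
  rw [← lintegral_hitProb_strip hM x]
  exact lintegral_mono fun p => ENNReal.ofReal_le_ofReal (hitProb_mono inter_subset_left p)

lemma integral_hitProb_inter_le (hM : IsIndependentMarking P Φ R μ)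
    (hRi : ∫⁻ ω, ENNReal.ofReal (2 * R 0 ω) ∂μ ≠ ∞) (x y : Plane) :
    ∫ p, hitProb Φ R μ (strip x ∩ strip y) p ≤ ∫ ω, baseLength R ω ∂μ := by
  rw [integral_hitProb_eq hM ((measurableSet_strip x).inter (measurableSet_strip y)),
    integral_baseLength hM]
  exact ENNReal.toReal_mono hRi (lintegral_hitProb_inter_le_mean hM x y)

lemma measurable_integral_hitProb_inter (hM : IsIndependentMarking P Φ R μ) :
    Measurable fun z : Plane × Plane => ∫ p, hitProb Φ R μ (strip z.1 ∩ strip z.2) p := by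
  simp_rw [fun x y => integral_hitProb_eq hM ((measurableSet_strip x).inter (measurableSet_strip y))]
  exact (measurable_lintegral_hitProb_inter hM).ennreal_toReal

lemma integral_integral_hitProb_inter (hM : IsIndependentMarking P Φ R μ)
    (hRi : ∫⁻ ω, ENNReal.ofReal (2 * R 0 ω) ∂μ ≠ ∞) (hK : MeasurableSet K) {ρ : ℝ} (hρ : 0 < ρ) :
    ∫ z : Plane × Plane, ∫ p, hitProb Φ R μ (strip z.1 ∩ strip z.2) p
        ∂volume ∂((volume.restrict (ρ • K)).prod (volume.restrict (ρ • K))) =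
      ρ ^ 3 * (∫⁻ ω, ∫⁻ q, stripArea K ρ q (Φ 0 ω) (R 0 ω) *
        stripArea K ρ q (Φ 0 ω) (R 0 ω) ∂volume ∂μ).toReal := by
  simp_rw [fun x y => integral_hitProb_eq hM ((measurableSet_strip x).inter (measurableSet_strip y))]
  have hm := measurable_lintegral_hitProb_inter (μ := μ) hM
  rw [integral_toReal hm.aemeasurable (ae_of_all _ fun z =>
      (lintegral_hitProb_inter_le_mean hM z.1 z.2).trans_lt hRi.lt_top),
    lintegral_prod _ hm.aemeasurable, lintegral_hitProb_inter_strip hM hK hρ, ENNReal.toReal_mul,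
    ENNReal.toReal_pow, ENNReal.toReal_ofReal hρ.le]

lemma cross_strip_ne_top (hM : IsIndependentMarking P Φ R μ)
    (hRi : ∫⁻ ω, ENNReal.ofReal (2 * R 0 ω) ∂μ ≠ ∞) (κ : Measure ℝ) [IsFiniteMeasure κ]
    (x y : Plane) : cross κ (hitProb Φ R μ (strip x)) (hitProb Φ R μ (strip y)) ≠ ∞ :=
  cross_ne_top (δ := 1) (integrable_hitProb_strip hM hRi x) (fun p => hitProb_nonneg (strip x) p)
    (hitProb_le_one (μ := μ) (strip y))

lemma cross_strip_toReal_le (hM : IsIndependentMarking P Φ R μ)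
    (hRi : ∫⁻ ω, ENNReal.ofReal (2 * R 0 ω) ∂μ ≠ ∞) (κ : Measure ℝ) [IsFiniteMeasure κ]
    (x y : Plane) : (cross κ (hitProb Φ R μ (strip x)) (hitProb Φ R μ (strip y))).toReal ≤
      (∫ ω, baseLength R ω ∂μ) * κ.real univ := by
  have := cross_toReal_le (κ := κ) (integrable_hitProb_strip hM hRi x) (hitProb_nonneg _)
    (hitProb_le_one (Φ := Φ) (R := R) (μ := μ) (strip y)) zero_le_one (integral_hitProb_strip hM x).le
  rwa [one_mul] at this

lemma integral_cross_strip (hM : IsIndependentMarking P Φ R μ)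
    (hRi : ∫⁻ ω, ENNReal.ofReal (2 * R 0 ω) ∂μ ≠ ∞) (hK : MeasurableSet K)
    (κ : Measure ℝ) [IsFiniteMeasure κ] {ρ : ℝ} (hρ : 0 < ρ) :
    ∫ z : Plane × Plane, (cross κ (hitProb Φ R μ (strip z.1)) (hitProb Φ R μ (strip z.2))).toReal
        ∂((volume.restrict (ρ • K)).prod (volume.restrict (ρ • K))) =
      ρ ^ 3 * (∫⁻ t, ∫⁻ q, meanStrip K μ (Φ 0) (R 0) ρ q *
        meanStrip K μ (Φ 0) (R 0) ρ (q + t / ρ) ∂volume ∂κ).toReal := by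
  have hm := measurable_cross_strip (μ := μ) hM κ
  rw [integral_toReal hm.aemeasurable (ae_of_all _ fun z =>
      (cross_strip_ne_top hM hRi κ z.1 z.2).lt_top),
    lintegral_prod _ hm.aemeasurable, lintegral_cross_strip hM hK κ hρ, ENNReal.toReal_mul,
    ENNReal.toReal_pow, ENNReal.toReal_ofReal hρ.le]

lemma volume_real_smul_plane (ρ : ℝ) : volume.real (ρ • K) = ρ ^ 2 * volume.real K := by
  rw [Measure.real, Measure.addHaar_smul, finrank_euclideanSpace_fin, ENNReal.toReal_mul,
    ENNReal.toReal_ofReal (abs_nonneg _), abs_pow, sq_abs]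
  rfl

/-- The leading term of the covariance of the indicators that two points are vacant. -/
def leadingCovariance (P Φ R : ℤ → Ω → ℝ) (μ : Measure Ω) (γ₁ γ₂ : Measure ℝ)
    (z : Plane × Plane) : ℝ :=
  Real.exp (-2 * intensity P μ * ∫ ω, baseLength R ω ∂μ) * (intensity P μ *
    ((∫ p, hitProb Φ R μ (strip z.1 ∩ strip z.2) p) +
      (cross γ₁ (hitProb Φ R μ (strip z.1)) (hitProb Φ R μ (strip z.2))).toReal -
      (cross γ₂ (hitProb Φ R μ (strip z.1)) (hitProb Φ R μ (strip z.2))).toReal))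

lemma measurable_leadingCovariance (hM : IsIndependentMarking P Φ R μ) (γ₁ γ₂ : Measure ℝ)
    [IsFiniteMeasure γ₁] [IsFiniteMeasure γ₂] : Measurable (leadingCovariance P Φ R μ γ₁ γ₂) :=
  (((measurable_integral_hitProb_inter hM).add (measurable_cross_strip hM γ₁).ennreal_toReal).sub
    (measurable_cross_strip hM γ₂).ennreal_toReal).const_mul _ |>.const_mul _

lemma abs_leadingCovariance_le (hM : IsIndependentMarking P Φ R μ)
    (hRi : ∫⁻ ω, ENNReal.ofReal (2 * R 0 ω) ∂μ ≠ ∞) (γ₁ γ₂ : Measure ℝ)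
    [IsFiniteMeasure γ₁] [IsFiniteMeasure γ₂] (z : Plane × Plane) :
    |leadingCovariance P Φ R μ γ₁ γ₂ z| ≤ intensity P μ * ((∫ ω, baseLength R ω ∂μ) +
      (∫ ω, baseLength R ω ∂μ) * γ₁.real univ + (∫ ω, baseLength R ω ∂μ) * γ₂.real univ) := by
  set m := ∫ ω, baseLength R ω ∂μ with hm
  have hm0 : 0 ≤ m := integral_baseLength_nonneg μ R
  have hl : 0 ≤ intensity P μ := ENNReal.toReal_nonneg
  have h1 := integral_hitProb_inter_le hM hRi z.1 z.2
  have h1' : 0 ≤ ∫ p, hitProb Φ R μ (strip z.1 ∩ strip z.2) p :=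
    integral_nonneg fun p => hitProb_nonneg _ p
  have h2 := cross_strip_toReal_le hM hRi γ₁ z.1 z.2
  have h3 := cross_strip_toReal_le hM hRi γ₂ z.1 z.2
  have h2' : 0 ≤ (cross γ₁ (hitProb Φ R μ (strip z.1)) (hitProb Φ R μ (strip z.2))).toReal :=
    ENNReal.toReal_nonneg
  have h3' : 0 ≤ (cross γ₂ (hitProb Φ R μ (strip z.1)) (hitProb Φ R μ (strip z.2))).toReal :=
    ENNReal.toReal_nonneg
  have he : Real.exp (-2 * intensity P μ * m) ≤ 1 := Real.exp_le_one_iff.2 (by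
    have := mul_nonneg hl hm0
    linarith)
  rw [leadingCovariance, abs_mul, abs_mul, abs_of_pos (Real.exp_pos _), abs_of_nonneg hl]
  refine (mul_le_of_le_one_left (by positivity) he).trans (mul_le_mul_of_nonneg_left ?_ hl)
  rw [abs_le]
  have : 0 ≤ m * γ₁.real univ := mul_nonneg hm0 measureReal_nonneg
  have : 0 ≤ m * γ₂.real univ := mul_nonneg hm0 measureReal_nonneg
  constructor <;> linarith

lemma integral_leadingCovariance (hM : IsIndependentMarking P Φ R μ)
    (hRi : ∫⁻ ω, ENNReal.ofReal (2 * R 0 ω) ∂μ ≠ ∞) (hK : IsCompact K) (γ₁ γ₂ : Measure ℝ)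
    [IsFiniteMeasure γ₁] [IsFiniteMeasure γ₂] {ρ : ℝ} (hρ : 0 < ρ) :
    ∫ z, leadingCovariance P Φ R μ γ₁ γ₂ z
        ∂((volume.restrict (ρ • K)).prod (volume.restrict (ρ • K))) =
      ρ ^ 3 * (Real.exp (-2 * intensity P μ * ∫ ω, baseLength R ω ∂μ) * (intensity P μ *
        ((∫⁻ ω, ∫⁻ q, stripArea K ρ q (Φ 0 ω) (R 0 ω) *
          stripArea K ρ q (Φ 0 ω) (R 0 ω) ∂volume ∂μ).toReal +
        (∫⁻ t, ∫⁻ q, meanStrip K μ (Φ 0) (R 0) ρ q *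
          meanStrip K μ (Φ 0) (R 0) ρ (q + t / ρ) ∂volume ∂γ₁).toReal -
        (∫⁻ t, ∫⁻ q, meanStrip K μ (Φ 0) (R 0) ρ q *
          meanStrip K μ (Φ 0) (R 0) ρ (q + t / ρ) ∂volume ∂γ₂).toReal))) := by
  have : IsFiniteMeasure (volume.restrict (ρ • K)) :=
    ⟨by simpa using (hK.smul ρ).measure_lt_top (μ := volume)⟩
  have hX : ∀ (κ : Measure ℝ) [IsFiniteMeasure κ], Integrable (fun z : Plane × Plane =>
      (cross κ (hitProb Φ R μ (strip z.1)) (hitProb Φ R μ (strip z.2))).toReal)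
      ((volume.restrict (ρ • K)).prod (volume.restrict (ρ • K))) := fun κ _ =>
    integrable_of_abs_le _ _ (measurable_cross_strip hM κ).ennreal_toReal fun z => by
      rw [abs_of_nonneg ENNReal.toReal_nonneg]
      exact cross_strip_toReal_le hM hRi κ z.1 z.2
  have hc : Integrable (fun z : Plane × Plane => ∫ p, hitProb Φ R μ (strip z.1 ∩ strip z.2) p)
      ((volume.restrict (ρ • K)).prod (volume.restrict (ρ • K))) :=
    integrable_of_abs_le _ _ (measurable_integral_hitProb_inter hM) fun z => by
      rw [abs_of_nonneg (integral_nonneg fun p => hitProb_nonneg _ p)]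
      exact integral_hitProb_inter_le hM hRi z.1 z.2
  simp only [leadingCovariance]
  rw [integral_const_mul, integral_const_mul, integral_sub (by have h := hc.add (hX γ₁); exact h) (hX γ₂),
    integral_add hc (hX γ₁), integral_integral_hitProb_inter hM hRi hK.measurableSet hρ,
    integral_cross_strip hM hRi hK.measurableSet γ₁ hρ,
    integral_cross_strip hM hRi hK.measurableSet γ₂ hρ]
  ring

end

end PlanarCylinder

end

noncomputable section

namespace PlanarCylinder

variable {Ω : Type*} [MeasurableSpace Ω]

section

variable {μ : Measure Ω} {P Φ R : ℤ → Ω → ℝ} {K : Set Plane} [IsProbabilityMeasure μ]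

/-! ### From the covariance to the asymptotic variance -/

lemma abs_voidProb_sub_mul_le (A B C : Set (ℝ × ℝ × ℝ)) :
    |voidProb P Φ R μ A - voidProb P Φ R μ B * voidProb P Φ R μ C| ≤ 1 := by
  have hv0 : ∀ A, 0 ≤ voidProb P Φ R μ A := fun A => measureReal_nonneg
  have hv1 : ∀ A, voidProb P Φ R μ A ≤ 1 := fun A => voidProb_le_one A
  have h := mul_nonneg (hv0 B) (hv0 C)
  have h' := mul_le_one₀ (hv1 B) (hv0 C) (hv1 C)
  rw [abs_le]
  constructor <;> linarith [hv0 A, hv1 A]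

/-- For pairs far apart and far from the origin the hit probabilities are small and the void
probability estimate applies. For the other pairs both the covariance and its leading term are
bounded, and the constant C covers them. -/
lemma exists_abs_covariance_sub_le (hP : IsStationaryPointProcess P μ)
    (hM : IsIndependentMarking P Φ R μ) (hfin : MomentsFinite P μ) (hsmall : CumulantsSmall P μ)
    {γ₁ γ₂ : Measure ℝ} [IsFiniteMeasure γ₁] [IsFiniteMeasure γ₂]
    (hγ : ∀ f : Fin 2 → ℝ → ℝ, (∀ i, IsTest (f i)) → cumulantFunctional P μ 2 f =
        intensity P μ * ((∫ q : ℝ × ℝ, f 0 q.1 * f 1 (q.2 + q.1) ∂((volume : Measure ℝ).prod γ₁)) -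
          ∫ q : ℝ × ℝ, f 0 q.1 * f 1 (q.2 + q.1) ∂((volume : Measure ℝ).prod γ₂)))
    (hG : Continuous (cdf (μ.map (Φ 0)))) (hRi : ∫⁻ ω, ENNReal.ofReal (2 * R 0 ω) ∂μ ≠ ∞)
    {η : ℝ} (hη : 0 < η) :
    ∃ M C : ℝ, ∃ ν : Measure ℝ, ν univ ≤ ENNReal.ofReal η ∧ 0 ≤ C ∧ ∀ z : Plane × Plane,
      |voidProb P Φ R μ (strip z.1 ∪ strip z.2) -
        voidProb P Φ R μ (strip z.1) * voidProb P Φ R μ (strip z.2) -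
        leadingCovariance P Φ R μ γ₁ γ₂ z| ≤
      {z : Plane × Plane | ¬ (M ≤ ‖z.1‖ ∧ M ≤ ‖z.2‖ ∧ M ≤ ‖z.1 - z.2‖)}.indicator (fun _ => C) z +
        η * (∫ p, hitProb Φ R μ (strip z.1 ∩ strip z.2) p) +
        (cross ν (hitProb Φ R μ (strip z.1)) (hitProb Φ R μ (strip z.2))).toReal := by
  set m := ∫ ω, baseLength R ω ∂μ with hm
  have hm0 : 0 ≤ m := integral_baseLength_nonneg μ R
  -- The two hit probabilities have integral m each; the summand 1 keeps S positive when m = 0.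
  obtain ⟨δ, hδ, ν, hν, hmain⟩ := hsmall.abs_voidProb_le hP hM hfin hγ
    (show 0 < 2 * m + 1 by linarith) hη
  obtain ⟨M₁, -, hM₁⟩ := exists_hitProb_strip_le hM hG (half_pos hδ)
  obtain ⟨M₂, -, hM₂⟩ := exists_lintegral_hitProb_inter_le hM hG hRi hδ
  set C := 1 + intensity P μ * (m + m * γ₁.real univ + m * γ₂.real univ) with hC
  have hl : 0 ≤ intensity P μ := ENNReal.toReal_nonneg
  refine ⟨max M₁ M₂, C, ν, hν, ?_, fun z => ?_⟩
  · have := measureReal_nonneg (μ := γ₁) (s := univ)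
    have := measureReal_nonneg (μ := γ₂) (s := univ)
    positivity
  have hc0 : 0 ≤ ∫ p, hitProb Φ R μ (strip z.1 ∩ strip z.2) p :=
    integral_nonneg fun p => hitProb_nonneg _ p
  have hX0 : 0 ≤ (cross ν (hitProb Φ R μ (strip z.1)) (hitProb Φ R μ (strip z.2))).toReal :=
    ENNReal.toReal_nonneg
  by_cases hz : max M₁ M₂ ≤ ‖z.1‖ ∧ max M₁ M₂ ≤ ‖z.2‖ ∧ max M₁ M₂ ≤ ‖z.1 - z.2‖
  · have hI := integral_hitProb_strip (μ := μ) hM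
    have h := hmain (strip z.1) (strip z.2) (measurableSet_strip _) (measurableSet_strip _)
      (integrable_hitProb_strip hM hRi _) (integrable_hitProb_strip hM hRi _)
      (fun p => by
        have h1 := hM₁ z.1 ((le_max_left _ _).trans hz.1) p
        have h2 := hM₁ z.2 ((le_max_left _ _).trans hz.2.1) p
        linarith)
      (by rw [hI, hI]; linarith)
      (by
        rw [integral_hitProb_eq hM ((measurableSet_strip _).inter (measurableSet_strip _))]
        exact ENNReal.toReal_le_of_le_ofReal hδ.le (hM₂ z.1 z.2 ((le_max_right _ _).trans hz.2.2)))
    rw [hI, hI, show -(intensity P μ * (m + m)) = -2 * intensity P μ * m by ring] at h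
    have hi : 0 ≤ {z : Plane × Plane | ¬ (max M₁ M₂ ≤ ‖z.1‖ ∧ max M₁ M₂ ≤ ‖z.2‖ ∧
        max M₁ M₂ ≤ ‖z.1 - z.2‖)}.indicator (fun _ => C) z := by
      rw [indicator_of_notMem]
      exact fun hcon => hcon hz
    have h' : _ ≤ _ := h
    rw [leadingCovariance]
    linarith
  · rw [indicator_of_mem (show z ∈ {z : Plane × Plane | ¬ (max M₁ M₂ ≤ ‖z.1‖ ∧ max M₁ M₂ ≤ ‖z.2‖ ∧
        max M₁ M₂ ≤ ‖z.1 - z.2‖)} from hz)]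
    have h1 := abs_leadingCovariance_le hM hRi γ₁ γ₂ z
    have h2 : |voidProb P Φ R μ (strip z.1 ∪ strip z.2) -
        voidProb P Φ R μ (strip z.1) * voidProb P Φ R μ (strip z.2)| ≤ 1 :=
      abs_voidProb_sub_mul_le _ _ _
    have h3 := abs_sub (voidProb P Φ R μ (strip z.1 ∪ strip z.2) -
        voidProb P Φ R μ (strip z.1) * voidProb P Φ R μ (strip z.2))
        (leadingCovariance P Φ R μ γ₁ γ₂ z)
    have : 0 ≤ η * ∫ p, hitProb Φ R μ (strip z.1 ∩ strip z.2) p := by positivity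
    linarith

/-- Integration of the pointwise error: the bad pairs contribute O(ρ²), and the other errors are η
ρ³ times quantities that do not involve η. -/
lemma exists_abs_variance_sub_le (hP : IsStationaryPointProcess P μ)
    (hM : IsIndependentMarking P Φ R μ) (hfin : MomentsFinite P μ) (hsmall : CumulantsSmall P μ)
    {γ₁ γ₂ : Measure ℝ} [IsFiniteMeasure γ₁] [IsFiniteMeasure γ₂]
    (hγ : ∀ f : Fin 2 → ℝ → ℝ, (∀ i, IsTest (f i)) → cumulantFunctional P μ 2 f =
        intensity P μ * ((∫ q : ℝ × ℝ, f 0 q.1 * f 1 (q.2 + q.1) ∂((volume : Measure ℝ).prod γ₁)) -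
          ∫ q : ℝ × ℝ, f 0 q.1 * f 1 (q.2 + q.1) ∂((volume : Measure ℝ).prod γ₂)))
    (hG : Continuous (cdf (μ.map (Φ 0)))) (hRi : ∫⁻ ω, ENNReal.ofReal (2 * R 0 ω) ∂μ ≠ ∞)
    (hK : IsCompact K) {D : ℝ} (hD : ∀ x ∈ K, ‖x‖ ≤ D) {η : ℝ} (hη : 0 < η) :
    ∃ C : ℝ, ∀ ρ : ℝ, 0 < ρ →
      |variance (fun ω => (volume (cylinderProcess P Φ R ω ∩ ρ • K)).toReal) μ / ρ ^ 3 -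
        Real.exp (-2 * intensity P μ * ∫ ω, baseLength R ω ∂μ) * (intensity P μ *
        ((∫⁻ ω, ∫⁻ q, stripArea K ρ q (Φ 0 ω) (R 0 ω) *
          stripArea K ρ q (Φ 0 ω) (R 0 ω) ∂volume ∂μ).toReal +
        (∫⁻ t, ∫⁻ q, meanStrip K μ (Φ 0) (R 0) ρ q *
          meanStrip K μ (Φ 0) (R 0) ρ (q + t / ρ) ∂volume ∂γ₁).toReal -
        (∫⁻ t, ∫⁻ q, meanStrip K μ (Φ 0) (R 0) ρ q *
          meanStrip K μ (Φ 0) (R 0) ρ (q + t / ρ) ∂volume ∂γ₂).toReal))| ≤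
      C / ρ + η * ((∫⁻ ω, ∫⁻ q, stripArea K ρ q (Φ 0 ω) (R 0 ω) *
          stripArea K ρ q (Φ 0 ω) (R 0 ω) ∂volume ∂μ).toReal +
        ((∫⁻ ω, ENNReal.ofReal (2 * R 0 ω) ∂μ) * volume K *
        ((∫⁻ ω, ENNReal.ofReal (2 * R 0 ω) ∂μ) * ENNReal.ofReal (2 * D))).toReal) := by
  obtain ⟨M, C, ν, hν, hC, hmain⟩ :=
    exists_abs_covariance_sub_le hP hM hfin hsmall hγ hG hRi hη
  have : IsFiniteMeasure ν := ⟨hν.trans_lt ENNReal.ofReal_lt_top⟩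
  refine ⟨C * (3 * (volume.real (Metric.ball (0 : Plane) M) * volume.real K)), fun ρ hρ => ?_⟩
  have hLt : volume (ρ • K) ≠ ∞ := (hK.smul ρ).measure_lt_top.ne
  have : IsFiniteMeasure (volume.restrict (ρ • K)) := ⟨by simpa using hLt.lt_top⟩
  have hvar := variance_volume_eq hP hM hLt
  have hlead := integral_leadingCovariance hM hRi hK γ₁ γ₂ hρ
  set m₂ := (volume.restrict (ρ • K)).prod (volume.restrict (ρ • K)) with hm₂
  set A := (∫⁻ ω, ∫⁻ q, stripArea K ρ q (Φ 0 ω) (R 0 ω) *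
          stripArea K ρ q (Φ 0 ω) (R 0 ω) ∂volume ∂μ).toReal with hA
  set T := (∫⁻ ω, ENNReal.ofReal (2 * R 0 ω) ∂μ) * volume K *
        ((∫⁻ ω, ENNReal.ofReal (2 * R 0 ω) ∂μ) * ENNReal.ofReal (2 * D)) with hT
  have hTt : T ≠ ∞ := ENNReal.mul_ne_top (ENNReal.mul_ne_top hRi hK.measure_lt_top.ne)
    (ENNReal.mul_ne_top hRi ENNReal.ofReal_ne_top)
  set F := Real.exp (-2 * intensity P μ * ∫ ω, baseLength R ω ∂μ) * _ with hF
  set bad := {z : Plane × Plane | ¬ (M ≤ ‖z.1‖ ∧ M ≤ ‖z.2‖ ∧ M ≤ ‖z.1 - z.2‖)} with hbad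
  have hbm : MeasurableSet bad := by
    have h1 : MeasurableSet {z : Plane × Plane | M ≤ ‖z.1‖} :=
      measurableSet_le measurable_const measurable_fst.norm
    have h2 : MeasurableSet {z : Plane × Plane | M ≤ ‖z.2‖} :=
      measurableSet_le measurable_const measurable_snd.norm
    have h3 : MeasurableSet {z : Plane × Plane | M ≤ ‖z.1 - z.2‖} :=
      measurableSet_le measurable_const (measurable_fst.sub measurable_snd).norm
    exact (h1.inter (h2.inter h3)).compl
  have hbr : m₂.real bad ≤ 3 * (volume.real (Metric.ball (0 : Plane) M) * (ρ ^ 2 * volume.real K)) := by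
    have h := measure_near_diagonal_le hLt M
    have h' := ENNReal.toReal_mono (ENNReal.mul_ne_top (by simp)
      (ENNReal.mul_ne_top measure_ball_lt_top.ne hLt)) h
    rw [ENNReal.toReal_mul, ENNReal.toReal_mul, ENNReal.toReal_ofNat] at h'
    rw [← volume_real_smul_plane]
    exact h'
  have hI1 : Integrable (bad.indicator fun _ => C) m₂ := (integrable_const C).indicator hbm
  have hI2 : Integrable (fun z : Plane × Plane => ∫ p, hitProb Φ R μ (strip z.1 ∩ strip z.2) p)
      m₂ := integrable_of_abs_le _ _ (measurable_integral_hitProb_inter hM) fun z => by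
    rw [abs_of_nonneg (integral_nonneg fun p => hitProb_nonneg _ p)]
    exact integral_hitProb_inter_le hM hRi z.1 z.2
  have hI3 : Integrable (fun z : Plane × Plane =>
      (cross ν (hitProb Φ R μ (strip z.1)) (hitProb Φ R μ (strip z.2))).toReal) m₂ :=
    integrable_of_abs_le _ _ (measurable_cross_strip hM ν).ennreal_toReal fun z => by
      rw [abs_of_nonneg ENNReal.toReal_nonneg]
      exact cross_strip_toReal_le hM hRi ν z.1 z.2
  have hI4 : Integrable (leadingCovariance P Φ R μ γ₁ γ₂) m₂ :=
    integrable_of_abs_le _ _ (measurable_leadingCovariance hM γ₁ γ₂) fun z =>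
      abs_leadingCovariance_le hM hRi γ₁ γ₂ z
  have hvm := measurable_voidProb_strip (μ := μ) hP hM
  have hI5 : Integrable (fun z : Plane × Plane => voidProb P Φ R μ (strip z.1 ∪ strip z.2) -
      voidProb P Φ R μ (strip z.1) * voidProb P Φ R μ (strip z.2)) m₂ :=
    integrable_of_abs_le _ 1 ((measurable_voidProb_strip_union hP hM).sub
      ((hvm.comp measurable_fst).mul (hvm.comp measurable_snd))) fun z =>
      abs_voidProb_sub_mul_le _ _ _
  have hX : (∫⁻ t, ∫⁻ q, meanStrip K μ (Φ 0) (R 0) ρ q *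
      meanStrip K μ (Φ 0) (R 0) ρ (q + t / ρ) ∂volume ∂ν).toReal ≤ T.toReal * η := by
    rw [← ENNReal.toReal_ofReal hη.le, ← ENNReal.toReal_mul]
    refine ENNReal.toReal_mono (ENNReal.mul_ne_top hTt ENNReal.ofReal_ne_top) ?_
    calc _ ≤ ∫⁻ _, T ∂ν := lintegral_mono fun t => lintegral_meanStrip_mul_le hK.measurableSet
          (hM.measurable_angle 0) (hM.measurable_radius 0) hD ρ (t / ρ)
      _ = T * ν univ := lintegral_const _
      _ ≤ _ := by gcongr
  have hρ3 : 0 < ρ ^ 3 := by positivity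
  have key : |variance (fun ω => (volume (cylinderProcess P Φ R ω ∩ ρ • K)).toReal) μ - ρ ^ 3 * F| ≤
      C * (3 * (volume.real (Metric.ball (0 : Plane) M) * (ρ ^ 2 * volume.real K))) +
        η * (ρ ^ 3 * A) + ρ ^ 3 * (T.toReal * η) := by
    rw [hvar, ← hlead, ← integral_sub hI5 hI4]
    refine (abs_integral_le_integral_abs).trans ?_
    have hI12 : Integrable (fun z : Plane × Plane => bad.indicator (fun _ => C) z +
        η * ∫ p, hitProb Φ R μ (strip z.1 ∩ strip z.2) p) m₂ := hI1.add (hI2.const_mul η)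
    refine (integral_mono (hI5.sub hI4).abs (hI12.add hI3) hmain).trans ?_
    rw [integral_add' hI12 hI3, integral_add hI1 (hI2.const_mul η), integral_const_mul,
      integral_integral_hitProb_inter hM hRi hK.measurableSet hρ,
      integral_cross_strip hM hRi hK.measurableSet ν hρ, integral_indicator_const _ hbm, smul_eq_mul,
      mul_comm _ C]
    gcongr
  have e : variance (fun ω => (volume (cylinderProcess P Φ R ω ∩ ρ • K)).toReal) μ / ρ ^ 3 - F =
      (variance (fun ω => (volume (cylinderProcess P Φ R ω ∩ ρ • K)).toReal) μ - ρ ^ 3 * F) / ρ ^ 3 := by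
    field_simp
  rw [e, abs_div, abs_of_pos hρ3, div_le_iff₀ hρ3]
  refine key.trans (le_of_eq ?_)
  field_simp
  ring

/-- The variance asymptotics in terms of a representation of the second cumulant. -/
lemma tendsto_variance_div (hP : IsStationaryPointProcess P μ)
    (hM : IsIndependentMarking P Φ R μ) (hfin : MomentsFinite P μ) (hsmall : CumulantsSmall P μ)
    {γ₁ γ₂ : Measure ℝ} [IsFiniteMeasure γ₁] [IsFiniteMeasure γ₂]
    (hγ : ∀ f : Fin 2 → ℝ → ℝ, (∀ i, IsTest (f i)) → cumulantFunctional P μ 2 f =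
        intensity P μ * ((∫ q : ℝ × ℝ, f 0 q.1 * f 1 (q.2 + q.1) ∂((volume : Measure ℝ).prod γ₁)) -
          ∫ q : ℝ × ℝ, f 0 q.1 * f 1 (q.2 + q.1) ∂((volume : Measure ℝ).prod γ₂)))
    (hG : Continuous (cdf (μ.map (Φ 0)))) (hR : Integrable (fun ω => R 0 ω ^ 2) μ)
    (hK : IsCompact K) (h0 : (0 : Plane) ∈ K) {ε : ℝ} (hε : ε = 1 ∨ ε = -1) :
    Tendsto (fun ρ : ℝ =>
        variance (fun ω => (volume (cylinderProcess P Φ R ω ∩ ρ • K)).toReal) μ / ρ ^ 3) atTop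
      (𝓝 (intensity P μ * Real.exp (-2 * intensity P μ * ∫ ω, baseLength R ω ∂μ) *
        ((∫ ω, baseLength R ω ∂μ) ^ 2 * (γ₁.real univ - γ₂.real univ) * constOne K Φ μ +
          2 * (∫ ω, baseLength R ω ^ 2 ∂μ) * constTwo K Φ μ ε))) := by
  obtain ⟨D, hD⟩ := hK.isBounded.exists_norm_le
  have hΦ := hM.measurable_angle 0
  have hRm := hM.measurable_radius 0
  have hRi := lintegral_radius_ne_top hR
  have hRi2 := lintegral_radius_sq_ne_top (hM.radius_nonneg 0) hR
  have hA := tendsto_lintegral_lintegral_stripArea_sq hK hΦ hRm hD hRi2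
  have hB := fun (κ : Measure ℝ) [IsFiniteMeasure κ] =>
    tendsto_lintegral_cross hK hΦ hRm hD hRi κ
  have hAt : ∫⁻ ω, ENNReal.ofReal (2 * R 0 ω) ^ 2 *
      ∫⁻ q, chord K q (Φ 0 ω) * chord K q (Φ 0 ω) ∂volume ∂μ ≠ ∞ := by
    have hm : Measurable fun ω => ENNReal.ofReal (2 * R 0 ω) ^ 2 := by fun_prop
    refine ne_top_of_le_ne_top (b := (∫⁻ ω, ENNReal.ofReal (2 * R 0 ω) ^ 2 ∂μ) *
      (volume K * ENNReal.ofReal (2 * D))) (ENNReal.mul_ne_top hRi2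
        (ENNReal.mul_ne_top hK.measure_lt_top.ne ENNReal.ofReal_ne_top)) ?_
    rw [← lintegral_mul_const _ hm]
    gcongr with ω
    exact lintegral_chord_sq_le hK.measurableSet hD _
  have hBt : ∫⁻ p, meanChord K μ (Φ 0) (R 0) p * meanChord K μ (Φ 0) (R 0) p ≠ ∞ := by
    -- The unit mass at 0 makes the limit the bare integral, which is then finite because the
    -- approximating integrals are uniformly bounded.
    have h := hB (Measure.dirac 0)
    rw [measure_univ, one_mul] at h
    refine ne_top_of_le_ne_top (b := (∫⁻ ω, ENNReal.ofReal (2 * R 0 ω) ∂μ) * volume K *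
        ((∫⁻ ω, ENNReal.ofReal (2 * R 0 ω) ∂μ) * ENNReal.ofReal (2 * D)))
      (ENNReal.mul_ne_top (ENNReal.mul_ne_top hRi hK.measure_lt_top.ne)
        (ENNReal.mul_ne_top hRi ENNReal.ofReal_ne_top)) (le_of_tendsto' h fun ρ => ?_)
    refine (lintegral_mono fun t =>
      lintegral_meanStrip_mul_le hK.measurableSet hΦ hRm hD ρ (t / ρ)).trans ?_
    rw [lintegral_const, measure_univ, mul_one]
  have hA' := (ENNReal.tendsto_toReal hAt).comp hA
  rw [toReal_lintegral_radius_sq_mul hM hK h0 hε] at hA'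
  have hB' := fun (κ : Measure ℝ) [IsFiniteMeasure κ] => by
    have h := (ENNReal.tendsto_toReal (ENNReal.mul_ne_top (measure_ne_top κ univ) hBt)).comp (hB κ)
    rw [ENNReal.toReal_mul, toReal_lintegral_meanChord_sq hM hK] at h
    exact h
  have hF := (((hA'.add (hB' γ₁)).sub (hB' γ₂)).const_mul (intensity P μ)).const_mul
    (Real.exp (-2 * intensity P μ * ∫ ω, baseLength R ω ∂μ))
  refine (hF.congr_dist ?_).trans (le_of_eq (congrArg 𝓝 ?_))
  · rw [tendsto_order]
    refine ⟨fun a ha => Eventually.of_forall fun ρ => ha.trans_le dist_nonneg, fun a ha => ?_⟩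
    set T := ((∫⁻ ω, ENNReal.ofReal (2 * R 0 ω) ∂μ) * volume K *
        ((∫⁻ ω, ENNReal.ofReal (2 * R 0 ω) ∂μ) * ENNReal.ofReal (2 * D))).toReal with hT
    have hT0 : 0 ≤ T := ENNReal.toReal_nonneg
    set a₀ := 2 * (∫ ω, baseLength R ω ^ 2 ∂μ) * constTwo K Φ μ ε with ha₀
    have ha₀' : 0 ≤ a₀ := by
      rw [ha₀, ← toReal_lintegral_radius_sq_mul hM hK h0 hε]
      exact ENNReal.toReal_nonneg
    have hs : 0 < a₀ + 1 + T := by positivity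
    -- For large ρ the integral multiplying η is below a₀ + 1, so the η-error is at most a / 2; the
    -- bad pairs leave the other half.
    have hη : 0 < a / 2 / (a₀ + 1 + T) := by positivity
    obtain ⟨C, hC⟩ := exists_abs_variance_sub_le hP hM hfin hsmall hγ hG hRi hK hD hη
    have hCρ : Tendsto (fun ρ : ℝ => C / ρ) atTop (𝓝 0) := tendsto_const_nhds.div_atTop tendsto_id
    filter_upwards [eventually_gt_atTop 0, hCρ.eventually (gt_mem_nhds (half_pos ha)),
      hA'.eventually (gt_mem_nhds (lt_add_one a₀))] with ρ hρ h1 h2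
    rw [dist_comm, Real.dist_eq]
    refine (hC ρ hρ).trans_lt ?_
    simp only [Function.comp_apply] at h2
    have h3 : a / 2 / (a₀ + 1 + T) * ((∫⁻ ω, ∫⁻ q, stripArea K ρ q (Φ 0 ω) (R 0 ω) *
          stripArea K ρ q (Φ 0 ω) (R 0 ω) ∂volume ∂μ).toReal + T) ≤ a / 2 := by
      calc _ ≤ a / 2 / (a₀ + 1 + T) * (a₀ + 1 + T) := by gcongr
        _ = a / 2 := div_mul_cancel₀ _ hs.ne'
    linarith
  · simp only [Measure.real]
    ring

end

end PlanarCylinder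

end

open PlanarCylinder

/-! ### The variance limit -/

theorem theorem2 {Ω : Type*} [MeasurableSpace Ω] (μ : Measure Ω) [IsProbabilityMeasure μ]
    (P Φ R : ℤ → Ω → ℝ)
    (hP : IsStationaryPointProcess P μ)
    (hM : IsIndependentMarking P Φ R μ)
    (K : Set Plane) (hK : IsCompact K) (hK_star : StarConvex ℝ (0 : Plane) K)
    (hK_int : (0 : Plane) ∈ interior K)
    (hmix : (∃ b : ℝ, b < 1 / 2 ∧ StronglyBrillingerMixing P μ b) ∨
      (∃ q b b' : ℝ, 1 < q ∧
        StronglyLqBrillingerMixing P μ q b ∧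
        (∫ ω, baseLength R ω ∂μ) ^ (1 - 1 / q) * b < 1 / 2 ∧
        StronglyLqStarBrillingerMixing P μ q b' ∧
        (∫ ω, baseLength R ω ∂μ) ^ (1 - 1 / q) * b' < 1 / 2))
    (hR : Integrable (fun ω => R 0 ω ^ 2) μ)
    (hG : Continuous (cdf (μ.map (Φ 0))))
    (ε : ℝ) (hε : ε = 1 ∨ ε = -1) :
    Tendsto
      (fun ϱ : ℝ =>
        variance (fun ω => (volume (cylinderProcess P Φ R ω ∩ ϱ • K)).toReal) μ / ϱ ^ 3)
      atTop
      (𝓝 (intensity P μ * Real.exp (-2 * intensity P μ * ∫ ω, baseLength R ω ∂μ) *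
        ((∫ ω, baseLength R ω ∂μ) ^ 2 * reducedCumulantMeasure P μ 1 univ * constOne K Φ μ +
          2 * (∫ ω, baseLength R ω ^ 2 ∂μ) * constTwo K Φ μ ε))) := by
  -- Either mixing alternative is used in the same form: finite moments, summably small cumulants on
  -- small functions, and a finite reduced covariance measure.
  obtain ⟨hmom, hsmall, hex⟩ : HasAllMoments P μ ∧ CumulantsSmall P μ ∧
      ∃ γ, IsReducedCumulantMeasure P μ 1 γ := by
    rcases hmix with ⟨b, -, h⟩ | ⟨q, b, b', hq, h, -, h', -⟩
    · refine ⟨h.1, h.cumulantsSmall hP, ?_⟩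
      obtain ⟨-, -, a, -, hγ⟩ := h
      obtain ⟨γ, hγ, -⟩ := hγ 1 le_rfl
      exact ⟨γ, hγ⟩
    · refine ⟨h.1, cumulantsSmall_of_density hP hq h h', ?_⟩
      obtain ⟨-, -, a, -, c, hc, hint, -⟩ := h
      exact exists_reduced_of_density (hc 1 le_rfl) hint
  have hfin := momentsFinite hP hmom
  obtain ⟨γ₁, γ₂, h₁, h₂, hu, hγ⟩ := exists_second_cumulant hfin hex
  rw [hu]
  exact tendsto_variance_div hP hM hfin hsmall hγ hG hR hK (interior_subset hK_int) hε
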